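/- Let $k\ge 2$, and let $(X,\omega)$ be either a non-empty bounded open subset of $\mathbb{C}^k$ with the Kähler form $\omega=c\,dd^c\|z\|^2$, $c>0$ (where $d^c=\frac{i}{2\pi}(\bar\partial-\partial)$), or a non-empty compact complex manifold of dimension $k$ with any Kähler form $\omega$. Let $W^{1,2}$ be the space of real functions $\varphi\in L^2(X,\omega^k)$ whose differential in the sense of currents is a form with $L^2$ coefficients. Let $W^*$ be the space of all $\varphi\in W^{1,2}$ for which there is a closed current $T$ of bidegree $(1,1)$ on $X$, of finite mass $m(T)=\int_X T\wedge\omega^{k-1}$, such that $$ i\partial\varphi\wedge\bar\partial\varphi\le T \qquad (1)$$ in the sense of currents, and for $\varphi\in W^*$ put $$\|\varphi\|_*^2=\|\varphi\|_{L^2}^2+\inf\{m(T)\,:\,T \text{ a closed current of bidegree } (1,1) \text{ satisfying } (1)\}.$$ Then $(W^*,\|\cdot\|_*)$ is a Banach space, and it is not reflexive. -/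

import Mathlib

open MeasureTheory Set
open scoped Manifold ContDiff ENNReal

noncomputable section

namespace ComplexSobolev

/-! ## Multilinear algebra on `ℂᵏ` -/

/-- The space `ℂᵏ` with its Hermitian norm; it is also regarded as a real vector space of
dimension `2k`, and `volume` is the Lebesgue measure on it. -/
abbrev Cn (k : ℕ) : Type := EuclideanSpace ℂ (Fin k)

/-- Real alternating `n`-forms on the real vector space `ℂᵏ`. -/
abbrev Alt (k n : ℕ) : Type := Cn k [⋀^Fin n]→L[ℝ] ℝ

/-- Real covectors on `ℂᵏ`. -/
abbrev Covec (k : ℕ) : Type := Cn k →L[ℝ] ℝ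

variable {k n : ℕ}

/-- Multiplication by the complex number `a`, as a real linear map of `ℂᵏ`. -/
def mulC (k : ℕ) (a : ℂ) : Cn k →L[ℝ] Cn k :=
  (a • ContinuousLinearMap.id ℂ (Cn k)).restrictScalars ℝ

/-- The exterior product of a covector and an `n`-form,
`(l ∧ Θ)(v₀,…,vₙ) = ∑ᵢ (-1)ⁱ l(vᵢ) Θ(v₀,…,v̂ᵢ,…,vₙ)`, as a continuous bilinear map. -/
def wedge₁ : Covec k →L[ℝ] Alt k n →L[ℝ] Alt k (n + 1) :=
  (ContinuousLinearMap.compL ℝ (Alt k n) (Cn k →L[ℝ] Alt k n) (Alt k (n + 1))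
    (ContinuousAlternatingMap.alternatizeUncurryFinCLM ℝ (Cn k) ℝ)).comp
    (ContinuousLinearMap.smulRightL ℝ (Cn k) (Alt k n))

/-- A covector as an alternating `1`-form, and back. -/
def covecEquiv (k : ℕ) : Covec k ≃ₗᵢ[ℝ] Alt k 1 :=
  ContinuousAlternatingMap.ofSubsingletonLIE (0 : Fin 1)

/-- The exterior product `η ∧ Θ` of a `2`-form and an `n`-form. In a basis `e_a` of `ℂᵏ` with dual
basis `eᵃ` it is `½ ∑_{a} eᵃ ∧ (η(e_a, ·) ∧ Θ)`. -/
def wedge₂ (η : Alt k 2) (Θ : Alt k n) : Alt k (n + 2) :=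
  (1 / 2 : ℝ) • ContinuousAlternatingMap.alternatizeUncurryFin
    ((wedge₁.flip Θ).comp
      (((covecEquiv k).symm : Alt k 1 →L[ℝ] Covec k).comp η.curryLeft))

/-- The exterior power `η^p` of a `2`-form. -/
def powForm (η : Alt k 2) : (p : ℕ) → Alt k (2 * p)
  | 0 => ContinuousAlternatingMap.constOfIsEmpty ℝ (Cn k) (Fin 0) (1 : ℝ)
  | p + 1 => wedge₂ η (powForm η p)

/-- The standard oriented real frame `e₁, i e₁, e₂, i e₂, …` of `ℂᵏ` (its first `n` vectors). -/
def frame (k n : ℕ) (j : Fin n) : Cn k :=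
  WithLp.toLp 2 fun a : Fin k =>
    if a.val = j.val / 2 then (if j.val % 2 = 0 then 1 else Complex.I) else 0

/-- The value of a form on the standard frame. For a form of the top degree `2k` this is its
coefficient with respect to `dx₁ ∧ dy₁ ∧ ⋯ ∧ dx_k ∧ dy_k`. -/
def coeff (η : Alt k n) : ℝ := η (frame k n)

/-- For a real covector `l = dφ` with `(1,0)`-part `β = ∂φ`, the form `iβ ∧ β̄ ∧ Θ`. Here
`iβ ∧ β̄ = ½ (l ∘ J) ∧ l`, where `J` is the multiplication by `i`, since `β = ½ (l - i l ∘ J)`. -/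
def gradWedge (l : Covec k) (Θ : Alt k n) : Alt k (n + 2) :=
  (1 / 2 : ℝ) • wedge₁ (l.comp (mulC k Complex.I)) (wedge₁ l Θ)

/-- A real form is of bidegree `(p,p)` for some `p` if it is invariant under the multiplications by
the complex numbers of modulus one (these act by `a^(p-q)` on the forms of bidegree `(p,q)`). -/
def IsDiagonal (Θ : Alt k n) : Prop :=
  ∀ a : ℂ, ‖a‖ = 1 → Θ.compContinuousLinearMap (mulC k a) = Θ

/-- Positivity of a `(k-1,k-1)`-form `Θ`: `iβ ∧ β̄ ∧ Θ ≥ 0` for every `(1,0)`-covector `β`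
(every such `β` is the `(1,0)`-part of a unique real covector). -/
def IsPositiveAlt (Θ : Alt k (2 * (k - 1))) : Prop :=
  IsDiagonal Θ ∧ ∀ l : Covec k, 0 ≤ coeff (gradWedge l Θ)

/-! ## Differential forms on complex manifolds

The tangent space of `X` at `x` is identified with `ℂᵏ` through the preferred chart at `x`, as is
always the case in Mathlib. -/

section Forms

variable {X : Type*} [TopologicalSpace X] [ChartedSpace (Cn k) X]

/-- The derivative at `y` of `e⁻¹`, as a map from `ℂᵏ` to the tangent space of `X` at `e⁻¹ y`. -/
def chartFrame (e : OpenPartialHomeomorph X (Cn k)) (y : Cn k) : Cn k →L[ℝ] Cn k :=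
  fderiv ℝ (chartAt (Cn k) (e.symm y) ∘ e.symm) y

/-- The expression in the chart `e` of a differential form, that is its pull-back by `e⁻¹`. -/
def formIn (e : OpenPartialHomeomorph X (Cn k)) (Θ : X → Alt k n) (y : Cn k) : Alt k n :=
  (Θ (e.symm y)).compContinuousLinearMap (chartFrame e y)

/-- The expression in the chart `e` of a field of covectors. -/
def covecIn (e : OpenPartialHomeomorph X (Cn k)) (θ : X → Covec k) (y : Cn k) : Covec k :=
  (θ (e.symm y)).comp (chartFrame e y)

/-- Smooth differential forms. -/
def IsSmoothForm (Θ : X → Alt k n) : Prop :=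
  ∀ e ∈ atlas (Cn k) X, ContDiffOn ℝ ∞ (formIn e Θ) e.target

/-- The exterior derivative of a differential form, computed at `x` in the preferred chart. -/
def dForm (Θ : X → Alt k n) (x : X) : Alt k (n + 1) :=
  extDeriv (formIn (chartAt (Cn k) x) Θ) (chartAt (Cn k) x x)

lemma formIn_add (e : OpenPartialHomeomorph X (Cn k)) (Θ Θ' : X → Alt k n) :
    formIn e (Θ + Θ') = formIn e Θ + formIn e Θ' := by
  ext y v; simp [formIn]

lemma formIn_smul (e : OpenPartialHomeomorph X (Cn k)) (a : ℝ) (Θ : X → Alt k n) :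
    formIn e (a • Θ) = a • formIn e Θ := by
  ext y v; simp [formIn]

lemma formIn_zero (e : OpenPartialHomeomorph X (Cn k)) :
    formIn e (0 : X → Alt k n) = 0 := by
  ext y v; simp [formIn]

lemma covecIn_add (e : OpenPartialHomeomorph X (Cn k)) (θ θ' : X → Covec k) :
    covecIn e (θ + θ') = covecIn e θ + covecIn e θ' := by
  ext y v; simp [covecIn]

lemma covecIn_smul (e : OpenPartialHomeomorph X (Cn k)) (a : ℝ) (θ : X → Covec k) :
    covecIn e (a • θ) = a • covecIn e θ := by
  ext y v; simp [covecIn]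

lemma covecIn_zero (e : OpenPartialHomeomorph X (Cn k)) :
    covecIn e (0 : X → Covec k) = 0 := by
  ext y v; simp [covecIn]

variable (k X n) in
/-- Real smooth compactly supported differential forms of degree `n`. -/
def TestForm : Submodule ℝ (X → Alt k n) where
  carrier := {Θ | IsSmoothForm Θ ∧ HasCompactSupport Θ}
  zero_mem' := ⟨fun e _ => by rw [formIn_zero]; exact contDiffOn_const, HasCompactSupport.zero⟩
  add_mem' := fun ha hb =>
    ⟨fun e he => by rw [formIn_add]; exact (ha.1 e he).add (hb.1 e he), ha.2.add hb.2⟩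
  smul_mem' := fun a Θ h =>
    ⟨fun e he => by rw [formIn_smul]; exact (h.1 e he).const_smul a,
      h.2.mono (Function.support_const_smul_subset a Θ)⟩

/-- Positive test forms of bidegree `(k-1,k-1)`: they are positive at every point, in every
chart. -/
def IsPositiveForm (Θ : X → Alt k (2 * (k - 1))) : Prop :=
  ∀ e ∈ atlas (Cn k) X, ∀ y ∈ e.target, IsPositiveAlt (formIn e Θ y)

/-! ## Currents of bidegree `(1,1)` -/

variable (k X) in
/-- Linear functionals on the test forms of degree `2k-2`. -/
abbrev PreCurrent : Type _ := TestForm k (2 * (k - 1)) X →ₗ[ℝ] ℝ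

/-- Continuity on test forms: for every compact set `K` in a chart domain, `T` is bounded, on the
test forms supported in `K`, by the uniform norm of finitely many derivatives of the
coefficients. -/
def IsContinuousCurrent (T : PreCurrent k X) : Prop :=
  ∀ e ∈ atlas (Cn k) X, ∀ K : Set X, IsCompact K → K ⊆ e.source →
    ∃ (N : ℕ) (C : ℝ), ∀ (Θ : TestForm k (2 * (k - 1)) X) (M : ℝ), 0 ≤ M →
      tsupport Θ.1 ⊆ K →
      (∀ j ≤ N, ∀ y ∈ e.target, ‖iteratedFDeriv ℝ j (formIn e Θ.1) y‖ ≤ M) → |T Θ| ≤ C * M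

/-- Real functionals of bidegree `(1,1)`: they vanish on the components of bidegree `(k,k-2)` and
`(k-2,k)` of the test forms, that is, they are unchanged when the test form is pulled back by the
multiplication by a complex number of modulus one in every tangent space. -/
def IsBidegreeOneOne (T : PreCurrent k X) : Prop :=
  ∀ a : ℂ, ‖a‖ = 1 → ∀ Θ Θ' : TestForm k (2 * (k - 1)) X,
    (∀ x, Θ'.1 x
      = (Θ.1 x).compContinuousLinearMap (mulC k a)) → T Θ' = T Θ

/-- Closed functionals: `T(dα) = 0` for every test form `α` of degree `2k-3` (there is no condition
if `k = 1`). -/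
def IsClosedCurrent (T : PreCurrent k X) : Prop :=
  ∀ (n : ℕ) (h : n + 1 = 2 * (k - 1)) (α : TestForm k n X) (Θ : TestForm k (2 * (k - 1)) X),
    (∀ (x : X) (v : Fin (2 * (k - 1)) → Cn k),
      Θ.1 x v = dForm α.1 x (v ∘ Fin.cast h)) → T Θ = 0

variable (k X) in
/-- The space of real closed currents of bidegree `(1,1)` on `X`. -/
def ClosedCurrent : Submodule ℝ (PreCurrent k X) where
  carrier := {T | IsContinuousCurrent T ∧ IsBidegreeOneOne T ∧ IsClosedCurrent T}
  zero_mem' := ⟨fun _ _ _ _ _ => ⟨0, 0, fun _ _ _ _ _ => by simp⟩, fun _ _ _ _ _ => rfl,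
    fun _ _ _ _ _ => rfl⟩
  add_mem' := by
    rintro T S ⟨hT, hT2, hT3⟩ ⟨hS, hS2, hS3⟩
    refine ⟨fun e he K hK hKe => ?_, fun a ha Θ Θ' h => ?_, fun n h α Θ hΘ => ?_⟩
    · obtain ⟨N, C, h1⟩ := hT e he K hK hKe
      obtain ⟨N', C', h2⟩ := hS e he K hK hKe
      refine ⟨max N N', C + C', fun Θ M hM hs hb => ?_⟩
      have a1 := h1 Θ M hM hs fun j hj => hb j (hj.trans (le_max_left _ _))
      have a2 := h2 Θ M hM hs fun j hj => hb j (hj.trans (le_max_right _ _))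
      calc |T Θ + S Θ| ≤ |T Θ| + |S Θ| := abs_add_le _ _
        _ ≤ (C + C') * M := by linarith
    · simp only [LinearMap.add_apply, hT2 a ha Θ Θ' h, hS2 a ha Θ Θ' h]
    · simp only [LinearMap.add_apply, hT3 n h α Θ hΘ, hS3 n h α Θ hΘ, add_zero]
  smul_mem' := by
    rintro c T ⟨hT, hT2, hT3⟩
    refine ⟨fun e he K hK hKe => ?_, fun a ha Θ Θ' h => ?_, fun n h α Θ hΘ => ?_⟩
    · obtain ⟨N, C, h1⟩ := hT e he K hK hKe
      refine ⟨N, |c| * C, fun Θ M hM hs hb => ?_⟩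
      rw [LinearMap.smul_apply, smul_eq_mul, abs_mul, mul_assoc]
      exact mul_le_mul_of_nonneg_left (h1 Θ M hM hs hb) (abs_nonneg c)
    · simp only [LinearMap.smul_apply, hT2 a ha Θ Θ' h]
    · simp only [LinearMap.smul_apply, hT3 n h α Θ hΘ, smul_zero]

/-- If `θ = dφ`, the inequality `i∂φ ∧ ∂̄φ ≤ T` in the sense of currents: `∫ i∂φ ∧ ∂̄φ ∧ Θ ≤ T(Θ)`
for every positive test form `Θ` of bidegree `(k-1,k-1)`. Inequalities between currents being
local, it is enough to take the forms supported in a chart domain, where the integral is the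
Lebesgue integral of the coefficient of the form. -/
def GradLE (θ : X → Covec k) (T : PreCurrent k X) : Prop :=
  ∀ e ∈ atlas (Cn k) X, ∀ Θ : TestForm k (2 * (k - 1)) X,
    tsupport Θ.1 ⊆ e.source →
    IsPositiveForm Θ.1 →
    IntegrableOn (fun y => coeff (gradWedge (covecIn e θ y) (formIn e Θ.1 y))) e.target ∧
    ∫ y in e.target, coeff (gradWedge (covecIn e θ y) (formIn e Θ.1 y)) ≤ T Θ

/-! ## Weak differentials -/

/-- `θ` is the differential of the function `f` in the sense of distributions: in every chart
`f` and `θ` are locally integrable and `∫ f ∂ᵥg = - ∫ θ(v) g` for every smooth function `g` with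
compact support in the chart and every vector `v`. -/
def IsWeakDifferential (f : X → ℝ) (θ : X → Covec k) : Prop :=
  ∀ e ∈ atlas (Cn k) X,
    LocallyIntegrableOn (f ∘ e.symm) e.target ∧ LocallyIntegrableOn (covecIn e θ) e.target ∧
    ∀ g : Cn k → ℝ, ContDiff ℝ ∞ g → HasCompactSupport g → tsupport g ⊆ e.target → ∀ v : Cn k,
      ∫ y in e.target, f (e.symm y) * fderiv ℝ g y v
        = - ∫ y in e.target, covecIn e θ y v * g y

/-! ## Kähler forms -/

variable (k X) in
/-- Kähler forms on `X`: smooth closed real `(1,1)`-forms which are positive definite. -/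
structure KahlerForm where
  /-- The underlying differential form. -/
  toForm : X → Alt k 2
  smooth : IsSmoothForm toForm
  closed : ∀ x, dForm toForm x = 0
  diagonal : ∀ x, IsDiagonal (toForm x)
  pos : ∀ x (v : Cn k), v ≠ 0 → 0 < toForm x ![v, Complex.I • v]

namespace KahlerForm

variable (Ω : KahlerForm k X)

/-- The differential form `Ω^p`. -/
def pow (p : ℕ) (x : X) : Alt k (2 * p) := powForm (Ω.toForm x) p

lemma form_nonneg (x : X) (v : Cn k) : 0 ≤ Ω.toForm x ![v, Complex.I • v] := by
  by_cases hv : v = 0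
  · subst hv
    exact le_of_eq ((Ω.toForm x).map_coord_zero (0 : Fin 2) rfl).symm
  · exact (Ω.pos x v hv).le

variable [MeasurableSpace X]

/-- The measure on `X` defined by the volume form `Ω^k`. In the domain of the chart `e` it is the
image by `e⁻¹` of the measure whose density with respect to the Lebesgue measure is the coefficient
of `Ω^k` in `e`. These measures agree on the intersections of the chart domains, and the measure
on `X` which they define is their supremum. -/
def vol : Measure X :=
  ⨆ x : X, ((volume.restrict (chartAt (Cn k) x).target).withDensity fun y =>
    ENNReal.ofReal (coeff (formIn (chartAt (Cn k) x) (Ω.pow k) y))).map (chartAt (Cn k) x).symm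

/-- A field of covectors has `L²` coefficients: its pointwise norm for the Hermitian metric
`v ↦ Ω(v, iv)` is bounded by a square integrable function. -/
def SqIntegrable (θ : X → Covec k) : Prop :=
  ∃ g : X → ℝ, MemLp g 2 Ω.vol ∧
    ∀ᵐ x ∂Ω.vol, ∀ v : Cn k, θ x v ^ 2 ≤ g x ^ 2 * Ω.toForm x ![v, Complex.I • v]

/-- The mass `∫_X T ∧ Ω^(k-1)` of a positive current: the supremum of `T(χ Ω^(k-1))` over the
smooth functions `χ : X → [0,1]` with compact support. -/
def mass (T : PreCurrent k X) : ℝ≥0∞ :=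
  ⨆ (χ : X → ℝ) (_ : ∀ x, χ x ∈ Icc (0 : ℝ) 1) (Θ : TestForm k (2 * (k - 1)) X)
    (_ : ∀ x, Θ.1 x = χ x • Ω.pow (k - 1) x), ENNReal.ofReal (T Θ)

/-- `φ` belongs to the Sobolev space `W^{1,2}` and `i∂φ ∧ ∂̄φ ≤ T`. -/
def Admissible (φ : Lp ℝ 2 Ω.vol) (T : PreCurrent k X) : Prop :=
  ∃ (f : X → ℝ) (θ : X → Covec k), f =ᵐ[Ω.vol] φ ∧ IsWeakDifferential f θ ∧
    Ω.SqIntegrable θ ∧ GradLE θ T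

/-- The infimum of the masses of the closed currents `T` of bidegree `(1,1)` such that
`i∂φ ∧ ∂̄φ ≤ T`. -/
def energy (φ : Lp ℝ 2 Ω.vol) : ℝ≥0∞ :=
  ⨅ (T : PreCurrent k X) (_ : T ∈ ClosedCurrent k X) (_ : Ω.Admissible φ T), Ω.mass T

end KahlerForm

end Forms

section NormFacts

/-! ### The norm of `W^*`: auxiliary facts -/

lemma coeff_add (η η' : Alt k n) : coeff (η + η') = coeff η + coeff η' := rfl

lemma coeff_smul (a : ℝ) (η : Alt k n) : coeff (a • η) = a * coeff η := rfl

lemma gradWedge_smul (a : ℝ) (l : Covec k) (Θ : Alt k n) :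
    gradWedge (a • l) Θ = a ^ 2 • gradWedge l Θ := by
  simp only [gradWedge, ContinuousLinearMap.smul_comp, map_smul, smul_apply,
    smul_smul]
  congr 1
  ring

lemma gradWedge_add_le (Θ : Alt k n) (h : ∀ l : Covec k, 0 ≤ coeff (gradWedge l Θ))
    (l m : Covec k) {c : ℝ} (hc : 0 < c) :
    coeff (gradWedge (l + m) Θ)
      ≤ (1 + c) * coeff (gradWedge l Θ) + (1 + 1 / c) * coeff (gradWedge m Θ) := by
  have key := h (c • l - m)
  have e1 : c * coeff (gradWedge (l + m) Θ) + coeff (gradWedge (c • l - m) Θ)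
      = c * ((1 + c) * coeff (gradWedge l Θ) + (1 + 1 / c) * coeff (gradWedge m Θ)) := by
    simp only [gradWedge, sub_eq_add_neg, ← neg_one_smul ℝ m, ContinuousLinearMap.add_comp,
      ContinuousLinearMap.smul_comp, map_add, map_smul, add_apply,
      smul_apply, coeff_add, coeff_smul, smul_add]
    field_simp
    ring
  have : c * coeff (gradWedge (l + m) Θ)
      ≤ c * ((1 + c) * coeff (gradWedge l Θ) + (1 + 1 / c) * coeff (gradWedge m Θ)) := by linarith
  exact le_of_mul_le_mul_left this hc

lemma continuous_coeff_gradWedge :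
    Continuous fun p : Covec k × Alt k n => coeff (gradWedge p.1 p.2) := by
  have h1 : Continuous fun η : Alt k (n + 2) => coeff η :=
    (ContinuousAlternatingMap.apply ℝ (Cn k) ℝ (frame k (n + 2))).continuous
  have h2 : Continuous fun p : Covec k × Alt k n => gradWedge p.1 p.2 := by
    unfold gradWedge
    have a1 : Continuous fun p : Covec k × Alt k n => wedge₁ p.1 p.2 :=
      (wedge₁.continuous.comp continuous_fst).clm_apply continuous_snd
    have a2 : Continuous fun p : Covec k × Alt k n => p.1.comp (mulC k Complex.I) :=
      continuous_fst.clm_comp continuous_const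
    exact ((wedge₁.continuous.comp a2).clm_apply a1).const_smul (1 / 2 : ℝ)
  exact h1.comp h2

variable {X : Type*} [TopologicalSpace X] [ChartedSpace (Cn k) X]

lemma locallyIntegrableOn_add {F : Type*} [NormedAddCommGroup F] {f g : Cn k → F} {s : Set (Cn k)}
    (hf : LocallyIntegrableOn f s) (hg : LocallyIntegrableOn g s) :
    LocallyIntegrableOn (f + g) s := fun x hx => by
  obtain ⟨u, hu, h1⟩ := hf x hx
  obtain ⟨v, hv, h2⟩ := hg x hx
  exact ⟨u ∩ v, Filter.inter_mem hu hv,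
    (h1.mono_set inter_subset_left).add (h2.mono_set inter_subset_right)⟩

lemma locallyIntegrableOn_zero' {F : Type*} [NormedAddCommGroup F] {s : Set (Cn k)} :
    LocallyIntegrableOn (0 : Cn k → F) s := fun _ _ =>
  ⟨s, self_mem_nhdsWithin, integrableOn_zero⟩

lemma aestronglyMeasurable_of_locallyIntegrableOn {F : Type*} [NormedAddCommGroup F]
    {f : Cn k → F} {s : Set (Cn k)} (hf : LocallyIntegrableOn f s) :
    AEStronglyMeasurable f (volume.restrict s) := hf.aestronglyMeasurable

lemma aestronglyMeasurable_of_continuousOn {F : Type*} [NormedAddCommGroup F]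
    {f : Cn k → F} {s : Set (Cn k)} (hf : ContinuousOn f s) (hs : IsOpen s) :
    AEStronglyMeasurable f (volume.restrict s) := hf.aestronglyMeasurable hs.measurableSet

lemma aestronglyMeasurable_comp₂ {A B : Type*} [NormedAddCommGroup A] [NormedAddCommGroup B]
    {g : A → B → ℝ} (hg : Continuous fun p : A × B => g p.1 p.2) {μ : Measure (Cn k)}
    {u : Cn k → A} {v : Cn k → B} (hu : AEStronglyMeasurable u μ)
    (hv : AEStronglyMeasurable v μ) : AEStronglyMeasurable (fun y => g (u y) (v y)) μ :=
  hg.comp_aestronglyMeasurable (hu.prodMk hv)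

lemma IsWeakDifferential.add {f f' : X → ℝ} {θ θ' : X → Covec k} (h : IsWeakDifferential f θ)
    (h' : IsWeakDifferential f' θ') : IsWeakDifferential (f + f') (θ + θ') := by
  intro e he
  obtain ⟨a1, a2, a3⟩ := h e he
  obtain ⟨b1, b2, b3⟩ := h' e he
  refine ⟨a1.add b1, by
    rw [covecIn_add]
    exact locallyIntegrableOn_add a2 b2, fun g hg hc hs v => ?_⟩
  have key : ∀ (F : Cn k → ℝ) (w : Cn k → ℝ), LocallyIntegrableOn F e.target →
      Continuous w → HasCompactSupport w → tsupport w ⊆ e.target →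
      IntegrableOn (fun y => F y * w y) e.target := by
    intro F w hF hw hwc hws
    have hi : IntegrableOn F (tsupport w) := hF.integrableOn_compact_subset hws hwc
    have h3 : IntegrableOn (fun y => F y * w y) (tsupport w) :=
      hi.mul_continuousOn hw.continuousOn hwc
    exact ((integrableOn_iff_integrable_of_support_subset (fun y hy => by
      by_contra hn
      exact hy (by simp [image_eq_zero_of_notMem_tsupport hn]))).1 h3).integrableOn
  have hgv : Continuous fun y => fderiv ℝ g y v :=
    (hg.continuous_fderiv (by simp)).clm_apply continuous_const
  have hgs : tsupport (fun y => fderiv ℝ g y v) ⊆ tsupport g := by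
    refine closure_minimal (fun y hy => ?_) (isClosed_tsupport g)
    by_contra hn
    have h0 : fderiv ℝ g y = 0 := by
      by_contra h4
      exact hn (support_fderiv_subset ℝ h4)
    exact hy (by simp [h0])
  have hgc : HasCompactSupport fun y => fderiv ℝ g y v :=
    hc.of_isClosed_subset (isClosed_tsupport _) hgs
  have hev : ∀ θ : X → Covec k, LocallyIntegrableOn (covecIn e θ) e.target →
      LocallyIntegrableOn (fun y => covecIn e θ y v) e.target := by
    intro θ hθ x hx
    obtain ⟨s, hs, hi⟩ := hθ x hx
    exact ⟨s, hs, hi.apply_continuousLinearMap v⟩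
  have i1 := key _ _ a1 hgv hgc (hgs.trans hs)
  have i2 := key _ _ b1 hgv hgc (hgs.trans hs)
  have i3 := key _ _ (hev θ a2) hg.continuous hc hs
  have i4 := key _ _ (hev θ' b2) hg.continuous hc hs
  have j1 := a3 g hg hc hs v
  have j2 := b3 g hg hc hs v
  simp only [Function.comp_apply] at i1 i2
  simp only [covecIn_add, Pi.add_apply, add_apply, add_mul]
  rw [integral_add i1 i2, integral_add i3 i4, j1, j2]
  ring

lemma IsWeakDifferential.smul {f : X → ℝ} {θ : X → Covec k} (h : IsWeakDifferential f θ)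
    (a : ℝ) : IsWeakDifferential (a • f) (a • θ) := by
  intro e he
  obtain ⟨a1, a2, a3⟩ := h e he
  refine ⟨a1.smul a, by rw [covecIn_smul]; exact a2.smul a, fun g hg hc hs v => ?_⟩
  simp only [covecIn_smul, Pi.smul_apply, smul_apply, smul_eq_mul, mul_assoc]
  rw [integral_const_mul, integral_const_mul, a3 g hg hc hs v]
  ring

lemma GradLE.add {f f' : X → ℝ} {θ θ' : X → Covec k} {T T' : PreCurrent k X}
    (hf : IsWeakDifferential f θ) (hf' : IsWeakDifferential f' θ')
    (h : GradLE θ T) (h' : GradLE θ' T') {c : ℝ} (hc : 0 < c) :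
    GradLE (θ + θ') ((1 + c) • T + (1 + 1 / c) • T') := by
  intro e he Θ hs hp
  obtain ⟨a1, a2⟩ := h e he Θ hs hp
  obtain ⟨b1, b2⟩ := h' e he Θ hs hp
  have hle : ∀ y ∈ e.target, coeff (gradWedge (covecIn e (θ + θ') y) (formIn e Θ.1 y))
      ≤ (1 + c) * coeff (gradWedge (covecIn e θ y) (formIn e Θ.1 y))
        + (1 + 1 / c) * coeff (gradWedge (covecIn e θ' y) (formIn e Θ.1 y)) := by
    intro y hy
    rw [covecIn_add]
    exact gradWedge_add_le _ (hp e he y hy).2 _ _ hc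
  have hmeas : AEStronglyMeasurable
      (fun y => coeff (gradWedge (covecIn e (θ + θ') y) (formIn e Θ.1 y)))
      (volume.restrict e.target) := by
    have m1 : AEStronglyMeasurable (covecIn e (θ + θ')) (volume.restrict e.target) :=
      aestronglyMeasurable_of_locallyIntegrableOn (hf.add hf' e he).2.1
    have m2 : AEStronglyMeasurable (formIn e Θ.1) (volume.restrict e.target) :=
      aestronglyMeasurable_of_continuousOn (Θ.2.1 e he).continuousOn e.open_target
    exact aestronglyMeasurable_comp₂ (g := fun l Θ => coeff (gradWedge l Θ))
      continuous_coeff_gradWedge m1 m2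
  generalize hq : (fun y => coeff (gradWedge (covecIn e (θ + θ') y) (formIn e Θ.1 y))) = q at *
  generalize hq1 : (fun y => coeff (gradWedge (covecIn e θ y) (formIn e Θ.1 y))) = q1 at *
  generalize hq2 : (fun y => coeff (gradWedge (covecIn e θ' y) (formIn e Θ.1 y))) = q2 at *
  have hle' : ∀ y ∈ e.target, q y ≤ (1 + c) * q1 y + (1 + 1 / c) * q2 y := by
    intro y hy
    rw [← hq, ← hq1, ← hq2]
    exact hle y hy
  have h0 : ∀ y ∈ e.target, 0 ≤ q y := by
    intro y hy
    rw [← hq]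
    exact (hp e he y hy).2 _
  clear hle hq hq1 hq2
  have hint : IntegrableOn (fun y => (1 + c) * q1 y + (1 + 1 / c) * q2 y) e.target :=
    (a1.const_mul (1 + c)).add (b1.const_mul (1 + 1 / c))
  have hi : IntegrableOn q e.target := by
    refine Integrable.mono' hint hmeas ?_
    refine (ae_restrict_iff' e.open_target.measurableSet).2 (Filter.Eventually.of_forall ?_)
    intro y hy
    rw [Real.norm_eq_abs, abs_of_nonneg (h0 y hy)]
    exact hle' y hy
  refine ⟨hi, ?_⟩
  have e1 : ∫ y in e.target, ((1 + c) * q1 y + (1 + 1 / c) * q2 y)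
      = (1 + c) * (∫ y in e.target, q1 y) + (1 + 1 / c) * ∫ y in e.target, q2 y := by
    rw [integral_add (a1.const_mul _) (b1.const_mul _), integral_const_mul, integral_const_mul]
  have e2 : ∫ y in e.target, q y ≤ ∫ y in e.target, ((1 + c) * q1 y + (1 + 1 / c) * q2 y) :=
    setIntegral_mono_on hi hint e.open_target.measurableSet hle'
  have e3 : (1 + c) * (∫ y in e.target, q1 y) ≤ (1 + c) * T Θ :=
    mul_le_mul_of_nonneg_left a2 (by positivity)
  have e4 : (1 + 1 / c) * (∫ y in e.target, q2 y) ≤ (1 + 1 / c) * T' Θ :=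
    mul_le_mul_of_nonneg_left b2 (by positivity)
  have e5 : ((1 + c) • T + (1 + 1 / c) • T') Θ = (1 + c) * T Θ + (1 + 1 / c) * T' Θ := rfl
  rw [e5]
  linarith

lemma GradLE.smul {θ : X → Covec k} {T : PreCurrent k X} (h : GradLE θ T) (a : ℝ) :
    GradLE (a • θ) (a ^ 2 • T) := by
  intro e he Θ hs hp
  obtain ⟨a1, a2⟩ := h e he Θ hs hp
  have : (fun y => coeff (gradWedge (covecIn e (a • θ) y) (formIn e Θ.1 y)))
      = fun y => a ^ 2 * coeff (gradWedge (covecIn e θ y) (formIn e Θ.1 y)) := by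
    funext y
    rw [covecIn_smul, Pi.smul_apply, gradWedge_smul, coeff_smul]
  rw [this]
  refine ⟨a1.const_mul _, ?_⟩
  rw [integral_const_mul, LinearMap.smul_apply, smul_eq_mul]
  exact mul_le_mul_of_nonneg_left a2 (sq_nonneg a)

lemma gradLE_zero : GradLE (0 : X → Covec k) (0 : PreCurrent k X) := by
  intro e _ Θ _ _
  have : (fun y => coeff (gradWedge (covecIn e (0 : X → Covec k) y) (formIn e Θ.1 y)))
      = fun _ => 0 := by
    funext y
    rw [covecIn_zero]
    simp [gradWedge, coeff]
  rw [this]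
  simp

namespace KahlerForm

variable (Ω : KahlerForm k X)

lemma mass_smul_add_smul_le (T T' : PreCurrent k X) {a b : ℝ} (ha : 0 ≤ a) (hb : 0 ≤ b) :
    Ω.mass (a • T + b • T') ≤ ENNReal.ofReal a * Ω.mass T + ENNReal.ofReal b * Ω.mass T' := by
  refine iSup_le fun χ => iSup_le fun hχ => iSup_le fun Θ => iSup_le fun hΘ => ?_
  have h1 : ∀ S : PreCurrent k X, ENNReal.ofReal (S Θ) ≤ Ω.mass S := fun S =>
    le_iSup_of_le χ (le_iSup_of_le hχ (le_iSup_of_le Θ (le_iSup_of_le hΘ le_rfl)))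
  calc ENNReal.ofReal ((a • T + b • T') Θ) ≤ ENNReal.ofReal (a * T Θ) + ENNReal.ofReal (b * T' Θ) :=
        ENNReal.ofReal_add_le
    _ = ENNReal.ofReal a * ENNReal.ofReal (T Θ) + ENNReal.ofReal b * ENNReal.ofReal (T' Θ) := by
        rw [ENNReal.ofReal_mul ha, ENNReal.ofReal_mul hb]
    _ ≤ _ := by gcongr <;> exact h1 _

lemma mass_zero : Ω.mass (0 : PreCurrent k X) = 0 := by
  simp [mass]

variable [MeasurableSpace X] {Ω}

lemma SqIntegrable.add {θ θ' : X → Covec k} (h : Ω.SqIntegrable θ) (h' : Ω.SqIntegrable θ') :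
    Ω.SqIntegrable (θ + θ') := by
  obtain ⟨g, hg, hb⟩ := h
  obtain ⟨g', hg', hb'⟩ := h'
  refine ⟨fun x => 2 * (|g x| + |g' x|), (hg.abs.add hg'.abs).const_mul 2, ?_⟩
  filter_upwards [hb, hb'] with x h1 h2 v
  have w := Ω.form_nonneg x v
  have e1 := h1 v
  have e2 := h2 v
  rw [← sq_abs (g x)] at e1
  rw [← sq_abs (g' x)] at e2
  have p1 := mul_nonneg (mul_nonneg (abs_nonneg (g x)) (abs_nonneg (g' x))) w
  have p2 := mul_nonneg (sq_nonneg |g x|) w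
  have p3 := mul_nonneg (sq_nonneg |g' x|) w
  simp only [Pi.add_apply, add_apply]
  nlinarith [sq_nonneg (θ x v - θ' x v)]

lemma SqIntegrable.smul {θ : X → Covec k} (h : Ω.SqIntegrable θ) (a : ℝ) :
    Ω.SqIntegrable (a • θ) := by
  obtain ⟨g, hg, hb⟩ := h
  refine ⟨fun x => a * g x, hg.const_mul a, ?_⟩
  filter_upwards [hb] with x h1 v
  simp only [Pi.smul_apply, smul_apply, smul_eq_mul, mul_pow, mul_assoc]
  exact mul_le_mul_of_nonneg_left (h1 v) (sq_nonneg a)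

lemma Admissible.add {φ ψ : Lp ℝ 2 Ω.vol} {T S : PreCurrent k X} (h : Ω.Admissible φ T)
    (h' : Ω.Admissible ψ S) {c : ℝ} (hc : 0 < c) :
    Ω.Admissible (φ + ψ) ((1 + c) • T + (1 + 1 / c) • S) := by
  obtain ⟨f, θ, h1, h2, h3, h4⟩ := h
  obtain ⟨f', θ', h1', h2', h3', h4'⟩ := h'
  exact ⟨f + f', θ + θ', (h1.add h1').trans (Lp.coeFn_add φ ψ).symm, h2.add h2', h3.add h3',
    GradLE.add h2 h2' h4 h4' hc⟩

lemma Admissible.smul {φ : Lp ℝ 2 Ω.vol} {T : PreCurrent k X} (h : Ω.Admissible φ T) (a : ℝ) :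
    Ω.Admissible (a • φ) (a ^ 2 • T) := by
  obtain ⟨f, θ, h1, h2, h3, h4⟩ := h
  exact ⟨a • f, a • θ, (h1.const_smul a).trans (Lp.coeFn_smul a φ).symm, h2.smul a, h3.smul a,
    h4.smul a⟩

lemma exists_of_energy_lt {φ : Lp ℝ 2 Ω.vol} {m : ℝ≥0∞} (h : Ω.energy φ < m) :
    ∃ T ∈ ClosedCurrent k X, Ω.Admissible φ T ∧ Ω.mass T < m := by
  simp only [energy, iInf_lt_iff] at h
  obtain ⟨T, h1, h2, h3⟩ := h
  exact ⟨T, h1, h2, h3⟩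

lemma energy_le {φ : Lp ℝ 2 Ω.vol} {T : PreCurrent k X} (h : T ∈ ClosedCurrent k X)
    (h' : Ω.Admissible φ T) : Ω.energy φ ≤ Ω.mass T :=
  iInf_le_of_le T (iInf_le_of_le h (iInf_le_of_le h' le_rfl))

lemma energy_add_le {φ ψ : Lp ℝ 2 Ω.vol} {a b : ℝ} (ha : 0 < a) (hb : 0 < b)
    (h : Ω.energy φ < ENNReal.ofReal (a ^ 2)) (h' : Ω.energy ψ < ENNReal.ofReal (b ^ 2)) :
    Ω.energy (φ + ψ) ≤ ENNReal.ofReal ((a + b) ^ 2) := by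
  obtain ⟨T, h1, h2, h3⟩ := exists_of_energy_lt h
  obtain ⟨S, h1', h2', h3'⟩ := exists_of_energy_lt h'
  have hc : 0 < b / a := by positivity
  have hc' : 0 < 1 / (b / a) := by positivity
  refine (energy_le (Submodule.add_mem _ (Submodule.smul_mem _ _ h1) (Submodule.smul_mem _ _ h1'))
    (h2.add h2' hc)).trans ((Ω.mass_smul_add_smul_le T S (by positivity) (by positivity)).trans ?_)
  calc _ ≤ ENNReal.ofReal (1 + b / a) * ENNReal.ofReal (a ^ 2)
        + ENNReal.ofReal (1 + 1 / (b / a)) * ENNReal.ofReal (b ^ 2) := by gcongr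
    _ = ENNReal.ofReal ((a + b) ^ 2) := by
      rw [← ENNReal.ofReal_mul (by positivity), ← ENNReal.ofReal_mul (by positivity),
        ← ENNReal.ofReal_add (by positivity) (by positivity)]
      congr 1
      field_simp
      ring

lemma energy_smul_le (φ : Lp ℝ 2 Ω.vol) (a : ℝ) :
    Ω.energy (a • φ) ≤ ENNReal.ofReal (a ^ 2) * Ω.energy φ := by
  by_cases ha : a = 0
  · subst ha
    refine le_trans (energy_le (T := 0) (Submodule.zero_mem _)
      ⟨0, 0, ?_, ?_, ⟨0, MemLp.zero, ?_⟩, gradLE_zero⟩) (by simp [mass_zero])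
    · rw [zero_smul]; exact (Lp.coeFn_zero ℝ 2 Ω.vol).symm
    · intro e _
      rw [covecIn_zero]
      exact ⟨locallyIntegrableOn_zero', locallyIntegrableOn_zero', by simp⟩
    · simp
  have ha2 : 0 < a ^ 2 := by positivity
  have hne : ENNReal.ofReal (a ^ 2) ≠ 0 := (ENNReal.ofReal_pos.2 ha2).ne'
  rw [mul_comm, ← ENNReal.div_le_iff hne ENNReal.ofReal_ne_top]
  refine le_iInf fun T => le_iInf fun h => le_iInf fun h' => ?_
  rw [ENNReal.div_le_iff hne ENNReal.ofReal_ne_top]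
  refine (energy_le (Submodule.smul_mem _ (a ^ 2) h) (h'.smul a)).trans ?_
  have := Ω.mass_smul_add_smul_le T 0 ha2.le le_rfl
  simpa [mul_comm] using this

end KahlerForm

end NormFacts

/-! ## The standard Kähler form on open subsets of `ℂᵏ` -/

section Flat

/-- The coordinate functions `x_j` and `y_j` of `ℂᵏ`, where `z_j = x_j + i y_j`. -/
def reCoord (j : Fin k) : Covec k :=
  Complex.reCLM.comp ((EuclideanSpace.proj j : Cn k →L[ℂ] ℂ).restrictScalars ℝ)

/-- See `reCoord`. -/
def imCoord (j : Fin k) : Covec k :=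
  Complex.imCLM.comp ((EuclideanSpace.proj j : Cn k →L[ℂ] ℂ).restrictScalars ℝ)

variable (k) in
/-- The form `∑ⱼ dx_j ∧ dy_j = (i/2) ∑ⱼ dz_j ∧ dz̄_j` on `ℂᵏ`. -/
def stdForm : Alt k 2 := ∑ j : Fin k, wedge₁ (reCoord j) (covecEquiv k (imCoord j))

lemma stdForm_apply (u v : Cn k) :
    stdForm k ![u, v] = ∑ j : Fin k, ((u j).re * (v j).im - (v j).re * (u j).im) := by
  have h : Fin.removeNth 1 ![u, v] 0 = u := rfl
  simp [stdForm, wedge₁, reCoord, imCoord, covecEquiv,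
    ContinuousAlternatingMap.alternatizeUncurryFin_apply, Fin.sum_univ_two, h, sub_eq_add_neg]

variable (U : TopologicalSpace.Opens (Cn k))

lemma chart_apply {e : OpenPartialHomeomorph U (Cn k)} (he : e ∈ atlas (Cn k) U) (x : U) :
    e x = x := by
  obtain ⟨z, rfl⟩ := TopologicalSpace.Opens.chart_eq ⟨x⟩ he
  rfl

lemma formIn_const {e : OpenPartialHomeomorph U (Cn k)} (he : e ∈ atlas (Cn k) U) (η : Alt k n)
    {y : Cn k} (hy : y ∈ e.target) : formIn e (fun _ => η) y = η := by
  have h : chartFrame e y = ContinuousLinearMap.id ℝ (Cn k) := by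
    have h1 : (chartAt (Cn k) (e.symm y) ∘ e.symm) =ᶠ[nhds y] id := by
      filter_upwards [e.open_target.mem_nhds hy] with w hw
      rw [Function.comp_apply, chart_apply U (chart_mem_atlas _ _), ← chart_apply U he,
        e.right_inv hw, id]
    rw [chartFrame, h1.fderiv_eq, fderiv_id]
  ext v
  simp [formIn, h]

/-- The Kähler form `c dd^c‖z‖²` on an open subset of `ℂᵏ`, where `c > 0` and
`d^c = (i/2π)(∂̄ - ∂)`, so that `dd^c‖z‖² = (i/π) ∑ⱼ dz_j ∧ dz̄_j = (2/π) ∑ⱼ dx_j ∧ dy_j`. -/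
def flatKahler (c : ℝ) (hc : 0 < c) : KahlerForm k U where
  toForm _ := (c * (2 / Real.pi)) • stdForm k
  smooth e he := contDiffOn_const.congr fun y hy => formIn_const U he _ hy
  closed x := by
    have h1 : formIn (chartAt (Cn k) x) (fun _ : U => (c * (2 / Real.pi)) • stdForm k)
        =ᶠ[nhds (chartAt (Cn k) x x)] fun _ => (c * (2 / Real.pi)) • stdForm k := by
      filter_upwards [(chartAt (Cn k) x).open_target.mem_nhds
        ((chartAt (Cn k) x).map_source (mem_chart_source _ x))] with w hw
      exact formIn_const U (chart_mem_atlas _ x) _ hw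
    rw [dForm, h1.extDeriv_eq]
    ext v
    simp [extDeriv, ContinuousAlternatingMap.alternatizeUncurryFin_apply]
  diagonal x a ha := by
    have hs : ∀ u v : Cn k, stdForm k ![a • u, a • v] = stdForm k ![u, v] := by
      intro u v
      have h2 : a.re * a.re + a.im * a.im = 1 := by
        rw [← Complex.normSq_apply, Complex.normSq_eq_norm_sq, ha, one_pow]
      rw [stdForm_apply, stdForm_apply]
      refine Finset.sum_congr rfl fun j _ => ?_
      simp only [PiLp.smul_apply, smul_eq_mul, Complex.mul_re, Complex.mul_im]
      linear_combination ((u j).re * (v j).im - (v j).re * (u j).im) * h2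
    ext v
    have h3 : v = ![v 0, v 1] := by
      ext i; fin_cases i <;> rfl
    have h4 : (fun i => mulC k a (v i)) = ![a • v 0, a • v 1] := by
      ext i; fin_cases i <;> rfl
    have h5 := hs (v 0) (v 1)
    rw [← h3, ← h4] at h5
    simp only [ContinuousAlternatingMap.compContinuousLinearMap_apply,
      ContinuousAlternatingMap.smul_apply]
    exact congrArg _ h5
  pos x v hv := by
    have h1 : 0 < stdForm k ![v, Complex.I • v] := by
      rw [stdForm_apply]
      obtain ⟨j, hj⟩ : ∃ j, v j ≠ 0 := by
        by_contra! h
        exact hv (PiLp.ext h)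
      have h2 : ∀ i, (v i).re * ((Complex.I • v) i).im - ((Complex.I • v) i).re * (v i).im
          = Complex.normSq (v i) := by
        intro i
        simp [Complex.normSq_apply]
      simp only [h2]
      exact Finset.sum_pos' (fun i _ => Complex.normSq_nonneg _)
        ⟨j, Finset.mem_univ j, Complex.normSq_pos.2 hj⟩
    have := Real.pi_pos
    rw [ContinuousAlternatingMap.smul_apply, smul_eq_mul]
    positivity

end Flat

/-! ## The space `W^*` -/

section Space

variable {X : Type*} [TopologicalSpace X] [ChartedSpace (Cn k) X] [MeasurableSpace X]

namespace KahlerForm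

variable (Ω : KahlerForm k X)

/-- The real vector space `W^*` of the functions `φ ∈ W^{1,2}` for which there is a closed current
`T` of bidegree `(1,1)` and of finite mass with `i∂φ ∧ ∂̄φ ≤ T`; functions are identified when they
agree almost everywhere. -/
def wStar : Submodule ℝ (Lp ℝ 2 Ω.vol) where
  carrier := {φ | ∃ T ∈ ClosedCurrent k X, Ω.Admissible φ T ∧ Ω.mass T < ⊤}
  zero_mem' := exists_of_energy_lt (by
    have := energy_smul_le (Ω := Ω) 0 0
    simp only [smul_zero, ne_eq, OfNat.ofNat_ne_zero, not_false_eq_true, zero_pow,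
      ENNReal.ofReal_zero, zero_mul] at this
    exact this.trans_lt ENNReal.zero_lt_top)
  add_mem' := by
    rintro φ ψ ⟨T, h1, h2, h3⟩ ⟨S, h1', h2', h3'⟩
    refine ⟨_, Submodule.add_mem _ (Submodule.smul_mem _ _ h1) (Submodule.smul_mem _ _ h1'),
      h2.add h2' one_pos,
      (Ω.mass_smul_add_smul_le T S (by norm_num) (by norm_num)).trans_lt ?_⟩
    exact ENNReal.add_lt_top.2
      ⟨ENNReal.mul_lt_top ENNReal.ofReal_lt_top h3, ENNReal.mul_lt_top ENNReal.ofReal_lt_top h3'⟩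
  smul_mem' := by
    rintro a φ ⟨T, h1, h2, h3⟩
    refine exists_of_energy_lt ((energy_smul_le φ a).trans_lt ?_)
    exact ENNReal.mul_lt_top ENNReal.ofReal_lt_top ((energy_le h1 h2).trans_lt h3)

/-- The type of the elements of `W^*`. It is not given the norm of `L²`. -/
def WStar : Type _ := Ω.wStar

instance : AddCommGroup Ω.WStar := inferInstanceAs (AddCommGroup Ω.wStar)

instance : Module ℝ Ω.WStar := inferInstanceAs (Module ℝ Ω.wStar)

variable {Ω}

/-- The class in `L²` of an element of `W^*`. -/
def WStar.toLp (φ : Ω.WStar) : Lp ℝ 2 Ω.vol := Subtype.val φ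

/-- The norm `‖φ‖_* = (‖φ‖²_{L²} + inf m(T))^(1/2)` of `W^*`, the infimum being taken over the closed
currents `T` of bidegree `(1,1)` with `i∂φ ∧ ∂̄φ ≤ T`. -/
instance : Norm Ω.WStar :=
  ⟨fun φ => √(‖φ.toLp‖ ^ 2 + (Ω.energy φ.toLp).toReal)⟩

lemma WStar.norm_def (φ : Ω.WStar) : ‖φ‖ = √(‖φ.toLp‖ ^ 2 + (Ω.energy φ.toLp).toReal) := rfl

lemma WStar.energy_ne_top (φ : Ω.WStar) : Ω.energy φ.toLp ≠ ⊤ := by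
  obtain ⟨T, h1, h2, h3⟩ := φ.2
  exact ((energy_le h1 h2).trans_lt h3).ne

lemma WStar.sqrt_energy_add_le (φ ψ : Ω.WStar) :
    √(Ω.energy (φ.toLp + ψ.toLp)).toReal
      ≤ √(Ω.energy φ.toLp).toReal + √(Ω.energy ψ.toLp).toReal := by
  refine le_of_forall_pos_le_add fun ε hε => ?_
  have key : ∀ χ : Ω.WStar,
      Ω.energy χ.toLp < ENNReal.ofReal ((√(Ω.energy χ.toLp).toReal + ε / 2) ^ 2) := by
    intro χ
    rw [← ENNReal.toReal_lt_toReal χ.energy_ne_top ENNReal.ofReal_ne_top,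
      ENNReal.toReal_ofReal (by positivity)]
    have h0 := Real.sq_sqrt (ENNReal.toReal_nonneg (a := Ω.energy χ.toLp))
    have h1 := Real.sqrt_nonneg (Ω.energy χ.toLp).toReal
    nlinarith
  have h := energy_add_le (by positivity) (by positivity) (key φ) (key ψ)
  have h2 := ENNReal.toReal_mono ENNReal.ofReal_ne_top h
  rw [ENNReal.toReal_ofReal (by positivity)] at h2
  refine (Real.sqrt_le_left (by positivity)).2 (h2.trans (le_of_eq ?_))
  ring

lemma WStar.energy_smul (a : ℝ) (φ : Ω.WStar) :
    Ω.energy (a • φ.toLp) = ENNReal.ofReal (a ^ 2) * Ω.energy φ.toLp := by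
  refine le_antisymm (energy_smul_le _ a) ?_
  by_cases ha : a = 0
  · simp [ha]
  have h := energy_smul_le (a • φ.toLp) a⁻¹
  rw [smul_smul, inv_mul_cancel₀ ha, one_smul] at h
  calc _ ≤ ENNReal.ofReal (a ^ 2)
        * (ENNReal.ofReal (a⁻¹ ^ 2) * Ω.energy (a • φ.toLp)) := by gcongr
    _ = Ω.energy (a • φ.toLp) := by
      rw [← mul_assoc, ← ENNReal.ofReal_mul (sq_nonneg a), ← mul_pow, mul_inv_cancel₀ ha]
      simp

lemma sqrt_minkowski {a r b c s t : ℝ} (ha : 0 ≤ a) (hr : 0 ≤ r) (h : a ≤ b + c) (h' : r ≤ s + t) :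
    √(a ^ 2 + r ^ 2) ≤ √(b ^ 2 + s ^ 2) + √(c ^ 2 + t ^ 2) := by
  refine (Real.sqrt_le_left (by positivity)).2 ?_
  have h1 : b * c + s * t ≤ √(b ^ 2 + s ^ 2) * √(c ^ 2 + t ^ 2) := by
    rw [← Real.sqrt_mul (by positivity)]
    refine Real.le_sqrt_of_sq_le ?_
    nlinarith [sq_nonneg (b * t - s * c)]
  have h2 := Real.sq_sqrt (show 0 ≤ b ^ 2 + s ^ 2 by positivity)
  have h3 := Real.sq_sqrt (show 0 ≤ c ^ 2 + t ^ 2 by positivity)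
  have h4 : a ^ 2 ≤ (b + c) ^ 2 := pow_le_pow_left₀ ha h 2
  have h5 : r ^ 2 ≤ (s + t) ^ 2 := pow_le_pow_left₀ hr h' 2
  nlinarith

lemma WStar.normCore : NormedSpace.Core ℝ Ω.WStar where
  norm_nonneg φ := Real.sqrt_nonneg _
  norm_smul a φ := by
    have h1 : (a • φ).toLp = a • φ.toLp := rfl
    rw [norm_def, norm_def, h1, energy_smul, norm_smul, ENNReal.toReal_mul,
      ENNReal.toReal_ofReal (sq_nonneg a), mul_pow, Real.norm_eq_abs, sq_abs, ← mul_add,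
      Real.sqrt_mul (sq_nonneg a), Real.sqrt_sq_eq_abs]
  norm_triangle φ ψ := by
    have h1 : (φ + ψ).toLp = φ.toLp + ψ.toLp := rfl
    have hs := sqrt_energy_add_le φ ψ
    have hn := norm_add_le φ.toLp ψ.toLp
    rw [norm_def, norm_def, norm_def, h1]
    have q0 := Real.sq_sqrt (ENNReal.toReal_nonneg (a := Ω.energy (φ.toLp + ψ.toLp)))
    have q1 := Real.sq_sqrt (ENNReal.toReal_nonneg (a := Ω.energy φ.toLp))
    have q2 := Real.sq_sqrt (ENNReal.toReal_nonneg (a := Ω.energy ψ.toLp))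
    rw [← q0, ← q1, ← q2]
    have r0 := Real.sqrt_nonneg (Ω.energy (φ.toLp + ψ.toLp)).toReal
    exact sqrt_minkowski (norm_nonneg _) r0 hn hs
  norm_eq_zero_iff φ := by
    constructor
    · intro h
      have h0 : (0 : ℝ) ≤ (Ω.energy φ.toLp).toReal := ENNReal.toReal_nonneg
      rw [norm_def, Real.sqrt_eq_zero (by positivity)] at h
      have h2 : ‖φ.toLp‖ = 0 := by nlinarith [sq_nonneg ‖φ.toLp‖, norm_nonneg φ.toLp]
      exact Subtype.ext (norm_eq_zero.1 h2)
    · rintro rfl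
      have h1 : (0 : Ω.WStar).toLp = (0 : ℝ) • (0 : Ω.WStar).toLp := by rw [zero_smul]; rfl
      rw [norm_def, h1, energy_smul]
      simp

instance : NormedAddCommGroup Ω.WStar := NormedAddCommGroup.ofCore WStar.normCore

instance : NormedSpace ℝ Ω.WStar := NormedSpace.ofCore WStar.normCore

end KahlerForm

end Space

/-- Reflexivity of a real normed space: the canonical map to the bidual is onto. -/
def IsReflexive (V : Type*) [NormedAddCommGroup V] [NormedSpace ℝ V] : Prop :=
  Function.Surjective (NormedSpace.inclusionInDoubleDual ℝ V)

end ComplexSobolev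

end

open ComplexSobolev

/-!
# The space `W^*` is complete and not reflexive

**Completeness.** Let `φ = ∑ φₙ` be an absolutely convergent series in `W^*`, let `aₙ > ‖φₙ‖` be summable
with sum `s`, and let `Tₙ` be a closed current with `i∂φₙ ∧ ∂̄φₙ ≤ Tₙ` and mass at most `aₙ²`. Since a
positive semidefinite quadratic form satisfies `q(∑ lₙ) ≤ s ∑ q(lₙ)/aₙ`, the current `s ∑ Tₙ/aₙ` bounds
`i∂φ ∧ ∂̄φ`, and its mass is at most `s²` (`KahlerForm.exists_admissible_tsum`). The currents `Tₙ` are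
positive, hence of order zero and controlled by their masses (`KahlerForm.exists_current_bound`), so the
series defines a current. The same bound for the tails gives the convergence in the norm of `W^*`.

**Non-reflexivity.** In a chart, write `w = z - z₀` and consider the smooth functions
`|w_0|²/(‖w‖² + c)`, cut off away from `z₀`. With `N = ‖w‖² + c`, their gradients are bounded by a closed
form `A Ω + d(H(N) d^c N)`, where `H(t) = 1/t` near `0` and `A` does not depend on `c`. By Stokes' theorem
the mass of this form is `A` times the volume of `X`, which is finite in both cases. So these functions
are bounded in `W^*` (`KahlerForm.exists_admissible_angFun`) while they converge in `L²`, as `c → 0`, to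
the cut-off of the function `Q = |w_0|²/‖w‖²`, which is not continuous at `z₀` because `k ≥ 2`. If `W^*`
is reflexive, then `Q` is in `W^*` and, by the Hahn–Banach theorem, in the closed span of smooth functions
(`IsReflexive.exists_mem_closure_span`, `KahlerForm.exists_mem_closure_smoothPart`).

This is excluded by a scaling argument. If `T` bounds `i∂f ∧ ∂̄f`, then testing the closed positive
current `T` against a cut-off of `N^(-(k-1)) d^c N ∧ (dd^c ‖w‖²)^(k-2)`, with `c = r²`, shows that the
energy of `f` on the ball of radius `r` is at most `C r^(2k-2)` times the mass of `T`, as in the theory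
of Lelong numbers (`exists_setIntegral_ball_le`). By the Cauchy–Schwarz inequality, a function `f` of
norm `δ` in `W^*` satisfies `∫ ‖df‖ ≤ C δ r^(2k-1)` on this ball (`exists_setIntegral_ball_norm_le`), and a
smooth function satisfies `∫ ‖ds‖ = O(r^(2k))`. But `Q` is homogeneous of degree `0` and not constant, so
`∫ ‖dQ‖` is at least `C' r^(2k-1)` for some `C' > 0` (`abs_integral_angQuot_le`,
`exists_integral_angQuot_ne_zero`). So `Q` is not a sum `f + s` if `δ` is small.

Mathlib has no positive forms, currents, or Stokes' theorem on manifolds. What is used of them is derived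
from linear algebra in the tangent spaces, integration by parts on `ℂᵏ` and partitions of unity.
-/

set_option linter.unusedSectionVars false

noncomputable section

namespace ComplexSobolev

section

variable {k n : ℕ}

/-! ### Exterior algebra of the real vector space `ℂᵏ` -/

lemma wedge₁_apply (l : Covec k) (Θ : Alt k n) (v : Fin (n + 1) → Cn k) :
    wedge₁ l Θ v = ∑ i : Fin (n + 1), (-1) ^ (i : ℕ) * (l (v i) * Θ (i.removeNth v)) := by
  simp [wedge₁, ContinuousAlternatingMap.alternatizeUncurryFin_apply]

/-- The contraction `η(v, ·)` of a `2`-form with a vector, as a covector. -/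
def contr (η : Alt k 2) (v : Cn k) : Covec k := (covecEquiv k).symm (η.curryLeft v)

lemma covecEquiv_apply (l : Covec k) (v : Fin 1 → Cn k) : covecEquiv k l v = l (v 0) := by
  simp [covecEquiv]

lemma contr_apply (η : Alt k 2) (v w : Cn k) : contr η v w = η ![v, w] := by
  have h : covecEquiv k (contr η v) ![w] = contr η v w := covecEquiv_apply _ _
  rw [← h, contr, LinearIsometryEquiv.apply_symm_apply]
  rfl

lemma covecEquiv_contr (η : Alt k 2) (v : Cn k) : covecEquiv k (contr η v) = η.curryLeft v := by
  simp [contr]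

lemma alt_ext_curryLeft {Θ Θ' : Alt k (n + 1)} (h : ∀ v, Θ.curryLeft v = Θ'.curryLeft v) :
    Θ = Θ' := by
  ext v
  have := congrArg (fun Φ : Alt k n => Φ (Fin.tail v)) (h (v 0))
  simp only [ContinuousAlternatingMap.curryLeft_apply_apply] at this
  have e : Matrix.vecCons (v 0) (Fin.tail v) = v := Fin.cons_self_tail v
  rwa [e] at this

lemma curryLeft_wedge₁_zero (l : Covec k) (Θ : Alt k 0) (v : Cn k) :
    (wedge₁ l Θ).curryLeft v = l v • Θ := by
  ext w
  rw [ContinuousAlternatingMap.curryLeft_apply_apply, wedge₁_apply]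
  simp only [Fin.sum_univ_succ, Finset.univ_eq_empty, Finset.sum_empty]
  simp [Subsingleton.elim (Fin.tail (Matrix.vecCons v w)) w]

lemma curryLeft_wedge₁ (l : Covec k) (Θ : Alt k (n + 1)) (v : Cn k) :
    (wedge₁ l Θ).curryLeft v = l v • Θ - wedge₁ l (Θ.curryLeft v) := by
  ext w
  rw [ContinuousAlternatingMap.curryLeft_apply_apply, wedge₁_apply, Fin.sum_univ_succ,
    ContinuousAlternatingMap.sub_apply, ContinuousAlternatingMap.smul_apply, wedge₁_apply,
    sub_eq_add_neg, ← Finset.sum_neg_distrib]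
  congr 1
  · simp [Fin.tail_def]
  · refine Finset.sum_congr rfl fun i _ => ?_
    have : (i.succ.removeNth (Matrix.vecCons v w) : Fin (n + 1) → Cn k)
        = Matrix.vecCons v (i.removeNth w) := by
      refine funext fun j => ?_
      refine Fin.cases ?_ (fun j => ?_) j
      · simp [Fin.removeNth]
      · simp [Fin.removeNth]
    rw [this, ContinuousAlternatingMap.curryLeft_apply_apply]
    simp [pow_succ]

lemma wedge₁_anticomm (l m : Covec k) (Θ : Alt k n) :
    wedge₁ l (wedge₁ m Θ) = -wedge₁ m (wedge₁ l Θ) := by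
  induction n with
  | zero =>
    refine alt_ext_curryLeft fun v => ?_
    rw [show (-wedge₁ m (wedge₁ l Θ)).curryLeft v = -((wedge₁ m (wedge₁ l Θ)).curryLeft v) from rfl,
      curryLeft_wedge₁, curryLeft_wedge₁, curryLeft_wedge₁_zero, curryLeft_wedge₁_zero]
    simp
  | succ n ih =>
    refine alt_ext_curryLeft fun v => ?_
    rw [show (-wedge₁ m (wedge₁ l Θ)).curryLeft v = -((wedge₁ m (wedge₁ l Θ)).curryLeft v) from rfl,
      curryLeft_wedge₁, curryLeft_wedge₁, curryLeft_wedge₁, curryLeft_wedge₁]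
    simp only [map_sub, map_smul]
    rw [ih]
    abel

variable (k) in
/-- Some basis of the real vector space `ℂᵏ`; the choice is irrelevant. -/
def rBasis : Module.Basis (Fin (Module.finrank ℝ (Cn k))) ℝ (Cn k) := Module.finBasis ℝ (Cn k)

/-- The basis of the covectors dual to `rBasis`. -/
def dualCovec (a : Fin (Module.finrank ℝ (Cn k))) : Covec k :=
  LinearMap.toContinuousLinearMap ((rBasis k).coord a)

lemma sum_dualCovec_smul {F : Type*} [AddCommGroup F] [Module ℝ F] (f : Cn k →ₗ[ℝ] F) (v : Cn k) :
    ∑ a, dualCovec a v • f (rBasis k a) = f v := by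
  conv_rhs => rw [← (rBasis k).sum_repr v, map_sum]
  simp [dualCovec]

lemma sum_apply_dualCovec (l : Covec k) : ∑ a, l (rBasis k a) • dualCovec a = l := by
  ext v
  have := sum_dualCovec_smul l.toLinearMap v
  simpa [mul_comm] using this

lemma alternatizeUncurryFin_eq_sum (f : Cn k →L[ℝ] Alt k n) :
    ContinuousAlternatingMap.alternatizeUncurryFin f
      = ∑ a, wedge₁ (dualCovec a) (f (rBasis k a)) := by
  ext v
  rw [ContinuousAlternatingMap.alternatizeUncurryFin_apply, ContinuousAlternatingMap.sum_apply]
  simp only [wedge₁_apply]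
  rw [Finset.sum_comm]
  refine Finset.sum_congr rfl fun i _ => ?_
  rw [← Finset.mul_sum]
  have := congrArg (fun Φ : Alt k n => Φ (i.removeNth v)) (sum_dualCovec_smul f.toLinearMap (v i))
  simp only [ContinuousAlternatingMap.sum_apply, ContinuousAlternatingMap.smul_apply] at this
  simp only [smul_eq_mul, ContinuousLinearMap.coe_coe] at this
  rw [this]
  simp

lemma sum_wedge₁_curryLeft (Θ : Alt k (n + 1)) :
    ∑ a, wedge₁ (dualCovec a) (Θ.curryLeft (rBasis k a)) = ((n : ℝ) + 1) • Θ := by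
  rw [← alternatizeUncurryFin_eq_sum, ContinuousAlternatingMap.alternatizeUncurryFin_curryLeft,
    ← Nat.cast_smul_eq_nsmul ℝ]
  push_cast
  rfl

lemma wedge₂_eq_sum (η : Alt k 2) (Θ : Alt k n) :
    wedge₂ η Θ
      = (1 / 2 : ℝ) • ∑ a, wedge₁ (dualCovec a) (wedge₁ (contr η (rBasis k a)) Θ) := by
  rw [wedge₂, alternatizeUncurryFin_eq_sum]
  rfl

/-- The exterior product with a `2`-form, as a continuous bilinear map. -/
def wedge₂L : Alt k 2 →L[ℝ] Alt k n →L[ℝ] Alt k (n + 2) :=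
  (1 / 2 : ℝ) • ∑ a, (ContinuousLinearMap.compL ℝ (Alt k n) (Alt k (n + 1)) (Alt k (n + 2))
    (wedge₁ (dualCovec a))).comp (wedge₁.comp
      (((covecEquiv k).symm : Alt k 1 →L[ℝ] Covec k).comp
        ((ContinuousLinearMap.apply ℝ (Alt k 1) (rBasis k a)).comp
          (ContinuousAlternatingMap.curryLeftLI (𝕜 := ℝ) (E := Cn k) (F := ℝ)
            (n := 1)).toContinuousLinearMap)))

lemma wedge₂L_apply (η : Alt k 2) (Θ : Alt k n) : wedge₂L η Θ = wedge₂ η Θ := by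
  rw [wedge₂_eq_sum]
  simp only [wedge₂L, smul_apply, _root_.sum_apply]
  rfl

lemma wedge₂_add_left (η η' : Alt k 2) (Θ : Alt k n) :
    wedge₂ (η + η') Θ = wedge₂ η Θ + wedge₂ η' Θ := by simp [← wedge₂L_apply]

lemma wedge₂_smul_left (c : ℝ) (η : Alt k 2) (Θ : Alt k n) :
    wedge₂ (c • η) Θ = c • wedge₂ η Θ := by simp [← wedge₂L_apply]

lemma wedge₂_zero_left (Θ : Alt k n) : wedge₂ 0 Θ = 0 := by simp [← wedge₂L_apply]

lemma wedge₂_add_right (η : Alt k 2) (Θ Θ' : Alt k n) :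
    wedge₂ η (Θ + Θ') = wedge₂ η Θ + wedge₂ η Θ' := by simp [← wedge₂L_apply]

lemma wedge₂_smul_right (c : ℝ) (η : Alt k 2) (Θ : Alt k n) :
    wedge₂ η (c • Θ) = c • wedge₂ η Θ := by simp [← wedge₂L_apply]

lemma wedge₂_sum_left {ι : Type*} (s : Finset ι) (η : ι → Alt k 2) (Θ : Alt k n) :
    wedge₂ (∑ i ∈ s, η i) Θ = ∑ i ∈ s, wedge₂ (η i) Θ := by
  simp [← wedge₂L_apply]

lemma contr_wedge₁ (l m : Covec k) (v : Cn k) :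
    contr (wedge₁ l (covecEquiv k m)) v = l v • m - m v • l := by
  ext w
  rw [contr_apply, wedge₁_apply]
  have h : Fin.removeNth 1 ![v, w] 0 = v := rfl
  have h' : Fin.removeNth 0 ![v, w] 0 = w := rfl
  simp [Fin.sum_univ_two, covecEquiv_apply, h, h']
  ring

lemma wedge₂_wedge₁ (l m : Covec k) (Θ : Alt k n) :
    wedge₂ (wedge₁ l (covecEquiv k m)) Θ = wedge₁ l (wedge₁ m Θ) := by
  have key : ∀ l m : Covec k, ∑ a, l (rBasis k a) • wedge₁ (dualCovec a) (wedge₁ m Θ)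
      = wedge₁ l (wedge₁ m Θ) := by
    intro l m
    conv_rhs => rw [← sum_apply_dualCovec l]
    simp
  rw [wedge₂_eq_sum]
  simp only [contr_wedge₁, map_sub, map_smul, sub_apply, smul_apply, Finset.sum_sub_distrib]
  rw [key, key, wedge₁_anticomm m l, sub_neg_eq_add, ← two_smul ℝ, smul_smul]
  norm_num

lemma alt_two_eq_sum (η : Alt k 2) :
    η = ∑ a, wedge₁ ((1 / 2 : ℝ) • dualCovec a) (covecEquiv k (contr η (rBasis k a))) := by
  have := sum_wedge₁_curryLeft η
  simp only [covecEquiv_contr, map_smul, smul_apply]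
  rw [← Finset.smul_sum, this, smul_smul]
  norm_num

/-- Every `2`-form is a sum of products of covectors. -/
lemma alt_two_induction {P : Alt k 2 → Prop}
    (zero : P 0) (add : ∀ η η', P η → P η' → P (η + η'))
    (wedge : ∀ l m : Covec k, P (wedge₁ l (covecEquiv k m))) (η : Alt k 2) : P η := by
  rw [alt_two_eq_sum η]
  exact Finset.sum_induction _ P (fun a b => add a b) zero fun a _ => wedge _ _

lemma wedge₂_wedge₁_comm (η : Alt k 2) (l : Covec k) (Θ : Alt k n) :
    wedge₂ η (wedge₁ l Θ) = wedge₁ l (wedge₂ η Θ) := by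
  induction η using alt_two_induction with
  | zero => simp [wedge₂_zero_left]
  | add η η' h h' =>
    rw [wedge₂_add_left, wedge₂_add_left, map_add, h, h']
  | wedge m m' =>
    rw [wedge₂_wedge₁, wedge₂_wedge₁, wedge₁_anticomm m' l, map_neg, wedge₁_anticomm m l, neg_neg]

lemma contr_add (η η' : Alt k 2) (v : Cn k) : contr (η + η') v = contr η v + contr η' v := by
  ext w; simp [contr_apply]

lemma contr_zero (v : Cn k) : contr (0 : Alt k 2) v = 0 := by
  ext w; simp [contr_apply]

lemma curryLeft_wedge₂_zero (η : Alt k 2) (Θ : Alt k 0) (v : Cn k) :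
    (wedge₂ η Θ).curryLeft v = wedge₁ (contr η v) Θ := by
  induction η using alt_two_induction with
  | zero => simp [wedge₂_zero_left, contr_zero]
  | add η η' h h' =>
    rw [wedge₂_add_left, ContinuousAlternatingMap.curryLeft_add, add_apply, h, h', contr_add,
      map_add, add_apply]
  | wedge m m' =>
    rw [wedge₂_wedge₁, curryLeft_wedge₁, curryLeft_wedge₁_zero, contr_wedge₁]
    simp

lemma curryLeft_wedge₂ (η : Alt k 2) (Θ : Alt k (n + 1)) (v : Cn k) :
    (wedge₂ η Θ).curryLeft v = wedge₁ (contr η v) Θ + wedge₂ η (Θ.curryLeft v) := by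
  induction η using alt_two_induction with
  | zero => simp [wedge₂_zero_left, contr_zero]
  | add η η' h h' =>
    rw [wedge₂_add_left, ContinuousAlternatingMap.curryLeft_add, add_apply, h, h', contr_add,
      map_add, add_apply, wedge₂_add_left]
    abel
  | wedge m m' =>
    rw [wedge₂_wedge₁, wedge₂_wedge₁, curryLeft_wedge₁, curryLeft_wedge₁, contr_wedge₁]
    simp only [map_sub, map_smul, sub_apply, smul_apply]
    abel

lemma powForm_succ (η : Alt k 2) (p : ℕ) : powForm η (p + 1) = wedge₂ η (powForm η p) := rfl

/-- The contraction is a derivation of the exterior algebra, so `ι_v η^(p+1) = (p+1) ι_v η ∧ η^p`. -/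
lemma curryLeft_powForm (η : Alt k 2) (p : ℕ) (v : Cn k) :
    ContinuousAlternatingMap.curryLeft (n := 2 * p + 1) (powForm η (p + 1)) v
      = ((p : ℝ) + 1) • wedge₁ (contr η v) (powForm η p) := by
  induction p with
  | zero => 
    have := curryLeft_wedge₂_zero η (powForm η 0) v
    refine this.trans ?_
    simp
  | succ p ih =>
    have := curryLeft_wedge₂ (n := 2 * p + 1) η (powForm η (p + 1)) v
    rw [ih, wedge₂_smul_right, wedge₂_wedge₁_comm, ← powForm_succ] at this
    refine this.trans ?_
    push_cast
    exact (add_comm _ _).trans ((add_smul ((p : ℝ) + 1) 1 _).trans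
      (congrArg _ (one_smul ℝ _))).symm

/-! ### Pull-backs -/

lemma wedge₁_comp (l : Covec k) (Θ : Alt k n) (A : Cn k →L[ℝ] Cn k) :
    (wedge₁ l Θ).compContinuousLinearMap A
      = wedge₁ (l.comp A) (Θ.compContinuousLinearMap A) := by
  ext v
  simp only [ContinuousAlternatingMap.compContinuousLinearMap_apply, wedge₁_apply]
  rfl

lemma covecEquiv_comp (l : Covec k) (A : Cn k →L[ℝ] Cn k) :
    (covecEquiv k l).compContinuousLinearMap A = covecEquiv k (l.comp A) := by
  ext v
  simp [covecEquiv_apply]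

lemma comp_add (η η' : Alt k n) (A : Cn k →L[ℝ] Cn k) :
    (η + η').compContinuousLinearMap A
      = η.compContinuousLinearMap A + η'.compContinuousLinearMap A := rfl

lemma comp_smul (c : ℝ) (η : Alt k n) (A : Cn k →L[ℝ] Cn k) :
    (c • η).compContinuousLinearMap A = c • η.compContinuousLinearMap A := rfl

lemma wedge₂_comp (η : Alt k 2) (Θ : Alt k n) (A : Cn k →L[ℝ] Cn k) :
    (wedge₂ η Θ).compContinuousLinearMap A
      = wedge₂ (η.compContinuousLinearMap A) (Θ.compContinuousLinearMap A) := by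
  induction η using alt_two_induction with
  | zero =>
    have : (0 : Alt k 2).compContinuousLinearMap A = 0 := rfl
    rw [this, wedge₂_zero_left, wedge₂_zero_left]
    rfl
  | add η η' h h' =>
    rw [wedge₂_add_left, comp_add, comp_add, wedge₂_add_left, h, h']
  | wedge m m' =>
    rw [wedge₂_wedge₁, wedge₁_comp, wedge₁_comp, wedge₁_comp, covecEquiv_comp, wedge₂_wedge₁]

lemma powForm_comp (η : Alt k 2) (A : Cn k →L[ℝ] Cn k) (p : ℕ) :
    (powForm η p).compContinuousLinearMap A = powForm (η.compContinuousLinearMap A) p := by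
  induction p with
  | zero => rfl
  | succ p ih => 
    rw [powForm_succ, powForm_succ, ← ih]
    exact wedge₂_comp _ _ _

/-- The forms `iβ ∧ β̄ ∧ Θ` are compatible with the pull-back by complex linear maps `A`. -/
lemma gradWedge_comp (l : Covec k) (Θ : Alt k n) (A : Cn k →L[ℝ] Cn k)
    (hA : A.comp (mulC k Complex.I) = (mulC k Complex.I).comp A) :
    (gradWedge l Θ).compContinuousLinearMap A
      = gradWedge (l.comp A) (Θ.compContinuousLinearMap A) := by
  rw [gradWedge, gradWedge, comp_smul, wedge₁_comp, wedge₁_comp, ContinuousLinearMap.comp_assoc,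
    ContinuousLinearMap.comp_assoc, hA]

/-- The form `iβ ∧ β̄` where `β` is the `(1,0)`-part of `l`. -/
def gradForm (l : Covec k) : Alt k 2 :=
  (1 / 2 : ℝ) • wedge₁ (l.comp (mulC k Complex.I)) (covecEquiv k l)

lemma wedge₂_gradForm (l : Covec k) (Θ : Alt k n) : wedge₂ (gradForm l) Θ = gradWedge l Θ := by
  rw [gradForm, wedge₂_smul_left, wedge₂_wedge₁, gradWedge]

end

section

variable {k n : ℕ}

/-! ### Forms of the top degree -/

lemma finrank_Cn : Module.finrank ℝ (Cn k) = 2 * k := by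
  rw [finrank_real_of_complex, finrank_euclideanSpace_fin]

lemma alt_eq_zero_of_lt (h : 2 * k < n) (Θ : Alt k n) : Θ = 0 := by
  ext v
  have : ¬ LinearIndependent ℝ v := fun hv => by
    have := hv.fintype_card_le_finrank
    rw [finrank_Cn, Fintype.card_fin] at this
    omega
  exact Θ.toAlternatingMap.map_linearDependent v this

lemma wedge₁_curryLeft_top (h : 2 * k = n + 1) (l : Covec k) (Ψ : Alt k (n + 1)) (v : Cn k) :
    wedge₁ l (Ψ.curryLeft v) = l v • Ψ := by
  have h1 := curryLeft_wedge₁ l Ψ v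
  rw [alt_eq_zero_of_lt (by omega) (wedge₁ l Ψ), ContinuousAlternatingMap.curryLeft_zero] at h1
  exact (sub_eq_zero.1 h1.symm).symm

/-- The vectors `u₀, i u₀, u₁, i u₁, …`. -/
def pairFrame (u : ℕ → Cn k) (n : ℕ) (j : Fin n) : Cn k :=
  if j.val % 2 = 0 then u (j.val / 2) else Complex.I • u (j.val / 2)

lemma powForm_pairFrame (η : Alt k 2) (p : ℕ) (u : ℕ → Cn k)
    (h1 : ∀ i j, η ![u i, u j] = 0)
    (h2 : ∀ i j, i < p → η ![u i, Complex.I • u j] = if i = j then 1 else 0) :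
    powForm η p (pairFrame u (2 * p)) = p.factorial := by
  induction p generalizing u with
  | zero => simp [powForm]
  | succ p ih =>
    have h3 : pairFrame u (2 * (p + 1))
        = Matrix.vecCons (u 0) (Fin.tail (n := 2 * p + 1) (pairFrame u (2 * (p + 1)))) := by
      have e := (Fin.cons_self_tail (n := 2 * p + 1) (pairFrame u (2 * (p + 1)))).symm
      have e0 : (pairFrame u (2 * (p + 1)) : Fin (2 * p + 1 + 1) → Cn k) 0 = u 0 := by
        change (if 0 % 2 = 0 then u (0 / 2) else Complex.I • u (0 / 2)) = u 0
        simp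
      rw [e0] at e
      exact e
    have h4 := congrArg (fun Φ : Alt k (2 * p + 1) =>
      Φ (Fin.tail (n := 2 * p + 1) (pairFrame u (2 * (p + 1))))) (curryLeft_powForm η p (u 0))
    simp only [ContinuousAlternatingMap.curryLeft_apply_apply,
      ContinuousAlternatingMap.smul_apply, smul_eq_mul] at h4
    rw [h3, h4, wedge₁_apply, Fin.sum_univ_succ]
    have h5 : ∀ j : Fin (2 * p), contr η (u 0)
        (Fin.tail (n := 2 * p + 1) (pairFrame u (2 * (p + 1))) j.succ) = 0 := by
      intro j
      rw [contr_apply]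
      have h6 : Fin.tail (n := 2 * p + 1) (pairFrame u (2 * (p + 1))) j.succ
          = pairFrame u (2 * (p + 1)) ⟨j.val + 2, by omega⟩ := rfl
      rw [h6, pairFrame]
      split_ifs with h7
      · exact h1 _ _
      · rw [h2 _ _ (by omega), if_neg]
        dsimp only
        omega
    have h8 : contr η (u 0) (Fin.tail (n := 2 * p + 1) (pairFrame u (2 * (p + 1))) 0) = 1 := by
      have h9 : Fin.tail (n := 2 * p + 1) (pairFrame u (2 * (p + 1))) 0 = Complex.I • u 0 := by
        change (if 1 % 2 = 0 then u (1 / 2) else Complex.I • u (1 / 2)) = Complex.I • u 0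
        simp
      rw [contr_apply, h9, h2 _ _ (by omega), if_pos rfl]
    have h10 : (Fin.removeNth 0 (Fin.tail (n := 2 * p + 1) (pairFrame u (2 * (p + 1)))) :
        Fin (2 * p) → Cn k) = pairFrame (fun i => u (i + 1)) (2 * p) := by
      funext j
      have : (Fin.removeNth 0 (Fin.tail (n := 2 * p + 1) (pairFrame u (2 * (p + 1)))) :
        Fin (2 * p) → Cn k) j = pairFrame u (2 * (p + 1)) ⟨j.val + 2, by omega⟩ := by
        rfl
      rw [this, pairFrame, pairFrame]
      simp only [Nat.add_mod_right, Nat.add_div_right _ (Nat.succ_pos 1)]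
    simp only [h5, h8, h10, zero_mul, mul_zero, Finset.sum_const_zero, add_zero]
    rw [ih (fun i => u (i + 1)) (fun i j => h1 _ _)
      (fun i j hi => by rw [h2 _ _ (by omega)]; simp)]
    simp [Nat.factorial_succ]

lemma coeff_powForm_stdForm : coeff (powForm (stdForm k) k) = k.factorial := by
  have h : frame k (2 * k)
      = pairFrame (fun i => WithLp.toLp 2 fun a : Fin k => if a.val = i then 1 else 0) (2 * k) := by
    funext j
    ext a
    simp only [frame, pairFrame]
    split_ifs <;> simp_all
  rw [coeff, h]
  refine powForm_pairFrame _ _ _ (fun i j => ?_) fun i j hi => ?_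
  · rw [stdForm_apply]
    refine Finset.sum_eq_zero fun a _ => ?_
    simp only
    split_ifs <;> simp
  · rw [stdForm_apply, Finset.sum_eq_single ⟨i, hi⟩]
    · simp
      split_ifs <;> simp
    · intro b _ hb
      have : b.val ≠ i := fun h => hb (Fin.ext h)
      simp [this]
    · simp

variable (k) in
/-- The standard frame, as a basis. -/
def frameBasis : Module.Basis (Fin (2 * k)) ℝ (Cn k) :=
  basisOfLinearIndependentOfCardEqFinrank' (frame k (2 * k)) (by
    by_contra h
    have h1 : coeff (powForm (stdForm k) k) = 0 :=
      (powForm (stdForm k) k).toAlternatingMap.map_linearDependent _ h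
    rw [coeff_powForm_stdForm] at h1
    exact (Nat.cast_ne_zero.2 k.factorial_ne_zero) h1) (by rw [finrank_Cn, Fintype.card_fin])

lemma coe_frameBasis : ⇑(frameBasis k) = frame k (2 * k) := by simp [frameBasis]

lemma alt_top_apply (h : n = 2 * k) (Ψ : Alt k n) (A : Cn k →L[ℝ] Cn k) :
    coeff (Ψ.compContinuousLinearMap A) = LinearMap.det A.toLinearMap * coeff Ψ := by
  subst h
  have h1 := Ψ.toAlternatingMap.eq_smul_basis_det (frameBasis k)
  have h2 : ∀ v, Ψ v = Ψ (frame k (2 * k)) * (frameBasis k).det v := by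
    intro v
    have := congrArg (fun Φ : (Cn k) [⋀^Fin (2 * k)]→ₗ[ℝ] ℝ => Φ v) h1
    simpa [coe_frameBasis] using this
  have h3 : coeff (Ψ.compContinuousLinearMap A)
      = Ψ (A.toLinearMap ∘ frameBasis k) := by rw [coe_frameBasis]; rfl
  rw [h3, h2, coeff, Module.Basis.det_comp, Module.Basis.det_self]
  ring

lemma alt_top_eq_zero (h : n = 2 * k) (Ψ : Alt k n) (h0 : coeff Ψ = 0) : Ψ = 0 := by
  subst h
  have h1 := Ψ.toAlternatingMap.eq_smul_basis_det (frameBasis k)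
  ext v
  have := congrArg (fun Φ : (Cn k) [⋀^Fin (2 * k)]→ₗ[ℝ] ℝ => Φ v) h1
  have h2 : Ψ (frame k (2 * k)) = 0 := h0
  simpa [coe_frameBasis, h2] using this

lemma det_restrictScalars_nonneg (A : Cn k →L[ℂ] Cn k) :
    LinearMap.det (A.restrictScalars ℝ).toLinearMap = Complex.normSq (LinearMap.det A.toLinearMap) := by
  have := LinearMap.det_restrictScalars (R := ℝ) (f := A.toLinearMap)
  rw [Algebra.norm_complex_apply] at this
  exact this

/-- A real linear map which commutes with the multiplication by `i` has a nonnegative real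
determinant. -/
lemma det_nonneg_of_comm {A : Cn k →L[ℝ] Cn k}
    (hA : A.comp (mulC k Complex.I) = (mulC k Complex.I).comp A) :
    0 ≤ LinearMap.det A.toLinearMap := by
  have hI : ∀ v, A (Complex.I • v) = Complex.I • A v := fun v => DFunLike.congr_fun hA v
  have hs : ∀ (c : ℂ) v, A (c • v) = c • A v := by
    intro c v
    have e : ∀ w : Cn k, c • w = c.re • w + c.im • (Complex.I • w) := by
      intro w
      conv_lhs => rw [← Complex.re_add_im c]
      rw [add_smul, mul_smul]
      rfl
    rw [e v, e (A v), map_add, map_smul, map_smul, hI]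
  let B : Cn k →L[ℂ] Cn k := ⟨{ toFun := A, map_add' := A.map_add, map_smul' := hs }, A.cont⟩
  have h : LinearMap.det (B.restrictScalars ℝ).toLinearMap = LinearMap.det A.toLinearMap := rfl
  rw [← h, det_restrictScalars_nonneg]
  exact Complex.normSq_nonneg _

lemma contDiff_powForm (p : ℕ) : ContDiff ℝ ∞ fun η : Alt k 2 => powForm η p := by
  induction p with
  | zero => exact contDiff_const
  | succ p ih =>
    have : (fun η : Alt k 2 => powForm η (p + 1)) = fun η => wedge₂L η (powForm η p) := by
      funext η
      rw [wedge₂L_apply]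
      rfl
    rw [this]
    exact wedge₂L.contDiff.clm_apply ih

variable (k) in
/-- The value on the standard frame as a continuous linear form. -/
def coeffL (n : ℕ) : Alt k n →L[ℝ] ℝ :=
  ContinuousAlternatingMap.apply ℝ (Cn k) ℝ (frame k n)

lemma coeffL_apply (Ψ : Alt k n) : coeffL k n Ψ = coeff Ψ := rfl

lemma eq_zero_of_forall_wedge₁ (hn : n < 2 * k) (Θ : Alt k n) (h : ∀ l : Covec k, wedge₁ l Θ = 0) :
    Θ = 0 := by
  have hd : ∀ a, dualCovec a (rBasis k a) = 1 := by
    intro a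
    simp [dualCovec]
  have h0 : ∀ a, (wedge₁ (dualCovec a) Θ).curryLeft (rBasis k a) = 0 := by
    intro a
    rw [h]
    rfl
  cases n with
  | zero =>
    have h1 := h0 ⟨0, by rw [finrank_Cn]; omega⟩
    rwa [curryLeft_wedge₁_zero, hd, one_smul] at h1
  | succ n =>
    have h1 : ∑ a, (wedge₁ (dualCovec a) Θ).curryLeft (rBasis k a) = 0 :=
      Finset.sum_eq_zero fun a _ => h0 a
    simp only [curryLeft_wedge₁, hd, one_smul, Finset.sum_sub_distrib] at h1
    rw [sum_wedge₁_curryLeft, Finset.sum_const, Finset.card_univ, Fintype.card_fin, finrank_Cn,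
      ← Nat.cast_smul_eq_nsmul ℝ, ← sub_smul, smul_eq_zero] at h1
    refine h1.resolve_left ?_
    have : ((n + 1 : ℕ) : ℝ) < ((2 * k : ℕ) : ℝ) := by exact_mod_cast hn
    push_cast at this ⊢
    linarith

section Positive

variable {η : Alt k 2}

lemma exists_contr_eq (hη : ∀ v : Cn k, v ≠ 0 → 0 < η ![v, Complex.I • v]) (l : Covec k) :
    ∃ w, contr η w = l := by
  let f : Cn k →ₗ[ℝ] Covec k :=
    (((covecEquiv k).symm : Alt k 1 →L[ℝ] Covec k).comp η.curryLeft).toLinearMap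
  have hf : ∀ w, f w = contr η w := fun w => rfl
  have hinj : Function.Injective f := by
    rw [← LinearMap.ker_eq_bot, LinearMap.ker_eq_bot']
    intro w hw
    by_contra h0
    have h1 := hη w h0
    rw [← contr_apply, ← hf, hw] at h1
    simp at h1
  have hdim : Module.finrank ℝ (Cn k) = Module.finrank ℝ (Covec k) := by
    have e : Covec k ≃ₗ[ℝ] Module.Dual ℝ (Cn k) := LinearMap.toContinuousLinearMap.symm
    rw [e.finrank_eq, Subspace.dual_finrank_eq]
  have : Module.Finite ℝ (Covec k) :=
    Module.Finite.equiv (LinearMap.toContinuousLinearMap (𝕜 := ℝ) (E := Cn k) (F' := ℝ))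
  exact (LinearMap.injective_iff_surjective_of_finrank_eq_finrank hdim).1 hinj l

lemma powForm_ne_zero (hη : ∀ v : Cn k, v ≠ 0 → 0 < η ![v, Complex.I • v]) {p : ℕ} (hp : p ≤ k) :
    powForm η p ≠ 0 := by
  induction p with
  | zero => 
    intro h
    have := congrArg (fun Φ : Alt k 0 => Φ 0) h
    simp [powForm] at this
  | succ p ih =>
    intro h
    refine ih (by omega) (eq_zero_of_forall_wedge₁ (by omega) _ fun l => ?_)
    obtain ⟨w, rfl⟩ := exists_contr_eq hη l
    have h1 := curryLeft_powForm η p w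
    rw [h] at h1
    have h2 : ((p : ℝ) + 1) • wedge₁ (contr η w) (powForm η p) = 0 := h1.symm
    exact (smul_eq_zero.1 h2).resolve_left (by positivity)

lemma stdForm_apply_I (v : Cn k) : stdForm k ![v, Complex.I • v] = ‖v‖ ^ 2 := by
  rw [stdForm_apply, EuclideanSpace.norm_sq_eq]
  refine Finset.sum_congr rfl fun i _ => ?_
  rw [← Complex.normSq_eq_norm_sq]
  simp [Complex.normSq_apply]

/-- The top power of a positive form has a positive coefficient: it does not vanish along the
segment from the standard form. -/
lemma coeff_powForm_pos (hη : ∀ v : Cn k, v ≠ 0 → 0 < η ![v, Complex.I • v]) :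
    0 < coeff (powForm η k) := by
  by_contra! hle
  let f : ℝ → ℝ := fun t => coeff (powForm ((1 - t) • stdForm k + t • η) k)
  have hf : Continuous f := by
    refine (coeffL k (2 * k)).continuous.comp ((contDiff_powForm k).continuous.comp ?_)
    fun_prop
  have h0 : 0 ≤ f 0 := by simp [f, coeff_powForm_stdForm]
  have h1 : f 1 ≤ 0 := by simpa [f] using hle
  obtain ⟨t, ht, h2⟩ := intermediate_value_Icc' zero_le_one hf.continuousOn ⟨h1, h0⟩
  refine powForm_ne_zero (η := (1 - t) • stdForm k + t • η) (fun v hv => ?_) le_rfl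
    (alt_top_eq_zero rfl _ h2)
  have h3 := hη v hv
  have h4 : 0 < ‖v‖ := norm_pos_iff.2 hv
  rw [ContinuousAlternatingMap.add_apply, ContinuousAlternatingMap.smul_apply,
    ContinuousAlternatingMap.smul_apply, stdForm_apply_I, smul_eq_mul, smul_eq_mul]
  rcases eq_or_lt_of_le ht.1 with h5 | h5
  · rw [← h5]; simp [h4]
  · have := ht.2
    have := mul_nonneg (sub_nonneg.2 this) (sq_nonneg ‖v‖)
    have := mul_pos h5 h3
    linarith

lemma mulC_apply (a : ℂ) (v : Cn k) : mulC k a v = a • v := rfl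

lemma IsDiagonal.apply_smul {σ : Alt k 2} (h : IsDiagonal σ) {a : ℂ} (ha : ‖a‖ = 1) (u v : Cn k) :
    σ ![a • u, a • v] = σ ![u, v] := by
  have h1 := congrArg (fun Φ : Alt k 2 => Φ ![u, v]) (h a ha)
  simp only [ContinuousAlternatingMap.compContinuousLinearMap_apply] at h1
  rw [← h1]
  congr 1
  ext i
  fin_cases i <;> rfl

lemma alt_two_swap (σ : Alt k 2) (u v : Cn k) : σ ![u, v] = -σ ![v, u] := by
  have h := σ.toAlternatingMap.map_swap ![v, u] (i := 0) (j := 1) (by decide)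
  refine Eq.trans ?_ h
  change σ _ = σ _
  congr 1
  ext i
  fin_cases i <;> rfl

lemma alt_two_add_right (σ : Alt k 2) (u v w : Cn k) : σ ![u, v + w] = σ ![u, v] + σ ![u, w] := by
  simp [← contr_apply]

lemma alt_two_smul_right (σ : Alt k 2) (u v : Cn k) (c : ℝ) :
    σ ![u, c • v] = c * σ ![u, v] := by
  simp [← contr_apply]

lemma alt_two_neg_right (σ : Alt k 2) (u v : Cn k) :
    σ ![u, -v] = -σ ![u, v] := by
  simp [← contr_apply]

lemma alt_two_add_left (σ : Alt k 2) (u v w : Cn k) : σ ![u + v, w] = σ ![u, w] + σ ![v, w] := by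
  rw [alt_two_swap, alt_two_add_right, alt_two_swap σ u, alt_two_swap σ v]; ring

lemma alt_two_smul_left (σ : Alt k 2) (u v : Cn k) (c : ℝ) :
    σ ![c • u, v] = c * σ ![u, v] := by
  rw [alt_two_swap, alt_two_smul_right, alt_two_swap σ u]; ring

lemma I_smul_I_smul (v : Cn k) : Complex.I • Complex.I • v = -v := by
  rw [smul_smul, Complex.I_mul_I, neg_one_smul]

lemma IsDiagonal.symm_I {σ : Alt k 2} (h : IsDiagonal σ) (u v : Cn k) :
    σ ![u, Complex.I • v] = σ ![v, Complex.I • u] := by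
  rw [← h.apply_smul (a := Complex.I) (by simp) u, I_smul_I_smul, alt_two_neg_right,
    ← alt_two_swap]

/-- The Cauchy–Schwarz inequality for the Hermitian metric defined by a positive
`(1,1)`-form. -/
lemma IsDiagonal.apply_sq_le {σ : Alt k 2} (h : IsDiagonal σ)
    (hσ : ∀ v : Cn k, v ≠ 0 → 0 < σ ![v, Complex.I • v]) (u v : Cn k) :
    σ ![u, v] ^ 2 ≤ σ ![u, Complex.I • u] * σ ![v, Complex.I • v] := by
  by_cases hv : v = 0
  · subst hv
    have : σ ![u, 0] = 0 := by rw [← contr_apply]; simp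
    rw [this]
    simp [← contr_apply]
  set w := -(Complex.I • v) with hw
  have hIw : Complex.I • w = v := by rw [hw, smul_neg, I_smul_I_smul, neg_neg]
  have hww : σ ![w, Complex.I • w] = σ ![v, Complex.I • v] := by
    rw [← h.apply_smul (a := Complex.I) (by simp) w, hIw]
  have hc := hσ v hv
  set c := σ ![v, Complex.I • v]
  set b := σ ![u, v]
  have h1 : 0 ≤ σ ![c • u + (-b) • w, Complex.I • (c • u + (-b) • w)] := by
    by_cases h0 : c • u + (-b) • w = 0
    · rw [h0]
      simp [← contr_apply]
    · exact (hσ _ h0).le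
  rw [smul_add, smul_comm Complex.I c u, smul_comm Complex.I (-b) w, alt_two_add_left,
    alt_two_add_right, alt_two_add_right, alt_two_smul_left, alt_two_smul_left, alt_two_smul_right,
    alt_two_smul_right, alt_two_smul_left, alt_two_smul_left, alt_two_smul_right,
    alt_two_smul_right, hww, h.symm_I w u, hIw] at h1
  change 0 ≤ c * (c * σ ![u, Complex.I • u]) + c * (-b * b) + (-b * (c * b) + -b * (-b * c)) at h1
  have h2 : 0 ≤ c * (c * σ ![u, Complex.I • u] - b ^ 2) := by linarith
  have h3 := nonneg_of_mul_nonneg_right h2 hc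
  linarith

/-- For `l = η(w, ·)`, `iβ ∧ β̄ ∧ η^(k-1) = (1/2k) η(w, iw) η^k` where `β` is the `(1,0)`-part
of `l`. -/
lemma coeff_gradWedge_contr {p : ℕ} (hp : k = p + 1) (η : Alt k 2) (w : Cn k) :
    2 * (k : ℝ) * coeff (gradWedge (contr η w) (powForm η p))
      = η ![w, Complex.I • w] * coeff (powForm η (p + 1)) := by
  have h1 := curryLeft_powForm η p w
  have h2 := wedge₁_curryLeft_top (n := 2 * p + 1) (by omega)
    ((contr η w).comp (mulC k Complex.I)) (powForm η (p + 1)) w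
  rw [h1, map_smul] at h2
  have h3 := congrArg coeff h2
  rw [coeff_smul] at h3
  have h4 : coeff ((contr η w ∘L mulC k Complex.I) w • powForm η (p + 1))
    = (contr η w ∘L mulC k Complex.I) w * coeff (powForm η (p + 1)) := coeff_smul _ _
  have h5 : coeff (gradWedge (contr η w) (powForm η p)) = (1 / 2) *
    coeff (wedge₁ (contr η w ∘L mulC k Complex.I) (wedge₁ (contr η w) (powForm η p))) :=
      coeff_smul _ _
  have h6 : (contr η w ∘L mulC k Complex.I) w = η ![w, Complex.I • w] := by
    rw [← contr_apply]
    rfl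
  have hk : (k : ℝ) = p + 1 := by rw [hp]; push_cast; rfl
  rw [h5, hk]
  rw [h6] at h4 h3
  rw [← h4, ← h3]
  ring

/-- The norm of a covector with respect to `η` is controlled by `iβ ∧ β̄ ∧ η^(k-1)`. -/
lemma covec_sq_mul_le (hk : 1 ≤ k) (hd : IsDiagonal η)
    (hη : ∀ v : Cn k, v ≠ 0 → 0 < η ![v, Complex.I • v]) (l : Covec k) (v : Cn k) :
    l v ^ 2 * coeff (powForm η k)
      ≤ 2 * k * coeff (gradWedge l (powForm η (k - 1))) * η ![v, Complex.I • v] := by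
  obtain ⟨p, rfl⟩ : ∃ p, k = p + 1 := ⟨k - 1, by omega⟩
  obtain ⟨w, rfl⟩ := exists_contr_eq hη l
  have h1 := coeff_gradWedge_contr rfl η w
  have h2 := hd.apply_sq_le hη w v
  have h3 := coeff_powForm_pos hη
  change _ ≤ 2 * ((p + 1 : ℕ) : ℝ) * coeff (gradWedge (contr η w) (powForm η p)) * _
  rw [h1, contr_apply]
  nlinarith

lemma coeff_gradWedge_powForm_nonneg (hk : 1 ≤ k)
    (hη : ∀ v : Cn k, v ≠ 0 → 0 < η ![v, Complex.I • v]) (l : Covec k) :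
    0 ≤ coeff (gradWedge l (powForm η (k - 1))) := by
  obtain ⟨p, rfl⟩ : ∃ p, k = p + 1 := ⟨k - 1, by omega⟩
  obtain ⟨w, rfl⟩ := exists_contr_eq hη l
  have h1 := coeff_gradWedge_contr rfl η w
  have h3 := coeff_powForm_pos hη
  have h4 : 0 ≤ η ![w, Complex.I • w] := by
    by_cases h : w = 0
    · rw [h]; simp [← contr_apply]
    · exact (hη w h).le
  change 0 ≤ coeff (gradWedge (contr η w) (powForm η p))
  have h5 : 0 ≤ 2 * ((p + 1 : ℕ) : ℝ) * coeff (gradWedge (contr η w) (powForm η p)) := by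
    rw [h1]
    positivity
  exact nonneg_of_mul_nonneg_right h5 (by positivity)

end Positive

end

section

variable {k n : ℕ}

/-! ### Positivity of forms -/

lemma gradForm_apply (l : Covec k) (u v : Cn k) :
    gradForm l ![u, v] = (1 / 2) * (l (Complex.I • u) * l v - l (Complex.I • v) * l u) := by
  have h : Fin.removeNth 1 ![u, v] 0 = u := rfl
  have h' : Fin.removeNth 0 ![u, v] 0 = v := rfl
  rw [gradForm, ContinuousAlternatingMap.smul_apply, wedge₁_apply]
  simp [Fin.sum_univ_two, covecEquiv_apply, h, h', mulC_apply]
  ring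

lemma gradForm_apply_I (l : Covec k) (v : Cn k) :
    gradForm l ![v, Complex.I • v] = (1 / 2) * (l v ^ 2 + l (Complex.I • v) ^ 2) := by
  rw [gradForm_apply, I_smul_I_smul, map_neg]
  ring

lemma complex_smul_eq (a : ℂ) (v : Cn k) : a • v = a.re • v + a.im • (Complex.I • v) := by
  conv_lhs => rw [← Complex.re_add_im a]
  rw [add_smul, mul_smul]
  rfl

lemma re_sq_add_im_sq {a : ℂ} (ha : ‖a‖ = 1) : a.re * a.re + a.im * a.im = 1 := by
  rw [← Complex.normSq_apply, Complex.normSq_eq_norm_sq, ha, one_pow]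

lemma alt_two_ext {σ σ' : Alt k 2} (h : ∀ u v, σ ![u, v] = σ' ![u, v]) : σ = σ' := by
  ext v
  have : v = ![v 0, v 1] := by ext i; fin_cases i <;> rfl
  rw [this, h]

lemma isDiagonal_of_apply {σ : Alt k 2}
    (h : ∀ a : ℂ, ‖a‖ = 1 → ∀ u v, σ ![a • u, a • v] = σ ![u, v]) : IsDiagonal σ := by
  intro a ha
  refine alt_two_ext fun u v => ?_
  rw [← h a ha u v, ContinuousAlternatingMap.compContinuousLinearMap_apply]
  congr 1
  ext i
  fin_cases i <;> rfl

lemma isDiagonal_gradForm (l : Covec k) : IsDiagonal (gradForm l) := by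
  refine isDiagonal_of_apply fun a ha u v => ?_
  have h := re_sq_add_im_sq ha
  rw [gradForm_apply, gradForm_apply, smul_comm Complex.I a u, smul_comm Complex.I a v]
  simp only [complex_smul_eq a, map_add, map_smul, smul_eq_mul, I_smul_I_smul, map_neg]
  linear_combination (1 / 2) * (l (Complex.I • u) * l v - l (Complex.I • v) * l u) * h

lemma IsDiagonal.add {Θ Θ' : Alt k n} (h : IsDiagonal Θ) (h' : IsDiagonal Θ') :
    IsDiagonal (Θ + Θ') := fun a ha => by rw [comp_add, h a ha, h' a ha]

lemma IsDiagonal.smul {Θ : Alt k n} (h : IsDiagonal Θ) (c : ℝ) : IsDiagonal (c • Θ) :=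
  fun a ha => by rw [comp_smul, h a ha]

lemma IsDiagonal.sub {Θ Θ' : Alt k n} (h : IsDiagonal Θ) (h' : IsDiagonal Θ') :
    IsDiagonal (Θ - Θ') := by
  have := h.add (h'.smul (-1))
  rwa [neg_one_smul ℝ Θ', ← sub_eq_add_neg] at this

lemma IsDiagonal.wedge₂ {σ : Alt k 2} {Θ : Alt k n} (h : IsDiagonal σ) (h' : IsDiagonal Θ) :
    IsDiagonal (wedge₂ σ Θ) := fun a ha => by rw [wedge₂_comp, h a ha, h' a ha]

lemma IsDiagonal.powForm {σ : Alt k 2} (h : IsDiagonal σ) (p : ℕ) : IsDiagonal (powForm σ p) :=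
  fun a ha => by rw [powForm_comp, h a ha]

lemma isDiagonal_stdForm : IsDiagonal (stdForm k) := by
  refine isDiagonal_of_apply fun a ha u v => ?_
  have h2 := re_sq_add_im_sq ha
  rw [stdForm_apply, stdForm_apply]
  refine Finset.sum_congr rfl fun j _ => ?_
  simp only [PiLp.smul_apply, smul_eq_mul, Complex.mul_re, Complex.mul_im]
  linear_combination ((u j).re * (v j).im - (v j).re * (u j).im) * h2

open scoped MatrixOrder in
/-- A nonnegative real `(1,1)`-form is a sum of forms `iβ ∧ β̄`. The associated symmetric bilinear
form `σ(u, iv)` is a sum of squares of real covectors, and averaging over the multiplication by `i`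
gives the result. -/
lemma IsDiagonal.eq_sum_gradForm {σ : Alt k 2} (h : IsDiagonal σ)
    (hσ : ∀ v : Cn k, 0 ≤ σ ![v, Complex.I • v]) :
    ∃ (N : ℕ) (m : Fin N → Covec k), σ = ∑ i, gradForm (m i) := by
  classical
  let N := Module.finrank ℝ (Cn k)
  let M : Matrix (Fin N) (Fin N) ℝ :=
    fun a b => σ ![rBasis k a, Complex.I • rBasis k b]
  have hexp : ∀ u v : Cn k, σ ![u, Complex.I • v]
      = ∑ a, ∑ b, dualCovec a u * dualCovec b v * M a b := by
    intro u v
    have e1 := sum_dualCovec_smul (((contr σ u).comp (mulC k Complex.I)).toLinearMap) v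
    have e2 : ∀ b, contr σ u (Complex.I • rBasis k b)
        = ∑ a, dualCovec a u * M a b := by
      intro b
      have e3 := sum_dualCovec_smul (contr σ (Complex.I • rBasis k b)).toLinearMap u
      simp only [ContinuousLinearMap.coe_coe, contr_apply, smul_eq_mul] at e3
      rw [contr_apply, alt_two_swap, ← e3, ← Finset.sum_neg_distrib]
      refine Finset.sum_congr rfl fun a _ => ?_
      rw [alt_two_swap σ (Complex.I • rBasis k b)]
      simp [M]
    change ∑ a, dualCovec a v • contr σ u (Complex.I • rBasis k a) = contr σ u (Complex.I • v) at e1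
    rw [← contr_apply, ← e1, Finset.sum_comm]
    refine Finset.sum_congr rfl fun b _ => ?_
    rw [e2, smul_eq_mul, Finset.mul_sum]
    refine Finset.sum_congr rfl fun a _ => ?_
    ring
  have hM : M.PosSemidef := by
    refine Matrix.PosSemidef.of_dotProduct_mulVec_nonneg ?_ fun x => ?_
    · ext a b
      simp only [Matrix.conjTranspose_apply, star_trivial]
      exact h.symm_I _ _
    · have h1 := hσ (∑ a, x a • rBasis k a)
      have h2 : ∀ a, dualCovec a (∑ a, x a • rBasis k a) = x a := by
        intro a
        simp [dualCovec, Finsupp.single_apply]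
      rw [hexp] at h1
      simp only [h2] at h1
      refine h1.trans (le_of_eq ?_)
      simp only [dotProduct, Matrix.mulVec, star_trivial, Finset.mul_sum]
      refine Finset.sum_congr rfl fun a _ => Finset.sum_congr rfl fun b _ => ?_
      ring
  obtain ⟨B, hB⟩ := (CStarAlgebra.nonneg_iff_eq_star_mul_self (a := M)).1 hM.nonneg
  let m : Fin N → Covec k := fun i => ∑ a, B i a • dualCovec a
  have hm : ∀ u v, σ ![u, Complex.I • v] = ∑ i, m i u * m i v := by
    intro u v
    rw [hexp, hB]
    simp only [m, _root_.sum_apply, smul_apply, smul_eq_mul]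
    simp only [Finset.sum_mul_sum]
    rw [Finset.sum_comm]
    conv_rhs => rw [Finset.sum_comm]
    rw [Finset.sum_comm]
    refine Finset.sum_congr rfl fun a _ => ?_
    conv_rhs => rw [Finset.sum_comm]
    refine Finset.sum_congr rfl fun b _ => ?_
    simp only [Matrix.star_eq_conjTranspose, Matrix.mul_apply, Matrix.conjTranspose_apply,
      star_trivial, Finset.mul_sum]
    refine Finset.sum_congr rfl fun i _ => ?_
    ring
  refine ⟨N, m, alt_two_ext fun u v => ?_⟩
  have e1 : σ ![u, v] = -∑ i, m i u * m i (Complex.I • v) := by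
    rw [← hm, I_smul_I_smul, alt_two_neg_right, neg_neg]
  have e2 : σ ![u, v] = ∑ i, m i (Complex.I • u) * m i v := by
    rw [← hm, h.apply_smul (by simp)]
  rw [ContinuousAlternatingMap.sum_apply]
  simp only [gradForm_apply]
  have e3 : σ ![u, v] = (1 / 2) * (∑ i, m i (Complex.I • u) * m i v
      - ∑ i, m i u * m i (Complex.I • v)) := by linarith
  rw [e3, ← Finset.sum_sub_distrib, Finset.mul_sum]
  refine Finset.sum_congr rfl fun i _ => ?_
  ring

lemma coeff_sum {ι : Type*} (s : Finset ι) (η : ι → Alt k n) :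
    coeff (∑ i ∈ s, η i) = ∑ i ∈ s, coeff (η i) := by
  simp only [← coeffL_apply, map_sum]

lemma coeff_wedge₂_nonneg {σ : Alt k 2} (h : IsDiagonal σ)
    (hσ : ∀ v : Cn k, 0 ≤ σ ![v, Complex.I • v]) {Θ : Alt k n}
    (hΘ : ∀ l : Covec k, 0 ≤ coeff (gradWedge l Θ)) : 0 ≤ coeff (wedge₂ σ Θ) := by
  obtain ⟨N, m, rfl⟩ := h.eq_sum_gradForm hσ
  rw [wedge₂_sum_left, coeff_sum]
  exact Finset.sum_nonneg fun i _ => by rw [wedge₂_gradForm]; exact hΘ _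

/-- If `l(v)² ≤ σ(v, iv)` for all `v`, then `iβ ∧ β̄ ≤ σ` where `β` is the `(1,0)`-part of `l`. -/
lemma coeff_gradWedge_le_wedge₂ {σ : Alt k 2} (h : IsDiagonal σ) {l : Covec k}
    (hσ : ∀ v : Cn k, l v ^ 2 ≤ σ ![v, Complex.I • v]) {Θ : Alt k n}
    (hΘ : ∀ l : Covec k, 0 ≤ coeff (gradWedge l Θ)) :
    coeff (gradWedge l Θ) ≤ coeff (wedge₂ σ Θ) := by
  have h1 : 0 ≤ coeff (wedge₂ (σ - gradForm l) Θ) := by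
    refine coeff_wedge₂_nonneg (h.sub (isDiagonal_gradForm l)) (fun v => ?_) hΘ
    have h2 := hσ v
    have h3 := hσ (Complex.I • v)
    rw [h.apply_smul (by simp)] at h3
    rw [ContinuousAlternatingMap.sub_apply, gradForm_apply_I]
    linarith
  have h4 : wedge₂ σ Θ = wedge₂ (σ - gradForm l) Θ + gradWedge l Θ := by
    rw [← wedge₂_gradForm, ← wedge₂_add_left, sub_add_cancel]
  rw [h4, coeff_add]
  linarith

lemma comm_mulC {A : Cn k →L[ℝ] Cn k}
    (hA : A.comp (mulC k Complex.I) = (mulC k Complex.I).comp A) (a : ℂ) :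
    A.comp (mulC k a) = (mulC k a).comp A := by
  ext1 v
  have hI : A (Complex.I • v) = Complex.I • A v := DFunLike.congr_fun hA v
  change A (a • v) = a • A v
  rw [complex_smul_eq a v, complex_smul_eq a (A v), map_add, map_smul, map_smul, hI]

lemma comp_comp (Θ : Alt k n) (A B : Cn k →L[ℝ] Cn k) :
    (Θ.compContinuousLinearMap A).compContinuousLinearMap B
      = Θ.compContinuousLinearMap (A.comp B) := rfl

lemma IsDiagonal.comp {Θ : Alt k n} (h : IsDiagonal Θ) {A : Cn k →L[ℝ] Cn k}
    (hA : A.comp (mulC k Complex.I) = (mulC k Complex.I).comp A) :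
    IsDiagonal (Θ.compContinuousLinearMap A) := by
  intro a ha
  rw [comp_comp, comm_mulC hA, ← comp_comp, h a ha]

/-- Positivity is invariant under complex linear isomorphisms. -/
lemma IsPositiveAlt.comp (hk : 1 ≤ k) {Θ : Alt k (2 * (k - 1))} (h : IsPositiveAlt Θ)
    {A B : Cn k →L[ℝ] Cn k} (hA : A.comp (mulC k Complex.I) = (mulC k Complex.I).comp A)
    (hB : B.comp A = ContinuousLinearMap.id ℝ (Cn k)) :
    IsPositiveAlt (Θ.compContinuousLinearMap A) := by
  refine ⟨h.1.comp hA, fun l => ?_⟩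
  have h1 := gradWedge_comp (l.comp B) Θ A hA
  rw [ContinuousLinearMap.comp_assoc, hB, ContinuousLinearMap.comp_id] at h1
  rw [← h1, alt_top_apply (by omega)]
  exact mul_nonneg (det_nonneg_of_comm hA) (h.2 _)

/-! ### The diagonal part of a form -/

/-- The average of a form over the multiplications by the roots of unity of an order larger than
its degree. It is the sum of the components of bidegree `(p,p)` of the form. -/
def diagPart (Θ : Alt k n) : Alt k n :=
  (1 / ((n : ℝ) + 1)) • ∑ j ∈ Finset.range (n + 1),
    Θ.compContinuousLinearMap (mulC k (Complex.exp (2 * Real.pi * Complex.I / (n + 1 : ℕ)) ^ j))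

/-- The value of a form of degree `n` on vectors rotated by `a` is a trigonometric polynomial of
degree at most `n` in `a`. -/
lemma exists_polynomial_apply_smul (Θ : Alt k n) (v : Fin n → Cn k) :
    ∃ P : Polynomial ℂ, P.natDegree ≤ 2 * n ∧ ∀ a : ℂ, ‖a‖ = 1 →
      ((Θ fun i => a • v i : ℝ) : ℂ) = P.eval a * (starRingEnd ℂ a) ^ n := by
  induction n with
  | zero => 
    refine ⟨Polynomial.C ((Θ v : ℝ) : ℂ), by simp, fun a _ => ?_⟩
    rw [Subsingleton.elim (fun i => a • v i) v]
    simp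
  | succ n ih =>
    obtain ⟨P, hP, h1⟩ := ih (Θ.curryLeft (v 0)) (Fin.tail v)
    obtain ⟨Q, hQ, h2⟩ := ih (Θ.curryLeft (Complex.I • v 0)) (Fin.tail v)
    refine ⟨P * (Polynomial.C (1 / 2) * (Polynomial.X ^ 2 + Polynomial.C 1))
      + Q * (Polynomial.C (1 / (2 * Complex.I)) * (Polynomial.X ^ 2 - Polynomial.C 1)),
      ?_, fun a ha => ?_⟩
    · have d1 : (Polynomial.X ^ 2 + Polynomial.C 1 : Polynomial ℂ).natDegree ≤ 2 := by
        compute_degree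
      have d2 : (Polynomial.X ^ 2 - Polynomial.C 1 : Polynomial ℂ).natDegree ≤ 2 := by
        compute_degree
      refine (Polynomial.natDegree_add_le_of_degree_le ?_ ?_)
      · refine (Polynomial.natDegree_mul_le).trans ?_
        have := (Polynomial.natDegree_C_mul_le (1 / 2 : ℂ)
          (Polynomial.X ^ 2 + Polynomial.C 1)).trans d1
        omega
      · refine (Polynomial.natDegree_mul_le).trans ?_
        have := (Polynomial.natDegree_C_mul_le (1 / (2 * Complex.I) : ℂ)
          (Polynomial.X ^ 2 - Polynomial.C 1)).trans d2
        omega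
    · have e1 : (fun i => a • v i) = Matrix.vecCons (a • v 0) (fun i => a • Fin.tail v i) := by
        funext i
        refine Fin.cases rfl (fun j => rfl) i
      have e2 : (Θ fun i => a • v i) = a.re * Θ.curryLeft (v 0) (fun i => a • Fin.tail v i)
          + a.im * Θ.curryLeft (Complex.I • v 0) (fun i => a • Fin.tail v i) := by
        rw [e1, ← ContinuousAlternatingMap.curryLeft_apply_apply, complex_smul_eq a (v 0), map_add,
          map_smul, map_smul]
        rfl
      have hu : a * starRingEnd ℂ a = 1 := by
        rw [Complex.mul_conj, Complex.normSq_eq_norm_sq, ha]; simp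
      rw [e2]
      push_cast
      rw [h1 a ha, h2 a ha, Complex.re_eq_add_conj, Complex.im_eq_sub_conj]
      simp only [Polynomial.eval_add, Polynomial.eval_sub, Polynomial.eval_mul, Polynomial.eval_C,
        Polynomial.eval_pow, Polynomial.eval_X]
      set b := starRingEnd ℂ a
      have hI := Complex.I_ne_zero
      field_simp
      linear_combination (-(Complex.I * P.eval a * a) - Q.eval a * a) * b ^ n * hu

lemma isDiagonal_diagPart (Θ : Alt k n) : IsDiagonal (diagPart Θ) := by
  intro b hb
  ext v
  set ζ := Complex.exp (2 * Real.pi * Complex.I / (n + 1 : ℕ)) with hζ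
  have hprim : IsPrimitiveRoot ζ (n + 1) := Complex.isPrimitiveRoot_exp (n + 1) (by omega)
  have hnorm : ‖ζ‖ = 1 := hprim.norm'_eq_one (by omega)
  obtain ⟨P, hP, h1⟩ := exists_polynomial_apply_smul Θ v
  have key : ∀ c : ℂ, ‖c‖ = 1 → ∑ j ∈ Finset.range (n + 1), ((Θ fun i => (ζ ^ j * c) • v i : ℝ) : ℂ)
      = (n + 1) * P.coeff n := by
    intro c hc
    have hcc : c * starRingEnd ℂ c = 1 := by
      rw [Complex.mul_conj, Complex.normSq_eq_norm_sq, hc]; simp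
    have hzz : ζ * starRingEnd ℂ ζ = 1 := by
      rw [Complex.mul_conj, Complex.normSq_eq_norm_sq, hnorm]; simp
    have e1 : ∀ j, ((Θ fun i => (ζ ^ j * c) • v i : ℝ) : ℂ)
        = ∑ m ∈ Finset.range (2 * n + 1), P.coeff m * (c ^ m * starRingEnd ℂ c ^ n)
          * (ζ ^ m * starRingEnd ℂ ζ ^ n) ^ j := by
      intro j
      rw [h1 _ (by rw [norm_mul, norm_pow, hnorm, hc]; simp),
        Polynomial.eval_eq_sum_range' (n := 2 * n + 1) (by omega), Finset.sum_mul]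
      refine Finset.sum_congr rfl fun m _ => ?_
      rw [map_mul, map_pow, mul_pow, mul_pow, mul_pow, ← pow_mul, ← pow_mul, ← pow_mul, ← pow_mul,
        mul_comm m j, mul_comm n j]
      ring
    simp only [e1]
    rw [Finset.sum_comm]
    simp only [← Finset.mul_sum]
    rw [Finset.sum_eq_single n]
    · rw [← mul_pow, hcc, ← mul_pow, hzz]
      simp
      ring
    · intro m hm hmn
      have hw1 : (ζ ^ m * starRingEnd ℂ ζ ^ n) ≠ 1 := by
        intro h
        have h2 : ζ ^ m = ζ ^ n := by
          calc ζ ^ m = ζ ^ m * (ζ * starRingEnd ℂ ζ) ^ n := by rw [hzz]; simp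
            _ = (ζ ^ m * starRingEnd ℂ ζ ^ n) * ζ ^ n := by ring
            _ = ζ ^ n := by rw [h, one_mul]
        have h3 : m ≡ n [MOD n + 1] := by
          have hu := hprim.isUnit_unit (by omega)
          have := pow_eq_pow_iff_modEq.1
            (show (hprim.isUnit (by omega)).unit ^ m = (hprim.isUnit (by omega)).unit ^ n by
              ext; simpa using h2)
          rwa [← hu.eq_orderOf] at this
        have h4 := Finset.mem_range.1 hm
        rcases lt_or_gt_of_ne hmn with h5 | h5
        · have := (Nat.modEq_iff_dvd' h5.le).1 h3
          have := Nat.le_of_dvd (by omega) this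
          omega
        · have := (Nat.modEq_iff_dvd' h5.le).1 h3.symm
          have := Nat.le_of_dvd (by omega) this
          omega
      have hwN : (ζ ^ m * starRingEnd ℂ ζ ^ n) ^ (n + 1) = 1 := by
        rw [mul_pow, ← pow_mul, ← pow_mul, mul_comm m, mul_comm n, pow_mul, pow_mul, ← map_pow,
          hprim.pow_eq_one]
        simp
      have h5 := mul_geom_sum (ζ ^ m * starRingEnd ℂ ζ ^ n) (n + 1)
      rw [hwN, sub_self] at h5
      rw [(mul_eq_zero.1 h5).resolve_left (sub_ne_zero.2 hw1), mul_zero]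
    · intro h
      exact absurd (Finset.mem_range.2 (by omega)) h
  have k1 := key b hb
  have k2 := key 1 (by simp)
  rw [← k2] at k1
  norm_cast at k1
  have e3 : ∀ w : Fin n → Cn k, diagPart Θ w = (1 / ((n : ℝ) + 1)) *
      ∑ j ∈ Finset.range (n + 1), Θ fun i => ζ ^ j • w i := by
    intro w
    rw [diagPart, ContinuousAlternatingMap.smul_apply, ContinuousAlternatingMap.sum_apply]
    rfl
  rw [ContinuousAlternatingMap.compContinuousLinearMap_apply, e3, e3]
  congr 1
  simp only [mul_one, ← smul_smul] at k1
  exact_mod_cast k1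

lemma norm_comp_mulC_le (Θ : Alt k n) {a : ℂ} (ha : ‖a‖ = 1) :
    ‖Θ.compContinuousLinearMap (mulC k a)‖ ≤ ‖Θ‖ := by
  refine ContinuousAlternatingMap.opNorm_le_bound _ (norm_nonneg _) fun v => ?_
  rw [ContinuousAlternatingMap.compContinuousLinearMap_apply]
  refine (Θ.le_opNorm _).trans (le_of_eq ?_)
  simp [mulC_apply, norm_smul, ha]

lemma norm_diagPart_le (Θ : Alt k n) : ‖diagPart Θ‖ ≤ ‖Θ‖ := by
  have hprim := Complex.isPrimitiveRoot_exp (n + 1) (by omega)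
  have hnorm := hprim.norm'_eq_one (by omega)
  rw [diagPart, norm_smul, Real.norm_of_nonneg (by positivity)]
  have h1 : ‖∑ j ∈ Finset.range (n + 1), Θ.compContinuousLinearMap
      (mulC k (Complex.exp (2 * Real.pi * Complex.I / (n + 1 : ℕ)) ^ j))‖
      ≤ ∑ j ∈ Finset.range (n + 1), ‖Θ‖ :=
    norm_sum_le_of_le _ fun j _ => norm_comp_mulC_le Θ (by rw [norm_pow, hnorm, one_pow])
  rw [Finset.sum_const, Finset.card_range, nsmul_eq_mul] at h1
  rw [div_mul_eq_mul_div, one_mul, div_le_iff₀ (by positivity)]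
  refine h1.trans (le_of_eq ?_)
  push_cast
  ring

/-! ### Norm estimates -/

set_option maxSynthPendingDepth 5 in
variable (k n) in
/-- The coefficient of `iβ ∧ β̄ ∧ Θ` is bounded by the norms. -/
lemma exists_coeff_gradWedge_le : ∃ C : ℝ, 0 ≤ C ∧ ∀ (l : Covec k) (Θ : Alt k n),
    |coeff (gradWedge l Θ)| ≤ C * ‖l‖ ^ 2 * ‖Θ‖ := by
  have hw : ∀ n, ∃ C : ℝ, 0 ≤ C ∧ ∀ (l : Covec k) (Θ : Alt k n),
      ‖wedge₁ l Θ‖ ≤ C * ‖l‖ * ‖Θ‖ := fun n =>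
    ⟨‖wedge₁ (k := k) (n := n)‖, norm_nonneg _, fun l Θ => (wedge₁ (k := k) (n := n)).le_opNorm₂ l Θ⟩
  obtain ⟨C₁, h01, hC₁⟩ := hw n
  obtain ⟨C₂, h02, hC₂⟩ := hw (n + 1)
  refine ⟨‖coeffL k (n + 2)‖ * ((1 / 2) * (C₂ * (‖mulC k Complex.I‖ * C₁))), by positivity,
    fun l Θ => ?_⟩
  rw [← coeffL_apply, ← Real.norm_eq_abs]
  have h1 := hC₁ l Θ
  have h2 := hC₂ (l.comp (mulC k Complex.I)) (wedge₁ l Θ)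
  have h3 := l.opNorm_comp_le (mulC k Complex.I)
  have h4 : ‖gradWedge l Θ‖ ≤ (1 / 2) * (C₂ * (‖l‖ * ‖mulC k Complex.I‖) *
      (C₁ * ‖l‖ * ‖Θ‖)) := by
    rw [gradWedge, norm_smul, Real.norm_of_nonneg (by norm_num)]
    refine mul_le_mul_of_nonneg_left (h2.trans ?_) (by norm_num)
    gcongr
  refine ((coeffL k (n + 2)).le_opNorm _).trans ((mul_le_mul_of_nonneg_left h4 (norm_nonneg _)).trans
    (le_of_eq ?_))
  ring

lemma norm_sq_le_of_pos (hk : 1 ≤ k) {η : Alt k 2} (hd : IsDiagonal η)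
    (hη : ∀ v : Cn k, v ≠ 0 → 0 < η ![v, Complex.I • v]) (l : Covec k) :
    ‖l‖ ^ 2 ≤ 2 * k * ‖η‖ / coeff (powForm η k) * coeff (gradWedge l (powForm η (k - 1))) := by
  have h0 := coeff_powForm_pos hη
  have h1 := coeff_gradWedge_powForm_nonneg hk hη l
  set Q := coeff (gradWedge l (powForm η (k - 1)))
  set c := 2 * k * ‖η‖ / coeff (powForm η k) * Q with hc
  have hc0 : 0 ≤ c := by positivity
  have h2 : ‖l‖ ≤ √c := by
    refine l.opNorm_le_bound (Real.sqrt_nonneg _) fun v => ?_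
    have h3 := covec_sq_mul_le hk hd hη l v
    have h4 : η ![v, Complex.I • v] ≤ ‖η‖ * ‖v‖ ^ 2 := by
      refine (le_abs_self _).trans ((η.le_opNorm _).trans (le_of_eq ?_))
      simp [Fin.prod_univ_two, norm_smul, sq]
    have h5 : l v ^ 2 ≤ c * ‖v‖ ^ 2 := by
      rw [hc, div_mul_eq_mul_div, div_mul_eq_mul_div, le_div_iff₀ h0]
      refine h3.trans ((mul_le_mul_of_nonneg_left h4 (by positivity)).trans (le_of_eq ?_))
      ring
    rw [Real.norm_eq_abs, ← Real.sqrt_sq (norm_nonneg v), ← Real.sqrt_mul hc0]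
    exact Real.abs_le_sqrt h5
  calc ‖l‖ ^ 2 ≤ √c ^ 2 := by gcongr
    _ = c := Real.sq_sqrt hc0

/-! ### The product of two forms `iβ ∧ β̄` -/

/-- For covectors `l` and `m = η(z, ·)` with `(1,0)`-parts `β` and `γ`, the product
`iβ ∧ β̄ ∧ iγ ∧ γ̄ ∧ η^(k-2)` in terms of `iβ ∧ β̄ ∧ η^(k-1)` and `η^k`. It comes from two contractions of
`η^k`, with `z` and `iz`, as `iβ ∧ β̄ ∧ η^k = 0` for reasons of degree. If `η` is positive, this shows that
the product is at most `η(z, iz) / 2(k-1)` times `iβ ∧ β̄ ∧ η^(k-1)`. -/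
lemma coeff_gradWedge_gradWedge {p : ℕ} (hp : k = p + 2) {η : Alt k 2} (hd : IsDiagonal η)
    (l : Covec k) (z : Cn k) :
    2 * ((p : ℝ) + 1) * (p + 2) * coeff (gradWedge l (gradWedge (contr η z) (powForm η p)))
      = (p + 2) * η ![z, Complex.I • z] * coeff (gradWedge l (powForm η (p + 1)))
        - (1 / 2) * (l z ^ 2 + l (Complex.I • z) ^ 2) * coeff (powForm η (p + 2)) := by
  set c := contr η z with hc
  set Ψ : Alt k (2 * p + 4) := powForm η (p + 2) with hΨ
  have hcJ : c.comp (mulC k Complex.I) = -contr η (Complex.I • z) := by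
    ext v
    change c (Complex.I • v) = -contr η (Complex.I • z) v
    rw [hc, contr_apply, contr_apply, ← hd.apply_smul (a := Complex.I) (by simp) z,
      I_smul_I_smul, alt_two_neg_right]
  have e1 : ((p : ℝ) + 1) • wedge₁ c (powForm η p)
      = ContinuousAlternatingMap.curryLeft (n := 2 * p + 1) (powForm η (p + 1)) z :=
    (curryLeft_powForm η p z).symm
  have e2 : ((p : ℝ) + 2) • wedge₁ (c.comp (mulC k Complex.I)) (powForm η (p + 1))
      = -ContinuousAlternatingMap.curryLeft (n := 2 * p + 3) Ψ (Complex.I • z) := by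
    rw [hΨ]
    refine Eq.trans ?_ (congrArg Neg.neg (curryLeft_powForm η (p + 1) (Complex.I • z)).symm)
    rw [hcJ, map_neg]
    push_cast
    rw [show (p : ℝ) + 1 + 1 = p + 2 by ring]
    simp
  have e3 : (2 * ((p : ℝ) + 1) * (p + 2)) • gradWedge c (powForm η p)
      = (((p : ℝ) + 2) * η ![z, Complex.I • z]) • (powForm η (p + 1) : Alt k (2 * p + 2))
        + (ContinuousAlternatingMap.curryLeft (n := 2 * p + 3) Ψ (Complex.I • z)).curryLeft z := by
    have f1 := curryLeft_wedge₁ (n := 2 * p + 1) (c.comp (mulC k Complex.I))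
      (powForm η (p + 1)) z
    have f2 : (c.comp (mulC k Complex.I)) z = η ![z, Complex.I • z] := by
      change c (Complex.I • z) = _
      rw [hc, contr_apply]
    have f3 : (2 * ((p : ℝ) + 1) * (p + 2)) • gradWedge c (powForm η p)
        = ((p : ℝ) + 2) • wedge₁ (c.comp (mulC k Complex.I))
            (ContinuousAlternatingMap.curryLeft (n := 2 * p + 1) (powForm η (p + 1)) z) := by
      rw [← e1, gradWedge, map_smul, smul_smul, smul_smul]
      congr 1
      ring
    have f4 : ((p : ℝ) + 2) • (wedge₁ (c.comp (mulC k Complex.I)) (powForm η (p + 1))).curryLeft z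
        = -(ContinuousAlternatingMap.curryLeft (n := 2 * p + 3) Ψ (Complex.I • z)).curryLeft z := by
      have := congrArg (fun Φ : Alt k (2 * p + 3) => Φ.curryLeft z) e2
      exact this
    rw [f3]
    have f5 : wedge₁ (c.comp (mulC k Complex.I))
            (ContinuousAlternatingMap.curryLeft (n := 2 * p + 1) (powForm η (p + 1)) z)
        = η ![z, Complex.I • z] • (powForm η (p + 1) : Alt k (2 * p + 2))
          - (wedge₁ (c.comp (mulC k Complex.I)) (powForm η (p + 1))).curryLeft z := by
      rw [← f2]
      exact (sub_eq_iff_eq_add.2 (by rw [f1]; abel)).symm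
    rw [f5, smul_sub, smul_smul]
    refine Eq.trans (congrArg _ f4) ?_
    rw [sub_neg_eq_add]
  have htop : 2 * k = (2 * p + 3) + 1 := by omega
  have e4 : wedge₁ (l.comp (mulC k Complex.I)) (wedge₁ l
      ((ContinuousAlternatingMap.curryLeft (n := 2 * p + 3) Ψ (Complex.I • z)).curryLeft z))
      = (-(l z ^ 2 + l (Complex.I • z) ^ 2)) • Ψ := by
    have f1 := curryLeft_wedge₁ (n := 2 * p + 2) l
      (ContinuousAlternatingMap.curryLeft (n := 2 * p + 3) Ψ (Complex.I • z)) z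
    rw [wedge₁_curryLeft_top htop] at f1
    have f2 : wedge₁ l
        ((ContinuousAlternatingMap.curryLeft (n := 2 * p + 3) Ψ (Complex.I • z)).curryLeft z)
        = l z • ContinuousAlternatingMap.curryLeft (n := 2 * p + 3) Ψ (Complex.I • z)
          - l (Complex.I • z) • ContinuousAlternatingMap.curryLeft (n := 2 * p + 3) Ψ z := by
      rw [eq_sub_iff_add_eq, ← eq_sub_iff_add_eq']
      exact f1
    have f3 : ∀ (m : Covec k) (s t : ℝ) (Φ Φ' : Alt k (2 * p + 3)),
        wedge₁ m (s • Φ - t • Φ') = s • wedge₁ m Φ - t • wedge₁ m Φ' := fun m s t Φ Φ' => by simp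
    rw [f2, f3, wedge₁_curryLeft_top htop, wedge₁_curryLeft_top htop,
      smul_smul, smul_smul]
    refine (sub_smul _ _ Ψ).symm.trans ?_
    congr 1
    change l z * l (Complex.I • Complex.I • z) - l (Complex.I • z) * l (Complex.I • z) = _
    rw [I_smul_I_smul, map_neg]
    ring
  have e5 : ∀ Φ : Alt k (2 * p + 2), coeff (gradWedge l Φ)
      = (1 / 2) * coeff (wedge₁ (l.comp (mulC k Complex.I)) (wedge₁ l Φ)) :=
    fun Φ => coeff_smul _ _
  have e6 := congrArg (fun Φ : Alt k (2 * p + 2) =>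
    coeff (wedge₁ (l.comp (mulC k Complex.I)) (wedge₁ l Φ))) e3
  simp only [map_smul, map_add, coeff_add, coeff_smul] at e6
  rw [e4, coeff_smul] at e6
  have e7 := e5 (gradWedge (contr η z) (powForm η p))
  have e8 := e5 (powForm η (p + 1))
  have e9 : coeff (gradWedge l (powForm η (p + 1)))
    = (1 / 2) * coeff (wedge₁ (l.comp (mulC k Complex.I)) (wedge₁ (n := 2 * p + 2) l
      (powForm η (p + 1)))) := e8
  rw [e7, e9]
  linear_combination (1 / 2) * e6

end

set_option maxSynthPendingDepth 5

section

variable {k n : ℕ}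

/-! ### Exterior differential calculus on `ℂᵏ` -/

lemma extDeriv_eq_sum (Φ : Cn k → Alt k n) (x : Cn k) :
    extDeriv Φ x = ∑ a, wedge₁ (dualCovec a) (fderiv ℝ Φ x (rBasis k a)) :=
  alternatizeUncurryFin_eq_sum _

lemma fderiv_wedge₁ {l : Cn k → Covec k} {Θ : Cn k → Alt k n} {x : Cn k}
    (hl : DifferentiableAt ℝ l x) (hΘ : DifferentiableAt ℝ Θ x) (v : Cn k) :
    fderiv ℝ (fun y => wedge₁ (l y) (Θ y)) x v
      = wedge₁ (l x) (fderiv ℝ Θ x v) + wedge₁ (fderiv ℝ l x v) (Θ x) := by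
  have h1 : HasFDerivAt (fun y => wedge₁ (n := n) (l y)) (wedge₁.comp (fderiv ℝ l x)) x :=
    (wedge₁ (k := k) (n := n)).hasFDerivAt.comp x hl.hasFDerivAt
  rw [(h1.clm_apply hΘ.hasFDerivAt).fderiv]
  rfl

lemma fderiv_wedge₂ {τ : Cn k → Alt k 2} {Θ : Cn k → Alt k n} {x : Cn k}
    (hτ : DifferentiableAt ℝ τ x) (hΘ : DifferentiableAt ℝ Θ x) (v : Cn k) :
    fderiv ℝ (fun y => wedge₂ (τ y) (Θ y)) x v
      = wedge₂ (τ x) (fderiv ℝ Θ x v) + wedge₂ (fderiv ℝ τ x v) (Θ x) := by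
  have h1 : HasFDerivAt (fun y => wedge₂L (n := n) (τ y)) (wedge₂L.comp (fderiv ℝ τ x)) x :=
    (wedge₂L (k := k) (n := n)).hasFDerivAt.comp x hτ.hasFDerivAt
  have h2 : (fun y => wedge₂ (τ y) (Θ y)) = fun y => wedge₂L (τ y) (Θ y) := by
    funext y
    rw [wedge₂L_apply]
  rw [h2, (h1.clm_apply hΘ.hasFDerivAt).fderiv, ← wedge₂L_apply, ← wedge₂L_apply]
  rfl

lemma contDiffOn_wedge₁ {r : WithTop ℕ∞} {l : Cn k → Covec k} {Θ : Cn k → Alt k n} {s : Set (Cn k)}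
    (hl : ContDiffOn ℝ r l s) (hΘ : ContDiffOn ℝ r Θ s) :
    ContDiffOn ℝ r (fun y => wedge₁ (l y) (Θ y)) s :=
  ((wedge₁ (k := k) (n := n)).contDiff.comp_contDiffOn hl).clm_apply hΘ

lemma contDiffOn_wedge₂ {r : WithTop ℕ∞} {τ : Cn k → Alt k 2} {Θ : Cn k → Alt k n} {s : Set (Cn k)}
    (hτ : ContDiffOn ℝ r τ s) (hΘ : ContDiffOn ℝ r Θ s) :
    ContDiffOn ℝ r (fun y => wedge₂ (τ y) (Θ y)) s := by
  simp only [← wedge₂L_apply]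
  exact ((wedge₂L (k := k) (n := n)).contDiff.comp_contDiffOn hτ).clm_apply hΘ

lemma contDiff_wedge₁ {r : WithTop ℕ∞} {l : Cn k → Covec k} {Θ : Cn k → Alt k n}
    (hl : ContDiff ℝ r l) (hΘ : ContDiff ℝ r Θ) :
    ContDiff ℝ r (fun y => wedge₁ (l y) (Θ y)) :=
  ((wedge₁ (k := k) (n := n)).contDiff.comp hl).clm_apply hΘ

lemma contDiff_wedge₂ {r : WithTop ℕ∞} {τ : Cn k → Alt k 2} {Θ : Cn k → Alt k n}
    (hτ : ContDiff ℝ r τ) (hΘ : ContDiff ℝ r Θ) :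
    ContDiff ℝ r (fun y => wedge₂ (τ y) (Θ y)) := by
  simp only [← wedge₂L_apply]
  exact ((wedge₂L (k := k) (n := n)).contDiff.comp hτ).clm_apply hΘ

lemma contDiff_extDeriv {Φ : Cn k → Alt k n} (h : ContDiff ℝ ∞ Φ) :
    ContDiff ℝ ∞ (extDeriv Φ) :=
  (ContinuousAlternatingMap.alternatizeUncurryFinCLM ℝ (Cn k) ℝ).contDiff.comp
    (h.fderiv_right (m := ∞) (by simp))

lemma extDeriv_wedge₁ {l : Cn k → Covec k} {Θ : Cn k → Alt k n} {x : Cn k}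
    (hl : DifferentiableAt ℝ l x) (hΘ : DifferentiableAt ℝ Θ x) :
    extDeriv (fun y => wedge₁ (l y) (Θ y)) x
      = wedge₂ (extDeriv (fun y => covecEquiv k (l y)) x) (Θ x)
        - wedge₁ (l x) (extDeriv Θ x) := by
  have h1 : ∀ v, fderiv ℝ (fun y => covecEquiv k (l y)) x v = covecEquiv k (fderiv ℝ l x v) := by
    intro v
    have : HasFDerivAt (fun y => covecEquiv k (l y))
        (((covecEquiv k : Covec k →L[ℝ] Alt k 1)).comp (fderiv ℝ l x)) x :=
      (covecEquiv k : Covec k →L[ℝ] Alt k 1).hasFDerivAt.comp x hl.hasFDerivAt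
    rw [this.fderiv]
    rfl
  rw [extDeriv_eq_sum, extDeriv_eq_sum, extDeriv_eq_sum, wedge₂_sum_left, map_sum,
    sub_eq_add_neg, ← Finset.sum_neg_distrib, ← Finset.sum_add_distrib]
  refine Finset.sum_congr rfl fun a _ => ?_
  rw [fderiv_wedge₁ hl hΘ, h1, wedge₂_wedge₁, map_add, wedge₁_anticomm (l x)]
  abel

lemma extDeriv_smul_fun {g : Cn k → ℝ} {Θ : Cn k → Alt k n} {x : Cn k}
    (hg : DifferentiableAt ℝ g x) (hΘ : DifferentiableAt ℝ Θ x) :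
    extDeriv (fun y => g y • Θ y) x = wedge₁ (fderiv ℝ g x) (Θ x) + g x • extDeriv Θ x := by
  rw [extDeriv_eq_sum, extDeriv_eq_sum, Finset.smul_sum]
  have h1 : ∀ v, fderiv ℝ (fun y => g y • Θ y) x v
      = g x • fderiv ℝ Θ x v + fderiv ℝ g x v • Θ x := by
    intro v
    have h2 : HasFDerivAt (fun y => g y • Θ y) _ x := hg.hasFDerivAt.smul hΘ.hasFDerivAt
    rw [h2.fderiv]
    rfl
  conv_rhs => rw [← sum_apply_dualCovec (fderiv ℝ g x)]
  rw [map_sum, _root_.sum_apply, ← Finset.sum_add_distrib]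
  refine Finset.sum_congr rfl fun a _ => ?_
  rw [h1, map_add, map_smul, map_smul, map_smul, smul_apply]
  abel

/-- The exterior product with a closed `2`-form commutes with the exterior derivative. Contracting
`∑ e^a ∧ ∂_a τ = 0` shows that the sum `S = ∑ e^a ∧ ∂_a τ ∧ Θ` satisfies `S = -2S`. -/
lemma extDeriv_wedge₂_of_closed {τ : Cn k → Alt k 2} {Θ : Cn k → Alt k n} {x : Cn k}
    (hτ : DifferentiableAt ℝ τ x) (hΘ : DifferentiableAt ℝ Θ x) (h0 : extDeriv τ x = 0) :
    extDeriv (fun y => wedge₂ (τ y) (Θ y)) x = wedge₂ (τ x) (extDeriv Θ x) := by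
  set σ : Fin (Module.finrank ℝ (Cn k)) → Alt k 2 := fun a => fderiv ℝ τ x (rBasis k a) with hσ
  have h1 : ∀ c, σ c = ∑ a, wedge₁ (dualCovec a) (covecEquiv k (contr (σ a) (rBasis k c))) := by
    intro c
    have h2 : (extDeriv τ x).curryLeft (rBasis k c) = 0 := by rw [h0]; rfl
    rw [extDeriv_eq_sum] at h2
    have h3 : (∑ a, wedge₁ (dualCovec a) (σ a)).curryLeft (rBasis k c)
        = ∑ a, (wedge₁ (dualCovec a) (σ a)).curryLeft (rBasis k c) := by
      ext v
      simp [ContinuousAlternatingMap.sum_apply]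
    change (∑ a, wedge₁ (dualCovec a) (σ a)).curryLeft (rBasis k c) = 0 at h2
    rw [h3] at h2
    simp only [curryLeft_wedge₁, Finset.sum_sub_distrib] at h2
    have h4 : ∑ a, dualCovec a (rBasis k c) • σ a = σ c :=
      sum_dualCovec_smul (fderiv ℝ τ x).toLinearMap (rBasis k c)
    rw [h4] at h2
    simp only [covecEquiv_contr]
    exact sub_eq_zero.1 h2
  set S := ∑ a, wedge₁ (dualCovec a) (wedge₂ (σ a) (Θ x)) with hS
  have h5 : S = (-2 : ℝ) • S := by
    calc S = ∑ c, ∑ a, wedge₁ (dualCovec c) (wedge₁ (dualCovec a)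
          (wedge₁ (contr (σ a) (rBasis k c)) (Θ x))) := by
          rw [hS]
          refine Finset.sum_congr rfl fun c _ => ?_
          rw [h1 c, wedge₂_sum_left, map_sum]
          refine Finset.sum_congr rfl fun a _ => ?_
          rw [wedge₂_wedge₁]
      _ = ∑ a, -wedge₁ (dualCovec a) (∑ c, wedge₁ (dualCovec c)
          (wedge₁ (contr (σ a) (rBasis k c)) (Θ x))) := by
          rw [Finset.sum_comm]
          refine Finset.sum_congr rfl fun a _ => ?_
          rw [map_sum, ← Finset.sum_neg_distrib]
          refine Finset.sum_congr rfl fun c _ => ?_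
          rw [wedge₁_anticomm]
      _ = (-2 : ℝ) • S := by
          rw [hS, Finset.smul_sum]
          refine Finset.sum_congr rfl fun a _ => ?_
          have h6 := wedge₂_eq_sum (σ a) (Θ x)
          have h7 : ∑ c, wedge₁ (dualCovec c) (wedge₁ (contr (σ a) (rBasis k c)) (Θ x))
              = (2 : ℝ) • wedge₂ (σ a) (Θ x) := by
            rw [h6, smul_smul]
            norm_num
          rw [h7, map_smul, neg_smul]
  have h8 : S = 0 := by
    have h9 : (3 : ℝ) • S = 0 := by
      have : (3 : ℝ) • S = S - (-2 : ℝ) • S := by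
        rw [show (3 : ℝ) = 1 - (-2) by norm_num]
        exact (sub_smul _ _ S).trans (by rw [one_smul])
      rw [this, ← h5, sub_self]
    exact (smul_eq_zero.1 h9).resolve_left (by norm_num)
  rw [extDeriv_eq_sum, extDeriv_eq_sum, ← wedge₂L_apply, map_sum]
  rw [← add_zero (∑ a, wedge₂L (τ x) _), ← h8, hS, ← Finset.sum_add_distrib]
  refine Finset.sum_congr rfl fun a _ => ?_
  rw [fderiv_wedge₂ hτ hΘ, map_add, wedge₂L_apply, wedge₂_wedge₁_comm]

lemma extDeriv_powForm {τ : Cn k → Alt k 2} {x : Cn k} (hτ : DifferentiableAt ℝ τ x)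
    (h0 : extDeriv τ x = 0) (p : ℕ) : extDeriv (fun y => powForm (τ y) p) x = 0 := by
  induction p with
  | zero =>
    rw [extDeriv_eq_sum]
    have : (fun y => powForm (τ y) 0) = fun _ => powForm (τ x) 0 := rfl
    rw [this]
    simp
  | succ p ih =>
    have hd : DifferentiableAt ℝ (fun y => powForm (τ y) p) x :=
      ((contDiff_powForm p).differentiable (by simp)).differentiableAt.comp x hτ
    refine (extDeriv_wedge₂_of_closed hτ hd h0).trans ?_
    rw [ih, ← wedge₂L_apply, map_zero]

/-- The integral of a partial derivative of a compactly supported function vanishes. -/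
lemma integral_fderiv_eq_zero {g : Cn k → ℝ} (hg : ContDiff ℝ 1 g) (hc : HasCompactSupport g)
    (v : Cn k) : ∫ x, fderiv ℝ g x v = 0 := by
  have hd : Continuous fun x => fderiv ℝ g x v :=
    (hg.continuous_fderiv one_ne_zero).clm_apply continuous_const
  have hdc : HasCompactSupport fun x => fderiv ℝ g x v := hc.fderiv_apply ℝ v
  have h := integral_mul_fderiv_eq_neg_fderiv_mul_of_integrable (μ := (volume : Measure (Cn k)))
    (f := fun _ : Cn k => (1 : ℝ)) (g := g) (v := v) (by simp)
    (by simpa using hd.integrable_of_hasCompactSupport hdc)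
    (by simpa using hg.continuous.integrable_of_hasCompactSupport hc)
    (fun x _ => differentiableAt_const _) (fun x _ => (hg.differentiable one_ne_zero) x)
  simpa using h

/-- Stokes' theorem for compactly supported forms on `ℂᵏ`. -/
lemma integral_coeff_extDeriv {Ψ : Cn k → Alt k n} (hΨ : ContDiff ℝ 1 Ψ)
    (hc : HasCompactSupport Ψ) : ∫ x, coeff (extDeriv Ψ x) = 0 := by
  have hd : Differentiable ℝ Ψ := hΨ.differentiable one_ne_zero
  let g : Fin (n + 1) → Cn k → ℝ := fun i x => Ψ x (i.removeNth (frame k (n + 1)))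
  have hg : ∀ i, ContDiff ℝ 1 (g i) := fun i =>
    (ContinuousAlternatingMap.apply ℝ (Cn k) ℝ (i.removeNth (frame k (n + 1)))).contDiff.comp hΨ
  have hgc : ∀ i, HasCompactSupport (g i) := fun i =>
    hc.mono fun x hx h => hx (by simp [g, h])
  have h1 : ∀ x, coeff (extDeriv Ψ x)
      = ∑ i : Fin (n + 1), (-1) ^ (i : ℕ) * fderiv ℝ (g i) x (frame k (n + 1) i) := by
    intro x
    rw [coeff, extDeriv_apply (hd x)]
    simp [g]
  simp only [h1]
  rw [integral_finsetSum]
  · refine Finset.sum_eq_zero fun i _ => ?_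
    rw [integral_const_mul, integral_fderiv_eq_zero (hg i) (hgc i), mul_zero]
  · intro i _
    refine Integrable.const_mul ?_ _
    exact (((hg i).continuous_fderiv one_ne_zero).clm_apply
      continuous_const).integrable_of_hasCompactSupport ((hgc i).fderiv_apply ℝ _)

end

section

variable {k n : ℕ}

/-! ### Changes of charts -/

lemma contDiffOn_comp {r : WithTop ℕ∞} {Φ : Cn k → Alt k n} {A : Cn k → Cn k →L[ℝ] Cn k}
    {s : Set (Cn k)} (hΦ : ContDiffOn ℝ r Φ s) (hA : ContDiffOn ℝ r A s) :
    ContDiffOn ℝ r (fun y => (Φ y).compContinuousLinearMap (A y)) s := by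
  induction n with
  | zero =>
    refine hΦ.congr fun y _ => ?_
    ext v
    rw [ContinuousAlternatingMap.compContinuousLinearMap_apply]
    congr 1
    exact Subsingleton.elim _ _
  | succ n ih =>
    have h1 : ∀ y, (Φ y).compContinuousLinearMap (A y)
        = (1 / ((n : ℝ) + 1)) • ∑ a, wedge₁ ((dualCovec a).comp (A y))
          (((Φ y).curryLeft (rBasis k a)).compContinuousLinearMap (A y)) := by
      intro y
      simp only [← wedge₁_comp]
      have h2 : ∀ Θ : Fin (Module.finrank ℝ (Cn k)) → Alt k (n + 1),
          ∑ a, (Θ a).compContinuousLinearMap (A y) = (∑ a, Θ a).compContinuousLinearMap (A y) := by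
        intro Θ
        ext v
        simp [ContinuousAlternatingMap.sum_apply]
      rw [h2, sum_wedge₁_curryLeft, comp_smul, smul_smul]
      have : (1 / ((n : ℝ) + 1)) * ((n : ℝ) + 1) = 1 := by field_simp
      rw [this, one_smul]
    simp only [h1]
    refine ContDiffOn.const_smul _ (ContDiffOn.sum fun a _ => contDiffOn_wedge₁ ?_ (ih ?_))
    · exact contDiffOn_const.clm_comp hA
    · exact (((ContinuousLinearMap.apply ℝ (Alt k n) (rBasis k a)).comp
        (ContinuousAlternatingMap.curryLeftLI (𝕜 := ℝ) (E := Cn k) (F := ℝ)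
          (n := n)).toContinuousLinearMap).contDiff).comp_contDiffOn hΦ

section Charts

variable {X : Type*} [TopologicalSpace X] [ChartedSpace (Cn k) X] [IsManifold 𝓘(ℂ, Cn k) ω X]
  {e e' : OpenPartialHomeomorph X (Cn k)}

lemma transition_contDiffOn_complex (he : e ∈ atlas (Cn k) X) (he' : e' ∈ atlas (Cn k) X) :
    ContDiffOn ℂ ω (e' ∘ e.symm) (e.target ∩ e.symm ⁻¹' e'.source) := by
  have h := (contDiffGroupoid ω 𝓘(ℂ, Cn k)).compatible he he'
  have h2 := contMDiffOn_of_mem_contDiffGroupoid h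
  rw [contMDiffOn_iff_contDiffOn] at h2
  have h3 : (e.symm ≫ₕ e').source = e.target ∩ e.symm ⁻¹' e'.source := by simp
  rw [h3] at h2
  exact h2

lemma isOpen_overlap (e e' : OpenPartialHomeomorph X (Cn k)) :
    IsOpen (e.target ∩ e.symm ⁻¹' e'.source) :=
  e.isOpen_inter_preimage_symm e'.open_source

lemma transition_contDiffOn (he : e ∈ atlas (Cn k) X) (he' : e' ∈ atlas (Cn k) X) :
    ContDiffOn ℝ ∞ (e' ∘ e.symm) (e.target ∩ e.symm ⁻¹' e'.source) :=
  ((transition_contDiffOn_complex he he').restrict_scalars ℝ).of_le (by simp)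

lemma transition_contDiffAt (he : e ∈ atlas (Cn k) X) (he' : e' ∈ atlas (Cn k) X) {y : Cn k}
    (hy : y ∈ e.target) (hy' : e.symm y ∈ e'.source) : ContDiffAt ℝ ∞ (e' ∘ e.symm) y :=
  (transition_contDiffOn he he').contDiffAt ((isOpen_overlap e e').mem_nhds ⟨hy, hy'⟩)

lemma transition_differentiableAt (he : e ∈ atlas (Cn k) X) (he' : e' ∈ atlas (Cn k) X) {y : Cn k}
    (hy : y ∈ e.target) (hy' : e.symm y ∈ e'.source) : DifferentiableAt ℝ (e' ∘ e.symm) y :=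
  (transition_contDiffAt he he' hy hy').differentiableAt (by simp)

lemma fderiv_transition_comm (he : e ∈ atlas (Cn k) X) (he' : e' ∈ atlas (Cn k) X) {y : Cn k}
    (hy : y ∈ e.target) (hy' : e.symm y ∈ e'.source) :
    (fderiv ℝ (e' ∘ e.symm) y).comp (mulC k Complex.I)
      = (mulC k Complex.I).comp (fderiv ℝ (e' ∘ e.symm) y) := by
  have h : DifferentiableAt ℂ (e' ∘ e.symm) y :=
    ((transition_contDiffOn_complex he he').contDiffAt
      ((isOpen_overlap e e').mem_nhds ⟨hy, hy'⟩)).differentiableAt (by simp)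
  rw [h.fderiv_restrictScalars ℝ]
  ext1 v
  exact map_smul (fderiv ℂ (e' ∘ e.symm) y) Complex.I v

lemma chartFrame_eq_comp (he : e ∈ atlas (Cn k) X) (he' : e' ∈ atlas (Cn k) X) {y : Cn k}
    (hy : y ∈ e.target) (hy' : e.symm y ∈ e'.source) :
    chartFrame e y = (chartFrame e' (e' (e.symm y))).comp (fderiv ℝ (e' ∘ e.symm) y) := by
  set c := chartAt (Cn k) (e.symm y) with hc
  have h1 : (c ∘ e.symm) =ᶠ[nhds y] (c ∘ e'.symm) ∘ (e' ∘ e.symm) := by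
    filter_upwards [(isOpen_overlap e e').mem_nhds ⟨hy, hy'⟩] with w hw
    simp only [Function.comp_apply]
    rw [e'.left_inv hw.2]
  have h2 : chartFrame e' (e' (e.symm y)) = fderiv ℝ (c ∘ e'.symm) (e' (e.symm y)) := by
    rw [chartFrame, e'.left_inv hy']
  rw [h2, chartFrame, ← hc, h1.fderiv_eq]
  refine fderiv_comp y ?_ (transition_differentiableAt he he' hy hy')
  refine transition_differentiableAt he' (chart_mem_atlas _ _) (e'.map_source hy') ?_
  rw [Function.comp_apply, e'.left_inv hy']
  exact mem_chart_source _ _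

lemma formIn_eq_comp (he : e ∈ atlas (Cn k) X) (he' : e' ∈ atlas (Cn k) X) {y : Cn k}
    (hy : y ∈ e.target) (hy' : e.symm y ∈ e'.source) (Θ : X → Alt k n) :
    formIn e Θ y = (formIn e' Θ (e' (e.symm y))).compContinuousLinearMap
      (fderiv ℝ (e' ∘ e.symm) y) := by
  rw [formIn, formIn, e'.left_inv hy', comp_comp, chartFrame_eq_comp he he' hy hy']

lemma fderiv_transition_comp (he : e ∈ atlas (Cn k) X) (he' : e' ∈ atlas (Cn k) X) {y : Cn k}
    (hy : y ∈ e.target) (hy' : e.symm y ∈ e'.source) :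
    (fderiv ℝ (e ∘ e'.symm) (e' (e.symm y))).comp (fderiv ℝ (e' ∘ e.symm) y)
      = ContinuousLinearMap.id ℝ (Cn k) := by
  have h1 : (e ∘ e'.symm) ∘ (e' ∘ e.symm) =ᶠ[nhds y] id := by
    filter_upwards [(isOpen_overlap e e').mem_nhds ⟨hy, hy'⟩] with w hw
    simp only [Function.comp_apply]
    rw [e'.left_inv hw.2, e.right_inv hw.1, id]
  have h2 : DifferentiableAt ℝ (e ∘ e'.symm) ((e' ∘ e.symm) y) := by
    refine transition_differentiableAt he' he (e'.map_source hy') ?_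
    rw [Function.comp_apply, e'.left_inv hy']
    exact e.map_target hy
  have h3 := fderiv_comp y h2 (transition_differentiableAt he he' hy hy')
  rw [h1.fderiv_eq, fderiv_id] at h3
  exact h3.symm

/-- The inverse of `chartFrame`: the derivative of `e` at `x`, as a map from the tangent space. -/
def frameInv (e : OpenPartialHomeomorph X (Cn k)) (x : X) : Cn k →L[ℝ] Cn k :=
  fderiv ℝ (e ∘ (chartAt (Cn k) x).symm) (chartAt (Cn k) x x)

lemma frameInv_comp_chartFrame (he : e ∈ atlas (Cn k) X) {y : Cn k} (hy : y ∈ e.target) :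
    (frameInv e (e.symm y)).comp (chartFrame e y) = ContinuousLinearMap.id ℝ (Cn k) :=
  fderiv_transition_comp he (chart_mem_atlas _ _) hy (mem_chart_source _ _)

lemma chartFrame_comp_frameInv (he : e ∈ atlas (Cn k) X) {y : Cn k} (hy : y ∈ e.target) :
    (chartFrame e y).comp (frameInv e (e.symm y)) = ContinuousLinearMap.id ℝ (Cn k) := by
  have h := frameInv_comp_chartFrame he hy
  have h2 : (frameInv e (e.symm y)).toLinearMap * (chartFrame e y).toLinearMap = 1 := by
    ext1 v
    exact DFunLike.congr_fun h v
  have h3 := mul_eq_one_comm.1 h2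
  ext1 v
  exact LinearMap.congr_fun h3 v

lemma chartFrame_comm (he : e ∈ atlas (Cn k) X) {y : Cn k} (hy : y ∈ e.target) :
    (chartFrame e y).comp (mulC k Complex.I) = (mulC k Complex.I).comp (chartFrame e y) :=
  fderiv_transition_comm he (chart_mem_atlas _ _) hy (mem_chart_source _ _)

lemma formIn_chartAt (Θ : X → Alt k n) (x : X) :
    formIn (chartAt (Cn k) x) Θ (chartAt (Cn k) x x) = Θ x := by
  set c := chartAt (Cn k) x with hc
  have hx := mem_chart_source (Cn k) x
  have h1 : chartFrame c (c x) = ContinuousLinearMap.id ℝ (Cn k) := by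
    have h2 : (chartAt (Cn k) (c.symm (c x)) ∘ c.symm) =ᶠ[nhds (c x)] id := by
      rw [c.left_inv hx]
      filter_upwards [c.open_target.mem_nhds (c.map_source hx)] with w hw
      exact c.right_inv hw
    rw [chartFrame, h2.fderiv_eq, fderiv_id]
  rw [formIn, h1, c.left_inv hx]
  rfl

/-! ### Operations on forms, in charts -/

lemma formIn_wedge₂ (e : OpenPartialHomeomorph X (Cn k)) (τ : X → Alt k 2) (Θ : X → Alt k n)
    (y : Cn k) : formIn e (fun x => wedge₂ (τ x) (Θ x)) y = wedge₂ (formIn e τ y) (formIn e Θ y) :=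
  wedge₂_comp _ _ _

lemma formIn_gradWedge (he : e ∈ atlas (Cn k) X) (θ : X → Covec k) (Θ : X → Alt k n)
    {y : Cn k} (hy : y ∈ e.target) :
    formIn e (fun x => gradWedge (θ x) (Θ x)) y = gradWedge (covecIn e θ y) (formIn e Θ y) :=
  gradWedge_comp _ _ _ (chartFrame_comm he hy)

/-- The exterior derivative may be computed in any chart. -/
lemma formIn_dForm (he : e ∈ atlas (Cn k) X) {Θ : X → Alt k n} (hΘ : IsSmoothForm Θ) {y : Cn k}
    (hy : y ∈ e.target) : formIn e (dForm Θ) y = extDeriv (formIn e Θ) y := by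
  set c := chartAt (Cn k) (e.symm y) with hc
  have hx : e.symm y ∈ c.source := mem_chart_source _ _
  have h1 : formIn e Θ =ᶠ[nhds y] fun w => (formIn c Θ ((c ∘ e.symm) w)).compContinuousLinearMap
      (fderiv ℝ (c ∘ e.symm) w) := by
    filter_upwards [(isOpen_overlap e c).mem_nhds ⟨hy, hx⟩] with w hw
    exact formIn_eq_comp he (chart_mem_atlas _ _) hw.1 hw.2 Θ
  rw [h1.extDeriv_eq]
  have h2 : DifferentiableAt ℝ (formIn c Θ) ((c ∘ e.symm) y) :=
    ((hΘ c (chart_mem_atlas _ _)).contDiffAt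
      (c.open_target.mem_nhds (c.map_source hx))).differentiableAt (by simp)
  rw [extDeriv_pullback h2 (transition_contDiffAt he (chart_mem_atlas _ _) hy hx)
    (by simp only [minSmoothness_of_isRCLikeNormedField]; exact WithTop.coe_le_coe.2 le_top)]
  rfl

lemma isSmoothForm_dForm {Θ : X → Alt k n} (hΘ : IsSmoothForm Θ) : IsSmoothForm (dForm Θ) := by
  intro e he
  have h1 : ContDiffOn ℝ ∞ (extDeriv (formIn e Θ)) e.target :=
    (ContinuousAlternatingMap.alternatizeUncurryFinCLM ℝ (Cn k) ℝ).contDiff.comp_contDiffOn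
      ((hΘ e he).fderiv_of_isOpen e.open_target (by simp))
  exact h1.congr fun y hy => formIn_dForm he hΘ hy

lemma dForm_eq_zero {Θ : X → Alt k n} {x : X} (hx : x ∉ tsupport Θ) : dForm Θ x = 0 := by
  set c := chartAt (Cn k) x with hc
  have hxc := mem_chart_source (Cn k) x
  have h1 : formIn c Θ =ᶠ[nhds (c x)] fun _ => 0 := by
    have h2 : ∀ᶠ z in nhds x, Θ z = 0 := notMem_tsupport_iff_eventuallyEq.1 hx
    have h3 : Filter.Tendsto c.symm (nhds (c x)) (nhds x) := by
      have := (c.continuousAt_symm (c.map_source hxc)).tendsto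
      rwa [c.left_inv hxc] at this
    filter_upwards [h3.eventually h2] with w hw
    rw [formIn, hw]
    rfl
  rw [dForm, h1.extDeriv_eq, extDeriv_eq_sum]
  simp

lemma support_dForm_subset (Θ : X → Alt k n) : Function.support (dForm Θ) ⊆ tsupport Θ :=
  fun _ hx => by_contra fun h => hx (dForm_eq_zero h)

lemma IsSmoothForm.wedge₂ {τ : X → Alt k 2} {Θ : X → Alt k n} (hτ : IsSmoothForm τ)
    (hΘ : IsSmoothForm Θ) : IsSmoothForm fun x => wedge₂ (τ x) (Θ x) := fun e he =>
  (contDiffOn_wedge₂ (hτ e he) (hΘ e he)).congr fun y _ => formIn_wedge₂ e τ Θ y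

/-! ### Smooth functions -/

/-- Smooth real functions on `X`. -/
def IsSmoothFun (f : X → ℝ) : Prop := ∀ e ∈ atlas (Cn k) X, ContDiffOn ℝ ∞ (f ∘ e.symm) e.target

lemma IsSmoothForm.smul_fun {g : X → ℝ} {Θ : X → Alt k n} (hg : IsSmoothFun (k := k) g)
    (hΘ : IsSmoothForm Θ) : IsSmoothForm fun x => g x • Θ x := fun e he =>
  (hg e he).smul (hΘ e he)

lemma IsSmoothFun.mul {f g : X → ℝ} (hf : IsSmoothFun (k := k) f) (hg : IsSmoothFun (k := k) g) :
    IsSmoothFun (k := k) fun x => f x * g x := fun e he => (hf e he).mul (hg e he)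

lemma isSmoothFun_const (c : ℝ) : IsSmoothFun (k := k) fun _ : X => c :=
  fun _ _ => contDiffOn_const

lemma IsSmoothFun.sub {f g : X → ℝ} (hf : IsSmoothFun (k := k) f) (hg : IsSmoothFun (k := k) g) :
    IsSmoothFun (k := k) fun x => f x - g x := fun e he => (hf e he).sub (hg e he)

lemma IsSmoothFun.sum {ι : Type*} {s : Finset ι} {f : ι → X → ℝ}
    (hf : ∀ i ∈ s, IsSmoothFun (k := k) (f i)) : IsSmoothFun (k := k) fun x => ∑ i ∈ s, f i x :=
  fun e he => ContDiffOn.sum (f := fun i => f i ∘ e.symm) fun i hi => hf i hi e he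

lemma IsSmoothFun.prod {ι : Type*} {s : Finset ι} {f : ι → X → ℝ}
    (hf : ∀ i ∈ s, IsSmoothFun (k := k) (f i)) : IsSmoothFun (k := k) fun x => ∏ i ∈ s, f i x :=
  fun e he => contDiffOn_prod (f := fun i => f i ∘ e.symm) fun i hi => hf i hi e he

lemma IsSmoothFun.continuous {f : X → ℝ} (hf : IsSmoothFun (k := k) f) : Continuous f := by
  rw [continuous_iff_continuousAt]
  intro x
  set c := chartAt (Cn k) x
  have hx := mem_chart_source (Cn k) x
  have h1 : ContinuousAt (f ∘ c.symm) (c x) :=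
    ((hf c (chart_mem_atlas _ _)).continuousOn).continuousAt
      (c.open_target.mem_nhds (c.map_source hx))
  have h2 : ContinuousAt ((f ∘ c.symm) ∘ c) x := h1.comp (c.continuousAt hx)
  refine h2.congr ?_
  filter_upwards [c.open_source.mem_nhds hx] with z hz
  simp only [Function.comp_apply]
  rw [c.left_inv hz]

/-! ### Extension by zero from a chart -/

section Extend

variable [T2Space X]

open Classical in
/-- The form on `X` which is given by `Φ` in the chart `e` and vanishes outside of its domain. -/
def extendForm (e : OpenPartialHomeomorph X (Cn k)) (Φ : Cn k → Alt k n) (x : X) : Alt k n :=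
  if x ∈ e.source then (Φ (e x)).compContinuousLinearMap (frameInv e x) else 0

open Classical in
/-- The function on `X` which is given by `g` in the chart `e` and vanishes outside of its
domain. -/
def extendFun (e : OpenPartialHomeomorph X (Cn k)) (g : Cn k → ℝ) (x : X) : ℝ :=
  if x ∈ e.source then g (e x) else 0

lemma formIn_extendForm (he : e ∈ atlas (Cn k) X) (Φ : Cn k → Alt k n) {y : Cn k}
    (hy : y ∈ e.target) : formIn e (extendForm e Φ) y = Φ y := by
  rw [formIn, extendForm, if_pos (e.map_target hy), comp_comp, frameInv_comp_chartFrame he hy,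
    e.right_inv hy]
  rfl

lemma extendForm_eq_zero {Φ : Cn k → Alt k n} {x : X} (h : x ∈ e.source → Φ (e x) = 0) :
    extendForm e Φ x = 0 := by
  rw [extendForm]
  split_ifs with hx
  · rw [h hx]; rfl
  · rfl

lemma extendFun_eq_zero {g : Cn k → ℝ} {x : X} (h : x ∈ e.source → g (e x) = 0) :
    extendFun e g x = 0 := by
  rw [extendFun]
  split_ifs with hx
  · exact h hx
  · rfl

lemma extendFun_symm {g : Cn k → ℝ} {y : Cn k} (hy : y ∈ e.target) :
    extendFun e g (e.symm y) = g y := by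
  rw [extendFun, if_pos (e.map_target hy), e.right_inv hy]

lemma isCompact_symm_image {K : Set (Cn k)} (hK : IsCompact K) (hKe : K ⊆ e.target) :
    IsCompact (e.symm '' K) := hK.image_of_continuousOn (e.continuousOn_symm.mono hKe)

lemma symm_image_subset {K : Set (Cn k)} (hKe : K ⊆ e.target) : e.symm '' K ⊆ e.source := by
  rintro _ ⟨y, hy, rfl⟩
  exact e.map_target (hKe hy)

lemma tsupport_extendForm {Φ : Cn k → Alt k n} (hc : HasCompactSupport Φ)
    (hs : tsupport Φ ⊆ e.target) : tsupport (extendForm e Φ) ⊆ e.symm '' tsupport Φ := by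
  refine closure_minimal (fun x hx => ?_) (isCompact_symm_image hc hs).isClosed
  by_contra h
  refine hx (extendForm_eq_zero fun hxe => ?_)
  by_contra h0
  exact h ⟨e x, subset_tsupport _ h0, e.left_inv hxe⟩

lemma tsupport_extendFun {g : Cn k → ℝ} (hc : HasCompactSupport g)
    (hs : tsupport g ⊆ e.target) : tsupport (extendFun e g) ⊆ e.symm '' tsupport g := by
  refine closure_minimal (fun x hx => ?_) (isCompact_symm_image hc hs).isClosed
  by_contra h
  refine hx (extendFun_eq_zero fun hxe => ?_)
  by_contra h0
  exact h ⟨e x, subset_tsupport _ h0, e.left_inv hxe⟩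

lemma hasCompactSupport_extendForm {Φ : Cn k → Alt k n} (hc : HasCompactSupport Φ)
    (hs : tsupport Φ ⊆ e.target) : HasCompactSupport (extendForm e Φ) :=
  (isCompact_symm_image hc hs).of_isClosed_subset (isClosed_tsupport _) (tsupport_extendForm hc hs)

lemma hasCompactSupport_extendFun {g : Cn k → ℝ} (hc : HasCompactSupport g)
    (hs : tsupport g ⊆ e.target) : HasCompactSupport (extendFun e g) :=
  (isCompact_symm_image hc hs).of_isClosed_subset (isClosed_tsupport _) (tsupport_extendFun hc hs)

lemma isSmoothForm_extendForm (he : e ∈ atlas (Cn k) X) {Φ : Cn k → Alt k n}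
    (hΦ : ContDiff ℝ ∞ Φ) (hc : HasCompactSupport Φ) (hs : tsupport Φ ⊆ e.target) :
    IsSmoothForm (extendForm e Φ) := by
  intro e' he' y hy
  refine ContDiffAt.contDiffWithinAt ?_
  by_cases h : e'.symm y ∈ e.source
  · have h1 : formIn e' (extendForm e Φ) =ᶠ[nhds y] fun w =>
        (Φ ((e ∘ e'.symm) w)).compContinuousLinearMap (fderiv ℝ (e ∘ e'.symm) w) := by
      filter_upwards [(isOpen_overlap e' e).mem_nhds ⟨hy, h⟩] with w hw
      rw [formIn_eq_comp he' he hw.1 hw.2, formIn_extendForm he _ (e.map_source hw.2)]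
      rfl
    refine ContDiffAt.congr_of_eventuallyEq ?_ h1
    have h2 := transition_contDiffOn he' he
    exact (contDiffOn_comp (hΦ.comp_contDiffOn h2)
      (h2.fderiv_of_isOpen (m := ∞) (isOpen_overlap e' e) (by simp))).contDiffAt
      ((isOpen_overlap e' e).mem_nhds ⟨hy, h⟩)
  · have h1 : e'.symm y ∉ tsupport (extendForm e Φ) := fun h2 =>
      h (symm_image_subset hs (tsupport_extendForm hc hs h2))
    have h2 : ∀ᶠ w in nhds y, extendForm e Φ (e'.symm w) = 0 :=
      (e'.continuousAt_symm hy).tendsto.eventually (notMem_tsupport_iff_eventuallyEq.1 h1)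
    refine (contDiffAt_const (c := (0 : Alt k n))).congr_of_eventuallyEq ?_
    filter_upwards [h2] with w hw
    rw [formIn, hw]
    rfl

lemma isSmoothFun_extendFun (he : e ∈ atlas (Cn k) X) {g : Cn k → ℝ}
    (hg : ContDiff ℝ ∞ g) (hc : HasCompactSupport g) (hs : tsupport g ⊆ e.target) :
    IsSmoothFun (k := k) (extendFun e g) := by
  intro e' he' y hy
  refine ContDiffAt.contDiffWithinAt ?_
  by_cases h : e'.symm y ∈ e.source
  · have h1 : extendFun e g ∘ e'.symm =ᶠ[nhds y] fun w => g ((e ∘ e'.symm) w) := by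
      filter_upwards [(isOpen_overlap e' e).mem_nhds ⟨hy, h⟩] with w hw
      exact if_pos hw.2
    refine ContDiffAt.congr_of_eventuallyEq ?_ h1
    exact (hg.comp_contDiffOn (transition_contDiffOn he' he)).contDiffAt
      ((isOpen_overlap e' e).mem_nhds ⟨hy, h⟩)
  · have h1 : e'.symm y ∉ tsupport (extendFun e g) := fun h2 =>
      h (symm_image_subset hs (tsupport_extendFun hc hs h2))
    have h2 : ∀ᶠ w in nhds y, extendFun e g (e'.symm w) = 0 :=
      (e'.continuousAt_symm hy).tendsto.eventually (notMem_tsupport_iff_eventuallyEq.1 h1)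
    exact (contDiffAt_const (c := (0 : ℝ))).congr_of_eventuallyEq h2

/-- A smooth bump at `x` supported in a given neighbourhood. -/
lemma exists_bump (x : X) {V : Set X} (hV : V ∈ nhds x) :
    ∃ b : X → ℝ, IsSmoothFun (k := k) b ∧ HasCompactSupport b ∧
      tsupport b ⊆ V ∩ (chartAt (Cn k) x).source ∧ (∀ z, b z ∈ Icc (0 : ℝ) 1) ∧
      ∀ᶠ z in nhds x, b z = 1 := by
  set c := chartAt (Cn k) x with hcdef
  have hx := mem_chart_source (Cn k) x
  have hW : c.target ∩ c.symm ⁻¹' V ∈ nhds (c x) := by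
    refine Filter.inter_mem (c.open_target.mem_nhds (c.map_source hx)) ?_
    refine (c.continuousAt_symm (c.map_source hx)).preimage_mem_nhds ?_
    rwa [c.left_inv hx]
  obtain ⟨ε, hε, hball⟩ := Metric.mem_nhds_iff.1 hW
  let g : ContDiffBump (c x) := ⟨ε / 4, ε / 2, by positivity, by linarith⟩
  have hts : tsupport g ⊆ c.target ∩ c.symm ⁻¹' V := by
    rw [g.tsupport_eq]
    exact (Metric.closedBall_subset_ball (by change ε / 2 < ε; linarith)).trans hball
  have hs : tsupport g ⊆ c.target := hts.trans inter_subset_left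
  refine ⟨extendFun c g, isSmoothFun_extendFun (chart_mem_atlas _ _) g.contDiff
    g.hasCompactSupport hs, hasCompactSupport_extendFun g.hasCompactSupport hs, ?_, ?_, ?_⟩
  · refine (tsupport_extendFun g.hasCompactSupport hs).trans ?_
    rintro _ ⟨y, hy, rfl⟩
    exact ⟨(hts hy).2, c.map_target (hs hy)⟩
  · intro z
    rw [extendFun]
    split_ifs
    · exact ⟨g.nonneg, g.le_one⟩
    · simp
  · filter_upwards [c.open_source.mem_nhds hx,
      (c.continuousAt hx).tendsto.eventually g.eventuallyEq_one] with z h1 h2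
    rw [extendFun, if_pos h1]
    exact h2

/-- Finite smooth partitions of unity on a compact set, subordinate to an open neighbourhood and to
the chart domains. -/
lemma exists_partition {K V : Set X} (hK : IsCompact K) (hV : IsOpen V) (hKV : K ⊆ V) :
    ∃ (N : ℕ) (ρ : Fin N → X → ℝ) (c : Fin N → X),
      (∀ i, IsSmoothFun (k := k) (ρ i) ∧ HasCompactSupport (ρ i) ∧
        tsupport (ρ i) ⊆ V ∩ (chartAt (Cn k) (c i)).source ∧ ∀ z, 0 ≤ ρ i z) ∧
      (∀ z, ∑ i, ρ i z ≤ 1) ∧ ∀ z ∈ K, ∑ i, ρ i z = 1 := by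
  choose b h1 h2 h3 h4 h5 using fun x : K =>
    exists_bump (k := k) x.1 (hV.mem_nhds (hKV x.2))
  obtain ⟨t, ht⟩ := hK.elim_nhds_subcover' (fun x hx => {z | b ⟨x, hx⟩ z = 1})
    (fun x hx => h5 ⟨x, hx⟩)
  let N := t.card
  let q : Fin N ≃ t := t.equivFin.symm
  let B : Fin N → X → ℝ := fun i => b (q i)
  have key : ∀ z, ∏ i, (1 - B i z)
      = 1 - ∑ i, B i z * ∏ j with j < i, (1 - B j z) := fun z =>
    Finset.prod_one_sub_ordered Finset.univ fun i => B i z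
  have hB : ∀ i z, 0 ≤ 1 - B i z := fun i z => sub_nonneg.2 (h4 (q i) z).2
  have hsub : ∀ i, Function.support (fun z => B i z * ∏ j with j < i, (1 - B j z))
      ⊆ Function.support (b (q i)) := by
    intro i z hz hz0
    have : B i z = 0 := hz0
    exact hz (by simp [this])
  refine ⟨N, fun i z => B i z * ∏ j with j < i, (1 - B j z), fun i => (q i).1.1,
    fun i => ⟨?_, ?_, ?_, ?_⟩, ?_, ?_⟩
  · exact (h1 (q i)).mul (IsSmoothFun.prod fun j _ => (isSmoothFun_const 1).sub (h1 (q j)))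
  · exact (h2 (q i)).mono (hsub i)
  · exact (closure_mono (hsub i)).trans (h3 (q i))
  · exact fun z => mul_nonneg (h4 (q i) z).1 (Finset.prod_nonneg fun j _ => hB j z)
  · intro z
    have := Finset.prod_nonneg (s := Finset.univ) fun i _ => hB i z
    rw [key z] at this
    linarith
  · intro z hz
    obtain ⟨x, hx, hxz⟩ := mem_iUnion₂.1 (ht hz)
    have h0 : ∏ i, (1 - B i z) = 0 := by
      refine Finset.prod_eq_zero (Finset.mem_univ (q.symm ⟨x, hx⟩)) ?_
      have : B (q.symm ⟨x, hx⟩) z = 1 := by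
        simp only [B, Equiv.apply_symm_apply]
        exact hxz
      rw [this, sub_self]
    rw [key z] at h0
    linarith

/-- Smooth cut-off functions. -/
lemma exists_cutoff {K V : Set X} (hK : IsCompact K) (hV : IsOpen V) (hKV : K ⊆ V) :
    ∃ χ : X → ℝ, IsSmoothFun (k := k) χ ∧ HasCompactSupport χ ∧ tsupport χ ⊆ V ∧
      (∀ z, χ z ∈ Icc (0 : ℝ) 1) ∧ ∀ z ∈ K, χ z = 1 := by
  obtain ⟨N, ρ, c, h1, h2, h3⟩ := exists_partition (k := k) hK hV hKV
  have h4 : Function.support (fun z => ∑ i, ρ i z) ⊆ ⋃ i, tsupport (ρ i) := by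
    intro z hz
    obtain ⟨i, -, hi⟩ := Finset.exists_ne_zero_of_sum_ne_zero hz
    exact mem_iUnion.2 ⟨i, subset_tsupport _ hi⟩
  have h5 : IsCompact (⋃ i, tsupport (ρ i)) := isCompact_iUnion fun i => (h1 i).2.1
  have h6 : tsupport (fun z => ∑ i, ρ i z) ⊆ ⋃ i, tsupport (ρ i) :=
    closure_minimal h4 h5.isClosed
  exact ⟨fun z => ∑ i, ρ i z, IsSmoothFun.sum fun i _ => (h1 i).1,
    h5.of_isClosed_subset (isClosed_tsupport _) h6,
    h6.trans (iUnion_subset fun i => (h1 i).2.2.1.trans inter_subset_left),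
    fun z => ⟨Finset.sum_nonneg fun i _ => (h1 i).2.2.2 z, h2 z⟩, h3⟩

end Extend

end Charts

end

section

variable {k n : ℕ}

/-! ### The volume in charts -/

section Volume

variable {X : Type*} [TopologicalSpace X] [ChartedSpace (Cn k) X]
  {e e' : OpenPartialHomeomorph X (Cn k)}

namespace KahlerForm

variable (Ω : KahlerForm k X)

/-- The coefficient of the volume form `Ω^k` in the chart `e`. -/
def volCoeff (e : OpenPartialHomeomorph X (Cn k)) (y : Cn k) : ℝ := coeff (formIn e (Ω.pow k) y)

lemma formIn_pow (e : OpenPartialHomeomorph X (Cn k)) (p : ℕ) (y : Cn k) :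
    formIn e (Ω.pow p) y = powForm (formIn e Ω.toForm y) p := powForm_comp _ _ _

lemma isSmoothForm_pow (p : ℕ) : IsSmoothForm (Ω.pow p) := fun e he =>
  ((contDiff_powForm p).comp_contDiffOn (Ω.smooth e he)).congr fun y _ => Ω.formIn_pow e p y

lemma volCoeff_contDiffOn (he : e ∈ atlas (Cn k) X) : ContDiffOn ℝ ∞ (Ω.volCoeff e) e.target :=
  (coeffL k (2 * k)).contDiff.comp_contDiffOn (Ω.isSmoothForm_pow k e he)

section

variable [IsManifold 𝓘(ℂ, Cn k) ω X]

lemma det_chartFrame_pos (he : e ∈ atlas (Cn k) X) {y : Cn k} (hy : y ∈ e.target) :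
    0 < LinearMap.det (chartFrame e y).toLinearMap := by
  refine lt_of_le_of_ne (det_nonneg_of_comm (chartFrame_comm he hy)) fun h => ?_
  have h1 := congrArg (fun A : Cn k →L[ℝ] Cn k => LinearMap.det A.toLinearMap)
    (frameInv_comp_chartFrame he hy)
  simp only [ContinuousLinearMap.toLinearMap_comp, LinearMap.det_comp, ← h, mul_zero] at h1
  simp at h1

lemma formIn_pos (he : e ∈ atlas (Cn k) X) {y : Cn k} (hy : y ∈ e.target) {v : Cn k}
    (hv : v ≠ 0) : 0 < formIn e Ω.toForm y ![v, Complex.I • v] := by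
  set A := chartFrame e y with hA
  have h1 : A (Complex.I • v) = Complex.I • A v := by
    have := DFunLike.congr_fun (chartFrame_comm he hy) v
    simpa [mulC_apply] using this
  have h2 : A v ≠ 0 := by
    intro h
    have := DFunLike.congr_fun (frameInv_comp_chartFrame he hy) v
    rw [ContinuousLinearMap.comp_apply, ← hA, h, map_zero] at this
    exact hv this.symm
  have h3 : (A ∘ ![v, Complex.I • v]) = ![A v, Complex.I • A v] := by
    ext i : 1
    fin_cases i
    · rfl
    · exact h1
  change 0 < Ω.toForm (e.symm y) (A ∘ ![v, Complex.I • v])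
  rw [h3]
  exact Ω.pos _ _ h2

lemma isDiagonal_formIn (he : e ∈ atlas (Cn k) X) {y : Cn k} (hy : y ∈ e.target) :
    IsDiagonal (formIn e Ω.toForm y) :=
  (Ω.diagonal _).comp (chartFrame_comm he hy)

lemma volCoeff_pos (he : e ∈ atlas (Cn k) X) {y : Cn k} (hy : y ∈ e.target) :
    0 < Ω.volCoeff e y := by
  rw [volCoeff, formIn_pow]
  exact coeff_powForm_pos fun v hv => Ω.formIn_pos he hy hv

lemma coeff_pow_pos (x : X) : 0 < coeff (Ω.pow k x) := coeff_powForm_pos (Ω.pos x)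

end

variable [MeasurableSpace X]

/-- The measure given by the volume form in the domain of the chart `e`. -/
def chartVol (e : OpenPartialHomeomorph X (Cn k)) : Measure X :=
  ((volume.restrict e.target).withDensity fun y => ENNReal.ofReal (Ω.volCoeff e y)).map e.symm

variable [BorelSpace X]

lemma measurableSet_preimage_symm (e : OpenPartialHomeomorph X (Cn k)) {B : Set X}
    (hB : MeasurableSet B) : MeasurableSet (e.target ∩ e.symm ⁻¹' B) := by
  have h1 : Measurable (e.target.domRestrict e.symm) := e.continuousOn_symm.domRestrict.measurable
  have h2 := e.open_target.measurableSet.subtype_image (h1 hB)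
  convert h2 using 1
  ext y
  simp [Set.domRestrict, and_comm]

lemma aemeasurable_symm (e : OpenPartialHomeomorph X (Cn k)) :
    AEMeasurable e.symm (volume.restrict e.target) :=
  e.continuousOn_symm.aemeasurable e.open_target.measurableSet

lemma aemeasurable_symm_withDensity (e : OpenPartialHomeomorph X (Cn k)) :
    AEMeasurable e.symm ((volume.restrict e.target).withDensity
      fun y => ENNReal.ofReal (Ω.volCoeff e y)) :=
  (aemeasurable_symm e).mono_ac (withDensity_absolutelyContinuous _ _)

lemma chartVol_apply (e : OpenPartialHomeomorph X (Cn k)) {B : Set X} (hB : MeasurableSet B) :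
    Ω.chartVol e B = ∫⁻ y in e.target ∩ e.symm ⁻¹' B, ENNReal.ofReal (Ω.volCoeff e y) := by
  rw [chartVol, Measure.map_apply_of_aemeasurable (Ω.aemeasurable_symm_withDensity e) hB, withDensity_apply',
    Measure.restrict_restrict' e.open_target.measurableSet, inter_comm]

lemma chartVol_inter (e : OpenPartialHomeomorph X (Cn k)) {B : Set X} (hB : MeasurableSet B) :
    Ω.chartVol e B = Ω.chartVol e (B ∩ e.source) := by
  rw [chartVol_apply _ _ hB, chartVol_apply _ _ (hB.inter e.open_source.measurableSet)]
  congr 2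
  ext y
  simp only [mem_inter_iff, mem_preimage]
  exact ⟨fun h => ⟨h.1, h.2, e.map_target h.1⟩, fun h => ⟨h.1, h.2.1⟩⟩

variable [IsManifold 𝓘(ℂ, Cn k) ω X]

lemma chartVol_eq (he : e ∈ atlas (Cn k) X) (he' : e' ∈ atlas (Cn k) X) {B : Set X}
    (hB : MeasurableSet B) (h : B ⊆ e.source) (h' : B ⊆ e'.source) :
    Ω.chartVol e B = Ω.chartVol e' B := by
  rw [chartVol_apply _ _ hB, chartVol_apply _ _ hB]
  have h1 : e'.target ∩ e'.symm ⁻¹' B = (e' ∘ e.symm) '' (e.target ∩ e.symm ⁻¹' B) := by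
    ext y
    constructor
    · rintro ⟨hy, hyB⟩
      refine ⟨e (e'.symm y), ⟨e.map_source (h hyB), ?_⟩, ?_⟩
      · rw [mem_preimage, e.left_inv (h hyB)]; exact hyB
      · rw [Function.comp_apply, e.left_inv (h hyB), e'.right_inv hy]
    · rintro ⟨w, ⟨hw, hwB⟩, rfl⟩
      refine ⟨e'.map_source (h' hwB), ?_⟩
      rw [mem_preimage, Function.comp_apply, e'.left_inv (h' hwB)]
      exact hwB
  rw [h1, lintegral_image_eq_lintegral_abs_det_fderiv_mul volume
    (measurableSet_preimage_symm e hB) (f' := fun y => fderiv ℝ (e' ∘ e.symm) y)]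
  · refine setLIntegral_congr_fun (measurableSet_preimage_symm e hB) fun y hy => ?_
    have hd := det_nonneg_of_comm (fderiv_transition_comm he he' hy.1 (h' hy.2))
    rw [← ENNReal.ofReal_mul (abs_nonneg _)]
    congr 1
    rw [volCoeff, formIn_eq_comp he he' hy.1 (h' hy.2), alt_top_apply rfl, volCoeff,
      ContinuousLinearMap.det, abs_of_nonneg hd]
    rfl
  · intro y hy
    exact (transition_differentiableAt he he' hy.1 (h' hy.2)).hasFDerivAt.hasFDerivWithinAt
  · intro y hy w hw hyw
    have h2 := e'.injOn (h' hy.2) (h' hw.2) hyw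
    exact e.symm.injOn hy.1 hw.1 h2

variable [LindelofSpace X]

lemma vol_restrict_source (he : e ∈ atlas (Cn k) X) :
    Ω.vol.restrict e.source = Ω.chartVol e := by
  obtain ⟨t, htc, ht⟩ := countable_cover_nhds fun x : X => chart_source_mem_nhds (Cn k) x
  have : Countable t := htc.to_subtype
  rcases isEmpty_or_nonempty t with h0 | h0
  · have hX : IsEmpty X := by
      refine ⟨fun x => ?_⟩
      have hx : x ∈ ⋃ x ∈ t, (chartAt (Cn k) x).source := by rw [ht]; trivial
      obtain ⟨z, hz, -⟩ := mem_iUnion₂.1 hx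
      exact h0.elim ⟨z, hz⟩
    rw [Measure.eq_zero_of_isEmpty (Ω.vol.restrict _), Measure.eq_zero_of_isEmpty (Ω.chartVol e)]
  obtain ⟨q, hq⟩ := exists_surjective_nat t
  set c : ℕ → OpenPartialHomeomorph X (Cn k) := fun i => chartAt (Cn k) (q i).1 with hc
  have hca : ∀ i, c i ∈ atlas (Cn k) X := fun i => chart_mem_atlas _ _
  set A : ℕ → Set X := disjointed fun i => (c i).source with hA
  have hAm : ∀ i, MeasurableSet (A i) :=
    MeasurableSet.disjointed fun i => (c i).open_source.measurableSet
  have hAs : ∀ i, A i ⊆ (c i).source := fun i => disjointed_subset _ i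
  have hAd : Pairwise (Function.onFun Disjoint A) := disjoint_disjointed _
  have hAu : ⋃ i, A i = univ := by
    rw [iUnion_disjointed, eq_univ_iff_forall]
    intro x
    have hx : x ∈ ⋃ x ∈ t, (chartAt (Cn k) x).source := by rw [ht]; trivial
    obtain ⟨z, hz, hxz⟩ := mem_iUnion₂.1 hx
    obtain ⟨i, hi⟩ := hq ⟨z, hz⟩
    exact mem_iUnion.2 ⟨i, by simpa [hc, hi] using hxz⟩
  set ν : Measure X := Measure.sum fun i => (Ω.chartVol (c i)).restrict (A i) with hν
  have hsum : ∀ (μ : Measure X) {B : Set X}, MeasurableSet B → μ B = ∑' i, μ (B ∩ A i) := by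
    intro μ B hB
    rw [← measure_iUnion (fun i j hij => ((hAd hij).inter_left' B).inter_right' B)
      (fun i => hB.inter (hAm i)), ← inter_iUnion, hAu, inter_univ]
  have hνB : ∀ {B : Set X}, MeasurableSet B → ν B = ∑' i, Ω.chartVol (c i) (B ∩ A i) := by
    intro B hB
    rw [hν, Measure.sum_apply _ hB]
    simp only [Measure.restrict_apply hB]
  have key : ∀ e ∈ atlas (Cn k) X, ∀ B : Set X, MeasurableSet B → B ⊆ e.source →
      ν B = Ω.chartVol e B := by
    intro e he B hB hBe
    rw [hνB hB, hsum _ hB]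
    exact tsum_congr fun i => Ω.chartVol_eq (hca i) he (hB.inter (hAm i))
      (inter_subset_right.trans (hAs i)) (inter_subset_left.trans hBe)
  have hle : Ω.vol ≤ ν := by
    refine iSup_le fun x => ?_
    refine Measure.le_iff.2 fun B hB => ?_
    change Ω.chartVol (chartAt (Cn k) x) B ≤ _
    rw [chartVol_inter _ _ hB, ← key _ (chart_mem_atlas _ x) _
      (hB.inter (chartAt (Cn k) x).open_source.measurableSet) inter_subset_right]
    exact measure_mono inter_subset_left
  have hge : ν ≤ Ω.vol := by
    refine Measure.le_iff.2 fun B hB => ?_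
    rw [hνB hB, hsum Ω.vol hB]
    refine ENNReal.tsum_le_tsum fun i => ?_
    exact (le_iSup (fun x : X => Ω.chartVol (chartAt (Cn k) x)) (q i).1) _
  have heq : Ω.vol = ν := le_antisymm hle hge
  refine Measure.ext fun B hB => ?_
  rw [Measure.restrict_apply hB, chartVol_inter _ _ hB, heq]
  exact key e he _ (hB.inter e.open_source.measurableSet) inter_subset_right

lemma aemeasurable_chart (e : OpenPartialHomeomorph X (Cn k)) (μ : Measure X) :
    AEMeasurable e (μ.restrict e.source) :=
  e.continuousOn.aemeasurable e.open_source.measurableSet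

lemma ae_volCoeff_pos (he : e ∈ atlas (Cn k) X) :
    ∀ᵐ y ∂(volume.restrict e.target), 0 < Ω.volCoeff e y :=
  (ae_restrict_iff' e.open_target.measurableSet).2 (.of_forall fun _ hy => Ω.volCoeff_pos he hy)

lemma aemeasurable_volCoeff (he : e ∈ atlas (Cn k) X) :
    AEMeasurable (fun y => ENNReal.ofReal (Ω.volCoeff e y)) (volume.restrict e.target) :=
  ((Ω.volCoeff_contDiffOn he).continuousOn.aemeasurable e.open_target.measurableSet).ennreal_ofReal

lemma map_chart_vol (he : e ∈ atlas (Cn k) X) :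
    (Ω.vol.restrict e.source).map e = (volume.restrict e.target).withDensity
      fun y => ENNReal.ofReal (Ω.volCoeff e y) := by
  have h0 := Ω.vol_restrict_source he
  have h1 : AEMeasurable e (Ω.chartVol e) := h0 ▸ aemeasurable_chart e Ω.vol
  rw [h0, chartVol, AEMeasurable.map_map_of_aemeasurable h1 (Ω.aemeasurable_symm_withDensity e)]
  conv_rhs => rw [← Measure.map_id (μ := (volume.restrict e.target).withDensity
      fun y => ENNReal.ofReal (Ω.volCoeff e y))]
  refine Measure.map_congr ?_
  refine (withDensity_absolutelyContinuous _ _).ae_le ?_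
  exact (ae_restrict_iff' e.open_target.measurableSet).2 (.of_forall fun y hy => e.right_inv hy)

/-- A property holds almost everywhere in a chart domain when it holds at almost every point of the
image of the chart. -/
lemma ae_restrict_source_iff (he : e ∈ atlas (Cn k) X) {P : X → Prop} :
    (∀ᵐ x ∂(Ω.vol.restrict e.source), P x) ↔ ∀ᵐ y ∂(volume.restrict e.target), P (e.symm y) := by
  have hac : volume.restrict e.target ≪ (volume.restrict e.target).withDensity
      fun y => ENNReal.ofReal (Ω.volCoeff e y) := by
    refine withDensity_absolutelyContinuous' (Ω.aemeasurable_volCoeff he) ?_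
    filter_upwards [Ω.ae_volCoeff_pos he] with y hy
    simpa using hy
  constructor
  · intro h
    rw [Ω.vol_restrict_source he, chartVol] at h
    exact hac.ae_le (ae_of_ae_map (Ω.aemeasurable_symm_withDensity e) h)
  · intro h
    have h1 := (withDensity_absolutelyContinuous _
      (fun y => ENNReal.ofReal (Ω.volCoeff e y))).ae_le h
    rw [← Ω.map_chart_vol he] at h1
    have h2 := ae_of_ae_map (aemeasurable_chart e Ω.vol) h1
    filter_upwards [h2, ae_restrict_mem e.open_source.measurableSet] with x hx hxe
    rwa [e.left_inv hxe] at hx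

lemma aestronglyMeasurable_source_iff (he : e ∈ atlas (Cn k) X) {E : Type*}
    [TopologicalSpace E] {F : X → E} :
    AEStronglyMeasurable F (Ω.vol.restrict e.source) ↔
      AEStronglyMeasurable (F ∘ e.symm) (volume.restrict e.target) := by
  have hac : volume.restrict e.target ≪ (volume.restrict e.target).withDensity
      fun y => ENNReal.ofReal (Ω.volCoeff e y) := by
    refine withDensity_absolutelyContinuous' (Ω.aemeasurable_volCoeff he) ?_
    filter_upwards [Ω.ae_volCoeff_pos he] with y hy
    simpa using hy
  constructor
  · intro h
    rw [Ω.vol_restrict_source he, chartVol] at h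
    exact (h.comp_aemeasurable (Ω.aemeasurable_symm_withDensity e)).mono_ac hac
  · intro h
    have h1 := h.mono_ac (withDensity_absolutelyContinuous _
      (fun y => ENNReal.ofReal (Ω.volCoeff e y)))
    rw [← Ω.map_chart_vol he] at h1
    have h2 := h1.comp_aemeasurable (aemeasurable_chart e Ω.vol)
    refine h2.congr ?_
    filter_upwards [ae_restrict_mem e.open_source.measurableSet] with x hxe
    simp only [Function.comp_apply]
    rw [e.left_inv hxe]

lemma integrableOn_source_iff (he : e ∈ atlas (Cn k) X) {F : X → ℝ} :
    IntegrableOn F e.source Ω.vol ↔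
      IntegrableOn (fun y => Ω.volCoeff e y * F (e.symm y)) e.target := by
  have h2 : IntegrableOn F e.source Ω.vol ↔ Integrable (F ∘ e.symm)
      ((volume.restrict e.target).withDensity fun y => ENNReal.ofReal (Ω.volCoeff e y)) := by
    rw [IntegrableOn]
    constructor
    · intro h
      rw [Ω.vol_restrict_source he, chartVol] at h
      exact (integrable_map_measure h.1 (Ω.aemeasurable_symm_withDensity e)).1 h
    · intro h
      rw [← Ω.map_chart_vol he] at h
      have h3 := (integrable_map_measure h.1 (aemeasurable_chart e Ω.vol)).1 h
      refine h3.congr ?_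
      filter_upwards [ae_restrict_mem e.open_source.measurableSet] with x hxe
      simp only [Function.comp_apply]
      rw [e.left_inv hxe]
  rw [h2, integrable_withDensity_iff_integrable_smul₀' (Ω.aemeasurable_volCoeff he)
    (.of_forall fun _ => ENNReal.ofReal_lt_top)]
  refine integrable_congr ?_
  filter_upwards [Ω.ae_volCoeff_pos he] with y hy
  rw [ENNReal.toReal_ofReal hy.le]
  rfl

lemma setIntegral_source (he : e ∈ atlas (Cn k) X) (F : X → ℝ) :
    ∫ x in e.source, F x ∂Ω.vol = ∫ y in e.target, Ω.volCoeff e y * F (e.symm y) := by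
  by_cases hF : AEStronglyMeasurable F (Ω.vol.restrict e.source)
  · have h0 := Ω.vol_restrict_source he
    have h1 : ∫ x in e.source, F x ∂Ω.vol = ∫ x, F x ∂Ω.chartVol e := by rw [h0]
    rw [h0] at hF
    rw [h1, chartVol, integral_map (Ω.aemeasurable_symm_withDensity e) hF,
      integral_withDensity_eq_integral_toReal_smul₀ (Ω.aemeasurable_volCoeff he)
        (.of_forall fun _ => ENNReal.ofReal_lt_top)]
    refine integral_congr_ae ?_
    filter_upwards [Ω.ae_volCoeff_pos he] with y hy
    rw [ENNReal.toReal_ofReal hy.le]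
    rfl
  · rw [integral_undef fun h => hF h.1, integral_undef fun h => hF ?_]
    exact ((Ω.integrableOn_source_iff he).2 h).1

/-! ### Integration of forms of the top degree -/

/-- The density of a form of the top degree with respect to the volume form. -/
def dens (Ψ : X → Alt k n) (x : X) : ℝ := coeff (Ψ x) / coeff (Ω.pow k x)

lemma volCoeff_mul_dens (hn : n = 2 * k) (he : e ∈ atlas (Cn k) X) (Ψ : X → Alt k n) {y : Cn k}
    (hy : y ∈ e.target) : Ω.volCoeff e y * Ω.dens Ψ (e.symm y) = coeff (formIn e Ψ y) := by
  have h1 := det_chartFrame_pos he hy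
  have h2 := Ω.coeff_pow_pos (e.symm y)
  rw [volCoeff, dens, formIn, formIn, alt_top_apply rfl, alt_top_apply hn]
  field_simp

lemma setIntegral_dens (hn : n = 2 * k) (he : e ∈ atlas (Cn k) X) (Ψ : X → Alt k n) :
    ∫ x in e.source, Ω.dens Ψ x ∂Ω.vol = ∫ y in e.target, coeff (formIn e Ψ y) := by
  rw [Ω.setIntegral_source he]
  exact setIntegral_congr_fun e.open_target.measurableSet fun y hy =>
    Ω.volCoeff_mul_dens hn he Ψ hy

lemma integrableOn_dens (hn : n = 2 * k) (he : e ∈ atlas (Cn k) X) (Ψ : X → Alt k n) :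
    IntegrableOn (Ω.dens Ψ) e.source Ω.vol ↔
      IntegrableOn (fun y => coeff (formIn e Ψ y)) e.target := by
  rw [Ω.integrableOn_source_iff he]
  exact integrableOn_congr_fun (fun y hy => Ω.volCoeff_mul_dens hn he Ψ hy)
    e.open_target.measurableSet

end KahlerForm

end Volume

end

section

variable {k n : ℕ}

/-! ### Stokes' theorem -/

lemma contDiff_of_tsupport_subset {F : Type*} [NormedAddCommGroup F] [NormedSpace ℝ F]
    {r : WithTop ℕ∞} {f : Cn k → F} {s : Set (Cn k)} (hs : IsOpen s) (hf : ContDiffOn ℝ r f s)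
    (h : tsupport f ⊆ s) : ContDiff ℝ r f := by
  rw [contDiff_iff_contDiffAt]
  intro y
  by_cases hy : y ∈ s
  · exact hf.contDiffAt (hs.mem_nhds hy)
  · exact contDiffAt_const.congr_of_eventuallyEq
      (notMem_tsupport_iff_eventuallyEq.1 fun hy' => hy (h hy'))

section Stokes

variable {X : Type*} [TopologicalSpace X] [ChartedSpace (Cn k) X]
  {e : OpenPartialHomeomorph X (Cn k)}

/-- The expression of a form in the chart `e`, extended by zero to `ℂᵏ`. -/
def localForm (e : OpenPartialHomeomorph X (Cn k)) (Ψ : X → Alt k n) : Cn k → Alt k n :=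
  e.target.indicator (formIn e Ψ)

lemma localForm_eq {Ψ : X → Alt k n} {y : Cn k} (hy : y ∈ e.target) :
    localForm e Ψ y = formIn e Ψ y := indicator_of_mem hy _

lemma localForm_eventuallyEq {Ψ : X → Alt k n} {y : Cn k} (hy : y ∈ e.target) :
    localForm e Ψ =ᶠ[nhds y] formIn e Ψ := by
  filter_upwards [e.open_target.mem_nhds hy] with w hw using localForm_eq hw

lemma isCompact_image {K : Set X} (hK : IsCompact K) (hKe : K ⊆ e.source) : IsCompact (e '' K) :=
  hK.image_of_continuousOn (e.continuousOn.mono hKe)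

lemma image_subset_target {K : Set X} (hKe : K ⊆ e.source) : e '' K ⊆ e.target := by
  rintro _ ⟨y, hy, rfl⟩
  exact e.map_source (hKe hy)

lemma formIn_eq_zero {Ψ : X → Alt k n} {y : Cn k} (h : Ψ (e.symm y) = 0) : formIn e Ψ y = 0 := by
  rw [formIn, h]; rfl

lemma support_localForm_subset {K : Set X} {Ψ : X → Alt k n} (h : Function.support Ψ ⊆ K) :
    Function.support (localForm e Ψ) ⊆ e '' K := by
  intro y hy
  have h1 : y ∈ e.target := by
    by_contra h0
    exact hy (indicator_of_notMem h0 _)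
  refine ⟨e.symm y, h fun h0 => hy ?_, e.right_inv h1⟩
  rw [localForm_eq h1, formIn_eq_zero h0]

lemma tsupport_localForm_subset {K : Set X} (hK : IsCompact K) (hKe : K ⊆ e.source)
    {Ψ : X → Alt k n} (h : Function.support Ψ ⊆ K) : tsupport (localForm e Ψ) ⊆ e '' K :=
  closure_minimal (support_localForm_subset h) (isCompact_image hK hKe).isClosed

lemma hasCompactSupport_localForm {Ψ : X → Alt k n} (hc : HasCompactSupport Ψ)
    (hs : tsupport Ψ ⊆ e.source) : HasCompactSupport (localForm e Ψ) :=
  (isCompact_image hc hs).of_isClosed_subset (isClosed_tsupport _)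
    (tsupport_localForm_subset hc hs (subset_tsupport _))

lemma contDiff_localForm (he : e ∈ atlas (Cn k) X) {Ψ : X → Alt k n} (hΨ : IsSmoothForm Ψ)
    (hc : HasCompactSupport Ψ) (hs : tsupport Ψ ⊆ e.source) : ContDiff ℝ ∞ (localForm e Ψ) :=
  contDiff_of_tsupport_subset e.open_target ((hΨ e he).congr fun _ hy => localForm_eq hy)
    ((tsupport_localForm_subset hc hs (subset_tsupport _)).trans (image_subset_target hs))

variable [T2Space X] [IsManifold 𝓘(ℂ, Cn k) ω X]

/-- A compactly supported form is a finite sum of nonnegative multiples of it which are supported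
in chart domains. -/
lemma exists_decomposition {Θ : X → Alt k n} (hΘ : IsSmoothForm Θ) (hc : HasCompactSupport Θ) :
    ∃ (N : ℕ) (ρ : Fin N → X → ℝ) (c : Fin N → X),
      (∀ i, IsSmoothForm (fun x => ρ i x • Θ x) ∧ HasCompactSupport (fun x => ρ i x • Θ x) ∧
        tsupport (fun x => ρ i x • Θ x) ⊆ (chartAt (Cn k) (c i)).source ∧
        IsSmoothFun (k := k) (ρ i) ∧ ∀ z, 0 ≤ ρ i z) ∧
      Θ = ∑ i, fun x => ρ i x • Θ x := by
  obtain ⟨N, ρ, c, h1, h2, h3⟩ := exists_partition (k := k) hc isOpen_univ (subset_univ _)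
  refine ⟨N, ρ, c, fun i => ⟨hΘ.smul_fun (h1 i).1, hc.mono ?_, ?_, (h1 i).1, (h1 i).2.2.2⟩, ?_⟩
  · exact fun x hx h0 => hx (by simp [show Θ x = 0 from h0])
  · refine (closure_mono ?_).trans ((h1 i).2.2.1.trans inter_subset_right)
    exact fun x hx h0 => hx (by simp [show ρ i x = 0 from h0])
  · ext1 x
    rw [Finset.sum_apply, ← Finset.sum_smul]
    by_cases hx : x ∈ tsupport Θ
    · rw [h3 x hx, one_smul]
    · rw [image_eq_zero_of_notMem_tsupport hx, smul_zero]

lemma dForm_add {Θ Θ' : X → Alt k n} (h : IsSmoothForm Θ) (h' : IsSmoothForm Θ') :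
    dForm (Θ + Θ') = dForm Θ + dForm Θ' := by
  ext1 x
  have hd : ∀ {Ψ : X → Alt k n}, IsSmoothForm Ψ →
      DifferentiableAt ℝ (formIn (chartAt (Cn k) x) Ψ) (chartAt (Cn k) x x) := fun hΨ =>
    ((hΨ _ (chart_mem_atlas _ x)).contDiffAt ((chartAt (Cn k) x).open_target.mem_nhds
      ((chartAt (Cn k) x).map_source (mem_chart_source _ x)))).differentiableAt (by simp)
  rw [Pi.add_apply, dForm, formIn_add, extDeriv_add (hd h) (hd h')]
  rfl

lemma dForm_zero : dForm (0 : X → Alt k n) = 0 := by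
  ext1 x
  refine dForm_eq_zero ?_
  simp [tsupport]

lemma isSmoothForm_zero : IsSmoothForm (0 : X → Alt k n) := fun e _ => by
  rw [formIn_zero]; exact contDiffOn_const

lemma isSmoothForm_sum {ι : Type*} (s : Finset ι) {Θ : ι → X → Alt k n}
    (h : ∀ i ∈ s, IsSmoothForm (Θ i)) : IsSmoothForm (∑ i ∈ s, Θ i) :=
  Finset.sum_induction _ IsSmoothForm
    (fun a b ha hb e he => by rw [formIn_add]; exact (ha e he).add (hb e he)) isSmoothForm_zero h

lemma dForm_sum {ι : Type*} (s : Finset ι) {Θ : ι → X → Alt k n}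
    (h : ∀ i ∈ s, IsSmoothForm (Θ i)) : dForm (∑ i ∈ s, Θ i) = ∑ i ∈ s, dForm (Θ i) := by
  classical
  induction s using Finset.induction_on with
  | empty => simpa using dForm_zero
  | insert i s hi ih =>
    rw [Finset.sum_insert hi, Finset.sum_insert hi, dForm_add (h i (by simp))
      (isSmoothForm_sum s fun j hj => h j (by simp [hj])), ih fun j hj => h j (by simp [hj])]

/-- The wedge product with a closed `2`-form commutes with the exterior derivative. -/
lemma dForm_wedge₂ {τ : X → Alt k 2} {Θ : X → Alt k n} (hτ : IsSmoothForm τ)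
    (h0 : ∀ x, dForm τ x = 0) (hΘ : IsSmoothForm Θ) :
    dForm (fun x => wedge₂ (τ x) (Θ x)) = fun x => wedge₂ (τ x) (dForm Θ x) := by
  ext1 x
  set c := chartAt (Cn k) x with hc
  have hd : ∀ {m : ℕ} {Ψ : X → Alt k m}, IsSmoothForm Ψ →
      DifferentiableAt ℝ (formIn c Ψ) (c x) := fun hΨ =>
    ((hΨ _ (chart_mem_atlas _ x)).contDiffAt (c.open_target.mem_nhds
      (c.map_source (mem_chart_source _ x)))).differentiableAt (by simp)
  have h1 : formIn c (fun x => wedge₂ (τ x) (Θ x))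
      = fun y => wedge₂ (formIn c τ y) (formIn c Θ y) := funext fun y => formIn_wedge₂ c τ Θ y
  rw [dForm, ← hc, h1, extDeriv_wedge₂_of_closed (hd hτ) (hd hΘ) (h0 x), formIn_chartAt]
  rfl

variable [MeasurableSpace X] [BorelSpace X] [LindelofSpace X] (Ω : KahlerForm k X)

namespace KahlerForm

lemma dens_eq_zero {Ψ : X → Alt k n} {x : X} (h : Ψ x = 0) : Ω.dens Ψ x = 0 := by
  rw [dens, h]; exact zero_div _

lemma integral_dens (hn : n = 2 * k) (he : e ∈ atlas (Cn k) X) {Ψ : X → Alt k n}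
    (h : Function.support Ψ ⊆ e.source) :
    ∫ x, Ω.dens Ψ x ∂Ω.vol = ∫ y in e.target, coeff (formIn e Ψ y) := by
  rw [← Ω.setIntegral_dens hn he]
  refine (setIntegral_eq_integral_of_forall_compl_eq_zero fun x hx => Ω.dens_eq_zero ?_).symm
  by_contra h0
  exact hx (h h0)

lemma integrable_dens_iff (hn : n = 2 * k) (he : e ∈ atlas (Cn k) X) {Ψ : X → Alt k n}
    (h : Function.support Ψ ⊆ e.source) :
    Integrable (Ω.dens Ψ) Ω.vol ↔ IntegrableOn (fun y => coeff (formIn e Ψ y)) e.target := by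
  rw [← Ω.integrableOn_dens hn he]
  refine (integrableOn_iff_integrable_of_support_subset fun x hx => h fun h0 => hx ?_).symm
  exact Ω.dens_eq_zero h0

lemma dens_sum {ι : Type*} (s : Finset ι) (Ψ : ι → X → Alt k n) (x : X) :
    Ω.dens (∑ i ∈ s, Ψ i) x = ∑ i ∈ s, Ω.dens (Ψ i) x := by
  simp only [dens, Finset.sum_apply, coeff_sum, Finset.sum_div]

lemma integrableOn_coeff_formIn (he : e ∈ atlas (Cn k) X) {Ψ : X → Alt k n}
    (hΨ : IsSmoothForm Ψ) (hc : HasCompactSupport Ψ) (hs : tsupport Ψ ⊆ e.source) :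
    IntegrableOn (fun y => coeff (formIn e Ψ y)) e.target := by
  have h1 : Integrable (fun y => coeff (localForm e Ψ y)) :=
    ((coeffL k n).continuous.comp (contDiff_localForm he hΨ hc hs).continuous).integrable_of_hasCompactSupport
      ((hasCompactSupport_localForm hc hs).comp_left (g := coeffL k n) (map_zero _))
  refine h1.integrableOn.congr_fun (fun y hy => ?_) e.open_target.measurableSet
  simp only [localForm_eq hy]

lemma integrable_dens (hn : n = 2 * k) {Ψ : X → Alt k n} (hΨ : IsSmoothForm Ψ)
    (hc : HasCompactSupport Ψ) : Integrable (Ω.dens Ψ) Ω.vol := by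
  obtain ⟨N, ρ, c, h1, h2⟩ := exists_decomposition hΨ hc
  rw [h2]
  have h3 : Ω.dens (∑ i, fun x => ρ i x • Ψ x)
      = fun x => ∑ i, Ω.dens (fun x => ρ i x • Ψ x) x := funext fun x => Ω.dens_sum _ _ x
  rw [h3]
  refine integrable_finsetSum _ fun i _ => ?_
  obtain ⟨a1, a2, a3, -⟩ := h1 i
  exact (Ω.integrable_dens_iff hn (chart_mem_atlas _ (c i)) ((subset_tsupport _).trans a3)).2
    (integrableOn_coeff_formIn (chart_mem_atlas _ (c i)) a1 a2 a3)

/-- Stokes' theorem for forms supported in a chart domain. -/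
lemma integral_dens_dForm_of_subset (hn : n + 1 = 2 * k) (he : e ∈ atlas (Cn k) X)
    {Ψ : X → Alt k n} (hΨ : IsSmoothForm Ψ) (hc : HasCompactSupport Ψ)
    (hs : tsupport Ψ ⊆ e.source) : ∫ x, Ω.dens (dForm Ψ) x ∂Ω.vol = 0 := by
  rw [Ω.integral_dens hn he ((support_dForm_subset Ψ).trans hs)]
  have h1 : ∫ y in e.target, coeff (formIn e (dForm Ψ) y)
      = ∫ y in e.target, coeff (extDeriv (localForm e Ψ) y) := by
    refine setIntegral_congr_fun e.open_target.measurableSet fun y hy => ?_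
    simp only [formIn_dForm he hΨ hy, (localForm_eventuallyEq (Ψ := Ψ) hy).extDeriv_eq]
  rw [h1, setIntegral_eq_integral_of_forall_compl_eq_zero]
  · exact integral_coeff_extDeriv ((contDiff_localForm he hΨ hc hs).of_le (by simp))
      (hasCompactSupport_localForm hc hs)
  · intro y hy
    have h2 : y ∉ tsupport (localForm e Ψ) := fun h3 => hy
      (image_subset_target hs (tsupport_localForm_subset hc hs (subset_tsupport _) h3))
    have h3 : localForm e Ψ =ᶠ[nhds y] fun _ => 0 := notMem_tsupport_iff_eventuallyEq.1 h2
    rw [h3.extDeriv_eq, extDeriv_eq_sum]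
    simp [coeff]

/-- Stokes' theorem. -/
lemma integral_dens_dForm (hn : n + 1 = 2 * k) {Ψ : X → Alt k n} (hΨ : IsSmoothForm Ψ)
    (hc : HasCompactSupport Ψ) : ∫ x, Ω.dens (dForm Ψ) x ∂Ω.vol = 0 := by
  obtain ⟨N, ρ, c, h1, h2⟩ := exists_decomposition hΨ hc
  rw [h2, dForm_sum _ fun i _ => (h1 i).1]
  simp only [Ω.dens_sum]
  rw [integral_finsetSum]
  · refine Finset.sum_eq_zero fun i _ => ?_
    obtain ⟨a1, a2, a3, -⟩ := h1 i
    exact Ω.integral_dens_dForm_of_subset hn (chart_mem_atlas _ (c i)) a1 a2 a3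
  · intro i _
    obtain ⟨a1, a2, a3, -⟩ := h1 i
    exact Ω.integrable_dens hn (isSmoothForm_dForm a1) (a2.mono' (support_dForm_subset _))

end KahlerForm

end Stokes

end

section

variable {k n : ℕ}

/-! ### Differentials of smooth functions -/

lemma aestronglyMeasurable_coeff_gradWedge {α : Type*} {_ : MeasurableSpace α} {μ : Measure α}
    {l : α → Covec k} {Θ : α → Alt k n} (hl : AEStronglyMeasurable l μ)
    (hΘ : AEStronglyMeasurable Θ μ) :
    AEStronglyMeasurable (fun y => coeff (gradWedge (l y) (Θ y))) μ := by
  have h := (continuous_coeff_gradWedge (k := k) (n := n)).comp_aestronglyMeasurable (hl.prodMk hΘ)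
  exact h


section Differential

variable {X : Type*} [TopologicalSpace X] [ChartedSpace (Cn k) X]
  {e : OpenPartialHomeomorph X (Cn k)}

/-- The differential of a function. -/
def dFun (f : X → ℝ) (x : X) : Covec k :=
  fderiv ℝ (f ∘ (chartAt (Cn k) x).symm) (chartAt (Cn k) x x)

variable [IsManifold 𝓘(ℂ, Cn k) ω X]

lemma covecIn_dFun (he : e ∈ atlas (Cn k) X) {f : X → ℝ} (hf : IsSmoothFun (k := k) f) {y : Cn k}
    (hy : y ∈ e.target) : covecIn e (dFun f) y = fderiv ℝ (f ∘ e.symm) y := by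
  set c := chartAt (Cn k) (e.symm y) with hc
  have hx : e.symm y ∈ c.source := mem_chart_source _ _
  have h1 : f ∘ e.symm =ᶠ[nhds y] (f ∘ c.symm) ∘ (c ∘ e.symm) := by
    filter_upwards [(isOpen_overlap e c).mem_nhds ⟨hy, hx⟩] with w hw
    simp only [Function.comp_apply]
    rw [c.left_inv hw.2]
  have h2 : DifferentiableAt ℝ (f ∘ c.symm) ((c ∘ e.symm) y) :=
    ((hf c (chart_mem_atlas _ _)).contDiffAt
      (c.open_target.mem_nhds (c.map_source hx))).differentiableAt (by simp)
  rw [h1.fderiv_eq, fderiv_comp y h2 (transition_differentiableAt he (chart_mem_atlas _ _) hy hx)]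
  rfl

lemma contDiffOn_covecIn_dFun (he : e ∈ atlas (Cn k) X) {f : X → ℝ}
    (hf : IsSmoothFun (k := k) f) : ContDiffOn ℝ ∞ (covecIn e (dFun f)) e.target :=
  ((hf e he).fderiv_of_isOpen (m := ∞) e.open_target (by simp)).congr fun _ hy =>
    covecIn_dFun he hf hy

/-- The differential of a smooth function is its differential in the sense of distributions. -/
lemma isWeakDifferential_dFun {f : X → ℝ} (hf : IsSmoothFun (k := k) f) :
    IsWeakDifferential (k := k) f (dFun f) := by
  intro e he
  refine ⟨(hf e he).continuousOn.locallyIntegrableOn e.open_target.measurableSet,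
    (contDiffOn_covecIn_dFun he hf).continuousOn.locallyIntegrableOn e.open_target.measurableSet,
    fun g hg hgc hgs v => ?_⟩
  set F : Cn k → ℝ := f ∘ e.symm with hF
  have hFs : ContDiffOn ℝ ∞ F e.target := hf e he
  set p : Cn k → ℝ := fun y => F y * g y with hp
  have hps : tsupport p ⊆ tsupport g := closure_mono fun y hy h0 => hy (by
    simp only [hp]; rw [show g y = 0 from h0, mul_zero])
  have hpc : HasCompactSupport p := hgc.of_isClosed_subset (isClosed_tsupport _) hps
  have hpd : ContDiff ℝ ∞ p := contDiff_of_tsupport_subset e.open_target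
    (hFs.mul hg.contDiffOn) (hps.trans hgs)
  have h0 := integral_fderiv_eq_zero (hpd.of_le (by simp)) hpc v
  have hd : ∀ y ∈ e.target, fderiv ℝ p y v = F y * fderiv ℝ g y v + covecIn e (dFun f) y v * g y := by
    intro y hy
    have a1 : DifferentiableAt ℝ F y :=
      (hFs.contDiffAt (e.open_target.mem_nhds hy)).differentiableAt (by simp)
    have a2 : DifferentiableAt ℝ g y := (hg.differentiable (by simp)) y
    rw [hp, fderiv_fun_mul a1 a2, covecIn_dFun he hf hy]
    simp only [add_apply, smul_apply, smul_eq_mul]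
    ring
  have hz : ∀ y ∉ e.target, fderiv ℝ p y v = 0 := by
    intro y hy
    have : y ∉ tsupport p := fun h => hy (hgs (hps h))
    rw [(notMem_tsupport_iff_eventuallyEq.1 this).fderiv_eq]
    simp
  rw [← setIntegral_eq_integral_of_forall_compl_eq_zero hz,
    setIntegral_congr_fun e.open_target.measurableSet hd] at h0
  have hi : ∀ {q r : Cn k → ℝ}, ContinuousOn q e.target → Continuous r → HasCompactSupport r →
      tsupport r ⊆ e.target → IntegrableOn (fun y => q y * r y) e.target := by
    intro q r hq hr hrc hrs
    have b1 : tsupport (fun y => q y * r y) ⊆ tsupport r := closure_mono fun y hy h0 => hy (by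
      change q y * r y = 0
      rw [show r y = 0 from h0, mul_zero])
    have b2 : Continuous fun y => q y * r y :=
      
      (contDiff_of_tsupport_subset (r := 0) e.open_target
        (contDiffOn_zero.2 (hq.mul hr.continuousOn)) (b1.trans hrs)).continuous
    exact (b2.integrable_of_hasCompactSupport
      (hrc.of_isClosed_subset (isClosed_tsupport _) b1)).integrableOn
  rw [integral_add] at h0
  · change ∫ y in e.target, F y * fderiv ℝ g y v = _
    linarith
  · exact hi hFs.continuousOn ((hg.continuous_fderiv (by simp)).clm_apply continuous_const)
      (hgc.fderiv_apply ℝ v) ((tsupport_fderiv_apply_subset ℝ v).trans hgs)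
  · exact hi ((contDiffOn_covecIn_dFun he hf).continuousOn.clm_apply continuousOn_const)
      hg.continuous hgc hgs

end Differential

/-! ### Smooth forms as currents -/

section FormCurrent

variable {X : Type*} [TopologicalSpace X] [ChartedSpace (Cn k) X] [T2Space X]
  [IsManifold 𝓘(ℂ, Cn k) ω X] [MeasurableSpace X] [BorelSpace X] [LindelofSpace X]
  {e : OpenPartialHomeomorph X (Cn k)} (Ω : KahlerForm k X)

namespace KahlerForm

lemma integrable_dens_wedge₂ (hk : 1 ≤ k) {τ : X → Alt k 2} (hτ : IsSmoothForm τ)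
    (Θ : TestForm k (2 * (k - 1)) X) :
    Integrable (Ω.dens fun x => wedge₂ (τ x) (Θ.1 x)) Ω.vol := by
  refine Ω.integrable_dens (by omega) (hτ.wedge₂ Θ.2.1) (Θ.2.2.mono fun x hx h0 => hx ?_)
  change wedge₂ (τ x) (Θ.1 x) = 0
  rw [show Θ.1 x = 0 from h0, ← wedge₂L_apply, map_zero]

/-- The current `Θ ↦ ∫ τ ∧ Θ` defined by a smooth `2`-form. -/
def formCurrent (hk : 1 ≤ k) {τ : X → Alt k 2} (hτ : IsSmoothForm τ) : PreCurrent k X where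
  toFun Θ := ∫ x, Ω.dens (fun x => wedge₂ (τ x) (Θ.1 x)) x ∂Ω.vol
  map_add' Θ Θ' := by
    rw [← integral_add (Ω.integrable_dens_wedge₂ hk hτ Θ) (Ω.integrable_dens_wedge₂ hk hτ Θ')]
    congr 1
    ext x
    simp only [dens, ← add_div, ← coeff_add, ← wedge₂_add_right]
    rfl
  map_smul' c Θ := by
    rw [RingHom.id_apply, smul_eq_mul, ← integral_const_mul]
    congr 1
    ext x
    simp only [dens, ← mul_div_assoc, ← coeff_smul, ← wedge₂_smul_right]
    rfl

lemma formCurrent_apply (hk : 1 ≤ k) {τ : X → Alt k 2} (hτ : IsSmoothForm τ)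
    (Θ : TestForm k (2 * (k - 1)) X) : Ω.formCurrent hk hτ Θ
      = ∫ x, Ω.dens (fun x => wedge₂ (τ x) (Θ.1 x)) x ∂Ω.vol := rfl

lemma formCurrent_eq (hk : 1 ≤ k) {τ : X → Alt k 2} (hτ : IsSmoothForm τ)
    (Θ : TestForm k (2 * (k - 1)) X) (he : e ∈ atlas (Cn k) X)
    (h : Function.support Θ.1 ⊆ e.source) : Ω.formCurrent hk hτ Θ
      = ∫ y in e.target, coeff (wedge₂ (formIn e τ y) (formIn e Θ.1 y)) := by
  rw [formCurrent_apply, Ω.integral_dens (by omega) he]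
  · simp only [formIn_wedge₂]
  · intro x hx
    refine h fun h0 => hx ?_
    change wedge₂ (τ x) (Θ.1 x) = 0
    rw [h0, ← wedge₂L_apply, map_zero]

/-- A closed smooth form of bidegree `(1,1)` defines a closed current. -/
lemma formCurrent_mem (hk : 2 ≤ k) {τ : X → Alt k 2} (hτ : IsSmoothForm τ)
    (hd : ∀ x, IsDiagonal (τ x)) (h0 : ∀ x, dForm τ x = 0) :
    Ω.formCurrent (by omega : 1 ≤ k) hτ ∈ ClosedCurrent k X := by
  refine ⟨fun e he K hK hKe => ?_, fun a ha Θ Θ' h => ?_, fun n h α Θ hΘ => ?_⟩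
  · have hK' := isCompact_image hK hKe
    have hc : ContinuousOn (formIn e τ) (e '' K) :=
      (hτ e he).continuousOn.mono (image_subset_target hKe)
    obtain ⟨B, hB⟩ := hK'.exists_bound_of_continuousOn hc
    set D : ℝ := ‖(coeffL k (2 * (k - 1) + 2))‖ * ‖wedge₂L (k := k) (n := 2 * (k - 1))‖ with hD
    refine ⟨0, D * |B| * (volume (e '' K)).toReal, fun Θ M hM hs hb => ?_⟩
    have hsup : Function.support Θ.1 ⊆ K := (subset_tsupport _).trans hs
    rw [Ω.formCurrent_eq _ hτ Θ he (hsup.trans hKe)]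
    have h1 : ∫ y in e.target, coeff (wedge₂ (formIn e τ y) (formIn e Θ.1 y))
        = ∫ y in e '' K, coeff (wedge₂ (formIn e τ y) (formIn e Θ.1 y)) := by
      refine setIntegral_eq_of_subset_of_forall_sdiff_eq_zero e.open_target.measurableSet
        (image_subset_target hKe) fun y hy => ?_
      have h2 : Θ.1 (e.symm y) = 0 := by
        by_contra h3
        exact hy.2 ⟨e.symm y, hsup h3, e.right_inv hy.1⟩
      rw [formIn_eq_zero h2, ← wedge₂L_apply, map_zero]
      rfl
    rw [h1, ← Real.norm_eq_abs]
    refine (norm_setIntegral_le_of_norm_le_const (C := D * |B| * M) hK'.measure_lt_top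
      fun y hy => ?_).trans (le_of_eq ?_)
    · have hy' := image_subset_target hKe hy
      have h3 : ‖formIn e Θ.1 y‖ ≤ M := by
        have := hb 0 le_rfl y hy'
        rwa [norm_iteratedFDeriv_zero] at this
      rw [← wedge₂L_apply, ← coeffL_apply]
      calc _ ≤ ‖coeffL k (2 * (k - 1) + 2)‖ * ‖wedge₂L (formIn e τ y) (formIn e Θ.1 y)‖ :=
            ContinuousLinearMap.le_opNorm _ _
        _ ≤ ‖coeffL k (2 * (k - 1) + 2)‖ * (‖wedge₂L (k := k) (n := 2 * (k - 1))‖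
              * ‖formIn e τ y‖ * ‖formIn e Θ.1 y‖) := by
            gcongr; exact ContinuousLinearMap.le_opNorm₂ _ _ _
        _ ≤ ‖coeffL k (2 * (k - 1) + 2)‖ * (‖wedge₂L (k := k) (n := 2 * (k - 1))‖
              * |B| * M) := by
            gcongr; exact (hB y hy).trans (le_abs_self B)
        _ = D * |B| * M := by rw [hD]; ring
    · rw [Measure.real]
      ring
  · rw [formCurrent_apply, formCurrent_apply]
    congr 1
    ext x
    have hn : 2 * (k - 1) + 2 = 2 * k := by omega
    have h1 : wedge₂ (τ x) (Θ'.1 x)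
        = (wedge₂ (τ x) (Θ.1 x)).compContinuousLinearMap (mulC k a) := by
      rw [wedge₂_comp, hd x a ha, h x]
    have h2 : LinearMap.det (mulC k a).toLinearMap = 1 := by
      have h3 := alt_top_apply rfl (Ω.pow k x) (mulC k a)
      have h4 : (Ω.pow k x).compContinuousLinearMap (mulC k a) = Ω.pow k x :=
        (Ω.diagonal x).powForm k a ha
      rw [h4] at h3
      have h5 := Ω.coeff_pow_pos x
      exact mul_right_cancel₀ h5.ne' (by rw [one_mul]; exact h3.symm)
    simp only [dens]
    rw [h1, alt_top_apply hn, h2, one_mul]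
  · obtain ⟨m, rfl⟩ : ∃ m, k = m + 2 := ⟨k - 2, by omega⟩
    obtain rfl : n = 2 * m + 1 := by omega
    have h1 : Θ.1 = dForm α.1 := by
      ext x v
      rw [hΘ x v]
      rfl
    rw [formCurrent_apply, h1]
    have h2 := dForm_wedge₂ hτ h0 α.2.1
    have h3 := Ω.integral_dens_dForm (n := 2 * m + 1 + 2) (by omega) (hτ.wedge₂ α.2.1)
      (α.2.2.mono fun x hx h0 => hx (by
        change wedge₂ (τ x) (α.1 x) = 0
        rw [show α.1 x = 0 from h0, ← wedge₂L_apply, map_zero]))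
    rw [h2] at h3
    exact h3

/-- If `dφ(v)² ≤ τ(v, iv)` for all `v` then `i∂φ ∧ ∂̄φ ≤ τ`. -/
lemma gradLE_formCurrent (hk : 1 ≤ k) {τ : X → Alt k 2} (hτ : IsSmoothForm τ)
    (hd : ∀ x, IsDiagonal (τ x)) {f : X → ℝ} (hf : IsSmoothFun (k := k) f)
    (hfτ : ∀ x v, dFun f x v ^ 2 ≤ τ x ![v, Complex.I • v]) :
    GradLE (dFun f) (Ω.formCurrent hk hτ) := by
  intro e he Θ hs hpos
  have hle : ∀ y ∈ e.target, coeff (gradWedge (covecIn e (dFun f) y) (formIn e Θ.1 y))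
      ≤ coeff (wedge₂ (formIn e τ y) (formIn e Θ.1 y)) := by
    intro y hy
    refine coeff_gradWedge_le_wedge₂ ((hd _).comp (chartFrame_comm he hy)) (fun v => ?_)
      (hpos e he y hy).2
    have h1 : chartFrame e y (Complex.I • v) = Complex.I • chartFrame e y v := by
      have := DFunLike.congr_fun (chartFrame_comm he hy) v
      simpa [mulC_apply] using this
    have h3 : (chartFrame e y ∘ ![v, Complex.I • v])
        = ![chartFrame e y v, Complex.I • chartFrame e y v] := by
      ext i : 1
      fin_cases i
      · rfl
      · exact h1
    have h4 := hfτ (e.symm y) (chartFrame e y v)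
    rw [← h3] at h4
    exact h4
  have hi : IntegrableOn (fun y => coeff (wedge₂ (formIn e τ y) (formIn e Θ.1 y))) e.target := by
    have h1 := Ω.integrable_dens_wedge₂ hk hτ Θ
    rw [Ω.integrable_dens_iff (by omega) he] at h1
    · simpa only [formIn_wedge₂] using h1
    · intro x hx
      refine hs (subset_tsupport _ fun h0 => hx ?_)
      change wedge₂ (τ x) (Θ.1 x) = 0
      rw [h0, ← wedge₂L_apply, map_zero]
  have hm : AEStronglyMeasurable
      (fun y => coeff (gradWedge (covecIn e (dFun f) y) (formIn e Θ.1 y)))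
      (volume.restrict e.target) := by
    exact aestronglyMeasurable_coeff_gradWedge
      ((contDiffOn_covecIn_dFun he hf).continuousOn.aestronglyMeasurable
        e.open_target.measurableSet)
      ((Θ.2.1 e he).continuousOn.aestronglyMeasurable e.open_target.measurableSet)
  have hi' : IntegrableOn
      (fun y => coeff (gradWedge (covecIn e (dFun f) y) (formIn e Θ.1 y))) e.target := by
    refine Integrable.mono' hi hm ?_
    refine (ae_restrict_iff' e.open_target.measurableSet).2 (.of_forall fun y hy => ?_)
    rw [Real.norm_eq_abs, abs_of_nonneg ((hpos e he y hy).2 _)]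
    exact hle y hy
  refine ⟨hi', ?_⟩
  rw [Ω.formCurrent_eq _ hτ Θ he ((subset_tsupport _).trans hs)]
  exact setIntegral_mono_on hi' hi e.open_target.measurableSet hle

end KahlerForm

end FormCurrent

end

section

variable {k n : ℕ}

/-! ### Positive forms and positive currents -/

lemma gradWedge_smul_right (l : Covec k) (c : ℝ) (Θ : Alt k n) :
    gradWedge l (c • Θ) = c • gradWedge l Θ := by
  rw [← wedge₂_gradForm, ← wedge₂_gradForm, wedge₂_smul_right]

lemma gradWedge_add_right (l : Covec k) (Θ Θ' : Alt k n) :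
    gradWedge l (Θ + Θ') = gradWedge l Θ + gradWedge l Θ' := by
  rw [← wedge₂_gradForm, ← wedge₂_gradForm, ← wedge₂_gradForm, wedge₂_add_right]

lemma gradWedge_zero_right (l : Covec k) : gradWedge l (0 : Alt k n) = 0 := by
  rw [← wedge₂_gradForm, ← wedge₂L_apply, map_zero]

lemma gradWedge_sum_right {ι : Type*} (s : Finset ι) (l : Covec k) (Θ : ι → Alt k n) :
    gradWedge l (∑ i ∈ s, Θ i) = ∑ i ∈ s, gradWedge l (Θ i) := by
  simp only [← wedge₂_gradForm, ← wedge₂L_apply, map_sum]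

lemma IsPositiveAlt.smul {Θ : Alt k (2 * (k - 1))} (h : IsPositiveAlt Θ) {c : ℝ} (hc : 0 ≤ c) :
    IsPositiveAlt (c • Θ) := by
  refine ⟨h.1.smul c, fun l => ?_⟩
  rw [gradWedge_smul_right, coeff_smul]
  exact mul_nonneg hc (h.2 l)

lemma isPositiveAlt_powForm (hk : 1 ≤ k) {η : Alt k 2} (hd : IsDiagonal η)
    (hη : ∀ v : Cn k, v ≠ 0 → 0 < η ![v, Complex.I • v]) :
    IsPositiveAlt (powForm η (k - 1)) :=
  ⟨hd.powForm _, fun l => coeff_gradWedge_powForm_nonneg hk hη l⟩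

lemma aestronglyMeasurable_of_contDiffOn {F : Type*} [NormedAddCommGroup F] [NormedSpace ℝ F]
    {r : WithTop ℕ∞} {f : Cn k → F} {s : Set (Cn k)} (hs : IsOpen s) (hf : ContDiffOn ℝ r f s) :
    AEStronglyMeasurable f (volume.restrict s) :=
  hf.continuousOn.aestronglyMeasurable hs.measurableSet

section Positive

variable {X : Type*} [TopologicalSpace X] [ChartedSpace (Cn k) X] [IsManifold 𝓘(ℂ, Cn k) ω X]
  {e : OpenPartialHomeomorph X (Cn k)}

lemma isPositiveForm_iff (hk : 1 ≤ k) {Θ : X → Alt k (2 * (k - 1))} :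
    IsPositiveForm Θ ↔ ∀ x, IsPositiveAlt (Θ x) := by
  constructor
  · intro h x
    rw [← formIn_chartAt Θ x]
    exact h _ (chart_mem_atlas _ x) _ ((chartAt (Cn k) x).map_source (mem_chart_source _ x))
  · intro h e he y hy
    exact (h _).comp hk (chartFrame_comm he hy) (frameInv_comp_chartFrame he hy)

variable [T2Space X]

/-- A test form is the sum of the test forms obtained by multiplication by functions of a partition
of unity, and these are supported in chart domains. -/
lemma exists_testForm_decomposition (Θ : TestForm k n X) :
    ∃ (N : ℕ) (ρ : Fin N → X → ℝ) (c : Fin N → X) (Φ : Fin N → TestForm k n X),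
      (∀ i, (Φ i).1 = (fun x => ρ i x • Θ.1 x) ∧ (∀ z, 0 ≤ ρ i z) ∧
        tsupport (Φ i).1 ⊆ (chartAt (Cn k) (c i)).source) ∧ Θ = ∑ i, Φ i := by
  obtain ⟨N, ρ, c, h1, h2⟩ := exists_decomposition Θ.2.1 Θ.2.2
  refine ⟨N, ρ, c, fun i => ⟨fun x => ρ i x • Θ.1 x, (h1 i).1, (h1 i).2.1⟩,
    fun i => ⟨rfl, (h1 i).2.2.2.2, (h1 i).2.2.1⟩, ?_⟩
  refine Subtype.ext ?_
  rw [AddSubmonoidClass.coe_finsetSum]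
  exact h2

variable [MeasurableSpace X] [BorelSpace X] (Ω : KahlerForm k X)

namespace KahlerForm

lemma dens_gradWedge_nonneg (x : X) {Θ : X → Alt k (2 * (k - 1))} {θ : X → Covec k}
    (h : IsPositiveAlt (Θ x)) : 0 ≤ Ω.dens (fun x => gradWedge (θ x) (Θ x)) x :=
  div_nonneg (h.2 _) (Ω.coeff_pow_pos x).le

lemma isPositiveAlt_pow (hk : 1 ≤ k) (x : X) : IsPositiveAlt (Ω.pow (k - 1) x) :=
  isPositiveAlt_powForm hk (Ω.diagonal x) (Ω.pos x)

/-- The test form `χ Ω^(k-1)`. -/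
def cutPow {χ : X → ℝ} (hχ : IsSmoothFun (k := k) χ) (hc : HasCompactSupport χ) :
    TestForm k (2 * (k - 1)) X :=
  ⟨fun x => χ x • Ω.pow (k - 1) x, (Ω.isSmoothForm_pow _).smul_fun hχ,
    hc.mono fun x hx h0 => hx (by simp [show χ x = 0 from h0])⟩

lemma ofReal_cutPow_le_mass (T : PreCurrent k X) {χ : X → ℝ} (hχ : IsSmoothFun (k := k) χ)
    (hc : HasCompactSupport χ) (h01 : ∀ x, χ x ∈ Icc (0 : ℝ) 1) :
    ENNReal.ofReal (T (Ω.cutPow hχ hc)) ≤ Ω.mass T :=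
  le_iSup_of_le χ <| le_iSup_of_le h01 <| le_iSup_of_le (Ω.cutPow hχ hc) <|
    le_iSup_of_le (fun _ => rfl) le_rfl

variable [LindelofSpace X]

/-- The integrated form of the inequality `i∂φ ∧ ∂̄φ ≤ T`, for all positive test forms. -/
lemma integral_dens_gradWedge_le (hk : 1 ≤ k) {θ : X → Covec k} {T : PreCurrent k X}
    (hθ : GradLE θ T) (Θ : TestForm k (2 * (k - 1)) X) (hΘ : ∀ x, IsPositiveAlt (Θ.1 x)) :
    Integrable (Ω.dens fun x => gradWedge (θ x) (Θ.1 x)) Ω.vol ∧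
      ∫ x, Ω.dens (fun x => gradWedge (θ x) (Θ.1 x)) x ∂Ω.vol ≤ T Θ := by
  obtain ⟨N, ρ, c, Φ, h1, h2⟩ := exists_testForm_decomposition Θ
  have hpos : ∀ i, ∀ x, IsPositiveAlt ((Φ i).1 x) := by
    intro i x
    rw [(h1 i).1]
    exact (hΘ x).smul ((h1 i).2.1 x)
  have key : ∀ i, Integrable (Ω.dens fun x => gradWedge (θ x) ((Φ i).1 x)) Ω.vol ∧
      ∫ x, Ω.dens (fun x => gradWedge (θ x) ((Φ i).1 x)) x ∂Ω.vol ≤ T (Φ i) := by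
    intro i
    have he := chart_mem_atlas (Cn k) (c i)
    set e := chartAt (Cn k) (c i) with hedef
    have hs : Function.support (fun x => gradWedge (θ x) ((Φ i).1 x)) ⊆ e.source := by
      intro x hx
      refine (h1 i).2.2 (subset_tsupport _ fun h0 => hx ?_)
      change gradWedge (θ x) ((Φ i).1 x) = 0
      rw [h0, gradWedge_zero_right]
    obtain ⟨a1, a2⟩ := hθ e he (Φ i) (h1 i).2.2 ((isPositiveForm_iff hk).2 (hpos i))
    have hn : 2 * (k - 1) + 2 = 2 * k := by omega
    rw [Ω.integrable_dens_iff hn he hs, Ω.integral_dens hn he hs]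
    constructor
    · refine a1.congr_fun (fun y hy => ?_) e.open_target.measurableSet
      simp only [formIn_gradWedge he θ _ hy]
    · refine le_trans (le_of_eq ?_) a2
      refine setIntegral_congr_fun e.open_target.measurableSet fun y hy => ?_
      simp only [formIn_gradWedge he θ _ hy]
  have h3 : (Ω.dens fun x => gradWedge (θ x) (Θ.1 x))
      = fun x => ∑ i, Ω.dens (fun x => gradWedge (θ x) ((Φ i).1 x)) x := by
    ext x
    have h4 : Θ.1 x = ∑ i, (Φ i).1 x := by
      conv_lhs => rw [h2]
      rw [AddSubmonoidClass.coe_finsetSum, Finset.sum_apply]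
    simp only [dens, h4, gradWedge_sum_right, coeff_sum, Finset.sum_div]
  constructor
  · rw [h3]
    exact integrable_finsetSum _ fun i _ => (key i).1
  · rw [h3, integral_finsetSum _ fun i _ => (key i).1]
    conv_rhs => rw [h2]
    rw [map_sum]
    exact Finset.sum_le_sum fun i _ => (key i).2

/-- A current which bounds `i∂φ ∧ ∂̄φ` is positive. -/
lemma current_nonneg (Ω : KahlerForm k X) (hk : 1 ≤ k) {θ : X → Covec k} {T : PreCurrent k X}
    (hθ : GradLE θ T) (Θ : TestForm k (2 * (k - 1)) X) (hΘ : ∀ x, IsPositiveAlt (Θ.1 x)) :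
    0 ≤ T Θ :=
  (integral_nonneg fun x => Ω.dens_gradWedge_nonneg x (hΘ x)).trans
    (Ω.integral_dens_gradWedge_le hk hθ Θ hΘ).2

lemma cutPow_le_mass {T : PreCurrent k X} (hT : Ω.mass T ≠ ⊤) {χ : X → ℝ}
    (hχ : IsSmoothFun (k := k) χ) (hc : HasCompactSupport χ) (h01 : ∀ x, χ x ∈ Icc (0 : ℝ) 1) :
    T (Ω.cutPow hχ hc) ≤ (Ω.mass T).toReal :=
  (ENNReal.ofReal_le_iff_le_toReal hT).1 (Ω.ofReal_cutPow_le_mass T hχ hc h01)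

/-! ### The energy density -/

/-- The density of `i∂φ ∧ ∂̄φ ∧ Ω^(k-1)` with respect to `Ω^k`, where `θ = dφ`. -/
def gradDens (θ : X → Covec k) : X → ℝ := Ω.dens fun x => gradWedge (θ x) (Ω.pow (k - 1) x)

lemma gradDens_nonneg (hk : 1 ≤ k) (θ : X → Covec k) (x : X) : 0 ≤ Ω.gradDens θ x :=
  Ω.dens_gradWedge_nonneg x (Ω.isPositiveAlt_pow hk x)

/-- The pointwise norm of `dφ` is controlled by the energy density. -/
lemma covec_sq_le_gradDens (hk : 1 ≤ k) (θ : X → Covec k) (x : X) (v : Cn k) :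
    θ x v ^ 2 ≤ 2 * k * Ω.gradDens θ x * Ω.toForm x ![v, Complex.I • v] := by
  have h1 := covec_sq_mul_le hk (Ω.diagonal x) (Ω.pos x) (θ x) v
  have h2 := Ω.coeff_pow_pos x
  have h3 : 2 * k * Ω.gradDens θ x * Ω.toForm x ![v, Complex.I • v]
      = 2 * k * coeff (gradWedge (θ x) (powForm (Ω.toForm x) (k - 1)))
        * Ω.toForm x ![v, Complex.I • v] / coeff (Ω.pow k x) := by
    rw [gradDens, dens]
    simp only [pow]
    ring
  rw [h3, le_div_iff₀ h2]
  exact h1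

lemma aestronglyMeasurable_of_charts {E : Type*} [TopologicalSpace E]
    [TopologicalSpace.PseudoMetrizableSpace E] {F : X → E}
    (h : ∀ e ∈ atlas (Cn k) X, AEStronglyMeasurable F (Ω.vol.restrict e.source)) :
    AEStronglyMeasurable F Ω.vol := by
  obtain ⟨t, htc, ht⟩ := countable_cover_nhds fun x : X => chart_source_mem_nhds (Cn k) x
  have : Countable t := htc.to_subtype
  rw [biUnion_eq_iUnion] at ht
  rw [← Measure.restrict_univ (μ := Ω.vol), ← ht, aestronglyMeasurable_iUnion_iff]
  exact fun i => h _ (chart_mem_atlas _ _)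

lemma aestronglyMeasurable_dens (hn : n = 2 * k) {Ψ : X → Alt k n}
    (h : ∀ e ∈ atlas (Cn k) X, AEStronglyMeasurable (fun y => coeff (formIn e Ψ y))
      (volume.restrict e.target)) : AEStronglyMeasurable (Ω.dens Ψ) Ω.vol := by
  refine Ω.aestronglyMeasurable_of_charts fun e he => ?_
  rw [Ω.aestronglyMeasurable_source_iff he]
  have h1 : AEMeasurable (Ω.volCoeff e) (volume.restrict e.target) :=
    (Ω.volCoeff_contDiffOn he).continuousOn.aemeasurable e.open_target.measurableSet
  refine ((h e he).aemeasurable.div h1).aestronglyMeasurable.congr ?_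
  refine (ae_restrict_iff' e.open_target.measurableSet).2 (.of_forall fun y hy => ?_)
  have h2 := Ω.volCoeff_pos he hy
  rw [Pi.div_apply, ← Ω.volCoeff_mul_dens hn he Ψ hy, Function.comp_apply]
  field_simp

lemma aestronglyMeasurable_gradDens (hk : 1 ≤ k) {θ : X → Covec k}
    (hm : ∀ e ∈ atlas (Cn k) X,
      AEStronglyMeasurable (covecIn e θ) (volume.restrict e.target)) :
    AEStronglyMeasurable (Ω.gradDens θ) Ω.vol := by
  refine Ω.aestronglyMeasurable_dens (by omega) fun e he => ?_
  refine (aestronglyMeasurable_coeff_gradWedge (hm e he)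
    (aestronglyMeasurable_of_contDiffOn e.open_target
      (Ω.isSmoothForm_pow (k - 1) e he))).congr ?_
  refine (ae_restrict_iff' e.open_target.measurableSet).2 (.of_forall fun y hy => ?_)
  simp only [formIn_gradWedge he θ _ hy]

variable [SigmaCompactSpace X]

/-- The energy of `φ` is at most the mass of every current which bounds `i∂φ ∧ ∂̄φ`. -/
lemma lintegral_gradDens_le (hk : 1 ≤ k) {θ : X → Covec k} {T : PreCurrent k X}
    (hm : ∀ e ∈ atlas (Cn k) X, AEStronglyMeasurable (covecIn e θ) (volume.restrict e.target))
    (hθ : GradLE θ T) :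
    ∫⁻ x, ENNReal.ofReal (Ω.gradDens θ x) ∂Ω.vol ≤ Ω.mass T := by
  choose χ h1 h2 h3 h4 h5 using fun j : ℕ =>
    exists_cutoff (k := k) (isCompact_compactCovering X j) isOpen_univ (subset_univ _)
  have hlim : ∀ x, Filter.Tendsto (fun j => ENNReal.ofReal (χ j x * Ω.gradDens θ x)) Filter.atTop
      (nhds (ENNReal.ofReal (Ω.gradDens θ x))) := by
    intro x
    obtain ⟨j, hj⟩ := exists_mem_compactCovering x
    refine tendsto_const_nhds.congr' ?_
    filter_upwards [Filter.eventually_ge_atTop j] with i hi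
    rw [h5 i x (compactCovering_subset X hi hj), one_mul]
  have hmeas := Ω.aestronglyMeasurable_gradDens hk hm
  calc ∫⁻ x, ENNReal.ofReal (Ω.gradDens θ x) ∂Ω.vol
      = ∫⁻ x, Filter.liminf (fun j => ENNReal.ofReal (χ j x * Ω.gradDens θ x)) Filter.atTop ∂Ω.vol :=
        lintegral_congr fun x => (hlim x).liminf_eq.symm
    _ ≤ Filter.liminf (fun j => ∫⁻ x, ENNReal.ofReal (χ j x * Ω.gradDens θ x) ∂Ω.vol)
        Filter.atTop := lintegral_liminf_le' fun j =>
          ((h1 j).continuous.aemeasurable.mul hmeas.aemeasurable).ennreal_ofReal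
    _ ≤ Filter.liminf (fun _ : ℕ => Ω.mass T) Filter.atTop := by
        refine Filter.liminf_le_liminf (.of_forall fun j => ?_)
        have hpos : ∀ x, IsPositiveAlt ((Ω.cutPow (h1 j) (h2 j)).1 x) := fun x =>
          (Ω.isPositiveAlt_pow hk x).smul (h4 j x).1
        obtain ⟨a1, a2⟩ := Ω.integral_dens_gradWedge_le hk hθ (Ω.cutPow (h1 j) (h2 j)) hpos
        have h6 : (Ω.dens fun x => gradWedge (θ x) ((Ω.cutPow (h1 j) (h2 j)).1 x))
            = fun x => χ j x * Ω.gradDens θ x := by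
          ext x
          simp only [gradDens, dens, cutPow, gradWedge_smul_right, coeff_smul, mul_div_assoc]
        rw [h6] at a1 a2
        rw [← ofReal_integral_eq_lintegral_ofReal a1
          (.of_forall fun x => mul_nonneg (h4 j x).1 (Ω.gradDens_nonneg hk θ x))]
        exact (ENNReal.ofReal_le_ofReal a2).trans (Ω.ofReal_cutPow_le_mass T (h1 j) (h2 j) (h4 j))
    _ = Ω.mass T := Filter.liminf_const _

lemma integrable_gradDens (hk : 1 ≤ k) {θ : X → Covec k} {T : PreCurrent k X}
    (hm : ∀ e ∈ atlas (Cn k) X, AEStronglyMeasurable (covecIn e θ) (volume.restrict e.target))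
    (hθ : GradLE θ T) (hT : Ω.mass T ≠ ⊤) :
    Integrable (Ω.gradDens θ) Ω.vol ∧ ∫ x, Ω.gradDens θ x ∂Ω.vol ≤ (Ω.mass T).toReal := by
  have h1 := Ω.lintegral_gradDens_le hk hm hθ
  have h2 := Ω.aestronglyMeasurable_gradDens hk hm
  have h0 : 0 ≤ᵐ[Ω.vol] Ω.gradDens θ := .of_forall (Ω.gradDens_nonneg hk θ)
  refine ⟨⟨h2, ?_⟩, ?_⟩
  · rw [hasFiniteIntegral_iff_ofReal h0]
    exact h1.trans_lt hT.lt_top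
  · rw [integral_eq_lintegral_of_nonneg_ae h0 h2]
    exact ENNReal.toReal_mono hT h1

/-- When the mass of the current is finite, the inequality `i∂φ ∧ ∂̄φ ≤ T` gives that `dφ` is
square integrable. -/
lemma sqIntegrable_of_gradLE (hk : 1 ≤ k) {θ : X → Covec k} {T : PreCurrent k X}
    (hm : ∀ e ∈ atlas (Cn k) X, AEStronglyMeasurable (covecIn e θ) (volume.restrict e.target))
    (hθ : GradLE θ T) (hT : Ω.mass T ≠ ⊤) : Ω.SqIntegrable θ := by
  have hi := (Ω.integrable_gradDens hk hm hθ hT).1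
  have h0 : ∀ x, 0 ≤ 2 * k * Ω.gradDens θ x := fun x =>
    mul_nonneg (by positivity) (Ω.gradDens_nonneg hk θ x)
  refine ⟨fun x => √(2 * k * Ω.gradDens θ x), ?_, .of_forall fun x v => ?_⟩
  · rw [memLp_two_iff_integrable_sq
      (Real.continuous_sqrt.comp_aestronglyMeasurable (hi.1.const_mul _))]
    refine (hi.const_mul (2 * (k : ℝ))).congr (.of_forall fun x => ?_)
    exact (Real.sq_sqrt (h0 x)).symm
  · rw [Real.sq_sqrt (h0 x)]
    exact Ω.covec_sq_le_gradDens hk θ x v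

end KahlerForm

end Positive

end

section

variable {k n : ℕ}

/-! ### Continuity of positive currents -/

lemma diagPart_comp (Θ : Alt k n) {A : Cn k →L[ℝ] Cn k}
    (hA : A.comp (mulC k Complex.I) = (mulC k Complex.I).comp A) :
    (diagPart Θ).compContinuousLinearMap A = diagPart (Θ.compContinuousLinearMap A) := by
  have h : ∀ (s : Finset ℕ) (f : ℕ → Alt k n), (∑ j ∈ s, f j).compContinuousLinearMap A
      = ∑ j ∈ s, (f j).compContinuousLinearMap A := by
    intro s f
    ext v
    simp [ContinuousAlternatingMap.sum_apply]
  rw [diagPart, diagPart, comp_smul, h]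
  congr 1
  refine Finset.sum_congr rfl fun j _ => ?_
  rw [comp_comp, comp_comp, comm_mulC hA]

section CurrentBound

variable {X : Type*} [TopologicalSpace X] [ChartedSpace (Cn k) X] [IsManifold 𝓘(ℂ, Cn k) ω X]
  {e : OpenPartialHomeomorph X (Cn k)}

/-- The pull-back of a test form by the multiplication by `a` in every tangent space. -/
def rotForm (a : ℂ) (Θ : TestForm k n X) : TestForm k n X :=
  ⟨fun x => (Θ.1 x).compContinuousLinearMap (mulC k a), fun e he => by
    refine (contDiffOn_comp (Θ.2.1 e he) (contDiffOn_const (c := mulC k a))).congr fun y hy => ?_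
    rw [formIn, formIn, comp_comp, comp_comp, comm_mulC (chartFrame_comm he hy)],
    Θ.2.2.mono fun x hx h0 => hx (by
      change (Θ.1 x).compContinuousLinearMap _ = 0
      rw [show Θ.1 x = 0 from h0]; rfl)⟩

/-- The diagonal part of a test form. -/
def diagTest (Θ : TestForm k n X) : TestForm k n X :=
  (1 / ((n : ℝ) + 1)) • ∑ j ∈ Finset.range (n + 1),
    rotForm (Complex.exp (2 * Real.pi * Complex.I / (n + 1 : ℕ)) ^ j) Θ

lemma diagTest_apply (Θ : TestForm k n X) (x : X) : (diagTest Θ).1 x = diagPart (Θ.1 x) := by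
  have h : (diagTest Θ).1 = (1 / ((n : ℝ) + 1)) • ∑ j ∈ Finset.range (n + 1),
      (rotForm (Complex.exp (2 * Real.pi * Complex.I / (n + 1 : ℕ)) ^ j) Θ).1 := by
    rw [diagTest, Submodule.coe_smul, AddSubmonoidClass.coe_finsetSum]
  rw [h, Pi.smul_apply, Finset.sum_apply]
  rfl

lemma current_diagTest {T : PreCurrent k X} (hT : IsBidegreeOneOne T)
    (Θ : TestForm k (2 * (k - 1)) X) : T (diagTest Θ) = T Θ := by
  have h : ∀ j ∈ Finset.range (2 * (k - 1) + 1), T (rotForm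
      (Complex.exp (2 * Real.pi * Complex.I / (2 * (k - 1) + 1 : ℕ)) ^ j) Θ) = T Θ := by
    intro j _
    refine hT _ ?_ _ _ fun x => rfl
    rw [norm_pow]
    have h1 : 2 * Real.pi * Complex.I / (2 * (k - 1) + 1 : ℕ)
        = ((2 * Real.pi / (2 * (k - 1) + 1 : ℕ) : ℝ) : ℂ) * Complex.I := by
      push_cast
      ring
    rw [h1, Complex.norm_exp_ofReal_mul_I, one_pow]
  rw [diagTest, map_smul, map_sum, Finset.sum_congr rfl h, Finset.sum_const, Finset.card_range,
    nsmul_eq_mul, smul_eq_mul]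
  push_cast
  field_simp

lemma frameInv_comm (he : e ∈ atlas (Cn k) X) {x : X} (hx : x ∈ e.source) :
    (frameInv e x).comp (mulC k Complex.I) = (mulC k Complex.I).comp (frameInv e x) := by
  refine fderiv_transition_comm (chart_mem_atlas _ x) he
    ((chartAt (Cn k) x).map_source (mem_chart_source _ x)) ?_
  rwa [(chartAt (Cn k) x).left_inv (mem_chart_source _ x)]

lemma isPositiveAlt_of_formIn (hk : 1 ≤ k) (he : e ∈ atlas (Cn k) X)
    {Θ : X → Alt k (2 * (k - 1))} {x : X} (hx : x ∈ e.source)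
    (h : IsPositiveAlt (formIn e Θ (e x))) : IsPositiveAlt (Θ x) := by
  have h1 : (chartFrame e (e x)).comp (frameInv e x) = ContinuousLinearMap.id ℝ (Cn k) := by
    have := chartFrame_comp_frameInv he (e.map_source hx)
    rwa [e.left_inv hx] at this
  have h2 : Θ x = (formIn e Θ (e x)).compContinuousLinearMap (frameInv e x) := by
    rw [formIn, comp_comp, h1, e.left_inv hx]
    rfl
  rw [h2]
  exact h.comp hk (frameInv_comm he hx) h1

variable [T2Space X] [MeasurableSpace X] [BorelSpace X] [LindelofSpace X] (Ω : KahlerForm k X)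

/-- A positive current is of order zero, with a bound by its mass that is uniform on the test
forms supported in a given compact subset of a chart domain. -/
lemma exists_current_bound (hk : 1 ≤ k) (he : e ∈ atlas (Cn k) X) {K : Set X} (hK : IsCompact K)
    (hKe : K ⊆ e.source) : ∃ C : ℝ, 0 ≤ C ∧ ∀ T : PreCurrent k X, IsBidegreeOneOne T →
      (∀ Θ : TestForm k (2 * (k - 1)) X, (∀ x, IsPositiveAlt (Θ.1 x)) → 0 ≤ T Θ) →
      Ω.mass T ≠ ⊤ → ∀ (Θ : TestForm k (2 * (k - 1)) X) (M : ℝ), 0 ≤ M →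
        Function.support Θ.1 ⊆ K → (∀ y ∈ e.target, ‖formIn e Θ.1 y‖ ≤ M) →
        |T Θ| ≤ C * M * (Ω.mass T).toReal := by
  obtain ⟨χ, hχ, hχc, -, hχ01, hχ1⟩ := exists_cutoff (k := k) hK isOpen_univ (subset_univ _)
  obtain ⟨C₁, hC₁, hC₁b⟩ := exists_coeff_gradWedge_le (k := k) (n := 2 * (k - 1))
  have hcont : ContinuousOn
      (fun y => 2 * (k : ℝ) * ‖formIn e Ω.toForm y‖ / Ω.volCoeff e y) (e '' K) := by
    have h1 := image_subset_target hKe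
    refine ContinuousOn.div (continuousOn_const.mul ?_)
      ((Ω.volCoeff_contDiffOn he).continuousOn.mono h1)
      fun y hy => (Ω.volCoeff_pos he (h1 hy)).ne'
    exact ((Ω.smooth e he).continuousOn.mono h1).norm
  obtain ⟨B, hB⟩ := (isCompact_image hK hKe).exists_bound_of_continuousOn hcont
  refine ⟨C₁ * |B|, by positivity, fun T hT hpos hm Θ M hM hs hb => ?_⟩
  set P := Ω.cutPow hχ hχc with hP
  have key : ∀ s : ℝ, |s| ≤ 1 → 0 ≤ C₁ * |B| * M * T P + s * T Θ := by
    intro s hs1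
    have h1 := hpos ((C₁ * |B| * M) • P + s • diagTest Θ) fun x => ?_
    · rw [map_add, map_smul, map_smul, current_diagTest hT] at h1
      exact h1
    change IsPositiveAlt ((C₁ * |B| * M) • P.1 x + s • (diagTest Θ).1 x)
    have hPx : IsPositiveAlt (P.1 x) := (Ω.isPositiveAlt_pow hk x).smul (hχ01 x).1
    have hc0 : 0 ≤ C₁ * |B| * M := by positivity
    rw [diagTest_apply]
    by_cases hx : Θ.1 x = 0
    · have h2 : diagPart (0 : Alt k (2 * (k - 1))) = 0 := by
        have := norm_diagPart_le (0 : Alt k (2 * (k - 1)))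
        rw [norm_zero] at this
        exact norm_le_zero_iff.1 this
      rw [hx, h2, smul_zero, add_zero]
      exact hPx.smul hc0
    · have hxK : x ∈ K := hs hx
      have hxe := hKe hxK
      have hy := e.map_source hxe
      refine isPositiveAlt_of_formIn hk he (Θ := fun x =>
        (C₁ * |B| * M) • P.1 x + s • diagPart (Θ.1 x)) hxe ?_
      set y := e x with hydef
      set η := formIn e Ω.toForm y with hη
      have h3 : formIn e (fun x => (C₁ * |B| * M) • P.1 x + s • diagPart (Θ.1 x)) y
          = (C₁ * |B| * M) • powForm η (k - 1) + s • diagPart (formIn e Θ.1 y) := by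
        rw [formIn, comp_add, comp_smul, comp_smul, diagPart_comp _ (chartFrame_comm he hy)]
        have h4 : (P.1 (e.symm y)).compContinuousLinearMap (chartFrame e y)
            = powForm η (k - 1) := by
          change (χ (e.symm y) • Ω.pow (k - 1) (e.symm y)).compContinuousLinearMap _ = _
          rw [hydef, e.left_inv hxe, hχ1 x hxK, one_smul, hη, ← Ω.formIn_pow, formIn, hydef,
            e.left_inv hxe]
        rw [h4]
        rfl
      rw [h3]
      have hηp : ∀ v : Cn k, v ≠ 0 → 0 < η ![v, Complex.I • v] := fun v hv => Ω.formIn_pos he hy hv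
      have hηd : IsDiagonal η := Ω.isDiagonal_formIn he hy
      refine ⟨((hηd.powForm _).smul _).add ((isDiagonal_diagPart _).smul _), fun l => ?_⟩
      rw [gradWedge_add_right, gradWedge_smul_right, gradWedge_smul_right, coeff_add, coeff_smul,
        coeff_smul]
      set q := coeff (gradWedge l (powForm η (k - 1))) with hq
      have hq0 : 0 ≤ q := coeff_gradWedge_powForm_nonneg hk hηp l
      have h5 : ‖l‖ ^ 2 ≤ |B| * q := by
        refine (norm_sq_le_of_pos hk hηd hηp l).trans ?_
        refine mul_le_mul_of_nonneg_right ?_ hq0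
        have h6 := hB y ⟨x, hxK, rfl⟩
        rw [Real.norm_eq_abs] at h6
        have h7 := (le_abs_self _).trans (h6.trans (le_abs_self B))
        rwa [KahlerForm.volCoeff, Ω.formIn_pow, ← hη] at h7
      have h8 : |s * coeff (gradWedge l (diagPart (formIn e Θ.1 y)))| ≤ C₁ * |B| * M * q := by
        rw [abs_mul]
        calc _ ≤ 1 * (C₁ * ‖l‖ ^ 2 * ‖diagPart (formIn e Θ.1 y)‖) := by
              gcongr
              exact hC₁b _ _
          _ ≤ 1 * (C₁ * (|B| * q) * M) := by
              gcongr
              exact (norm_diagPart_le _).trans (hb y hy)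
          _ = C₁ * |B| * M * q := by ring
      have h9 := neg_abs_le (s * coeff (gradWedge l (diagPart (formIn e Θ.1 y))))
      linarith
  have hTP := Ω.cutPow_le_mass hm hχ hχc hχ01
  have k1 := key 1 (by simp)
  have k2 := key (-1) (by simp)
  have hTP2 : C₁ * |B| * M * T P ≤ C₁ * |B| * M * (Ω.mass T).toReal :=
    mul_le_mul_of_nonneg_left hTP (by positivity)
  rw [abs_le]
  constructor <;> linarith

end CurrentBound

end

section

variable {k n : ℕ}

/-! ### Series of integrable functions -/

lemma integrable_tsum_of_summable {α E : Type*} {_ : MeasurableSpace α} {μ : Measure α}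
    [NormedAddCommGroup E] [CompleteSpace E] {F : ℕ → α → E} (hF : ∀ i, Integrable (F i) μ)
    (hs : Summable fun i => ∫ a, ‖F i a‖ ∂μ) :
    (∀ᵐ a ∂μ, Summable fun i => ‖F i a‖) ∧ Integrable (fun a => ∑' i, F i a) μ := by
  have h0 : ∑' i, ∫⁻ a, ‖F i a‖ₑ ∂μ ≠ ⊤ := by
    have h1 : ∀ i, ∫⁻ a, ‖F i a‖ₑ ∂μ = ENNReal.ofReal (∫ a, ‖F i a‖ ∂μ) := fun i =>
      (ofReal_integral_norm_eq_lintegral_enorm (hF i)).symm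
    simp only [h1]
    exact hs.tsum_ofReal_ne_top
  have h1 : ∀ᵐ a ∂μ, Summable fun i => ‖F i a‖ := by
    refine summable_norm_of_tsum_eLpNorm_ne_top le_rfl (fun i => (hF i).1) ?_
    simpa only [eLpNorm_one_eq_lintegral_enorm] using h0
  refine ⟨h1, ?_, ?_⟩
  · refine aestronglyMeasurable_of_tendsto_ae Filter.atTop
      (f := fun N a => ∑ i ∈ Finset.range N, F i a)
      (fun N => Finset.aestronglyMeasurable_fun_sum _ fun i _ => (hF i).1) ?_
    filter_upwards [h1] with a ha
    exact ha.of_norm.hasSum.tendsto_sum_nat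
  · refine lt_of_le_of_lt (lintegral_mono_ae (g := fun a => ∑' i, ‖F i a‖ₑ) ?_) ?_
    · filter_upwards [h1] with a ha
      exact enorm_tsum_le_tsum_enorm
    · rw [lintegral_tsum fun i => (hF i).1.enorm]
      exact h0.lt_top

lemma ae_restrict_of_compact {s : Set (Cn k)} (hs : IsOpen s) {P : Cn k → Prop}
    (h : ∀ K ⊆ s, IsCompact K → ∀ᵐ y ∂(volume.restrict K), P y) :
    ∀ᵐ y ∂(volume.restrict s), P y := by
  rw [ae_restrict_iff' hs.measurableSet, ae_iff]
  refine measure_null_of_locally_null _ fun y hy => ?_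
  have hys : y ∈ s := by
    by_contra h0
    exact hy fun h1 => (h0 h1).elim
  obtain ⟨K, hK, hyK, hKs⟩ := exists_compact_subset hs hys
  refine ⟨_, inter_mem_nhdsWithin _ (mem_interior_iff_mem_nhds.1 hyK), ?_⟩
  have h1 := h K hKs hK
  rw [ae_restrict_iff' hK.measurableSet, ae_iff] at h1
  refine measure_mono_null (fun z hz => ?_) h1
  exact fun h2 => hz.1 fun _ => h2 hz.2

/-- A positive semidefinite quadratic form `q` satisfies `q(∑ lₙ) ≤ (∑ aₙ) ∑ q(lₙ)/aₙ`. -/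
lemma coeff_gradWedge_sum_le {Θ : Alt k n} (hΘ : ∀ l : Covec k, 0 ≤ coeff (gradWedge l Θ))
    {a : ℕ → ℝ} (ha : ∀ i, 0 < a i) (l : ℕ → Covec k) (N : ℕ) :
    coeff (gradWedge (∑ i ∈ Finset.range N, l i) Θ) ≤ (∑ i ∈ Finset.range N, a i)
      * ∑ i ∈ Finset.range N, (a i)⁻¹ * coeff (gradWedge (l i) Θ) := by
  induction N with
  | zero =>
    have := gradWedge_smul 0 (0 : Covec k) Θ
    simp only [smul_zero, ne_eq, OfNat.ofNat_ne_zero, not_false_eq_true, zero_pow, zero_smul] at this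
    simp [this, coeff]
  | succ N ih =>
    rw [Finset.sum_range_succ, Finset.sum_range_succ, Finset.sum_range_succ]
    set A := ∑ i ∈ Finset.range N, a i with hA
    set Q := ∑ i ∈ Finset.range N, (a i)⁻¹ * coeff (gradWedge (l i) Θ) with hQ
    set L := ∑ i ∈ Finset.range N, l i with hL
    have haN := ha N
    have hq := hΘ (l N)
    rcases Nat.eq_zero_or_pos N with h0 | h0
    · have hL0 : L = 0 := by rw [hL, h0]; simp
      have hA0 : A = 0 := by rw [hA, h0]; simp
      have hQ0 : Q = 0 := by rw [hQ, h0]; simp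
      rw [hL0, hA0, hQ0, zero_add, zero_add, zero_add]
      field_simp
      exact le_rfl
    · have hApos : 0 < A := Finset.sum_pos (fun i _ => ha i) ⟨0, by simpa using h0⟩
      have h1 := gradWedge_add_le Θ hΘ L (l N) (c := a N / A) (by positivity)
      have h2 : (1 + a N / A) * coeff (gradWedge L Θ) ≤ (1 + a N / A) * (A * Q) := by gcongr
      have h3 : (1 + a N / A) * (A * Q) + (1 + 1 / (a N / A)) * coeff (gradWedge (l N) Θ)
          = (A + a N) * (Q + (a N)⁻¹ * coeff (gradWedge (l N) Θ)) := by
        field_simp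
        ring
      linarith

lemma coeff_gradWedge_tsum_le {Θ : Alt k n} (hΘ : ∀ l : Covec k, 0 ≤ coeff (gradWedge l Θ))
    {a : ℕ → ℝ} (ha : ∀ i, 0 < a i) {s : ℝ} (hs : HasSum a s) {l : ℕ → Covec k}
    (hl : Summable l) (hq : Summable fun i => (a i)⁻¹ * coeff (gradWedge (l i) Θ)) :
    coeff (gradWedge (∑' i, l i) Θ) ≤ s * ∑' i, (a i)⁻¹ * coeff (gradWedge (l i) Θ) := by
  have h1 : Filter.Tendsto (fun N => coeff (gradWedge (∑ i ∈ Finset.range N, l i) Θ)) Filter.atTop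
      (nhds (coeff (gradWedge (∑' i, l i) Θ))) := by
    have hc : Continuous fun m : Covec k => coeff (gradWedge m Θ) := by
      have h2 := (continuous_coeff_gradWedge (k := k) (n := n)).comp
        (Continuous.prodMk continuous_id (continuous_const (y := Θ)))
      exact h2
    exact (hc.tendsto _).comp hl.hasSum.tendsto_sum_nat
  exact le_of_tendsto_of_tendsto' h1 (hs.tendsto_sum_nat.mul hq.hasSum.tendsto_sum_nat)
    fun N => coeff_gradWedge_sum_le hΘ ha l N

section Series

variable {X : Type*} [TopologicalSpace X] [ChartedSpace (Cn k) X] [IsManifold 𝓘(ℂ, Cn k) ω X]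
  {e : OpenPartialHomeomorph X (Cn k)} [T2Space X] [MeasurableSpace X] [BorelSpace X]
  (Ω : KahlerForm k X)

lemma exists_formIn_bound (he : e ∈ atlas (Cn k) X) (Θ : TestForm k n X)
    (hs : tsupport Θ.1 ⊆ e.source) : ∃ M : ℝ, 0 ≤ M ∧ ∀ y ∈ e.target, ‖formIn e Θ.1 y‖ ≤ M := by
  obtain ⟨M, hM⟩ := (contDiff_localForm he Θ.2.1 Θ.2.2 hs).continuous.bounded_above_of_compact_support
    (hasCompactSupport_localForm Θ.2.2 hs)
  refine ⟨M, (norm_nonneg _).trans (hM 0), fun y hy => ?_⟩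
  rw [← localForm_eq hy]
  exact hM y

namespace KahlerForm

variable [LindelofSpace X]

/-- A local `L¹` bound for fields whose square is controlled by an integrable function on `X`. -/
lemma setIntegral_norm_le_of_sq_le (he : e ∈ atlas (Cn k) X) {K : Set (Cn k)} (hK : IsCompact K)
    (hKe : K ⊆ e.target) {E : Type*} [NormedAddCommGroup E] {h : Cn k → E} {G : X → ℝ} {a B : ℝ}
    (hB : 0 ≤ B) (hm : AEStronglyMeasurable h (volume.restrict e.target)) (hG : Integrable G Ω.vol)
    (hG0 : ∀ x, 0 ≤ G x) (ha : 0 < a) (hGa : ∫ x, G x ∂Ω.vol ≤ a ^ 2)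
    (hle : ∀ y ∈ K, ‖h y‖ ^ 2 ≤ B * (Ω.volCoeff e y * G (e.symm y))) :
    IntegrableOn h K ∧ ∫ y in K, ‖h y‖ ≤ (volume.real K + B) / 2 * a := by
  have hp : IntegrableOn (fun y => Ω.volCoeff e y * G (e.symm y)) e.target :=
    (Ω.integrableOn_source_iff he).1 hG.integrableOn
  have hp0 : ∀ y ∈ e.target, 0 ≤ Ω.volCoeff e y * G (e.symm y) := fun y hy =>
    mul_nonneg (Ω.volCoeff_pos he hy).le (hG0 _)
  have hpK : IntegrableOn (fun y => Ω.volCoeff e y * G (e.symm y)) K := hp.mono_set hKe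
  have hb : ∀ y ∈ K, ‖h y‖ ≤ a / 2 + B / (2 * a) * (Ω.volCoeff e y * G (e.symm y)) := by
    intro y hy
    have h1 := hle y hy
    have h2 : ‖h y‖ ≤ a / 2 + ‖h y‖ ^ 2 / (2 * a) := by
      have h3 : a / 2 + ‖h y‖ ^ 2 / (2 * a) - ‖h y‖ = (‖h y‖ - a) ^ 2 / (2 * a) := by
        field_simp
        ring
      have h4 : 0 ≤ (‖h y‖ - a) ^ 2 / (2 * a) := by positivity
      linarith
    have h5 : ‖h y‖ ^ 2 / (2 * a) ≤ B * (Ω.volCoeff e y * G (e.symm y)) / (2 * a) := by gcongr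
    calc _ ≤ _ := h2
      _ ≤ a / 2 + B * (Ω.volCoeff e y * G (e.symm y)) / (2 * a) := by gcongr
      _ = _ := by ring
  have hc : IntegrableOn (fun _ : Cn k => a / 2) K := integrableOn_const hK.measure_lt_top.ne
  have hI : IntegrableOn (fun y => a / 2 + B / (2 * a) * (Ω.volCoeff e y * G (e.symm y))) K :=
    hc.add (hpK.const_mul _)
  have hh : IntegrableOn h K := Integrable.mono' hI (hm.mono_measure (Measure.restrict_mono hKe le_rfl))
    ((ae_restrict_iff' hK.measurableSet).2 (.of_forall hb))
  refine ⟨hh, ?_⟩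
  calc ∫ y in K, ‖h y‖ ≤ ∫ y in K, (a / 2 + B / (2 * a) * (Ω.volCoeff e y * G (e.symm y))) :=
        setIntegral_mono_on hh.norm hI hK.measurableSet hb
    _ = a / 2 * volume.real K + B / (2 * a) * ∫ y in K, Ω.volCoeff e y * G (e.symm y) := by
        rw [integral_add hc (hpK.const_mul _),
          integral_const_mul, setIntegral_const, smul_eq_mul, mul_comm (volume.real K)]
    _ ≤ a / 2 * volume.real K + B / (2 * a) * a ^ 2 := by
        gcongr
        calc _ ≤ ∫ y in e.target, Ω.volCoeff e y * G (e.symm y) :=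
              setIntegral_mono_set hp ((ae_restrict_iff' e.open_target.measurableSet).2
                (.of_forall hp0)) hKe.eventuallyLE
          _ = ∫ x in e.source, G x ∂Ω.vol := (Ω.setIntegral_source he G).symm
          _ ≤ ∫ x, G x ∂Ω.vol := setIntegral_le_integral hG (.of_forall hG0)
          _ ≤ a ^ 2 := hGa
    _ = (volume.real K + B) / 2 * a := by field_simp

lemma exists_setIntegral_fun_le (he : e ∈ atlas (Cn k) X) {K : Set (Cn k)} (hK : IsCompact K)
    (hKe : K ⊆ e.target) : ∃ C : ℝ, ∀ (f : X → ℝ) (a : ℝ), MemLp f 2 Ω.vol → 0 < a →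
      ∫ x, f x ^ 2 ∂Ω.vol ≤ a ^ 2 →
      IntegrableOn (f ∘ e.symm) K ∧ ∫ y in K, ‖f (e.symm y)‖ ≤ C * a := by
  obtain ⟨B, hB⟩ := hK.exists_bound_of_continuousOn (f := fun y => (Ω.volCoeff e y)⁻¹)
    (((Ω.volCoeff_contDiffOn he).continuousOn.mono hKe).inv₀
      fun y hy => (Ω.volCoeff_pos he (hKe hy)).ne')
  refine ⟨(volume.real K + |B|) / 2, fun f a hf ha hfa => ?_⟩
  refine Ω.setIntegral_norm_le_of_sq_le he hK hKe (h := f ∘ e.symm) (abs_nonneg B)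
    ((Ω.aestronglyMeasurable_source_iff he).1 hf.1.restrict)
    ((memLp_two_iff_integrable_sq hf.1).1 hf) (fun x => sq_nonneg _) ha hfa fun y hy => ?_
  have h1 := Ω.volCoeff_pos he (hKe hy)
  have h2 : (Ω.volCoeff e y)⁻¹ ≤ |B| := (le_abs_self _).trans ((hB y hy).trans (le_abs_self B))
  rw [Function.comp_apply, Real.norm_eq_abs, sq_abs, ← mul_assoc]
  refine le_mul_of_one_le_left (sq_nonneg _) ?_
  rwa [inv_le_iff_one_le_mul₀ h1] at h2

variable [SigmaCompactSpace X]

lemma exists_setIntegral_covecIn_le (hk : 1 ≤ k) (he : e ∈ atlas (Cn k) X) {K : Set (Cn k)}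
    (hK : IsCompact K) (hKe : K ⊆ e.target) : ∃ C : ℝ, ∀ (θ : X → Covec k) (T : PreCurrent k X)
      (a : ℝ), (∀ e ∈ atlas (Cn k) X, AEStronglyMeasurable (covecIn e θ)
        (volume.restrict e.target)) → GradLE θ T → 0 < a → Ω.mass T ≤ ENNReal.ofReal (a ^ 2) →
      IntegrableOn (covecIn e θ) K ∧ ∫ y in K, ‖covecIn e θ y‖ ≤ C * a := by
  have hcont : ContinuousOn
      (fun y => 2 * (k : ℝ) * ‖formIn e Ω.toForm y‖ / Ω.volCoeff e y) K := by
    refine ContinuousOn.div (continuousOn_const.mul ?_)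
      ((Ω.volCoeff_contDiffOn he).continuousOn.mono hKe)
      fun y hy => (Ω.volCoeff_pos he (hKe hy)).ne'
    exact ((Ω.smooth e he).continuousOn.mono hKe).norm
  obtain ⟨B, hB⟩ := hK.exists_bound_of_continuousOn hcont
  refine ⟨(volume.real K + |B|) / 2, fun θ T a hm hθ ha hT => ?_⟩
  have hTt : Ω.mass T ≠ ⊤ := (hT.trans_lt ENNReal.ofReal_lt_top).ne
  obtain ⟨i1, i2⟩ := Ω.integrable_gradDens hk hm hθ hTt
  have i3 : (Ω.mass T).toReal ≤ a ^ 2 := ENNReal.toReal_le_of_le_ofReal (by positivity) hT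
  refine Ω.setIntegral_norm_le_of_sq_le he hK hKe (abs_nonneg B) (hm e he) i1
    (Ω.gradDens_nonneg hk θ) ha (i2.trans i3) fun y hy => ?_
  have hy' := hKe hy
  rw [gradDens, Ω.volCoeff_mul_dens (by omega) he _ hy', formIn_gradWedge he θ _ hy', formIn_pow]
  have hηp : ∀ v : Cn k, v ≠ 0 → 0 < formIn e Ω.toForm y ![v, Complex.I • v] :=
    fun v hv => Ω.formIn_pos he hy' hv
  refine (norm_sq_le_of_pos hk (Ω.isDiagonal_formIn he hy') hηp _).trans ?_
  refine mul_le_mul_of_nonneg_right ?_ (coeff_gradWedge_powForm_nonneg hk hηp _)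
  have h6 := (le_abs_self _).trans ((hB y hy).trans (le_abs_self B))
  rwa [volCoeff, formIn_pow] at h6

end KahlerForm

end Series

end

section

variable {k n : ℕ}

/-! ### Series of currents -/

section SeriesCurrent

variable {X : Type*} [TopologicalSpace X] [ChartedSpace (Cn k) X] [IsManifold 𝓘(ℂ, Cn k) ω X]
  {e : OpenPartialHomeomorph X (Cn k)} [T2Space X] [MeasurableSpace X] [BorelSpace X]
  (Ω : KahlerForm k X)

/-- The current `s ∑ Tₙ / aₙ`. If `Tₙ` bounds `i∂φₙ ∧ ∂̄φₙ` and `s = ∑ aₙ`, it bounds `i∂φ ∧ ∂̄φ` for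
`φ = ∑ φₙ`. -/
def seriesCurrent (a : ℕ → ℝ) (s : ℝ) (T : ℕ → PreCurrent k X)
    (h : ∀ Θ, Summable fun n => (a n)⁻¹ * T n Θ) : PreCurrent k X where
  toFun Θ := s * ∑' n, (a n)⁻¹ * T n Θ
  map_add' Θ Θ' := by
    rw [← mul_add, ← (h Θ).tsum_add (h Θ')]
    simp only [map_add, mul_add]
  map_smul' c Θ := by
    simp only [map_smul, smul_eq_mul, RingHom.id_apply, mul_left_comm _ c, tsum_mul_left]

lemma seriesCurrent_apply (a : ℕ → ℝ) (s : ℝ) (T : ℕ → PreCurrent k X)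
    (h : ∀ Θ, Summable fun n => (a n)⁻¹ * T n Θ) (Θ : TestForm k (2 * (k - 1)) X) :
    seriesCurrent a s T h Θ = s * ∑' n, (a n)⁻¹ * T n Θ := rfl

namespace KahlerForm

variable [LindelofSpace X]

lemma exists_series_bound (hk : 1 ≤ k) (he : e ∈ atlas (Cn k) X) {K : Set X} (hK : IsCompact K)
    (hKe : K ⊆ e.source) : ∃ C : ℝ, 0 ≤ C ∧ ∀ T : PreCurrent k X, IsBidegreeOneOne T →
      (∀ Θ : TestForm k (2 * (k - 1)) X, (∀ x, IsPositiveAlt (Θ.1 x)) → 0 ≤ T Θ) →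
      ∀ a : ℝ, 0 < a → Ω.mass T ≤ ENNReal.ofReal (a ^ 2) →
      ∀ (Θ : TestForm k (2 * (k - 1)) X) (M : ℝ), 0 ≤ M →
        Function.support Θ.1 ⊆ K → (∀ y ∈ e.target, ‖formIn e Θ.1 y‖ ≤ M) →
        |a⁻¹ * T Θ| ≤ C * M * a := by
  obtain ⟨C, hC, h⟩ := exists_current_bound Ω hk he hK hKe
  refine ⟨C, hC, fun T hT hpos a ha hm Θ M hM hs hb => ?_⟩
  have hTt : Ω.mass T ≠ ⊤ := (hm.trans_lt ENNReal.ofReal_lt_top).ne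
  have h1 := h T hT hpos hTt Θ M hM hs hb
  have h2 : (Ω.mass T).toReal ≤ a ^ 2 := ENNReal.toReal_le_of_le_ofReal (by positivity) hm
  rw [abs_mul, abs_of_pos (inv_pos.2 ha), inv_mul_le_iff₀ ha]
  calc _ ≤ _ := h1
    _ ≤ C * M * a ^ 2 := by gcongr
    _ = a * (C * M * a) := by ring

lemma ofReal_apply_le_mass (T : PreCurrent k X) {χ : X → ℝ} (hχ : ∀ x, χ x ∈ Icc (0 : ℝ) 1)
    {Θ : TestForm k (2 * (k - 1)) X} (hΘ : ∀ x, Θ.1 x = χ x • Ω.pow (k - 1) x) :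
    ENNReal.ofReal (T Θ) ≤ Ω.mass T := by
  refine le_iSup_of_le χ (le_iSup_of_le hχ (le_iSup_of_le Θ ?_))
  exact le_iSup (fun _ : ∀ x, Θ.1 x = χ x • Ω.pow (k - 1) x => ENNReal.ofReal (T Θ)) hΘ

variable {a : ℕ → ℝ} {s : ℝ} {T : ℕ → PreCurrent k X}

lemma summable_series (hk : 1 ≤ k) (ha : ∀ n, 0 < a n) (hs : HasSum a s)
    (hT : ∀ n, IsBidegreeOneOne (T n))
    (hpos : ∀ n, ∀ Θ : TestForm k (2 * (k - 1)) X, (∀ x, IsPositiveAlt (Θ.1 x)) → 0 ≤ T n Θ)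
    (hm : ∀ n, Ω.mass (T n) ≤ ENNReal.ofReal (a n ^ 2)) (Θ : TestForm k (2 * (k - 1)) X) :
    Summable fun n => (a n)⁻¹ * T n Θ := by
  obtain ⟨N, ρ, c, Φ, h1, h2⟩ := exists_testForm_decomposition Θ
  have key : ∀ i, Summable fun n => (a n)⁻¹ * T n (Φ i) := by
    intro i
    have he := chart_mem_atlas (Cn k) (c i)
    obtain ⟨M, hM, hMb⟩ := exists_formIn_bound he (Φ i) (h1 i).2.2
    obtain ⟨C, hC, hCb⟩ := Ω.exists_series_bound hk he (Φ i).2.2 (h1 i).2.2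
    refine Summable.of_norm_bounded (g := fun n => C * M * a n) (hs.summable.mul_left _) fun n => ?_
    exact hCb (T n) (hT n) (hpos n) (a n) (ha n) (hm n) (Φ i) M hM (subset_tsupport _) hMb
  have h3 : (fun n => (a n)⁻¹ * T n Θ) = fun n => ∑ i, (a n)⁻¹ * T n (Φ i) := by
    ext n
    conv_lhs => rw [h2]
    rw [map_sum, Finset.mul_sum]
  rw [h3]
  exact summable_sum fun i _ => key i

lemma seriesCurrent_mem (hk : 1 ≤ k) (ha : ∀ n, 0 < a n) (hs : HasSum a s)
    (hT : ∀ n, T n ∈ ClosedCurrent k X)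
    (hpos : ∀ n, ∀ Θ : TestForm k (2 * (k - 1)) X, (∀ x, IsPositiveAlt (Θ.1 x)) → 0 ≤ T n Θ)
    (hm : ∀ n, Ω.mass (T n) ≤ ENNReal.ofReal (a n ^ 2))
    (h : ∀ Θ, Summable fun n => (a n)⁻¹ * T n Θ) : seriesCurrent a s T h ∈ ClosedCurrent k X := by
  refine ⟨fun e he K hK hKe => ?_, fun b hb Θ Θ' hΘ => ?_, fun n hn α Θ hΘ => ?_⟩
  · obtain ⟨C, hC, hCb⟩ := Ω.exists_series_bound hk he hK hKe
    refine ⟨0, |s| * (C * s), fun Θ M hM hΘ hb => ?_⟩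
    have hb' : ∀ y ∈ e.target, ‖formIn e Θ.1 y‖ ≤ M := fun y hy => by
      have := hb 0 le_rfl y hy
      rwa [norm_iteratedFDeriv_zero] at this
    have h1 : ∀ n, ‖(a n)⁻¹ * T n Θ‖ ≤ C * M * a n := fun n =>
      hCb (T n) (hT n).2.1 (hpos n) (a n) (ha n) (hm n) Θ M hM ((subset_tsupport _).trans hΘ) hb'
    have h2 := tsum_of_norm_bounded (hs.mul_left (C * M)) h1
    rw [seriesCurrent_apply, abs_mul, ← Real.norm_eq_abs (∑' _, _)]
    calc _ ≤ |s| * (C * M * s) := by gcongr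
      _ = |s| * (C * s) * M := by ring
  · simp only [seriesCurrent_apply, (hT _).2.1 b hb Θ Θ' hΘ]
  · simp only [seriesCurrent_apply, (hT _).2.2 n hn α Θ hΘ, mul_zero, tsum_zero]

lemma mass_seriesCurrent_le (ha : ∀ n, 0 < a n) (hs : HasSum a s)
    (hm : ∀ n, Ω.mass (T n) ≤ ENNReal.ofReal (a n ^ 2))
    (h : ∀ Θ, Summable fun n => (a n)⁻¹ * T n Θ) :
    Ω.mass (seriesCurrent a s T h) ≤ ENNReal.ofReal (s ^ 2) := by
  refine iSup_le fun χ => iSup_le fun hχ => iSup_le fun Θ => iSup_le fun hΘ => ?_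
  have hs0 : 0 ≤ s := hs.nonneg fun n => (ha n).le
  refine ENNReal.ofReal_le_ofReal ?_
  have h1 : ∀ n, (a n)⁻¹ * T n Θ ≤ a n := by
    intro n
    have h2 : ENNReal.ofReal (T n Θ) ≤ ENNReal.ofReal (a n ^ 2) :=
      (Ω.ofReal_apply_le_mass (T n) hχ hΘ).trans (hm n)
    rw [ENNReal.ofReal_le_ofReal_iff (sq_nonneg _)] at h2
    rw [inv_mul_le_iff₀ (ha n)]
    linarith [sq (a n)]
  rw [seriesCurrent_apply, sq]
  gcongr
  exact hasSum_le h1 (h Θ).hasSum hs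

variable [SigmaCompactSpace X]

/-- A series of elements of `W^*` with summable norms converges to an element of `W^*`, with a bound
of the energy of the sum. -/
lemma exists_admissible_tsum (hk : 1 ≤ k) (ha : ∀ n, 0 < a n) (hs : HasSum a s)
    {u : ℕ → Lp ℝ 2 Ω.vol} (hu : ∀ n, ‖u n‖ ≤ a n) (hT : ∀ n, T n ∈ ClosedCurrent k X)
    (hA : ∀ n, Ω.Admissible (u n) (T n))
    (hm : ∀ n, Ω.mass (T n) ≤ ENNReal.ofReal (a n ^ 2)) :
    ∃ S ∈ ClosedCurrent k X, Ω.Admissible (∑' n, u n) S ∧ Ω.mass S ≤ ENNReal.ofReal (s ^ 2) := by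
  choose f θ hf hw hsq hg using hA
  have hmeas : ∀ n, ∀ e ∈ atlas (Cn k) X,
      AEStronglyMeasurable (covecIn e (θ n)) (volume.restrict e.target) := fun n e he =>
    (hw n e he).2.1.aestronglyMeasurable
  have hpos : ∀ n, ∀ Θ : TestForm k (2 * (k - 1)) X, (∀ x, IsPositiveAlt (Θ.1 x)) → 0 ≤ T n Θ :=
    fun n Θ hΘ => current_nonneg Ω hk (hg n) Θ hΘ
  have hsum := Ω.summable_series hk ha hs (fun n => (hT n).2.1) hpos hm
  set S := seriesCurrent a s T hsum with hS
  have hSm : Ω.mass S ≤ ENNReal.ofReal (s ^ 2) := Ω.mass_seriesCurrent_le ha hs hm hsum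
  have hs0 : 0 ≤ s := hs.nonneg fun n => (ha n).le
  refine ⟨S, Ω.seriesCurrent_mem hk ha hs hT hpos hm hsum, ?_, hSm⟩
  -- On compact subsets of charts, the `L¹` norms of `fₙ` and `θₙ` are at most a multiple of `aₙ`.
  have hfL : ∀ n, MemLp (f n) 2 Ω.vol := fun n => (memLp_congr_ae (hf n)).2 (Lp.memLp (u n))
  have hfI : ∀ n, ∫ x, f n x ^ 2 ∂Ω.vol ≤ a n ^ 2 := by
    intro n
    have h1 : ∫ x, f n x ^ 2 ∂Ω.vol = ‖u n‖ ^ 2 := by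
      have h2 := L2.inner_def (𝕜 := ℝ) (u n) (u n)
      rw [real_inner_self_eq_norm_sq] at h2
      rw [h2]
      refine integral_congr_ae ?_
      filter_upwards [hf n] with x hx
      rw [hx]
      simp [sq]
    rw [h1]
    have := hu n
    gcongr
  have hFK : ∀ e ∈ atlas (Cn k) X, ∀ K ⊆ e.target, IsCompact K →
      (∀ n, IntegrableOn (f n ∘ e.symm) K) ∧
        Summable fun n => ∫ y in K, ‖(f n ∘ e.symm) y‖ := by
    intro e he K hKe hK
    obtain ⟨C, hC⟩ := Ω.exists_setIntegral_fun_le he hK hKe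
    have h1 := fun n => hC (f n) (a n) (hfL n) (ha n) (hfI n)
    exact ⟨fun n => (h1 n).1, Summable.of_nonneg_of_le
      (fun n => integral_nonneg fun y => norm_nonneg _) (fun n => (h1 n).2)
      (hs.summable.mul_left C)⟩
  have hθK : ∀ e ∈ atlas (Cn k) X, ∀ K ⊆ e.target, IsCompact K →
      (∀ n, IntegrableOn (covecIn e (θ n)) K) ∧
        Summable fun n => ∫ y in K, ‖covecIn e (θ n) y‖ := by
    intro e he K hKe hK
    obtain ⟨C, hC⟩ := Ω.exists_setIntegral_covecIn_le hk he hK hKe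
    have h1 := fun n => hC (θ n) (T n) (a n) (hmeas n) (hg n) (ha n) (hm n)
    exact ⟨fun n => (h1 n).1, Summable.of_nonneg_of_le
      (fun n => integral_nonneg fun y => norm_nonneg _) (fun n => (h1 n).2)
      (hs.summable.mul_left C)⟩
  -- Hence both series converge in `L¹` on these sets, and `F` has the weak differential `η`.
  set F : X → ℝ := fun x => ∑' n, f n x with hF
  set η : X → Covec k := fun x => ∑' n, θ n x with hη
  have hηe : ∀ e ∈ atlas (Cn k) X, ∀ᵐ y ∂(volume.restrict e.target),
      Summable (fun n => covecIn e (θ n) y) ∧ covecIn e η y = ∑' n, covecIn e (θ n) y := by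
    intro e he
    have h1 : ∀ᵐ y ∂(volume.restrict e.target), Summable fun n => ‖covecIn e (θ n) y‖ :=
      ae_restrict_of_compact e.open_target fun K hKe hK =>
        (integrable_tsum_of_summable (hθK e he K hKe hK).1 (hθK e he K hKe hK).2).1
    filter_upwards [h1, ae_restrict_mem e.open_target.measurableSet] with y hy hye
    have h2 := hy.of_norm
    refine ⟨h2, ?_⟩
    have h3 : Summable fun n => θ n (e.symm y) := by
      have h4 := h2.map (ContinuousLinearMap.precomp ℝ (frameInv e (e.symm y)))
        (ContinuousLinearMap.continuous _)
      refine h4.congr fun n => ?_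
      change (covecIn e (θ n) y).comp _ = _
      rw [covecIn, ContinuousLinearMap.comp_assoc, chartFrame_comp_frameInv he hye]
      rfl
    exact (ContinuousLinearMap.precomp ℝ (chartFrame e y)).map_tsum h3
  have hwd : IsWeakDifferential F η := by
    intro e he
    have hFK' : ∀ K ⊆ e.target, IsCompact K → IntegrableOn (F ∘ e.symm) K := fun K hKe hK =>
      (integrable_tsum_of_summable (hFK e he K hKe hK).1 (hFK e he K hKe hK).2).2
    refine ⟨(locallyIntegrableOn_iff e.open_target.isLocallyClosed).2 hFK',
      (locallyIntegrableOn_iff e.open_target.isLocallyClosed).2 fun K hKe hK => ?_,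
      fun g hgs hgc hgt v => ?_⟩
    · refine (integrable_tsum_of_summable (hθK e he K hKe hK).1 (hθK e he K hKe hK).2).2.congr ?_
      filter_upwards [ae_restrict_of_ae_restrict_of_subset hKe (hηe e he)] with y hy
      exact hy.2.symm
    · set K := tsupport g with hK
      have hg0 : ∀ y ∉ K, g y = 0 := fun y hy => image_eq_zero_of_notMem_tsupport hy
      have hdg0 : ∀ y ∉ K, fderiv ℝ g y v = 0 := fun y hy => by
        rw [(notMem_tsupport_iff_eventuallyEq.1 hy).fderiv_eq]
        simp
      have hred : ∀ (p q : Cn k → ℝ), (∀ y ∉ K, q y = 0) →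
          ∫ y in e.target, p y * q y = ∫ y in K, p y * q y := fun p q hq =>
        setIntegral_eq_of_subset_of_forall_sdiff_eq_zero e.open_target.measurableSet hgt
          fun y hy => by rw [hq y hy.2, mul_zero]
      have hser : ∀ {p : ℕ → Cn k → ℝ} {q : Cn k → ℝ}, Continuous q → HasCompactSupport q →
          (∀ n, IntegrableOn (p n) K) → (Summable fun n => ∫ y in K, ‖p n y‖) →
          HasSum (fun n => ∫ y in K, p n y * q y) (∫ y in K, ∑' n, p n y * q y) := by
        intro p q hq hqc hp1 hp2
        obtain ⟨M, hM⟩ := hq.bounded_above_of_compact_support hqc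
        have hM0 : 0 ≤ M := (norm_nonneg _).trans (hM 0)
        have hi : ∀ n, IntegrableOn (fun y => p n y * q y) K := fun n =>
          Integrable.mul_bdd (c := M) (hp1 n) hq.aestronglyMeasurable (.of_forall hM)
        refine hasSum_integral_of_summable_integral_norm hi ?_
        refine Summable.of_nonneg_of_le (fun n => integral_nonneg fun y => norm_nonneg _)
          (fun n => ?_) (hp2.mul_left M)
        rw [← integral_const_mul]
        refine integral_mono (hi n).norm ((hp1 n).norm.const_mul M) fun y => ?_
        simp only [norm_mul]
        rw [mul_comm]
        gcongr
        exact hM y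
      have hdg : Continuous fun y => fderiv ℝ g y v :=
        (hgs.continuous_fderiv (by simp)).clm_apply continuous_const
      have s1 := hser hdg (hgc.fderiv_apply ℝ v) (hFK e he K hgt hgc).1 (hFK e he K hgt hgc).2
      have hθv : ∀ n, IntegrableOn (fun y => covecIn e (θ n) y v) K := fun n =>
        ((hθK e he K hgt hgc).1 n).apply_continuousLinearMap v
      have s2 := hser (p := fun n y => covecIn e (θ n) y v) hgs.continuous hgc hθv (by
        refine Summable.of_nonneg_of_le (fun n => integral_nonneg fun y => norm_nonneg _)
          (fun n => ?_) ((hθK e he K hgt hgc).2.mul_right ‖v‖)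
        rw [← integral_mul_const]
        exact integral_mono (hθv n).norm (((hθK e he K hgt hgc).1 n).norm.mul_const _)
          fun y => (covecIn e (θ n) y).le_opNorm v)
      rw [hred _ _ hdg0, hred _ _ hg0]
      have e1 : ∫ y in K, F (e.symm y) * fderiv ℝ g y v
          = ∫ y in K, ∑' n, (f n ∘ e.symm) y * fderiv ℝ g y v := by
        simp only [hF, Function.comp_apply, tsum_mul_right]
      have e2 : ∫ y in K, covecIn e η y v * g y
          = ∫ y in K, ∑' n, covecIn e (θ n) y v * g y := by
        refine integral_congr_ae ?_
        filter_upwards [ae_restrict_of_ae_restrict_of_subset hgt (hηe e he)] with y hy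
        rw [tsum_mul_right, hy.2]
        congr 1
        exact (ContinuousLinearMap.apply ℝ ℝ v).map_tsum hy.1
      rw [e1, e2, ← s1.tsum_eq, ← s2.tsum_eq, ← tsum_neg]
      refine tsum_congr fun n => ?_
      have h1 := (hw n e he).2.2 g hgs hgc hgt v
      rw [hred _ _ hdg0, hred _ _ hg0] at h1
      exact h1
  have hmη : ∀ e ∈ atlas (Cn k) X,
      AEStronglyMeasurable (covecIn e η) (volume.restrict e.target) := fun e he =>
    (hwd e he).2.1.aestronglyMeasurable
  have hgrad : GradLE η S := by
    intro e he Θ hΘs hΘ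
    set q : (Cn k → Covec k) → Cn k → ℝ := fun l y => coeff (gradWedge (l y) (formIn e Θ.1 y)) with hq
    have h1 : ∀ n, IntegrableOn (q (covecIn e (θ n))) e.target ∧
        ∫ y in e.target, q (covecIn e (θ n)) y ≤ T n Θ := fun n => hg n e he Θ hΘs hΘ
    have h2 : ∀ n, IntegrableOn (fun y => (a n)⁻¹ * q (covecIn e (θ n)) y) e.target := fun n =>
      (h1 n).1.const_mul _
    have hq0 : ∀ y ∈ e.target, ∀ l : Covec k, 0 ≤ coeff (gradWedge l (formIn e Θ.1 y)) :=
      fun y hy => (hΘ e he y hy).2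
    have hI : ∀ n, ∫ y in e.target, ‖(a n)⁻¹ * q (covecIn e (θ n)) y‖
        = ∫ y in e.target, (a n)⁻¹ * q (covecIn e (θ n)) y := fun n =>
      setIntegral_congr_fun e.open_target.measurableSet fun y hy => by
        rw [Real.norm_eq_abs, abs_of_nonneg (mul_nonneg (inv_pos.2 (ha n)).le (hq0 y hy _))]
    have hle : ∀ n, ∫ y in e.target, (a n)⁻¹ * q (covecIn e (θ n)) y ≤ (a n)⁻¹ * T n Θ := by
      intro n
      rw [integral_const_mul]
      exact mul_le_mul_of_nonneg_left (h1 n).2 (inv_pos.2 (ha n)).le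
    have h3 : Summable fun n => ∫ y in e.target, ‖(a n)⁻¹ * q (covecIn e (θ n)) y‖ :=
      Summable.of_nonneg_of_le (fun n => integral_nonneg fun y => norm_nonneg _)
        (fun n => (hI n).trans_le (hle n)) (hsum Θ)
    obtain ⟨h4, h5⟩ := integrable_tsum_of_summable h2 h3
    have h6 := hasSum_integral_of_summable_integral_norm h2 h3
    have h7 : ∀ᵐ y ∂(volume.restrict e.target),
        q (covecIn e η) y ≤ s * ∑' n, (a n)⁻¹ * q (covecIn e (θ n)) y := by
      filter_upwards [h4, hηe e he, ae_restrict_mem e.open_target.measurableSet] with y hy1 hy2 hy3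
      simp only [hq]
      rw [hy2.2]
      exact coeff_gradWedge_tsum_le (hq0 y hy3) ha hs hy2.1 hy1.of_norm
    have h8 : IntegrableOn (q (covecIn e η)) e.target := by
      refine Integrable.mono' (h5.const_mul s) (aestronglyMeasurable_coeff_gradWedge (hmη e he)
        (aestronglyMeasurable_of_contDiffOn e.open_target (Θ.2.1 e he))) ?_
      filter_upwards [h7, ae_restrict_mem e.open_target.measurableSet] with y hy1 hy2
      rw [Real.norm_eq_abs, abs_of_nonneg (hq0 y hy2 _)]
      exact hy1
    refine ⟨h8, ?_⟩
    calc ∫ y in e.target, q (covecIn e η) y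
        ≤ ∫ y in e.target, s * ∑' n, (a n)⁻¹ * q (covecIn e (θ n)) y :=
          integral_mono_ae h8 (h5.const_mul s) h7
      _ = s * ∑' n, ∫ y in e.target, (a n)⁻¹ * q (covecIn e (θ n)) y := by
          rw [integral_const_mul, h6.tsum_eq]
      _ ≤ s * ∑' n, (a n)⁻¹ * T n Θ :=
          mul_le_mul_of_nonneg_left (hasSum_le hle h6.summable.hasSum (hsum Θ).hasSum) hs0
      _ = S Θ := rfl
  have hun : ∑' n, ‖u n‖ₑ ≠ ⊤ := by
    have h1 : Summable fun n => ‖u n‖ :=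
      Summable.of_nonneg_of_le (fun n => norm_nonneg _) hu hs.summable
    simpa only [ofReal_norm] using h1.tsum_ofReal_ne_top
  refine ⟨F, η, ?_, hwd, Ω.sqIntegrable_of_gradLE hk hmη hgrad
    (hSm.trans_lt ENNReal.ofReal_lt_top).ne, hgrad⟩
  filter_upwards [Lp.coeFn_tsum hun, ae_all_iff.2 hf] with x h1 h2
  rw [h1]
  exact tsum_congr h2

end KahlerForm

end SeriesCurrent

/-! ### Completeness -/

section Complete

variable {X : Type*} [TopologicalSpace X] [ChartedSpace (Cn k) X] [IsManifold 𝓘(ℂ, Cn k) ω X]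
  [T2Space X] [MeasurableSpace X] [BorelSpace X] [SigmaCompactSpace X] {Ω : KahlerForm k X}

namespace KahlerForm

/-- The inclusion of `W^*` in `L²`. -/
def toLpL : Ω.WStar →L[ℝ] Lp ℝ 2 Ω.vol :=
  LinearMap.mkContinuous
    { toFun := WStar.toLp
      map_add' := fun _ _ => rfl
      map_smul' := fun _ _ => rfl } 1 fun φ => by
    rw [one_mul, WStar.norm_def]
    exact Real.le_sqrt_of_sq_le (le_add_of_nonneg_right ENNReal.toReal_nonneg)

lemma WStar.norm_le_of_admissible {φ : Ω.WStar} {T : PreCurrent k X} (hT : T ∈ ClosedCurrent k X)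
    (hA : Ω.Admissible φ.toLp T) {r s : ℝ} (hr : ‖φ.toLp‖ ≤ r) (hs : 0 ≤ s)
    (hm : Ω.mass T ≤ ENNReal.ofReal (s ^ 2)) : ‖φ‖ ≤ r + s := by
  have hr0 : 0 ≤ r := (norm_nonneg _).trans hr
  rw [WStar.norm_def]
  refine (Real.sqrt_le_left (by positivity)).2 ?_
  have h1 : (Ω.energy φ.toLp).toReal ≤ s ^ 2 :=
    ENNReal.toReal_le_of_le_ofReal (by positivity) ((energy_le hT hA).trans hm)
  have h2 : ‖φ.toLp‖ ^ 2 ≤ r ^ 2 := by gcongr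
  nlinarith

/-- `W^*` is a Banach space: absolutely convergent series converge, with the sum given by
`exists_admissible_tsum`, which applied to the tails also gives the convergence in `W^*`. -/
lemma completeSpace_wStar (hk : 1 ≤ k) : CompleteSpace Ω.WStar := by
  refine NormedAddCommGroup.completeSpace_of_summable_imp_tendsto fun φ hφ => ?_
  -- The term `2⁻ⁿ` makes the inequality `‖φ n‖ < a n` strict, since the infimum of the masses need not
  -- be attained.
  set a : ℕ → ℝ := fun n => ‖φ n‖ + (1 / 2) ^ n with ha
  have ha0 : ∀ n, 0 < a n := fun n => by positivity
  have has : Summable a := hφ.add summable_geometric_two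
  have hu : ∀ n, ‖(φ n).toLp‖ ≤ a n := by
    intro n
    have h1 : ‖toLpL (φ n)‖ ≤ ‖φ n‖ := by
      simpa using (toLpL (Ω := Ω)).le_of_opNorm_le
        (LinearMap.mkContinuous_norm_le _ zero_le_one _) (φ n)
    exact h1.trans (le_add_of_nonneg_right (by positivity))
  have hen : ∀ n, ∃ T ∈ ClosedCurrent k X, Ω.Admissible (φ n).toLp T ∧
      Ω.mass T < ENNReal.ofReal (a n ^ 2) := by
    intro n
    refine exists_of_energy_lt ?_
    rw [ENNReal.lt_ofReal_iff_toReal_lt (φ n).energy_ne_top]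
    have h1 : ‖φ n‖ ^ 2 = ‖(φ n).toLp‖ ^ 2 + (Ω.energy (φ n).toLp).toReal := by
      rw [WStar.norm_def, Real.sq_sqrt (by positivity)]
    have h2 : ‖φ n‖ < a n := lt_add_of_pos_right _ (by positivity)
    have h3 : ‖φ n‖ ^ 2 < a n ^ 2 := pow_lt_pow_left₀ h2 (norm_nonneg _) two_ne_zero
    nlinarith [sq_nonneg ‖(φ n).toLp‖]
  choose T hT hA hm using hen
  have key : ∀ N, ∃ S ∈ ClosedCurrent k X, Ω.Admissible (∑' n, (φ (n + N)).toLp) S ∧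
      Ω.mass S ≤ ENNReal.ofReal ((∑' n, a (n + N)) ^ 2) := fun N =>
    Ω.exists_admissible_tsum hk (fun n => ha0 (n + N)) ((summable_nat_add_iff N).2 has).hasSum
      (fun n => hu (n + N)) (fun n => hT (n + N)) (fun n => hA (n + N)) fun n => (hm (n + N)).le
  have hus : Summable fun n => (φ n).toLp := Summable.of_norm_bounded has hu
  obtain ⟨S, hS1, hS2, hS3⟩ := key 0
  let ψ : Ω.WStar := ⟨∑' n, (φ n).toLp, S, hS1, hS2, hS3.trans_lt ENNReal.ofReal_lt_top⟩
  refine ⟨ψ, ?_⟩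
  rw [tendsto_iff_norm_sub_tendsto_zero]
  have hb : ∀ N, ‖∑ i ∈ Finset.range N, φ i - ψ‖ ≤ (∑' n, a (n + N)) + ∑' n, a (n + N) := by
    intro N
    obtain ⟨S, hS1, hS2, hS3⟩ := key N
    have h1 : (ψ - ∑ i ∈ Finset.range N, φ i).toLp = ∑' n, (φ (n + N)).toLp := by
      have h2 : toLpL (ψ - ∑ i ∈ Finset.range N, φ i)
          = toLpL ψ - ∑ i ∈ Finset.range N, toLpL (φ i) := by rw [map_sub, map_sum]
      have h3 := hus.sum_add_tsum_nat_add N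
      exact h2.trans (sub_eq_iff_eq_add'.2 h3.symm)
    rw [norm_sub_rev]
    rw [← h1] at hS2
    have h4 := ((summable_nat_add_iff N).2 has)
    refine WStar.norm_le_of_admissible hS1 hS2 ?_ (tsum_nonneg fun n => (ha0 _).le) hS3
    rw [h1]
    exact tsum_of_norm_bounded h4.hasSum fun n => hu (n + N)
  have h0 := tendsto_sum_nat_add a
  refine squeeze_zero (fun N => norm_nonneg _) hb ?_
  simpa using h0.add h0

end KahlerForm

end Complete

end

section

variable {k n : ℕ}

/-! ### Limits in reflexive spaces -/

/-- In a reflexive space `V`, if the images in `H` of a bounded sequence converge then the limit is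
the image of a point of the closed span of the sequence. The point represents the limit along an
ultrafilter in the bidual. -/
lemma IsReflexive.exists_mem_closure_span {V H : Type*} [NormedAddCommGroup V] [NormedSpace ℝ V]
    [NormedAddCommGroup H] [NormedSpace ℝ H] (hV : IsReflexive V) (ι : V →L[ℝ] H) {S : ℕ → V}
    {R : ℝ} (hR : ∀ n, ‖S n‖ ≤ R) {h : H}
    (hS : Filter.Tendsto (fun n => ι (S n)) Filter.atTop (nhds h)) :
    ∃ y : V, ι y = h ∧ y ∈ (Submodule.span ℝ (range S)).topologicalClosure := by
  set U : Ultrafilter ℕ := Filter.hyperfilter ℕ with hU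
  have hUle : (U : Filter ℕ) ≤ Filter.atTop := by
    rw [← Nat.cofinite_eq_atTop]; exact Filter.hyperfilter_le_cofinite
  have hb : ∀ (f : StrongDual ℝ V) n, f (S n) ∈ Icc (-(R * ‖f‖)) (R * ‖f‖) := by
    intro f n
    rw [mem_Icc, ← abs_le, ← Real.norm_eq_abs]
    calc ‖f (S n)‖ ≤ ‖f‖ * ‖S n‖ := f.le_opNorm _
      _ ≤ ‖f‖ * R := by gcongr; exact hR n
      _ = R * ‖f‖ := mul_comm _ _
  have hlim : ∀ f : StrongDual ℝ V, ∃ L ∈ Icc (-(R * ‖f‖)) (R * ‖f‖),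
      Filter.Tendsto (fun n => f (S n)) U (nhds L) := fun f =>
    isCompact_Icc.ultrafilter_le_nhds (U.map fun n => f (S n)) (by
      rw [Filter.le_principal_iff]
      exact Filter.Eventually.of_forall (f := (U : Filter ℕ)) (hb f))
  choose L hL hLt using hlim
  let Λ : StrongDual ℝ (StrongDual ℝ V) := LinearMap.mkContinuous
    { toFun := L
      map_add' := fun f g => tendsto_nhds_unique (hLt (f + g)) ((hLt f).add (hLt g))
      map_smul' := fun c f => tendsto_nhds_unique (hLt (c • f)) ((hLt f).const_mul c) } R
    fun f => by
      rw [Real.norm_eq_abs]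
      exact abs_le.2 (hL f)
  obtain ⟨y, hy⟩ := hV Λ
  have hyf : ∀ f : StrongDual ℝ V, Filter.Tendsto (fun n => f (S n)) U (nhds (f y)) := by
    intro f
    have h1 : f y = L f := by
      have := DFunLike.congr_fun hy f
      rwa [NormedSpace.dual_def] at this
    rw [h1]
    exact hLt f
  refine ⟨y, ?_, ?_⟩
  · rw [← sub_eq_zero]
    refine SeparatingDual.eq_zero_of_forall_dual_eq_zero (R := ℝ) fun g => ?_
    have h1 := hyf (g.comp ι)
    have h2 : Filter.Tendsto (fun n => g (ι (S n))) U (nhds (g h)) :=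
      (g.continuous.tendsto _).comp (hS.mono_left hUle)
    rw [map_sub, sub_eq_zero]
    exact tendsto_nhds_unique h1 h2
  · by_contra hc
    obtain ⟨f, u, h1, h2⟩ := geometric_hahn_banach_closed_point
      (Submodule.span ℝ (range S)).topologicalClosure.convex
      (Submodule.isClosed_topologicalClosure _) hc
    have h3 : ∀ n, f (S n) ≤ u := fun n =>
      (h1 _ (Submodule.le_topologicalClosure _ (Submodule.subset_span ⟨n, rfl⟩))).le
    exact h2.not_ge (le_of_tendsto' (hyf f) h3)

end

section

variable {k n : ℕ}

/-! ### Radial forms on `ℂᵏ` -/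

/-- `contr`, as a continuous linear map. -/
def contrL (η : Alt k 2) : Cn k →L[ℝ] Covec k :=
  ((covecEquiv k).symm : Alt k 1 →L[ℝ] Covec k).comp η.curryLeft

lemma contrL_apply (η : Alt k 2) (v : Cn k) : contrL η v = contr η v := rfl

/-- The squared distance to `z₀`. -/
def radSq (z₀ z : Cn k) : ℝ := ‖z - z₀‖ ^ 2

/-- The form `d^c ‖z - z₀‖²`, normalized by `dd^c ‖z - z₀‖² = 4 ∑ⱼ dx_j ∧ dy_j`. -/
def radCovec (z₀ z : Cn k) : Covec k := (2 : ℝ) • contr (stdForm k) (z - z₀)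

lemma radSq_nonneg (z₀ z : Cn k) : 0 ≤ radSq z₀ z := sq_nonneg _

lemma radCovec_apply (z₀ z v : Cn k) : radCovec z₀ z v = 2 * stdForm k ![z - z₀, v] := by
  simp [radCovec, contr_apply]

lemma hasFDerivAt_radSq (z₀ z : Cn k) :
    HasFDerivAt (radSq z₀) ((radCovec z₀ z).comp (mulC k Complex.I)) z := by
  have h0 : radSq z₀ = fun z => contrL (stdForm k) (z - z₀) (mulC k Complex.I (z - z₀)) := by
    ext w
    rw [contrL_apply, contr_apply, mulC_apply, stdForm_apply_I]
    rfl
  have h1 : HasFDerivAt (fun z : Cn k => z - z₀) (ContinuousLinearMap.id ℝ (Cn k)) z :=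
    (hasFDerivAt_id z).sub_const z₀
  have h2 := ((contrL (stdForm k)).hasFDerivAt.comp z h1).clm_apply
    ((mulC k Complex.I).hasFDerivAt.comp z h1)
  rw [h0]
  refine h2.congr_fderiv ?_
  ext1 v
  have h3 := (isDiagonal_stdForm (k := k)).symm_I v (z - z₀)
  simp only [add_apply, ContinuousLinearMap.comp_apply, ContinuousLinearMap.flip_apply,
    ContinuousLinearMap.id_apply, Function.comp_apply, contrL_apply, contr_apply, mulC_apply,
    radCovec_apply]
  rw [h3]
  ring

lemma contDiff_radCovec (z₀ : Cn k) : ContDiff ℝ ∞ (radCovec z₀) :=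
  ((contrL (stdForm k)).contDiff.comp (contDiff_id.sub contDiff_const)).const_smul (2 : ℝ)

lemma contDiff_radSq (z₀ : Cn k) : ContDiff ℝ ∞ (radSq z₀) := by
  have h0 : radSq z₀ = fun z => contrL (stdForm k) (z - z₀) (mulC k Complex.I (z - z₀)) := by
    ext w
    rw [contrL_apply, contr_apply, mulC_apply, stdForm_apply_I]
    rfl
  rw [h0]
  exact ((contrL (stdForm k)).contDiff.comp (contDiff_id.sub contDiff_const)).clm_apply
    ((mulC k Complex.I).contDiff.comp (contDiff_id.sub contDiff_const))

lemma fderiv_radCovec (z₀ z v : Cn k) :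
    fderiv ℝ (radCovec z₀) z v = (2 : ℝ) • contr (stdForm k) v := by
  have h1 : HasFDerivAt (fun z : Cn k => z - z₀) (ContinuousLinearMap.id ℝ (Cn k)) z :=
    (hasFDerivAt_id z).sub_const z₀
  have h2 := ((contrL (stdForm k)).hasFDerivAt.comp z h1).const_smul (2 : ℝ)
  have h3 : radCovec z₀ = (2 : ℝ) • ⇑(contrL (stdForm k)) ∘ fun z => z - z₀ := rfl
  rw [h3, h2.fderiv]
  rfl

lemma extDeriv_covecEquiv {l : Cn k → Covec k} {z : Cn k} (hl : DifferentiableAt ℝ l z) :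
    extDeriv (fun z => covecEquiv k (l z)) z
      = ∑ a, wedge₁ (dualCovec a) (covecEquiv k (fderiv ℝ l z (rBasis k a))) := by
  rw [extDeriv_eq_sum]
  refine Finset.sum_congr rfl fun a _ => ?_
  have h1 := ((covecEquiv k).toContinuousLinearEquiv : Covec k →L[ℝ] Alt k 1).hasFDerivAt.comp z
    hl.hasFDerivAt
  have h2 : (fun z => covecEquiv k (l z))
      = ⇑((covecEquiv k).toContinuousLinearEquiv : Covec k →L[ℝ] Alt k 1) ∘ l := rfl
  rw [h2, h1.fderiv]
  rfl

lemma extDeriv_radCovec (z₀ z : Cn k) :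
    extDeriv (fun z => covecEquiv k (radCovec z₀ z)) z = (4 : ℝ) • stdForm k := by
  rw [extDeriv_covecEquiv (((contDiff_radCovec z₀).differentiable (by simp)) z)]
  conv_rhs => rw [alt_two_eq_sum (stdForm k)]
  rw [Finset.smul_sum]
  refine Finset.sum_congr rfl fun a _ => ?_
  rw [fderiv_radCovec]
  simp only [map_smul, smul_apply, smul_smul]
  norm_num

/-- The form `d(H(N) d^c N) = H'(N) dN ∧ d^c N + H(N) dd^c N` for `N = ‖z - z₀‖² + c`, where `H'` stands
for the derivative of `H` (see `extDeriv_radial`). -/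
def radialForm (z₀ : Cn k) (c : ℝ) (H H' : ℝ → ℝ) (z : Cn k) : Alt k 2 :=
  (2 * H' (radSq z₀ z + c)) • gradForm (radCovec z₀ z) + (4 * H (radSq z₀ z + c)) • stdForm k

lemma isDiagonal_radialForm (z₀ : Cn k) (c : ℝ) (H H' : ℝ → ℝ) (z : Cn k) :
    IsDiagonal (radialForm z₀ c H H' z) :=
  ((isDiagonal_gradForm _).smul _).add (isDiagonal_stdForm.smul _)

lemma radialForm_apply_I (z₀ : Cn k) (c : ℝ) (H H' : ℝ → ℝ) (z v : Cn k) :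
    radialForm z₀ c H H' z ![v, Complex.I • v]
      = 4 * H' (radSq z₀ z + c)
          * (stdForm k ![z - z₀, v] ^ 2 + stdForm k ![z - z₀, Complex.I • v] ^ 2)
        + 4 * H (radSq z₀ z + c) * ‖v‖ ^ 2 := by
  have h1 : radialForm z₀ c H H' z ![v, Complex.I • v]
      = (2 * H' (radSq z₀ z + c)) * gradForm (radCovec z₀ z) ![v, Complex.I • v]
        + (4 * H (radSq z₀ z + c)) * stdForm k ![v, Complex.I • v] := rfl
  rw [h1, gradForm_apply_I, stdForm_apply_I, radCovec_apply, radCovec_apply]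
  ring

variable {z₀ z : Cn k} {c : ℝ} {H H' : ℝ → ℝ}

lemma hasFDerivAt_comp_radSq (hH : HasDerivAt H (H' (radSq z₀ z + c)) (radSq z₀ z + c)) :
    HasFDerivAt (fun z => H (radSq z₀ z + c))
      (H' (radSq z₀ z + c) • (radCovec z₀ z).comp (mulC k Complex.I)) z := by
  have h1 : HasFDerivAt (fun z => radSq z₀ z + c) ((radCovec z₀ z).comp (mulC k Complex.I)) z :=
    (hasFDerivAt_radSq z₀ z).add_const c
  exact hH.comp_hasFDerivAt z h1

lemma extDeriv_radial (hH : HasDerivAt H (H' (radSq z₀ z + c)) (radSq z₀ z + c)) :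
    extDeriv (fun z => covecEquiv k (H (radSq z₀ z + c) • radCovec z₀ z)) z
      = radialForm z₀ c H H' z := by
  have h1 := hasFDerivAt_comp_radSq hH
  have h2 : DifferentiableAt ℝ (fun z => covecEquiv k (radCovec z₀ z)) z :=
    ((covecEquiv k).toContinuousLinearEquiv.contDiff.comp
      (contDiff_radCovec z₀)).differentiable (n := ∞) (by simp) z
  simp only [map_smul]
  rw [extDeriv_smul_fun h1.differentiableAt h2, extDeriv_radCovec, h1.fderiv, radialForm, gradForm]
  simp only [map_smul, smul_apply, smul_smul]
  congr 1
  · congr 1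
    ring
  · congr 1
    ring

lemma extDeriv_const (Θ : Alt k n) (z : Cn k) : extDeriv (fun _ => Θ) z = 0 := by
  rw [extDeriv_eq_sum]
  simp

lemma extDeriv_radial_wedge (hH : HasDerivAt H (H' (radSq z₀ z + c)) (radSq z₀ z + c))
    (Θ : Alt k n) : extDeriv (fun z => wedge₁ (H (radSq z₀ z + c) • radCovec z₀ z) Θ) z
      = wedge₂ (radialForm z₀ c H H' z) Θ := by
  have h1 : DifferentiableAt ℝ (fun z => H (radSq z₀ z + c) • radCovec z₀ z) z :=
    (hasFDerivAt_comp_radSq hH).differentiableAt.smul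
      ((contDiff_radCovec z₀).differentiable (by simp) z)
  rw [extDeriv_wedge₁ h1 (differentiableAt_const Θ), extDeriv_radial hH, extDeriv_const, map_zero,
    sub_zero]

lemma contDiff_radialForm (hH : ContDiff ℝ ∞ fun z => H (radSq z₀ z + c))
    (hH' : ContDiff ℝ ∞ fun z => H' (radSq z₀ z + c)) :
    ContDiff ℝ ∞ (radialForm z₀ c H H') := by
  have h1 : ContDiff ℝ ∞ fun z => gradForm (radCovec z₀ z) := by
    have h2 : (fun z => gradForm (radCovec z₀ z)) = fun z => (1 / 2 : ℝ) •
        wedge₁ ((radCovec z₀ z).comp (mulC k Complex.I)) (covecEquiv k (radCovec z₀ z)) := rfl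
    rw [h2]
    exact (contDiff_wedge₁ ((contDiff_radCovec z₀).clm_comp contDiff_const)
      ((covecEquiv k).toContinuousLinearEquiv.contDiff.comp (contDiff_radCovec z₀))).const_smul _
  exact ((contDiff_const.mul hH').smul h1).add ((contDiff_const.mul hH).smul contDiff_const)

/-! ### The form `d(N^(-(k-1)) d^c N) ∧ (∑ⱼ dx_j ∧ dy_j)^(k-2)` -/

lemma hasDerivAt_inv_pow (p : ℕ) {t : ℝ} (ht : t ≠ 0) :
    HasDerivAt (fun t => (t ^ (p + 1))⁻¹) (-((p : ℝ) + 1) * (t ^ (p + 2))⁻¹) t := by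
  have h1 := (hasDerivAt_pow (p + 1) t).inv (pow_ne_zero _ ht)
  refine h1.congr_deriv ?_
  have : p + 1 - 1 = p := rfl
  rw [this]
  push_cast
  field_simp
  ring

/-- For `N = ‖z - z₀‖² + c`, the form `d(N^(-(k-1)) d^c N) ∧ (∑ⱼ dx_j ∧ dy_j)^(k-2)` is at least
`4 c N^(-k) (∑ⱼ dx_j ∧ dy_j)^(k-1)`. The exponent `k - 1` is the largest for which it is positive for every
`c > 0`. -/
lemma le_coeff_gradWedge_radial {p : ℕ} (hp : k = p + 2) (z₀ z : Cn k) {c : ℝ} (hc : 0 < c)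
    (l : Covec k) :
    4 * c * ((radSq z₀ z + c) ^ (p + 2))⁻¹ * coeff (gradWedge l (powForm (stdForm k) (p + 1)))
      ≤ coeff (gradWedge l (wedge₂ (radialForm z₀ c (fun t => (t ^ (p + 1))⁻¹)
        (fun t => -((p : ℝ) + 1) * (t ^ (p + 2))⁻¹) z) (powForm (stdForm k) p))) := by
  set N := radSq z₀ z + c with hN
  have hs := radSq_nonneg z₀ z
  have hNpos : 0 < N := by positivity
  set w := z - z₀ with hw
  set q := coeff (gradWedge l (powForm (stdForm k) (p + 1))) with hq
  set Y := coeff (gradWedge l (gradWedge (contr (stdForm k) w) (powForm (stdForm k) p))) with hY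
  have h1 := coeff_gradWedge_gradWedge hp isDiagonal_stdForm l w
  rw [stdForm_apply_I, ← hq, ← hY] at h1
  have h2 : 0 ≤ coeff (powForm (stdForm k) (p + 2)) := by
    rw [← hp]
    exact (coeff_powForm_pos fun v hv => by rw [stdForm_apply_I]; positivity).le
  have h3 : 2 * ((p : ℝ) + 1) * Y ≤ radSq z₀ z * q := by
    have h4 : 0 ≤ (1 / 2) * (l w ^ 2 + l (Complex.I • w) ^ 2) * coeff (powForm (stdForm k) (p + 2)) := by
      positivity
    have h5 : 2 * ((p : ℝ) + 1) * (p + 2) * Y ≤ (p + 2) * ‖w‖ ^ 2 * q := by linarith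
    have h6 : ((p : ℝ) + 2) * (2 * ((p : ℝ) + 1) * Y) ≤ (p + 2) * (radSq z₀ z * q) := by
      rw [radSq]
      linarith
    exact le_of_mul_le_mul_left h6 (by positivity)
  have h7 : coeff (gradWedge l (wedge₂ (radialForm z₀ c (fun t => (t ^ (p + 1))⁻¹)
        (fun t => -((p : ℝ) + 1) * (t ^ (p + 2))⁻¹) z) (powForm (stdForm k) p)))
      = 2 * (-((p : ℝ) + 1) * (N ^ (p + 2))⁻¹) * (4 * Y) + 4 * (N ^ (p + 1))⁻¹ * q := by
    rw [radialForm, wedge₂_add_left, wedge₂_smul_left, wedge₂_smul_left, gradWedge_add_right,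
      gradWedge_smul_right, gradWedge_smul_right, coeff_add, coeff_smul, coeff_smul,
      wedge₂_gradForm, radCovec, gradWedge_smul, gradWedge_smul_right, coeff_smul]
    have h8 : wedge₂ (stdForm k) (powForm (stdForm k) p) = powForm (stdForm k) (p + 1) := rfl
    rw [h8]
    norm_num
    rfl
  rw [h7]
  have h9 : (N ^ (p + 1))⁻¹ = N * (N ^ (p + 2))⁻¹ := by
    field_simp
    ring
  rw [h9]
  have h10 : 0 < (N ^ (p + 2))⁻¹ := by positivity
  have h11 : 2 * (-((p : ℝ) + 1) * (N ^ (p + 2))⁻¹) * (4 * Y) + 4 * (N * (N ^ (p + 2))⁻¹) * q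
      - 4 * c * (N ^ (p + 2))⁻¹ * q
      = 4 * (N ^ (p + 2))⁻¹ * (radSq z₀ z * q - 2 * ((p : ℝ) + 1) * Y) := by
    rw [hN]
    ring
  have h12 : 0 ≤ 4 * (N ^ (p + 2))⁻¹ * (radSq z₀ z * q - 2 * ((p : ℝ) + 1) * Y) :=
    mul_nonneg (by positivity) (by linarith)
  linarith

end

section

variable {k n : ℕ}

/-! ### A cut-off function -/

/-- A smooth function on `ℝ`, equal to `1` on `(-∞, a]` and to `0` on `[b, ∞)`. -/
def cutFun (a b t : ℝ) : ℝ := Real.smoothTransition ((b - t) / (b - a))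

lemma cutFun_mem (a b t : ℝ) : cutFun a b t ∈ Icc (0 : ℝ) 1 :=
  ⟨Real.smoothTransition.nonneg _, Real.smoothTransition.le_one _⟩

lemma contDiff_cutFun (a b : ℝ) : ContDiff ℝ ∞ (cutFun a b) :=
  Real.smoothTransition.contDiff.comp ((contDiff_const.sub contDiff_id).div_const _)

lemma cutFun_eq_one {a b t : ℝ} (hab : a < b) (h : t ≤ a) : cutFun a b t = 1 :=
  Real.smoothTransition.one_of_one_le (by rw [le_div_iff₀ (by linarith)]; linarith)

lemma cutFun_eq_zero {a b t : ℝ} (hab : a < b) (h : b ≤ t) : cutFun a b t = 0 :=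
  Real.smoothTransition.zero_of_nonpos (div_nonpos_of_nonpos_of_nonneg (by linarith) (by linarith))

lemma deriv_cutFun_of_lt {a b t : ℝ} (hab : a < b) (h : t < a) : deriv (cutFun a b) t = 0 := by
  have h1 : cutFun a b =ᶠ[nhds t] fun _ => 1 := by
    filter_upwards [Iio_mem_nhds h] with u hu using cutFun_eq_one hab (le_of_lt hu)
  rw [h1.deriv_eq, deriv_const]

lemma deriv_cutFun_of_ge {a b t : ℝ} (hab : a < b) (h : b < t) : deriv (cutFun a b) t = 0 := by
  have h1 : cutFun a b =ᶠ[nhds t] fun _ => 0 := by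
    filter_upwards [Ioi_mem_nhds h] with u hu using cutFun_eq_zero hab (le_of_lt hu)
  rw [h1.deriv_eq, deriv_const]

lemma contDiff_deriv_cutFun (a b : ℝ) : ContDiff ℝ ∞ (deriv (cutFun a b)) :=
  (contDiff_infty_iff_deriv.1 (contDiff_cutFun a b)).2

lemma hasDerivAt_cutFun (a b t : ℝ) : HasDerivAt (cutFun a b) (deriv (cutFun a b) t) t :=
  ((contDiff_cutFun a b).differentiable (by simp) t).hasDerivAt

lemma support_radSq_subset {F : Type*} [Zero F] {z₀ : Cn k} {b : ℝ} {Φ : Cn k → F}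
    (h : ∀ z, b < radSq z₀ z → Φ z = 0) : Function.support Φ ⊆ Metric.closedBall z₀ (√b) := by
  intro z hz
  rw [Metric.mem_closedBall, dist_eq_norm]
  refine Real.le_sqrt_of_sq_le ?_
  by_contra h0
  exact hz (h z (not_le.1 h0))

lemma tsupport_radSq_subset {F : Type*} [Zero F] {z₀ : Cn k} {b : ℝ} {Φ : Cn k → F}
    (h : ∀ z, b < radSq z₀ z → Φ z = 0) : tsupport Φ ⊆ Metric.closedBall z₀ (√b) :=
  closure_minimal (support_radSq_subset h) Metric.isClosed_closedBall

lemma hasCompactSupport_radSq {F : Type*} [Zero F] {z₀ : Cn k} {b : ℝ} {Φ : Cn k → F}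
    (h : ∀ z, b < radSq z₀ z → Φ z = 0) : HasCompactSupport Φ :=
  (isCompact_closedBall z₀ (√b)).of_isClosed_subset (isClosed_tsupport _) (tsupport_radSq_subset h)

/-! ### Test forms defined in a chart -/

section ExtTest

variable {X : Type*} [TopologicalSpace X] [ChartedSpace (Cn k) X] [IsManifold 𝓘(ℂ, Cn k) ω X]
  {e : OpenPartialHomeomorph X (Cn k)} [T2Space X]

lemma eq_of_formIn_eq (he : e ∈ atlas (Cn k) X) {Θ Θ' : X → Alt k n} {x : X} (hx : x ∈ e.source)
    (h : formIn e Θ (e x) = formIn e Θ' (e x)) : Θ x = Θ' x := by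
  have h1 : (chartFrame e (e x)).comp (frameInv e x) = ContinuousLinearMap.id ℝ (Cn k) := by
    have := chartFrame_comp_frameInv he (e.map_source hx)
    rwa [e.left_inv hx] at this
  have h2 : ∀ Θ : X → Alt k n,
      Θ x = (formIn e Θ (e x)).compContinuousLinearMap (frameInv e x) := by
    intro Θ
    rw [formIn, comp_comp, h1, e.left_inv hx]
    rfl
  rw [h2 Θ, h2 Θ', h]

/-- The exterior derivative commutes with the extension by zero. -/
lemma dForm_extendForm (he : e ∈ atlas (Cn k) X) {Φ : Cn k → Alt k n} (hΦ : ContDiff ℝ ∞ Φ)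
    (hc : HasCompactSupport Φ) (hs : tsupport Φ ⊆ e.target) :
    dForm (extendForm e Φ) = extendForm e (extDeriv Φ) := by
  ext1 x
  by_cases hx : x ∈ e.source
  · refine eq_of_formIn_eq he hx ?_
    have hy := e.map_source hx
    rw [formIn_dForm he (isSmoothForm_extendForm he hΦ hc hs) hy, formIn_extendForm he _ hy]
    have h1 : formIn e (extendForm e Φ) =ᶠ[nhds (e x)] Φ := by
      filter_upwards [e.open_target.mem_nhds hy] with w hw using formIn_extendForm he _ hw
    exact h1.extDeriv_eq
  · rw [extendForm, if_neg hx]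
    exact dForm_eq_zero fun h => hx (symm_image_subset hs (tsupport_extendForm hc hs h))

/-- The test form on `X` given by a test form in the image of a chart. -/
def extTest (he : e ∈ atlas (Cn k) X) {Φ : Cn k → Alt k n} (hΦ : ContDiff ℝ ∞ Φ)
    (hc : HasCompactSupport Φ) (hs : tsupport Φ ⊆ e.target) : TestForm k n X :=
  ⟨extendForm e Φ, isSmoothForm_extendForm he hΦ hc hs, hasCompactSupport_extendForm hc hs⟩

lemma isPositiveAlt_extendForm (hk : 1 ≤ k) (he : e ∈ atlas (Cn k) X)
    {Φ : Cn k → Alt k (2 * (k - 1))} (h : ∀ y ∈ e.target, IsPositiveAlt (Φ y)) (x : X) :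
    IsPositiveAlt (extendForm e Φ x) := by
  by_cases hx : x ∈ e.source
  · refine isPositiveAlt_of_formIn hk he hx ?_
    rw [formIn_extendForm he _ (e.map_source hx)]
    exact h _ (e.map_source hx)
  · rw [extendForm, if_neg hx]
    refine ⟨fun a _ => rfl, fun l => ?_⟩
    rw [gradWedge_zero_right]
    exact le_rfl

end ExtTest

/-! ### The energy of `φ` on small balls -/

section Lelong

variable {p : ℕ} {X : Type*} [TopologicalSpace X] [ChartedSpace (Cn (p + 2)) X]
  [IsManifold 𝓘(ℂ, Cn (p + 2)) ω X] {e : OpenPartialHomeomorph X (Cn (p + 2))} [T2Space X]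

lemma IsClosedCurrent.extTest_extDeriv {T : PreCurrent (p + 2) X} (hT : IsClosedCurrent T)
    (he : e ∈ atlas (Cn (p + 2)) X) {α : Cn (p + 2) → Alt (p + 2) (2 * p + 1)}
    (hα : ContDiff ℝ ∞ α) (hc : HasCompactSupport α) (hs : tsupport α ⊆ e.target)
    (Θ : TestForm (p + 2) (2 * (p + 2 - 1)) X) (hΘ : Θ.1 = extendForm e (extDeriv α)) :
    T Θ = 0 := by
  refine hT (2 * p + 1) rfl (extTest he hα hc hs) Θ fun x v => ?_
  rw [hΘ, ← dForm_extendForm he hα hc hs]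
  rfl

/-- The function `t ↦ t^(-(p+1))`, to be taken at `t = ‖z - z₀‖² + c`. -/
def lelongCoeff (p : ℕ) (t : ℝ) : ℝ := (t ^ (p + 1))⁻¹

/-- The derivative of `lelongCoeff`. -/
def lelongCoeff' (p : ℕ) (t : ℝ) : ℝ := -((p : ℝ) + 1) * (t ^ (p + 2))⁻¹

lemma contDiff_inv_radSq_pow (z₀ : Cn k) {c : ℝ} (hc : 0 < c) (m : ℕ) :
    ContDiff ℝ ∞ fun z => ((radSq z₀ z + c) ^ m)⁻¹ :=
  (((contDiff_radSq z₀).add contDiff_const).pow m).inv fun z => by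
    have := radSq_nonneg z₀ z
    positivity

/-- The positive form `d(N^(-(p+1)) d^c N) ∧ (∑ⱼ dx_j ∧ dy_j)^p` on `ℂ^(p+2)`. -/
def lelongForm (z₀ : Cn (p + 2)) (c : ℝ) (z : Cn (p + 2)) : Alt (p + 2) (2 * (p + 2 - 1)) :=
  wedge₂ (radialForm z₀ c (lelongCoeff p) (lelongCoeff' p) z) (powForm (stdForm (p + 2)) p)

lemma le_coeff_gradWedge_lelongForm (z₀ z : Cn (p + 2)) {c : ℝ} (hc : 0 < c)
    (l : Covec (p + 2)) :
    4 * c * ((radSq z₀ z + c) ^ (p + 2))⁻¹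
        * coeff (gradWedge l (powForm (stdForm (p + 2)) (p + 1)))
      ≤ coeff (gradWedge l (lelongForm z₀ c z)) :=
  le_coeff_gradWedge_radial rfl z₀ z hc l

lemma contDiff_lelongForm (z₀ : Cn (p + 2)) {c : ℝ} (hc : 0 < c) :
    ContDiff ℝ ∞ (lelongForm z₀ c) :=
  contDiff_wedge₂ (contDiff_radialForm (contDiff_inv_radSq_pow z₀ hc (p + 1))
    (contDiff_const.mul (contDiff_inv_radSq_pow z₀ hc (p + 2)))) contDiff_const

lemma stdForm_pos {v : Cn k} (hv : v ≠ 0) : 0 < stdForm k ![v, Complex.I • v] := by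
  rw [stdForm_apply_I]; positivity

lemma coeff_gradWedge_stdForm_nonneg (l : Covec (p + 2)) :
    0 ≤ coeff (gradWedge l (powForm (stdForm (p + 2)) (p + 1))) :=
  coeff_gradWedge_powForm_nonneg (by omega) (fun _ hv => stdForm_pos hv) l

lemma isPositiveAlt_lelongForm (z₀ z : Cn (p + 2)) {c : ℝ} (hc : 0 < c) :
    IsPositiveAlt (lelongForm z₀ c z) := by
  refine ⟨(isDiagonal_radialForm _ _ _ _ _).wedge₂ (isDiagonal_stdForm.powForm p), fun l => ?_⟩
  refine le_trans ?_ (le_coeff_gradWedge_lelongForm z₀ z hc l)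
  have h1 := radSq_nonneg z₀ z
  have h2 := coeff_gradWedge_stdForm_nonneg l
  positivity

/-- The primitive `N^(-(p+1)) d^c N ∧ (∑ⱼ dx_j ∧ dy_j)^p` of `lelongForm`. -/
def lelongPrim (z₀ : Cn (p + 2)) (c : ℝ) (z : Cn (p + 2)) : Alt (p + 2) (2 * p + 1) :=
  wedge₁ (lelongCoeff p (radSq z₀ z + c) • radCovec z₀ z) (powForm (stdForm (p + 2)) p)

lemma contDiff_lelongPrim (z₀ : Cn (p + 2)) {c : ℝ} (hc : 0 < c) :
    ContDiff ℝ ∞ (lelongPrim z₀ c) :=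
  contDiff_wedge₁ ((contDiff_inv_radSq_pow z₀ hc (p + 1)).smul (contDiff_radCovec z₀))
    contDiff_const

lemma extDeriv_lelongPrim (z₀ z : Cn (p + 2)) {c : ℝ} (hc : 0 < c) :
    extDeriv (lelongPrim z₀ c) z = lelongForm z₀ c z := by
  have h := radSq_nonneg z₀ z
  exact extDeriv_radial_wedge (hasDerivAt_inv_pow p (by positivity)) _

/-- The summand `+ 0` in the argument of the cut-off function is the constant `c = 0` of
`hasFDerivAt_comp_radSq`. -/
lemma extDeriv_cut_lelongPrim (z₀ z : Cn (p + 2)) {c : ℝ} (hc : 0 < c) (a b : ℝ) :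
    extDeriv (fun z => cutFun a b (radSq z₀ z + 0) • lelongPrim z₀ c z) z
      = (2 * lelongCoeff p (radSq z₀ z + c) * deriv (cutFun a b) (radSq z₀ z + 0))
          • gradWedge (radCovec z₀ z) (powForm (stdForm (p + 2)) p)
        + cutFun a b (radSq z₀ z + 0) • wedge₂ (radialForm z₀ c (lelongCoeff p) (lelongCoeff' p) z)
          (powForm (stdForm (p + 2)) p) := by
  have h1 := hasFDerivAt_comp_radSq (z₀ := z₀) (z := z) (c := 0) (H := cutFun a b)
    (H' := deriv (cutFun a b)) (hasDerivAt_cutFun a b _)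
  rw [extDeriv_smul_fun h1.differentiableAt ((contDiff_lelongPrim z₀ hc).differentiable (by simp) z),
    extDeriv_lelongPrim z₀ z hc, h1.fderiv, lelongPrim, gradWedge]
  congr 1
  simp only [map_smul, smul_apply, smul_smul]
  congr 1
  ring

variable [MeasurableSpace X] [BorelSpace X] [LindelofSpace X] (Ω : KahlerForm (p + 2) X)

/-- If `T` bounds `i∂φ ∧ ∂̄φ` then the energy of `φ` on the ball of radius `r` is at most
`C r^(2k-2)` times the mass of `T`. This is the bound of the Lelong numbers of `T` by its mass. -/
lemma exists_setIntegral_ball_le (he : e ∈ atlas (Cn (p + 2)) X) {z₀ : Cn (p + 2)} {a b : ℝ}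
    (ha : 0 < a) (hab : a < b) (hs : Metric.closedBall z₀ (√b) ⊆ e.target) :
    ∃ C : ℝ, 0 ≤ C ∧ ∀ (θ : X → Covec (p + 2)) (T : PreCurrent (p + 2) X),
      AEStronglyMeasurable (covecIn e θ) (volume.restrict e.target) →
      T ∈ ClosedCurrent (p + 2) X → GradLE θ T → Ω.mass T ≠ ⊤ → ∀ r : ℝ, 0 < r → r ^ 2 ≤ a →
      IntegrableOn (fun y => coeff (gradWedge (covecIn e θ y)
        (powForm (stdForm (p + 2)) (p + 1)))) (Metric.closedBall z₀ r) ∧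
      ∫ y in Metric.closedBall z₀ r, coeff (gradWedge (covecIn e θ y)
        (powForm (stdForm (p + 2)) (p + 1))) ≤ C * r ^ (2 * p + 2) * (Ω.mass T).toReal := by
  have hk : 1 ≤ p + 2 := by omega
  have hb : 0 < b := ha.trans hab
  set K := Metric.closedBall z₀ (√b) with hK
  have hKc : IsCompact K := isCompact_closedBall _ _
  obtain ⟨C₀, hC₀, hcur⟩ := exists_current_bound Ω hk he (isCompact_symm_image hKc hs)
    (symm_image_subset hs)
  set G : Cn (p + 2) → Alt (p + 2) (2 * (p + 2 - 1)) := fun z =>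
    deriv (cutFun a b) (radSq z₀ z + 0) •
      gradWedge (radCovec z₀ z) (powForm (stdForm (p + 2)) p) with hG
  have hGsm : ContDiff ℝ ∞ G := by
    have h1 : ContDiff ℝ ∞ fun z => gradWedge (radCovec z₀ z) (powForm (stdForm (p + 2)) p) :=
      (contDiff_wedge₁ ((contDiff_radCovec z₀).clm_comp contDiff_const)
        (contDiff_wedge₁ (contDiff_radCovec z₀) contDiff_const)).const_smul (1 / 2 : ℝ)
    exact (((contDiff_deriv_cutFun a b).comp ((contDiff_radSq z₀).add contDiff_const))).smul h1
  have hG0 : ∀ z, b < radSq z₀ z → G z = 0 := by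
    intro z hz
    simp only [hG]
    rw [deriv_cutFun_of_ge hab (by linarith), zero_smul]
  obtain ⟨M₀, hM₀⟩ := hGsm.continuous.bounded_above_of_compact_support (hasCompactSupport_radSq hG0)
  have hM₀0 : 0 ≤ M₀ := (norm_nonneg _).trans (hM₀ z₀)
  refine ⟨2 ^ (p + 2) / 4 * (C₀ * (2 * (a ^ (p + 1))⁻¹ * M₀)), by positivity,
    fun θ T hmθ hT hθ hm r hr hra => ?_⟩
  -- With `c = r²`, the lower bound `4 c N^(-k)` of `lelongForm` is of order `r^(-(2k-2))` on the ball.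
  set c := r ^ 2 with hc
  have hc0 : 0 < c := by positivity
  -- By Stokes, `T` vanishes on `dα = Ξ + Φ`, where `Φ` is positive and `Ξ` is supported in
  -- `a ≤ ‖z - z₀‖² ≤ b`, so it is bounded independently of `r`.
  set Φ : Cn (p + 2) → Alt (p + 2) (2 * (p + 2 - 1)) := fun z =>
    cutFun a b (radSq z₀ z + 0) • lelongForm z₀ c z with hΦ
  set Ξ : Cn (p + 2) → Alt (p + 2) (2 * (p + 2 - 1)) := fun z =>
    (2 * lelongCoeff p (radSq z₀ z + c)) • G z with hΞ
  set α : Cn (p + 2) → Alt (p + 2) (2 * p + 1) := fun z =>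
    cutFun a b (radSq z₀ z + 0) • lelongPrim z₀ c z with hα
  have hcut : ContDiff ℝ ∞ fun z : Cn (p + 2) => cutFun a b (radSq z₀ z + 0) :=
    (contDiff_cutFun a b).comp ((contDiff_radSq z₀).add contDiff_const)
  have hΦsm : ContDiff ℝ ∞ Φ := hcut.smul (contDiff_lelongForm z₀ hc0)
  have hΞsm : ContDiff ℝ ∞ Ξ :=
    (contDiff_const.mul (contDiff_inv_radSq_pow z₀ hc0 (p + 1))).smul hGsm
  have hαsm : ContDiff ℝ ∞ α := hcut.smul (contDiff_lelongPrim z₀ hc0)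
  have hcut0 : ∀ z : Cn (p + 2), b < radSq z₀ z → cutFun a b (radSq z₀ z + 0) = 0 := fun z hz =>
    cutFun_eq_zero hab (by linarith)
  have hΦ0 : ∀ z, b < radSq z₀ z → Φ z = 0 := fun z hz => by
    simp only [hΦ]; rw [hcut0 z hz, zero_smul]
  have hα0 : ∀ z, b < radSq z₀ z → α z = 0 := fun z hz => by
    simp only [hα]; rw [hcut0 z hz, zero_smul]
  have hΞ0 : ∀ z, b < radSq z₀ z → Ξ z = 0 := fun z hz => by
    simp only [hΞ]; rw [hG0 z hz, smul_zero]
  have hαΦ : extDeriv α = Ξ + Φ := by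
    ext1 z
    rw [hα, extDeriv_cut_lelongPrim z₀ z hc0 a b, Pi.add_apply, hΞ, hG]
    simp only [smul_smul]
    rfl
  set Θ := extTest he hΦsm (hasCompactSupport_radSq hΦ0) ((tsupport_radSq_subset hΦ0).trans hs)
    with hΘ
  set Υ := extTest he hΞsm (hasCompactSupport_radSq hΞ0) ((tsupport_radSq_subset hΞ0).trans hs)
    with hΥ
  have hsum : T (Υ + Θ) = 0 := by
    refine IsClosedCurrent.extTest_extDeriv hT.2.2 he hαsm (hasCompactSupport_radSq hα0)
      ((tsupport_radSq_subset hα0).trans hs) _ ?_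
    rw [hαΦ]
    ext1 x
    change extendForm e Ξ x + extendForm e Φ x = _
    by_cases hx : x ∈ e.source
    · simp only [extendForm, if_pos hx]
      rfl
    · simp only [extendForm, if_neg hx, add_zero]
  have hΥb : |T Υ| ≤ C₀ * (2 * (a ^ (p + 1))⁻¹ * M₀) * (Ω.mass T).toReal := by
    refine hcur T hT.2.1 (fun Θ hΘ => KahlerForm.current_nonneg Ω hk hθ Θ hΘ) hm Υ _ (by positivity) ?_ ?_
    · exact (subset_tsupport _).trans ((tsupport_extendForm (hasCompactSupport_radSq hΞ0)
        ((tsupport_radSq_subset hΞ0).trans hs)).trans (image_mono (tsupport_radSq_subset hΞ0)))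
    · intro y hy
      have h1 : formIn e Υ.1 y = Ξ y := formIn_extendForm he Ξ hy
      rw [h1]
      by_cases hya : radSq z₀ y < a
      · have : G y = 0 := by
          simp only [hG]
          rw [deriv_cutFun_of_lt hab (by linarith), zero_smul]
        simp only [hΞ]
        rw [this, smul_zero, norm_zero]
        positivity
      · have h2 : lelongCoeff p (radSq z₀ y + c) ≤ (a ^ (p + 1))⁻¹ := by
          rw [lelongCoeff]
          gcongr
          linarith
        have h3 : 0 ≤ lelongCoeff p (radSq z₀ y + c) := by
          have := radSq_nonneg z₀ y
          rw [lelongCoeff]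
          positivity
        simp only [hΞ]
        rw [norm_smul, Real.norm_eq_abs, abs_of_nonneg (by positivity)]
        gcongr
        exact hM₀ y
  have hTΘ : T Θ ≤ C₀ * (2 * (a ^ (p + 1))⁻¹ * M₀) * (Ω.mass T).toReal := by
    rw [map_add] at hsum
    have := neg_abs_le (T Υ)
    linarith
  have hΦpos : ∀ y ∈ e.target, IsPositiveAlt (Φ y) := fun y _ =>
    (isPositiveAlt_lelongForm z₀ y hc0).smul (cutFun_mem a b _).1
  have hΘpos : IsPositiveForm Θ.1 := (isPositiveForm_iff hk).2 (isPositiveAlt_extendForm hk he hΦpos)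
  have hΘs : tsupport Θ.1 ⊆ e.source := (tsupport_extendForm (hasCompactSupport_radSq hΦ0)
    ((tsupport_radSq_subset hΦ0).trans hs)).trans
    (symm_image_subset ((tsupport_radSq_subset hΦ0).trans hs))
  obtain ⟨i1, i2⟩ := hθ e he Θ hΘs hΘpos
  have hform : ∀ y ∈ e.target, formIn e Θ.1 y = Φ y := fun y hy => formIn_extendForm he Φ hy
  set Q : Cn (p + 2) → ℝ := fun y => coeff (gradWedge (covecIn e θ y) (formIn e Θ.1 y)) with hQ
  set q : Cn (p + 2) → ℝ := fun y =>
    coeff (gradWedge (covecIn e θ y) (powForm (stdForm (p + 2)) (p + 1))) with hq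
  have hq0 : ∀ y, 0 ≤ q y := fun y => coeff_gradWedge_stdForm_nonneg _
  have hQ0 : ∀ y ∈ e.target, 0 ≤ Q y := fun y hy => (hΘpos e he y hy).2 _
  have hrb : Metric.closedBall z₀ r ⊆ e.target := by
    refine (Metric.closedBall_subset_closedBall ?_).trans hs
    exact Real.le_sqrt_of_sq_le (hra.trans hab.le)
  set D : ℝ := 2 ^ (p + 2) / 4 * r ^ (2 * p + 2) with hD
  have hD0 : 0 < D := by positivity
  have hle : ∀ y ∈ Metric.closedBall z₀ r, q y ≤ D * Q y := by
    intro y hy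
    have hy2 : radSq z₀ y ≤ c := by
      rw [Metric.mem_closedBall, dist_eq_norm] at hy
      rw [radSq, hc]
      gcongr
    have h1 : Q y = coeff (gradWedge (covecIn e θ y) (lelongForm z₀ c y)) := by
      simp only [hQ]
      rw [hform y (hrb hy)]
      simp only [hΦ]
      rw [cutFun_eq_one hab (by linarith), one_smul]
    have h2 := le_coeff_gradWedge_lelongForm z₀ y hc0 (covecIn e θ y)
    rw [← h1] at h2
    have h3 : (2 * c) ^ (p + 2) ≥ (radSq z₀ y + c) ^ (p + 2) := by
      have := radSq_nonneg z₀ y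
      gcongr
      linarith
    have h4 : ((2 * c) ^ (p + 2))⁻¹ ≤ ((radSq z₀ y + c) ^ (p + 2))⁻¹ := by
      have := radSq_nonneg z₀ y
      gcongr
    have h5 : 4 * c * ((2 * c) ^ (p + 2))⁻¹ * q y ≤ Q y := by
      refine le_trans ?_ h2
      have := hq0 y
      gcongr
    have h6 : D * (4 * c * ((2 * c) ^ (p + 2))⁻¹) = 1 := by
      rw [hD, hc]
      field_simp
      ring
    calc q y = D * (4 * c * ((2 * c) ^ (p + 2))⁻¹ * q y) := by
          rw [← mul_assoc, h6, one_mul]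
      _ ≤ D * Q y := by gcongr
  have hQi : IntegrableOn (fun y => D * Q y) (Metric.closedBall z₀ r) :=
    (i1.mono_set hrb).const_mul D
  have hmeas : AEStronglyMeasurable q (volume.restrict (Metric.closedBall z₀ r)) := by
    exact aestronglyMeasurable_coeff_gradWedge
      ((hmθ.mono_measure (Measure.restrict_mono hrb le_rfl))) aestronglyMeasurable_const
  have hqi : IntegrableOn q (Metric.closedBall z₀ r) := by
    refine Integrable.mono' hQi hmeas ((ae_restrict_iff' measurableSet_closedBall).2
      (.of_forall fun y hy => ?_))
    rw [Real.norm_eq_abs, abs_of_nonneg (hq0 y)]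
    exact hle y hy
  refine ⟨hqi, ?_⟩
  calc ∫ y in Metric.closedBall z₀ r, q y ≤ ∫ y in Metric.closedBall z₀ r, D * Q y :=
        setIntegral_mono_on hqi hQi measurableSet_closedBall hle
    _ = D * ∫ y in Metric.closedBall z₀ r, Q y := integral_const_mul _ _
    _ ≤ D * ∫ y in e.target, Q y := by
        refine mul_le_mul_of_nonneg_left (setIntegral_mono_set i1
          ((ae_restrict_iff' e.open_target.measurableSet).2 (.of_forall hQ0))
          hrb.eventuallyLE) hD0.le
    _ ≤ D * (C₀ * (2 * (a ^ (p + 1))⁻¹ * M₀) * (Ω.mass T).toReal) := by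
        gcongr
        exact i2.trans hTΘ
    _ = _ := by rw [hD]; ring

end Lelong

end

section

variable {k n : ℕ}

/-! ### The differential of `φ` on small balls -/

section BallNorm

variable {p : ℕ} {X : Type*} [TopologicalSpace X] [ChartedSpace (Cn (p + 2)) X]
  [IsManifold 𝓘(ℂ, Cn (p + 2)) ω X] {e : OpenPartialHomeomorph X (Cn (p + 2))} [T2Space X]
  [MeasurableSpace X] [BorelSpace X] [LindelofSpace X] (Ω : KahlerForm (p + 2) X)

/-- If `T` bounds `i∂φ ∧ ∂̄φ` and has mass at most `δ²`, then the integral of `‖dφ‖` over the ball of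
radius `r` is at most `C δ r^(2k-1)`. -/
lemma exists_setIntegral_ball_norm_le (he : e ∈ atlas (Cn (p + 2)) X) {z₀ : Cn (p + 2)} {a b : ℝ}
    (ha : 0 < a) (hab : a < b) (hs : Metric.closedBall z₀ (√b) ⊆ e.target) :
    ∃ C : ℝ, 0 ≤ C ∧ ∀ (θ : X → Covec (p + 2)) (T : PreCurrent (p + 2) X) (δ : ℝ), 0 < δ →
      AEStronglyMeasurable (covecIn e θ) (volume.restrict e.target) →
      T ∈ ClosedCurrent (p + 2) X → GradLE θ T → Ω.mass T ≤ ENNReal.ofReal (δ ^ 2) →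
      ∀ r : ℝ, 0 < r → r ^ 2 ≤ a →
      IntegrableOn (covecIn e θ) (Metric.closedBall z₀ r) ∧
      ∫ y in Metric.closedBall z₀ r, ‖covecIn e θ y‖ ≤ C * δ * r ^ (2 * p + 3) := by
  obtain ⟨C₀, hC₀, hcur⟩ := exists_setIntegral_ball_le Ω he ha hab hs
  set D : ℝ := 2 * (p + 2 : ℕ) * ‖stdForm (p + 2)‖ / coeff (powForm (stdForm (p + 2)) (p + 2))
    with hD
  have hpos : ∀ v : Cn (p + 2), v ≠ 0 → 0 < stdForm (p + 2) ![v, Complex.I • v] :=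
    fun _ hv => stdForm_pos hv
  have hD0 : 0 ≤ D := by
    have := coeff_powForm_pos hpos
    positivity
  set ν : ℝ := volume.real (Metric.ball (0 : Cn (p + 2)) 1) with hν
  refine ⟨ν / 2 + D * C₀ / 2, by positivity, fun θ T δ hδ hmθ hT hθ hm r hr hra => ?_⟩
  obtain ⟨hqi, hq⟩ := hcur θ T hmθ hT hθ (hm.trans_lt ENNReal.ofReal_lt_top).ne r hr hra
  have hm' : (Ω.mass T).toReal ≤ δ ^ 2 := ENNReal.toReal_le_of_le_ofReal (by positivity) hm
  set q : Cn (p + 2) → ℝ := fun y =>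
    coeff (gradWedge (covecIn e θ y) (powForm (stdForm (p + 2)) (p + 1))) with hqd
  -- `‖dφ‖ ≤ δ/(2r) + (r/2δ) ‖dφ‖²`, where the weights balance the two terms after integration
  have hle : ∀ y, ‖covecIn e θ y‖ ≤ δ / (2 * r) + r * D / (2 * δ) * q y := by
    intro y
    have h1 : ‖covecIn e θ y‖ ^ 2 ≤ D * q y :=
      norm_sq_le_of_pos (by omega) isDiagonal_stdForm hpos (covecIn e θ y)
    have h2 : 0 ≤ (r * ‖covecIn e θ y‖ - δ) ^ 2 := sq_nonneg _
    have h3 : δ / (2 * r) + r * D / (2 * δ) * q y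
        = (δ ^ 2 + r ^ 2 * (D * q y)) / (2 * r * δ) := by
      field_simp
    rw [h3, le_div_iff₀ (by positivity)]
    have h4 : r ^ 2 * ‖covecIn e θ y‖ ^ 2 ≤ r ^ 2 * (D * q y) := by gcongr
    nlinarith
  have hrb : Metric.closedBall z₀ r ⊆ e.target :=
    (Metric.closedBall_subset_closedBall (Real.le_sqrt_of_sq_le (hra.trans hab.le))).trans hs
  have hvol : volume.real (Metric.closedBall z₀ r) = r ^ (2 * p + 4) * ν := by
    rw [Measure.addHaar_real_closedBall _ _ hr.le, finrank_Cn, hν]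
    congr 1
  have hci : IntegrableOn (fun _ : Cn (p + 2) => δ / (2 * r)) (Metric.closedBall z₀ r) :=
    integrableOn_const measure_closedBall_lt_top.ne
  have hi : IntegrableOn (fun y => δ / (2 * r) + r * D / (2 * δ) * q y)
      (Metric.closedBall z₀ r) := hci.add (hqi.const_mul _)
  have hθi : IntegrableOn (covecIn e θ) (Metric.closedBall z₀ r) :=
    Integrable.mono' hi (hmθ.mono_measure (Measure.restrict_mono hrb le_rfl))
      (.of_forall hle)
  refine ⟨hθi, ?_⟩
  calc ∫ y in Metric.closedBall z₀ r, ‖covecIn e θ y‖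
      ≤ ∫ y in Metric.closedBall z₀ r, (δ / (2 * r) + r * D / (2 * δ) * q y) :=
        setIntegral_mono hθi.norm hi hle
    _ = δ / (2 * r) * (r ^ (2 * p + 4) * ν)
        + r * D / (2 * δ) * ∫ y in Metric.closedBall z₀ r, q y := by
        rw [integral_add hci (hqi.const_mul _), setIntegral_const, hvol, integral_const_mul,
          smul_eq_mul, mul_comm]
    _ ≤ δ / (2 * r) * (r ^ (2 * p + 4) * ν)
        + r * D / (2 * δ) * (C₀ * r ^ (2 * p + 2) * δ ^ 2) := by
        gcongr
        exact hq.trans (by gcongr)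
    _ = _ := by
        field_simp
        ring

end BallNorm

end

section

variable {k n : ℕ}

/-! ### The functions `|w_j|² / (‖w‖² + c)` -/

lemma norm_sq_eq_sum (v : Cn k) : ‖v‖ ^ 2 = ∑ j, ((v j).re ^ 2 + (v j).im ^ 2) := by
  rw [EuclideanSpace.norm_sq_eq]
  refine Finset.sum_congr rfl fun j _ => ?_
  rw [← Complex.normSq_eq_norm_sq, Complex.normSq_apply]
  ring

/-- The Cauchy–Schwarz inequality for the `j`-th coordinates of `w` and of `N v - ρ w - κ i w`, which for
`N = ‖w‖²` is `N` times the projection of `v` on the orthogonal complement of `w`. -/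
lemma sq_coord_sub_le (w v : Cn k) (j : Fin k) {N : ℝ} (hN : ‖w‖ ^ 2 ≤ N) :
    (N * ((w j).re * (v j).re + (w j).im * (v j).im)
        - ((w j).re ^ 2 + (w j).im ^ 2) * stdForm k ![w, Complex.I • v]) ^ 2
      ≤ N ^ 2 * (N * ‖v‖ ^ 2
        - (stdForm k ![w, v] ^ 2 + stdForm k ![w, Complex.I • v] ^ 2)) := by
  set ρ := stdForm k ![w, Complex.I • v] with hρ
  set κ := stdForm k ![w, v] with hκ
  have hρs : ρ = ∑ i, ((w i).re * (v i).re + (w i).im * (v i).im) := by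
    rw [hρ, stdForm_apply]
    refine Finset.sum_congr rfl fun i _ => ?_
    simp
    ring
  have hκs : κ = ∑ i, ((w i).re * (v i).im - (w i).im * (v i).re) := by
    rw [hκ, stdForm_apply]
    refine Finset.sum_congr rfl fun i _ => ?_
    ring
  have hN0 : 0 ≤ N := (sq_nonneg _).trans hN
  -- the real and imaginary parts of the coordinates of `N v - ρ w - κ i w`
  set a : Fin k → ℝ := fun i => N * (v i).re - ρ * (w i).re + κ * (w i).im with ha
  set b : Fin k → ℝ := fun i => N * (v i).im - ρ * (w i).im - κ * (w i).re with hb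
  have h1 : ∑ i, (a i ^ 2 + b i ^ 2)
      = N ^ 2 * ‖v‖ ^ 2 + (ρ ^ 2 + κ ^ 2) * ‖w‖ ^ 2 - 2 * N * ρ * ρ - 2 * N * κ * κ := by
    have e1 : 2 * N * ρ * ρ = 2 * N * ρ * ∑ i, ((w i).re * (v i).re + (w i).im * (v i).im) := by
      rw [← hρs]
    have e2 : 2 * N * κ * κ = 2 * N * κ * ∑ i, ((w i).re * (v i).im - (w i).im * (v i).re) := by
      rw [← hκs]
    rw [e1, e2, norm_sq_eq_sum v, norm_sq_eq_sum w, Finset.mul_sum, Finset.mul_sum, Finset.mul_sum,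
      Finset.mul_sum, ← Finset.sum_add_distrib, ← Finset.sum_sub_distrib, ← Finset.sum_sub_distrib]
    refine Finset.sum_congr rfl fun i _ => ?_
    simp only [ha, hb]
    ring
  have h2 : a j ^ 2 + b j ^ 2 ≤ ∑ i, (a i ^ 2 + b i ^ 2) :=
    Finset.single_le_sum (f := fun i => a i ^ 2 + b i ^ 2) (fun i _ => by positivity)
      (Finset.mem_univ j)
  have h3 : (w j).re ^ 2 + (w j).im ^ 2 ≤ N := by
    refine le_trans ?_ hN
    rw [norm_sq_eq_sum]
    exact Finset.single_le_sum (f := fun i => (w i).re ^ 2 + (w i).im ^ 2)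
      (fun i _ => by positivity) (Finset.mem_univ j)
  have h4 : (ρ ^ 2 + κ ^ 2) * ‖w‖ ^ 2 ≤ (ρ ^ 2 + κ ^ 2) * N := by gcongr
  have h5 : N * ((w j).re * (v j).re + (w j).im * (v j).im) - ((w j).re ^ 2 + (w j).im ^ 2) * ρ
      = (w j).re * a j + (w j).im * b j := by
    simp only [ha, hb]
    ring
  rw [h5]
  calc ((w j).re * a j + (w j).im * b j) ^ 2
      ≤ ((w j).re ^ 2 + (w j).im ^ 2) * (a j ^ 2 + b j ^ 2) := by
        nlinarith [sq_nonneg ((w j).re * b j - (w j).im * a j)]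
    _ ≤ N * (N ^ 2 * ‖v‖ ^ 2 + (ρ ^ 2 + κ ^ 2) * N - 2 * N * ρ * ρ - 2 * N * κ * κ) := by
        gcongr
        linarith
    _ = _ := by ring

/-- The function `1/t`, cut off near `[b, ∞)`. -/
def cutInv (a b t : ℝ) : ℝ := cutFun a b t / t

/-- The derivative of `cutInv` on `(0, ∞)`. -/
def cutInv' (a b t : ℝ) : ℝ := deriv (cutFun a b) t / t - cutFun a b t / t ^ 2

lemma hasDerivAt_cutInv (a b : ℝ) {t : ℝ} (ht : 0 < t) :
    HasDerivAt (cutInv a b) (cutInv' a b t) t := by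
  refine ((hasDerivAt_cutFun a b t).div (hasDerivAt_id t) ht.ne').congr_deriv ?_
  rw [cutInv']
  simp only [id]
  field_simp

lemma continuousOn_cutInv (a b : ℝ) : ContinuousOn (cutInv a b) (Ioi 0) := fun _ ht =>
  (hasDerivAt_cutInv a b ht).continuousAt.continuousWithinAt

lemma continuousOn_cutInv' (a b : ℝ) : ContinuousOn (cutInv' a b) (Ioi 0) :=
  ((contDiff_deriv_cutFun a b).continuous.continuousOn.div continuousOn_id fun _ ht => ht.ne').sub
    ((contDiff_cutFun a b).continuous.continuousOn.div (continuousOn_id.pow 2)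
      fun _ ht => (pow_pos ht 2).ne')

lemma exists_cutInv_bound {a b : ℝ} (ha : 0 < a) :
    ∃ M, ∀ t ∈ Icc a b, |cutInv a b t| ≤ M ∧ |cutInv' a b t| ≤ M := by
  have hs : Icc a b ⊆ Ioi 0 := fun t ht => ha.trans_le ht.1
  obtain ⟨M, hM⟩ := isCompact_Icc.exists_bound_of_continuousOn ((continuousOn_cutInv a b).mono hs)
  obtain ⟨M', hM'⟩ :=
    isCompact_Icc.exists_bound_of_continuousOn ((continuousOn_cutInv' a b).mono hs)
  exact ⟨max M M', fun t ht => ⟨(hM t ht).trans (le_max_left _ _),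
    (hM' t ht).trans (le_max_right _ _)⟩⟩

lemma cutInv_of_le {a b t : ℝ} (hab : a < b) (h : t ≤ a) : cutInv a b t = 1 / t := by
  rw [cutInv, cutFun_eq_one hab h]

lemma cutInv'_of_lt {a b t : ℝ} (hab : a < b) (h : t < a) : cutInv' a b t = -(1 / t ^ 2) := by
  rw [cutInv', cutFun_eq_one hab h.le, deriv_cutFun_of_lt hab h]
  ring

lemma cutInv_of_gt {a b t : ℝ} (hab : a < b) (h : b < t) : cutInv a b t = 0 := by
  rw [cutInv, cutFun_eq_zero hab h.le, zero_div]

lemma cutInv'_of_gt {a b t : ℝ} (hab : a < b) (h : b < t) : cutInv' a b t = 0 := by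
  rw [cutInv', cutFun_eq_zero hab h.le, deriv_cutFun_of_ge hab h]
  ring

variable {z₀ z : Cn k} {j : Fin k} {a b c : ℝ}

/-- The squared modulus of the `j`-th coordinate of `z - z₀`. -/
def coordSq (z₀ : Cn k) (j : Fin k) (z : Cn k) : ℝ :=
  reCoord j (z - z₀) ^ 2 + imCoord j (z - z₀) ^ 2

/-- The function `|w_j|² / (‖w‖² + c)` of `w = z - z₀`, cut off near `‖w‖² + c ≥ b`. -/
def angFun (z₀ : Cn k) (j : Fin k) (a b c : ℝ) (z : Cn k) : ℝ :=
  coordSq z₀ j z * cutInv a b (radSq z₀ z + c)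

lemma coordSq_nonneg : 0 ≤ coordSq z₀ j z := by rw [coordSq]; positivity

lemma coordSq_le : coordSq z₀ j z ≤ radSq z₀ z := by
  rw [radSq, norm_sq_eq_sum]
  exact Finset.single_le_sum (f := fun i => ((z - z₀) i).re ^ 2 + ((z - z₀) i).im ^ 2)
    (fun i _ => by positivity) (Finset.mem_univ j)

lemma contDiff_coordSq (z₀ : Cn k) (j : Fin k) : ContDiff ℝ ∞ (coordSq z₀ j) :=
  (((reCoord j).contDiff.comp (contDiff_id.sub contDiff_const)).pow 2).add
    (((imCoord j).contDiff.comp (contDiff_id.sub contDiff_const)).pow 2)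

lemma hasFDerivAt_coordSq (z₀ : Cn k) (j : Fin k) (z : Cn k) :
    HasFDerivAt (coordSq z₀ j) ((2 * reCoord j (z - z₀)) • reCoord j
      + (2 * imCoord j (z - z₀)) • imCoord j) z := by
  have h : ∀ l : Covec k, HasFDerivAt (fun z => l (z - z₀) ^ 2) ((2 * l (z - z₀)) • l) z := by
    intro l
    have h1 : HasFDerivAt (fun z => l (z - z₀)) l z :=
      ((l.hasFDerivAt (x := z - z₀)).comp z ((hasFDerivAt_id z).sub_const z₀)).congr_fderiv rfl
    refine (h1.pow 2).congr_fderiv ?_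
    simp
  exact (h _).add (h _)

lemma contDiff_cutInv_radSq (z₀ : Cn k) (a b : ℝ) (hc : 0 < c) :
    ContDiff ℝ ∞ fun z => cutInv a b (radSq z₀ z + c) :=
  ((contDiff_cutFun a b).comp ((contDiff_radSq z₀).add contDiff_const)).div
    ((contDiff_radSq z₀).add contDiff_const) fun z => by
      have := radSq_nonneg z₀ z
      positivity

lemma contDiff_angFun (z₀ : Cn k) (j : Fin k) (a b : ℝ) (hc : 0 < c) :
    ContDiff ℝ ∞ (angFun z₀ j a b c) :=
  (contDiff_coordSq z₀ j).mul (contDiff_cutInv_radSq z₀ a b hc)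

lemma angFun_mem (hc : 0 ≤ c) : angFun z₀ j a b c z ∈ Icc (0 : ℝ) 1 := by
  have h0 := coordSq_nonneg (z₀ := z₀) (j := j) (z := z)
  have h1 := coordSq_le (z₀ := z₀) (j := j) (z := z)
  obtain ⟨h2, h3⟩ := cutFun_mem a b (radSq z₀ z + c)
  rw [angFun, cutInv, mul_div_assoc']
  refine ⟨div_nonneg (mul_nonneg h0 h2) (by linarith), div_le_one_of_le₀ ?_ (by linarith)⟩
  nlinarith

lemma angFun_of_gt (hab : a < b) (h : b < radSq z₀ z + c) : angFun z₀ j a b c z = 0 := by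
  rw [angFun, cutInv_of_gt hab h, mul_zero]

lemma fderiv_angFun (z₀ : Cn k) (j : Fin k) (a b : ℝ) (hc : 0 < c) (z v : Cn k) :
    fderiv ℝ (angFun z₀ j a b c) z v
      = 2 * cutInv a b (radSq z₀ z + c)
          * (((z - z₀) j).re * (v j).re + ((z - z₀) j).im * (v j).im)
        + 2 * coordSq z₀ j z * cutInv' a b (radSq z₀ z + c)
          * stdForm k ![z - z₀, Complex.I • v] := by
  have hN : 0 < radSq z₀ z + c := by
    have := radSq_nonneg z₀ z
    positivity
  have h1 := (hasFDerivAt_coordSq z₀ j z).mul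
    (hasFDerivAt_comp_radSq (H := cutInv a b) (H' := cutInv' a b) (hasDerivAt_cutInv a b hN))
  have h2 : HasFDerivAt (angFun z₀ j a b c) _ z := h1
  rw [h2.fderiv]
  simp only [add_apply, smul_apply, smul_eq_mul, ContinuousLinearMap.comp_apply, mulC_apply,
    radCovec_apply]
  have hre : ∀ u : Cn k, reCoord j u = (u j).re := fun _ => rfl
  have him : ∀ u : Cn k, imCoord j u = (u j).im := fun _ => rfl
  simp only [hre, him]
  ring

lemma stdForm_sq_add_sq_le (w v : Cn k) (hk : 0 < k) :
    stdForm k ![w, v] ^ 2 + stdForm k ![w, Complex.I • v] ^ 2 ≤ ‖w‖ ^ 2 * ‖v‖ ^ 2 := by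
  by_cases hw : w = 0
  · subst hw
    have h : ∀ u : Cn k, stdForm k ![0, u] = 0 := fun u => by simp [stdForm_apply]
    simp [h]
  have h1 := (sq_nonneg _).trans (sq_coord_sub_le w v ⟨0, hk⟩ le_rfl)
  have h2 : 0 < (‖w‖ ^ 2) ^ 2 := by positivity
  have := nonneg_of_mul_nonneg_right h1 h2
  linarith

/-- The gradients of the functions `angFun z₀ j a b c` are bounded by the forms `d(H(N) d^c N)`,
`H = cutInv a b`, up to a bounded form, uniformly in `c`. -/
lemma exists_fderiv_angFun_sq_le (z₀ : Cn k) (j : Fin k) (ha : 0 < a) (hab : a < b) :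
    ∃ C, 0 ≤ C ∧ ∀ c : ℝ, 0 < c → ∀ z v : Cn k, (fderiv ℝ (angFun z₀ j a b c) z v) ^ 2
      ≤ radialForm z₀ c (cutInv a b) (cutInv' a b) z ![v, Complex.I • v] + C * ‖v‖ ^ 2 := by
  obtain ⟨M, hM⟩ := exists_cutInv_bound (b := b) ha
  have hM0 : 0 ≤ M := (abs_nonneg _).trans (hM a ⟨le_rfl, hab.le⟩).1
  have hb : 0 < b := ha.trans hab
  have hb0 : 0 ≤ b := hb.le
  refine ⟨8 * M ^ 2 * b + 8 * b ^ 3 * M ^ 2 + 4 * M * b + 4 * M, by positivity, fun c hc z v => ?_⟩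
  set w := z - z₀ with hw
  set N := radSq z₀ z + c with hNd
  have hs := radSq_nonneg z₀ z
  have hN : 0 < N := by positivity
  have hwN : ‖w‖ ^ 2 ≤ N := by
    have : ‖w‖ ^ 2 = radSq z₀ z := rfl
    linarith
  have hP : 0 ≤ ‖v‖ ^ 2 := sq_nonneg _
  have hC := sq_coord_sub_le w v j hwN
  have hD := stdForm_sq_add_sq_le w v j.pos
  rw [fderiv_angFun z₀ j a b hc, radialForm_apply_I]
  rw [← hw, ← hNd]
  have hq : coordSq z₀ j z = (w j).re ^ 2 + (w j).im ^ 2 := rfl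
  rw [hq]
  set ρ := stdForm k ![w, Complex.I • v]
  set κ := stdForm k ![w, v]
  set x := (w j).re * (v j).re + (w j).im * (v j).im with hx
  set q := (w j).re ^ 2 + (w j).im ^ 2 with hqd
  -- For `N < a` the inequality is `sq_coord_sub_le`. Otherwise `N` is bounded away from `0` and the
  -- crude bounds by `M` and `b` are enough.
  rcases lt_or_ge N a with h | h
  · rw [cutInv_of_le hab h.le, cutInv'_of_lt hab h]
    have e1 : 2 * (1 / N) * x + 2 * q * -(1 / N ^ 2) * ρ = 2 * (N * x - q * ρ) / N ^ 2 := by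
      field_simp
      ring
    have e2 : 4 * -(1 / N ^ 2) * (κ ^ 2 + ρ ^ 2) + 4 * (1 / N) * ‖v‖ ^ 2
        = 4 * (N ^ 2 * (N * ‖v‖ ^ 2 - (κ ^ 2 + ρ ^ 2))) / (N ^ 2) ^ 2 := by
      field_simp
      ring
    rw [e1, e2, div_pow]
    have e3 : 4 * (N ^ 2 * (N * ‖v‖ ^ 2 - (κ ^ 2 + ρ ^ 2))) / (N ^ 2) ^ 2
        ≥ (2 * (N * x - q * ρ)) ^ 2 / (N ^ 2) ^ 2 := by
      gcongr
      linarith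
    have : 0 ≤ (8 * M ^ 2 * b + 8 * b ^ 3 * M ^ 2 + 4 * M * b + 4 * M) * ‖v‖ ^ 2 := by positivity
    linarith
  rcases lt_or_ge b N with h' | h'
  · rw [cutInv_of_gt hab h', cutInv'_of_gt hab h']
    have : 0 ≤ (8 * M ^ 2 * b + 8 * b ^ 3 * M ^ 2 + 4 * M * b + 4 * M) * ‖v‖ ^ 2 := by positivity
    linarith
  obtain ⟨m1, m2⟩ := hM N ⟨h, h'⟩
  set F := cutInv a b N
  set F' := cutInv' a b N
  have hq0 : 0 ≤ q := by positivity
  have hqb : q ≤ b := by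
    have : q ≤ radSq z₀ z := coordSq_le (z₀ := z₀) (j := j) (z := z)
    linarith
  have hvj : (v j).re ^ 2 + (v j).im ^ 2 ≤ ‖v‖ ^ 2 := by
    rw [norm_sq_eq_sum]
    exact Finset.single_le_sum (f := fun i => (v i).re ^ 2 + (v i).im ^ 2)
      (fun i _ => by positivity) (Finset.mem_univ j)
  have hx2 : x ^ 2 ≤ b * ‖v‖ ^ 2 := by
    calc x ^ 2 ≤ q * ((v j).re ^ 2 + (v j).im ^ 2) := by
          rw [hx, hqd]
          nlinarith [sq_nonneg ((w j).re * (v j).im - (w j).im * (v j).re)]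
      _ ≤ b * ‖v‖ ^ 2 := by gcongr
  have hD' : κ ^ 2 + ρ ^ 2 ≤ b * ‖v‖ ^ 2 := hD.trans (by gcongr; linarith)
  have hρ2 : ρ ^ 2 ≤ b * ‖v‖ ^ 2 := by nlinarith [sq_nonneg κ]
  have hF2 : F ^ 2 ≤ M ^ 2 := sq_le_sq' (abs_le.1 m1).1 (abs_le.1 m1).2
  have hF'2 : F' ^ 2 ≤ M ^ 2 := sq_le_sq' (abs_le.1 m2).1 (abs_le.1 m2).2
  have t1 : F ^ 2 * x ^ 2 ≤ M ^ 2 * (b * ‖v‖ ^ 2) := by gcongr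
  have t2 : q ^ 2 * F' ^ 2 * ρ ^ 2 ≤ b ^ 2 * M ^ 2 * (b * ‖v‖ ^ 2) := by gcongr
  have t3 : -F' * (κ ^ 2 + ρ ^ 2) ≤ M * (b * ‖v‖ ^ 2) :=
    mul_le_mul (by linarith [neg_abs_le F']) hD' (by positivity) hM0
  have t4 : -F * ‖v‖ ^ 2 ≤ M * ‖v‖ ^ 2 := by
    gcongr
    linarith [neg_abs_le F]
  have t5 : (2 * F * x + 2 * q * F' * ρ) ^ 2 ≤ 8 * (F ^ 2 * x ^ 2) + 8 * (q ^ 2 * F' ^ 2 * ρ ^ 2) := by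
    linarith [sq_nonneg (F * x - q * F' * ρ)]
  have t6 : (8 * M ^ 2 * b + 8 * b ^ 3 * M ^ 2 + 4 * M * b + 4 * M) * ‖v‖ ^ 2
      = 8 * (M ^ 2 * (b * ‖v‖ ^ 2)) + 8 * (b ^ 2 * M ^ 2 * (b * ‖v‖ ^ 2)) + 4 * (M * (b * ‖v‖ ^ 2))
        + 4 * (M * ‖v‖ ^ 2) := by ring
  rw [t6]
  linarith

lemma radialForm_cutInv_of_gt (hab : a < b) (h : b < radSq z₀ z + c) :
    radialForm z₀ c (cutInv a b) (cutInv' a b) z = 0 := by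
  rw [radialForm, cutInv_of_gt hab h, cutInv'_of_gt hab h]
  simp

lemma fderiv_angFun_of_gt (hab : a < b) (hc : 0 < c) (h : b < radSq z₀ z + c) (v : Cn k) :
    fderiv ℝ (angFun z₀ j a b c) z v = 0 := by
  rw [fderiv_angFun z₀ j a b hc, cutInv_of_gt hab h, cutInv'_of_gt hab h]
  ring

lemma tendsto_angFun (z₀ : Cn k) (j : Fin k) (a b : ℝ) (z : Cn k) {c : ℕ → ℝ}
    (hc : Filter.Tendsto c Filter.atTop (nhds 0)) :
    Filter.Tendsto (fun n => angFun z₀ j a b (c n) z) Filter.atTop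
      (nhds (angFun z₀ j a b 0 z)) := by
  rcases (radSq_nonneg z₀ z).eq_or_lt with h | h
  · have h1 : coordSq z₀ j z = 0 :=
      le_antisymm (by rw [h]; exact coordSq_le) coordSq_nonneg
    simp [angFun, h1]
  · have h1 : ContinuousAt (cutInv a b) (radSq z₀ z + 0) :=
      (hasDerivAt_cutInv a b (by linarith)).continuousAt
    exact ((h1.tendsto.comp (tendsto_const_nhds.add hc))).const_mul _

end

section

variable {k n : ℕ}

/-! ### A bounded sequence of smooth functions -/

section AngSeq

variable {X : Type*} [TopologicalSpace X] [ChartedSpace (Cn k) X] [IsManifold 𝓘(ℂ, Cn k) ω X]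
  {e : OpenPartialHomeomorph X (Cn k)} [T2Space X]

lemma isSmoothForm_add {Θ Θ' : X → Alt k n} (h : IsSmoothForm Θ) (h' : IsSmoothForm Θ') :
    IsSmoothForm (Θ + Θ') := fun e he => by
  rw [formIn_add]; exact (h e he).add (h' e he)

lemma isSmoothForm_smul {Θ : X → Alt k n} (a : ℝ) (h : IsSmoothForm Θ) :
    IsSmoothForm (a • Θ) := fun e he => by
  rw [formIn_smul]; exact (h e he).const_smul a

lemma dForm_smul (a : ℝ) (Θ : X → Alt k n) : dForm (a • Θ) = a • dForm Θ := by
  ext1 x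
  rw [dForm, formIn_smul, extDeriv_smul]
  rfl

lemma dFun_eq_comp_frameInv (he : e ∈ atlas (Cn k) X) (f : X → ℝ) {x : X} (hx : x ∈ e.source) :
    dFun f x = (covecIn e (dFun f) (e x)).comp (frameInv e x) := by
  have h1 := chartFrame_comp_frameInv he (e.map_source hx)
  rw [e.left_inv hx] at h1
  rw [covecIn, ContinuousLinearMap.comp_assoc, h1, e.left_inv hx]
  rfl

lemma dFun_eq_zero {f : X → ℝ} {x : X} (hx : x ∉ tsupport f) : dFun (k := k) f x = 0 := by
  have h1 : f ∘ (chartAt (Cn k) x).symm =ᶠ[nhds (chartAt (Cn k) x x)] fun _ => 0 := by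
    have h2 : ∀ᶠ z in nhds x, f z = 0 := notMem_tsupport_iff_eventuallyEq.1 hx
    have h3 : Filter.Tendsto (chartAt (Cn k) x).symm (nhds (chartAt (Cn k) x x)) (nhds x) := by
      have := (chartAt (Cn k) x).tendsto_symm (mem_chart_source _ x)
      exact this
    exact h3.eventually h2
  rw [dFun, h1.fderiv_eq, fderiv_fun_const]
  rfl

lemma extendForm_apply_I (he : e ∈ atlas (Cn k) X) (Φ : Cn k → Alt k 2) {x : X}
    (hx : x ∈ e.source) (v : Cn k) : extendForm e Φ x ![v, Complex.I • v]
      = Φ (e x) ![frameInv e x v, Complex.I • frameInv e x v] := by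
  have h1 := DFunLike.congr_fun (frameInv_comm he hx) v
  simp only [ContinuousLinearMap.comp_apply, mulC_apply] at h1
  rw [extendForm, if_pos hx, ContinuousAlternatingMap.compContinuousLinearMap_apply]
  congr 1
  ext i : 1
  fin_cases i
  · rfl
  · exact h1

namespace KahlerForm

variable (Ω : KahlerForm k X)

lemma toForm_apply_I (he : e ∈ atlas (Cn k) X) {x : X} (hx : x ∈ e.source) (v : Cn k) :
    Ω.toForm x ![v, Complex.I • v] = formIn e Ω.toForm (e x)
      ![frameInv e x v, Complex.I • frameInv e x v] := by
  rw [← extendForm_apply_I he _ hx]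
  congr 2
  refine eq_of_formIn_eq he hx ?_
  rw [formIn_extendForm he _ (e.map_source hx)]

/-- On compact sets `Ω` is bounded below by a multiple of the Hermitian metric of the chart. -/
lemma exists_norm_sq_le (he : e ∈ atlas (Cn k) X) {K : Set (Cn k)} (hK : IsCompact K)
    (hKe : K ⊆ e.target) : ∃ B : ℝ, 0 ≤ B ∧ ∀ y ∈ K, ∀ v : Cn k,
      ‖v‖ ^ 2 ≤ B * formIn e Ω.toForm y ![v, Complex.I • v] := by
  have hc : ContinuousOn (fun q : Cn k × Cn k => formIn e Ω.toForm q.1 ![q.2, Complex.I • q.2])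
      (K ×ˢ Metric.sphere 0 1) := by
    have h1 : ContinuousOn (fun q : Cn k × Cn k =>
        contrL (formIn e Ω.toForm q.1) q.2 (mulC k Complex.I q.2)) (K ×ˢ Metric.sphere 0 1) := by
      refine ContinuousOn.clm_apply (ContinuousOn.clm_apply ?_ continuousOn_snd)
        ((mulC k Complex.I).continuous.comp_continuousOn continuousOn_snd)
      have h2 : Continuous fun η : Alt k 2 => contrL η := by
        have h3 : Continuous fun η : Alt k 2 => η.curryLeft :=
          (ContinuousAlternatingMap.curryLeftLI (𝕜 := ℝ) (E := Cn k) (F := ℝ) (n := 1)).continuous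
        exact continuous_const.clm_comp h3
      exact h2.comp_continuousOn ((((Ω.smooth e he).continuousOn).mono hKe).comp continuousOn_fst
        fun q hq => hq.1)
    exact h1.congr fun q _ => by simp only [contrL_apply, contr_apply, mulC_apply]
  obtain ⟨a, ha, hle⟩ := (hK.prod (isCompact_sphere (0 : Cn k) 1)).exists_forall_le' hc (a := 0)
    fun q hq => Ω.formIn_pos he (hKe hq.1) (by
      rintro h
      have := mem_sphere_zero_iff_norm.1 hq.2
      rw [h, norm_zero] at this
      exact zero_ne_one this)
  refine ⟨a⁻¹, by positivity, fun y hy v => ?_⟩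
  by_cases hv : v = 0
  · subst hv
    have : formIn e Ω.toForm y ![0, Complex.I • 0] = 0 :=
      (formIn e Ω.toForm y).map_coord_zero (0 : Fin 2) rfl
    rw [this]
    simp
  have hv0 : 0 < ‖v‖ := norm_pos_iff.2 hv
  have h1 := hle (y, ‖v‖⁻¹ • v) ⟨hy, by
    rw [mem_sphere_zero_iff_norm, norm_smul, norm_inv, norm_norm, inv_mul_cancel₀ hv0.ne']⟩
  have h2 : formIn e Ω.toForm y ![‖v‖⁻¹ • v, Complex.I • ‖v‖⁻¹ • v]
      = ‖v‖⁻¹ ^ 2 * formIn e Ω.toForm y ![v, Complex.I • v] := by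
    rw [smul_comm Complex.I, ← contr_apply, ← contrL_apply,
      (contrL (formIn e Ω.toForm y)).map_smul ‖v‖⁻¹ v, smul_apply, ContinuousLinearMap.map_smul,
      contrL_apply, contr_apply, smul_eq_mul, smul_eq_mul]
    ring
  simp only [h2] at h1
  rw [inv_pow, inv_mul_eq_div, le_div_iff₀ (by positivity)] at h1
  rw [inv_mul_eq_div, le_div_iff₀ ha]
  linarith

variable [MeasurableSpace X] [BorelSpace X] [LindelofSpace X]

lemma mass_formCurrent_le (hk : 1 ≤ k) {τ : X → Alt k 2} (hτ : IsSmoothForm τ)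
    (hd : ∀ x, IsDiagonal (τ x)) (h0 : ∀ x v, 0 ≤ τ x ![v, Complex.I • v])
    (hi : Integrable (Ω.dens fun x => wedge₂ (τ x) (Ω.pow (k - 1) x)) Ω.vol) :
    Ω.mass (Ω.formCurrent hk hτ)
      ≤ ENNReal.ofReal (∫ x, Ω.dens (fun x => wedge₂ (τ x) (Ω.pow (k - 1) x)) x ∂Ω.vol) := by
  refine iSup_le fun χ => iSup_le fun hχ => iSup_le fun Θ => iSup_le fun hΘ =>
    ENNReal.ofReal_le_ofReal ?_
  rw [formCurrent_apply]
  refine integral_mono (Ω.integrable_dens_wedge₂ hk hτ Θ) hi fun x => ?_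
  have h1 : 0 ≤ Ω.dens (fun x => wedge₂ (τ x) (Ω.pow (k - 1) x)) x :=
    div_nonneg (coeff_wedge₂_nonneg (hd x) (h0 x) (Ω.isPositiveAlt_pow hk x).2)
      (Ω.coeff_pow_pos x).le
  have h2 : Ω.dens (fun x => wedge₂ (τ x) (Θ.1 x)) x
      = χ x * Ω.dens (fun x => wedge₂ (τ x) (Ω.pow (k - 1) x)) x := by
    simp only [dens]
    rw [hΘ x, wedge₂_smul_right, coeff_smul, mul_div_assoc]
  simp only [h2]
  exact mul_le_of_le_one_left h1 (hχ x).2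

lemma dens_wedge₂_self (hk : 1 ≤ k) (x : X) :
    Ω.dens (fun x => wedge₂ (Ω.toForm x) (Ω.pow (k - 1) x)) x = 1 := by
  obtain ⟨m, rfl⟩ : ∃ m, k = m + 1 := ⟨k - 1, by omega⟩
  exact div_self (Ω.coeff_pow_pos x).ne'

/-- The integral of `dL ∧ Ω^(k-1)` vanishes if `L` has compact support in a chart. -/
lemma integral_dens_extDeriv_wedge_pow (hk : 1 ≤ k) (he : e ∈ atlas (Cn k) X)
    {L : Cn k → Covec k} (hL : ContDiff ℝ ∞ L) (hc : HasCompactSupport L)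
    (hs : tsupport L ⊆ e.target) :
    ∫ x, Ω.dens (fun x => wedge₂ (extendForm e (extDeriv fun z => covecEquiv k (L z)) x)
      (Ω.pow (k - 1) x)) x ∂Ω.vol = 0 := by
  set Φ := extDeriv fun z => covecEquiv k (L z) with hΦ
  set P := formIn e (Ω.pow (k - 1)) with hP
  set G : Cn k → Alt k (2 * (k - 1) + 1) := fun y => wedge₁ (L y) (P y) with hG
  have hL0 : ∀ y, y ∉ tsupport L → L =ᶠ[nhds y] fun _ => 0 := fun y hy =>
    notMem_tsupport_iff_eventuallyEq.1 hy
  have hGs : tsupport G ⊆ tsupport L := closure_mono fun y hy h0 => hy (by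
    simp only [hG]
    rw [h0, map_zero]
    rfl)
  have hPs : ContDiffOn ℝ ∞ P e.target := Ω.isSmoothForm_pow (k - 1) e he
  have hGsm : ContDiff ℝ ∞ G :=
    contDiff_of_tsupport_subset e.open_target (contDiffOn_wedge₁ hL.contDiffOn hPs) (hGs.trans hs)
  have hGc : HasCompactSupport G := hc.of_isClosed_subset (isClosed_tsupport _) hGs
  have hΦ0 : ∀ y, y ∉ tsupport L → Φ y = 0 := by
    intro y hy
    have h1 : (fun z => covecEquiv k (L z)) =ᶠ[nhds y] fun _ => 0 := by
      filter_upwards [hL0 y hy] with w hw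
      rw [hw, map_zero]
    rw [hΦ, h1.extDeriv_eq, extDeriv_const]
  rw [Ω.integral_dens (by omega) he]
  · have h1 : ∀ y ∈ e.target, coeff (formIn e (fun x => wedge₂ (extendForm e Φ x)
        (Ω.pow (k - 1) x)) y) = coeff (extDeriv G y) := by
      intro y hy
      have hPd : DifferentiableAt ℝ P y :=
        ((hPs.contDiffAt (e.open_target.mem_nhds hy)).differentiableAt (by simp))
      have hPc : extDeriv P y = 0 := by
        have h2 : P = fun y => powForm (formIn e Ω.toForm y) (k - 1) :=
          funext fun y => Ω.formIn_pow e (k - 1) y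
        rw [h2]
        refine extDeriv_powForm (((Ω.smooth e he).contDiffAt
          (e.open_target.mem_nhds hy)).differentiableAt (by simp)) ?_ _
        rw [← formIn_dForm he Ω.smooth hy, formIn, Ω.closed]
        rfl
      rw [formIn_wedge₂, formIn_extendForm he _ hy,
        extDeriv_wedge₁ (hL.differentiable (by simp) y) hPd, hPc, map_zero, sub_zero]
    rw [setIntegral_congr_fun e.open_target.measurableSet h1,
      setIntegral_eq_integral_of_forall_compl_eq_zero]
    · exact integral_coeff_extDeriv (hGsm.of_le (by simp)) hGc
    · intro y hy
      have h2 : G =ᶠ[nhds y] fun _ => 0 := by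
        filter_upwards [hL0 y fun h => hy (hs h)] with w hw
        simp only [hG]
        rw [hw, map_zero]
        rfl
      rw [h2.extDeriv_eq, extDeriv_const]
      rfl
  · intro x hx
    by_contra h
    refine hx ?_
    change wedge₂ _ _ = 0
    rw [extendForm, if_neg h, wedge₂_zero_left]

variable [SigmaCompactSpace X]

/-- The functions `angFun z₀ j a b c` in a chart are bounded in `W^*`, uniformly in `c`. -/
lemma exists_admissible_angFun (hk : 2 ≤ k) (hfin : Ω.vol univ ≠ ⊤) (he : e ∈ atlas (Cn k) X)
    {z₀ : Cn k} (j : Fin k) {a b : ℝ} (ha : 0 < a) (hab : a < b)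
    (hs : Metric.closedBall z₀ (√b) ⊆ e.target) :
    ∃ m : ℝ, 0 ≤ m ∧ ∀ c : ℝ, 0 < c → IsSmoothFun (k := k) (extendFun e (angFun z₀ j a b c)) ∧
      ∀ φ : Lp ℝ 2 Ω.vol, extendFun e (angFun z₀ j a b c) =ᵐ[Ω.vol] φ →
        ∃ T ∈ ClosedCurrent k X, Ω.Admissible φ T ∧ Ω.mass T ≤ ENNReal.ofReal m := by
  have hk1 : 1 ≤ k := by omega
  have : IsFiniteMeasure Ω.vol := ⟨hfin.lt_top⟩
  obtain ⟨C, hC, hang⟩ := exists_fderiv_angFun_sq_le z₀ j ha hab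
  obtain ⟨B, hB, hnorm⟩ := Ω.exists_norm_sq_le he (isCompact_closedBall z₀ (√b)) hs
  set A := C * B with hA
  have hA0 : 0 ≤ A := mul_nonneg hC hB
  refine ⟨A * Ω.vol.real univ, by positivity, fun c hc => ?_⟩
  have hgt : ∀ z, b < radSq z₀ z → b < radSq z₀ z + c := fun z hz => by linarith
  set S := angFun z₀ j a b c with hS
  have hS0 : ∀ z, b < radSq z₀ z → S z = 0 := fun z hz => angFun_of_gt hab (hgt z hz)
  have hSs := (tsupport_radSq_subset hS0).trans hs
  have hf : IsSmoothFun (k := k) (extendFun e S) :=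
    isSmoothFun_extendFun he (contDiff_angFun z₀ j a b hc) (hasCompactSupport_radSq hS0) hSs
  refine ⟨hf, fun φ hφ => ?_⟩
  set f := extendFun e S with hfd
  -- The form `τ = A Ω + dL` with `L = H(N) d^c N` bounds the gradient of `f`.
  set L : Cn k → Covec k := fun z => cutInv a b (radSq z₀ z + c) • radCovec z₀ z with hL
  have hLsm : ContDiff ℝ ∞ L := (contDiff_cutInv_radSq z₀ a b hc).smul (contDiff_radCovec z₀)
  have hL0 : ∀ z, b < radSq z₀ z → L z = 0 := fun z hz => by
    simp only [hL]
    rw [cutInv_of_gt hab (hgt z hz), zero_smul]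
  have hμsm : ContDiff ℝ ∞ fun z => covecEquiv k (L z) :=
    (covecEquiv k).toContinuousLinearEquiv.contDiff.comp hLsm
  set Φ := extDeriv fun z => covecEquiv k (L z) with hΦ
  have hΦeq : ∀ z, Φ z = radialForm z₀ c (cutInv a b) (cutInv' a b) z := fun z =>
    extDeriv_radial (hasDerivAt_cutInv a b (by have := radSq_nonneg z₀ z; positivity))
  have hΦ0 : ∀ z, b < radSq z₀ z → Φ z = 0 := fun z hz => by
    rw [hΦeq, radialForm_cutInv_of_gt hab (hgt z hz)]
  have hΦsm : ContDiff ℝ ∞ Φ := contDiff_extDeriv hμsm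
  have hΦs := (tsupport_radSq_subset hΦ0).trans hs
  have hΦc : HasCompactSupport Φ := hasCompactSupport_radSq hΦ0
  have hE : IsSmoothForm (extendForm e Φ) := isSmoothForm_extendForm he hΦsm hΦc hΦs
  set τ : X → Alt k 2 := A • Ω.toForm + extendForm e Φ with hτd
  have hτ : IsSmoothForm τ := isSmoothForm_add (isSmoothForm_smul A Ω.smooth) hE
  have hτdiag : ∀ x, IsDiagonal (τ x) := by
    intro x
    refine ((Ω.diagonal x).smul A).add ?_
    by_cases hx : x ∈ e.source
    · rw [extendForm, if_pos hx, hΦeq]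
      exact (isDiagonal_radialForm _ _ _ _ _).comp (frameInv_comm he hx)
    · rw [extendForm, if_neg hx]
      exact fun _ _ => rfl
  have hτcl : ∀ x, dForm τ x = 0 := by
    intro x
    have h1 : extDeriv Φ = 0 :=
      extDeriv_extDeriv hμsm (by
      rw [minSmoothness_of_isRCLikeNormedField]; exact WithTop.coe_le_coe.2 le_top)
    have h2 : dForm Ω.toForm = 0 := funext Ω.closed
    rw [hτd, dForm_add (isSmoothForm_smul A Ω.smooth) hE, dForm_smul, h2, smul_zero, zero_add,
      dForm_extendForm he hΦsm hΦc hΦs, h1]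
    exact extendForm_eq_zero fun _ => rfl
  have hdf : ∀ x v, dFun f x v ^ 2 ≤ τ x ![v, Complex.I • v] := by
    intro x v
    have e1 : τ x ![v, Complex.I • v]
        = A * Ω.toForm x ![v, Complex.I • v] + extendForm e Φ x ![v, Complex.I • v] := rfl
    by_cases hx : x ∈ e.source
    · have hy := e.map_source hx
      have e2 : covecIn e (dFun f) (e x) = fderiv ℝ S (e x) := by
        rw [covecIn_dFun he hf hy]
        refine Filter.EventuallyEq.fderiv_eq ?_
        filter_upwards [e.open_target.mem_nhds hy] with w hw using extendFun_symm hw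
      rw [e1, dFun_eq_comp_frameInv he f hx, ContinuousLinearMap.comp_apply, e2,
        extendForm_apply_I he Φ hx, hΦeq, Ω.toForm_apply_I he hx]
      set u := frameInv e x v
      by_cases hb : b < radSq z₀ (e x)
      · rw [radialForm_cutInv_of_gt hab (hgt _ hb), hS, fderiv_angFun_of_gt hab hc (hgt _ hb)]
        have h3 : 0 ≤ formIn e Ω.toForm (e x) ![u, Complex.I • u] := by
          rw [← Ω.toForm_apply_I he hx]
          exact Ω.form_nonneg x v
        have h4 := mul_nonneg hA0 h3
        have h5 : (0 : Alt k 2) ![u, Complex.I • u] = 0 := rfl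
        rw [h5]
        linarith
      · have h3 : e x ∈ Metric.closedBall z₀ (√b) := by
          rw [Metric.mem_closedBall, dist_eq_norm]
          exact Real.le_sqrt_of_sq_le (not_lt.1 hb)
        have h4 := mul_le_mul_of_nonneg_left (hnorm _ h3 u) hC
        have h5 := hang c hc (e x) u
        rw [← mul_assoc, ← hA] at h4
        linarith
    · have h3 : x ∉ tsupport f := fun h =>
        hx (symm_image_subset hSs (tsupport_extendFun (hasCompactSupport_radSq hS0) hSs h))
      rw [e1, dFun_eq_zero h3, extendForm, if_neg hx]
      have h4 := mul_nonneg hA0 (Ω.form_nonneg x v)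
      have h5 : (0 : Alt k 2) ![v, Complex.I • v] = 0 := rfl
      have h6 : (0 : Covec k) v = 0 := rfl
      rw [h5, h6]
      linarith
  have hτ0 : ∀ x v, 0 ≤ τ x ![v, Complex.I • v] := fun x v => (sq_nonneg _).trans (hdf x v)
  -- By Stokes the exact part of `τ` does not contribute to the mass, which is `A` times the volume.
  have hsplit : (Ω.dens fun x => wedge₂ (τ x) (Ω.pow (k - 1) x))
      = fun x => A + Ω.dens (fun x => wedge₂ (extendForm e Φ x) (Ω.pow (k - 1) x)) x := by
    ext1 x
    have e1 : τ x = A • Ω.toForm x + extendForm e Φ x := rfl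
    have e2 := Ω.dens_wedge₂_self hk1 x
    simp only [dens] at e2 ⊢
    rw [e1, wedge₂_add_left, wedge₂_smul_left, coeff_add, coeff_smul, add_div, mul_div_assoc, e2,
      mul_one]
  have hi1 : Integrable (Ω.dens fun x => wedge₂ (extendForm e Φ x) (Ω.pow (k - 1) x)) Ω.vol :=
    Ω.integrable_dens (by omega) (hE.wedge₂ (Ω.isSmoothForm_pow (k - 1)))
      ((hasCompactSupport_extendForm hΦc hΦs).mono fun x hx h0 => hx (by
        change wedge₂ _ _ = 0
        rw [show extendForm e Φ x = 0 from h0, wedge₂_zero_left]))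
  have hi : Integrable (Ω.dens fun x => wedge₂ (τ x) (Ω.pow (k - 1) x)) Ω.vol := by
    rw [hsplit]
    exact (integrable_const A).add hi1
  have hmass : Ω.mass (Ω.formCurrent hk1 hτ) ≤ ENNReal.ofReal (A * Ω.vol.real univ) := by
    refine (Ω.mass_formCurrent_le hk1 hτ hτdiag hτ0 hi).trans (ENNReal.ofReal_le_ofReal ?_)
    rw [hsplit, integral_add (integrable_const A) hi1, integral_const,
      Ω.integral_dens_extDeriv_wedge_pow hk1 he hLsm (hasCompactSupport_radSq hL0)
        ((tsupport_radSq_subset hL0).trans hs), add_zero, smul_eq_mul, mul_comm]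
  have hgrad := Ω.gradLE_formCurrent hk1 hτ hτdiag hf hdf
  refine ⟨Ω.formCurrent hk1 hτ, Ω.formCurrent_mem hk hτ hτdiag hτcl,
    ⟨f, dFun f, hφ, isWeakDifferential_dFun hf, ?_, hgrad⟩, hmass⟩
  exact Ω.sqIntegrable_of_gradLE hk1 (fun e' he' => aestronglyMeasurable_of_contDiffOn
    e'.open_target (contDiffOn_covecIn_dFun he' hf)) hgrad (hmass.trans_lt ENNReal.ofReal_lt_top).ne

end KahlerForm

end AngSeq

end

section

variable {k n : ℕ}

/-! ### The limit of the sequence in `L²` -/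

section AngLimit

/-- Dominated convergence in `L²` for uniformly bounded functions. -/
lemma tendsto_toLp_of_bounded {X : Type*} [MeasurableSpace X] {μ : Measure X} [IsFiniteMeasure μ]
    {f : ℕ → X → ℝ} {g : X → ℝ} (hf : ∀ n, AEStronglyMeasurable (f n) μ)
    (hb : ∀ n x, f n x ∈ Icc (0 : ℝ) 1) (hg : ∀ x, g x ∈ Icc (0 : ℝ) 1)
    (hlim : ∀ x, Filter.Tendsto (fun n => f n x) Filter.atTop (nhds (g x)))
    (hf2 : ∀ n, MemLp (f n) 2 μ) (hg2 : MemLp g 2 μ) :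
    Filter.Tendsto (fun n => (hf2 n).toLp (f n)) Filter.atTop (nhds (hg2.toLp g)) := by
  rw [Lp.tendsto_Lp_iff_tendsto_eLpNorm'']
  have h1 : ∀ n, eLpNorm (f n - g) 2 μ = (∫⁻ x, ‖f n x - g x‖ₑ ^ (2 : ℝ) ∂μ) ^ (1 / (2 : ℝ)) := by
    intro n
    rw [eLpNorm_eq_lintegral_rpow_enorm_toReal (by simp) (by simp)]
    simp
  simp only [h1]
  have h2 : Filter.Tendsto (fun n => ∫⁻ x, ‖f n x - g x‖ₑ ^ (2 : ℝ) ∂μ) Filter.atTop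
      (nhds (∫⁻ _, 0 ∂μ)) := by
    refine tendsto_lintegral_of_dominated_convergence' (fun _ => 1)
      (fun n => ((hf n).sub hg2.1).enorm.pow_const _) (fun n => .of_forall fun x => ?_) (by simp)
      (.of_forall fun x => ?_)
    · refine ENNReal.rpow_le_one ?_ (by norm_num)
      rw [← ofReal_norm, ENNReal.ofReal_le_one, Real.norm_eq_abs, abs_le]
      obtain ⟨a1, a2⟩ := hb n x
      obtain ⟨a3, a4⟩ := hg x
      constructor <;> linarith
    · have h3 : Filter.Tendsto (fun n => ‖f n x - g x‖ₑ) Filter.atTop (nhds 0) := by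
        have := ((hlim x).sub_const (g x)).enorm
        simpa using this
      have h4 := h3.ennrpow_const (2 : ℝ)
      simpa using h4
  have h5 := h2.ennrpow_const (1 / (2 : ℝ))
  simpa using h5

variable {X : Type*} [TopologicalSpace X] [ChartedSpace (Cn k) X] [IsManifold 𝓘(ℂ, Cn k) ω X]
  {e : OpenPartialHomeomorph X (Cn k)} [T2Space X] [MeasurableSpace X] [BorelSpace X]
  [SigmaCompactSpace X]

namespace KahlerForm

variable (Ω : KahlerForm k X)

/-- The classes in `W^*` of smooth functions. -/
def smoothPart : Submodule ℝ Ω.WStar where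
  carrier := {φ | ∃ f : X → ℝ, IsSmoothFun (k := k) f ∧ f =ᵐ[Ω.vol] φ.toLp}
  zero_mem' := ⟨fun _ => 0, isSmoothFun_const 0, (Lp.coeFn_zero ℝ 2 Ω.vol).symm⟩
  add_mem' := by
    rintro φ ψ ⟨f, hf, hf'⟩ ⟨g, hg, hg'⟩
    exact ⟨f + g, fun e he => (hf e he).add (hg e he),
      (hf'.add hg').trans (Lp.coeFn_add φ.toLp ψ.toLp).symm⟩
  smul_mem' := by
    rintro a φ ⟨f, hf, hf'⟩
    exact ⟨a • f, fun e he => (hf e he).const_smul a,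
      (hf'.const_smul a).trans (Lp.coeFn_smul a φ.toLp).symm⟩

lemma extendFun_mem {g : Cn k → ℝ} (h : ∀ z, g z ∈ Icc (0 : ℝ) 1) (x : X) :
    extendFun e g x ∈ Icc (0 : ℝ) 1 := by
  rw [extendFun]
  split_ifs
  · exact h _
  · simp

/-- If `W^*` is reflexive, then it contains the class of the singular function
`|w_j|² / ‖w‖²`, cut off in a chart, and this class is a limit of smooth functions. -/
lemma exists_mem_closure_smoothPart (hk : 2 ≤ k) (hfin : Ω.vol univ ≠ ⊤)
    (hR : IsReflexive Ω.WStar) (he : e ∈ atlas (Cn k) X)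
    {z₀ : Cn k} (j : Fin k) {a b : ℝ} (ha : 0 < a) (hab : a < b)
    (hs : Metric.closedBall z₀ (√b) ⊆ e.target) :
    ∃ φ : Ω.WStar, φ ∈ Ω.smoothPart.topologicalClosure ∧
      φ.toLp =ᵐ[Ω.vol] extendFun e (angFun z₀ j a b 0) := by
  have : IsFiniteMeasure Ω.vol := ⟨hfin.lt_top⟩
  obtain ⟨m, hm, hadm⟩ := Ω.exists_admissible_angFun hk hfin he j ha hab hs
  set c : ℕ → ℝ := fun n => 1 / ((n : ℝ) + 1) with hc
  have hc0 : ∀ n, 0 < c n := fun n => by simp only [hc]; positivity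
  have hct : Filter.Tendsto c Filter.atTop (nhds 0) := tendsto_one_div_add_atTop_nhds_zero_nat
  set f : ℕ → X → ℝ := fun n => extendFun e (angFun z₀ j a b (c n)) with hf
  set g : X → ℝ := extendFun e (angFun z₀ j a b 0) with hg
  have hfs : ∀ n, IsSmoothFun (k := k) (f n) := fun n => (hadm (c n) (hc0 n)).1
  have hfm : ∀ n, AEStronglyMeasurable (f n) Ω.vol := fun n =>
    (hfs n).continuous.aestronglyMeasurable
  have hf01 : ∀ n x, f n x ∈ Icc (0 : ℝ) 1 := fun n =>
    extendFun_mem fun z => angFun_mem (hc0 n).le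
  have hg01 : ∀ x, g x ∈ Icc (0 : ℝ) 1 := extendFun_mem fun z => angFun_mem le_rfl
  have hlim : ∀ x, Filter.Tendsto (fun n => f n x) Filter.atTop (nhds (g x)) := by
    intro x
    by_cases hx : x ∈ e.source
    · simp only [hf, hg, extendFun, if_pos hx]
      exact tendsto_angFun z₀ j a b _ hct
    · simp only [hf, hg, extendFun, if_neg hx]
      exact tendsto_const_nhds
  have hgm : AEStronglyMeasurable g Ω.vol :=
    aestronglyMeasurable_of_tendsto_ae Filter.atTop hfm (.of_forall hlim)
  have hbd : ∀ t ∈ Icc (0 : ℝ) 1, ‖t‖ ≤ 1 := fun t ht => by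
    rw [Real.norm_eq_abs, abs_of_nonneg ht.1]; exact ht.2
  have hf2 : ∀ n, MemLp (f n) 2 Ω.vol := fun n =>
    MemLp.of_bound (hfm n) 1 (.of_forall fun x => hbd _ (hf01 n x))
  have hg2 : MemLp g 2 Ω.vol := MemLp.of_bound hgm 1 (.of_forall fun x => hbd _ (hg01 x))
  have hlp := tendsto_toLp_of_bounded hfm hf01 hg01 hlim hf2 hg2
  have hT : ∀ n, ∃ T ∈ ClosedCurrent k X, Ω.Admissible ((hf2 n).toLp (f n)) T ∧
      Ω.mass T ≤ ENNReal.ofReal m := fun n =>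
    (hadm (c n) (hc0 n)).2 _ (hf2 n).coeFn_toLp.symm
  choose T hT1 hT2 hT3 using hT
  obtain ⟨S, hS⟩ : ∃ S : ℕ → Ω.WStar, ∀ n, (S n).toLp = (hf2 n).toLp (f n) :=
    ⟨fun n => ⟨(hf2 n).toLp (f n), T n, hT1 n, hT2 n,
      (hT3 n).trans_lt ENNReal.ofReal_lt_top⟩, fun n => rfl⟩
  obtain ⟨r, hr⟩ : ∃ r, ∀ n, ‖(hf2 n).toLp (f n)‖ ≤ r := by
    obtain ⟨r, hr⟩ := (Metric.isBounded_range_of_tendsto _ hlp).exists_norm_le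
    exact ⟨r, fun n => hr _ ⟨n, rfl⟩⟩
  have hnorm : ∀ n, ‖S n‖ ≤ r + √m := fun n =>
    WStar.norm_le_of_admissible (hT1 n) (by rw [hS]; exact hT2 n) (by rw [hS]; exact hr n)
      (Real.sqrt_nonneg m) (by rw [Real.sq_sqrt hm]; exact hT3 n)
  have hlp' : Filter.Tendsto (fun n => toLpL (S n)) Filter.atTop (nhds (hg2.toLp g)) :=
    hlp.congr fun n => (hS n).symm
  obtain ⟨y, hy1, hy2⟩ := hR.exists_mem_closure_span toLpL hnorm hlp'
  refine ⟨y, ?_, ?_⟩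
  · refine Submodule.topologicalClosure_mono (Submodule.span_le.2 ?_) hy2
    rintro _ ⟨n, rfl⟩
    exact ⟨f n, hfs n, by rw [hS]; exact (hf2 n).coeFn_toLp.symm⟩
  · have h1 : y.toLp = hg2.toLp g := hy1
    rw [h1]
    exact hg2.coeFn_toLp

end KahlerForm

end AngLimit

end

section

variable {k n : ℕ}

/-! ### The function `|w_j|² / ‖w‖²` is not constant -/

section TestFun

/-- The function `|u_j|² / ‖u‖²`, homogeneous of degree `0`. Its junk value at the origin is `0`. -/
def angQuot (j : Fin k) (u : Cn k) : ℝ := coordSq 0 j u / radSq 0 u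

lemma hasFDerivAt_angQuot (j : Fin k) {u : Cn k} (hu : u ≠ 0) (v : Cn k) :
    DifferentiableAt ℝ (angQuot j) u ∧ fderiv ℝ (angQuot j) u v
      = 2 * (((u j).re * (v j).re + (u j).im * (v j).im) * radSq 0 u
        - coordSq 0 j u * stdForm k ![u, Complex.I • v]) / radSq 0 u ^ 2 := by
  have h0 : radSq 0 u ≠ 0 := by
    rw [radSq, sub_zero]
    exact pow_ne_zero 2 (norm_ne_zero_iff.2 hu)
  have h1 := (hasFDerivAt_coordSq 0 j u).mul
    ((hasDerivAt_inv h0).comp_hasFDerivAt u (hasFDerivAt_radSq 0 u))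
  have h2 : HasFDerivAt (angQuot j) _ u := h1
  refine ⟨h2.differentiableAt, ?_⟩
  rw [h2.fderiv]
  have hre : ∀ u : Cn k, reCoord j u = (u j).re := fun _ => rfl
  have him : ∀ u : Cn k, imCoord j u = (u j).im := fun _ => rfl
  simp only [add_apply, smul_apply, smul_eq_mul, ContinuousLinearMap.comp_apply, mulC_apply,
    radCovec_apply, hre, him, sub_zero, Function.comp_apply]
  field_simp
  ring

lemma contDiffOn_angQuot (j : Fin k) : ContDiffOn ℝ ∞ (angQuot j) {0}ᶜ :=
  (contDiff_coordSq 0 j).contDiffOn.div (contDiff_radSq 0).contDiffOn fun u hu => by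
    rw [radSq, sub_zero]
    exact pow_ne_zero 2 (norm_ne_zero_iff.2 hu)

variable {p : ℕ}

/-- The function `|u_0|² / ‖u‖²` is not constant in the unit ball, in the weak sense: the integral of
its product with some derivative of a test function does not vanish. -/
lemma exists_integral_angQuot_ne_zero : ∃ (g : Cn (p + 2) → ℝ) (v : Cn (p + 2)),
    ContDiff ℝ ∞ g ∧ tsupport g ⊆ Metric.closedBall 0 1 ∧
      ∫ u, angQuot 0 u * fderiv ℝ g u v ≠ 0 := by
  set v : Cn (p + 2) := EuclideanSpace.single 0 1 with hv
  set w : Cn (p + 2) :=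
    EuclideanSpace.single 0 (1 / 2 : ℂ) + EuclideanSpace.single 1 (1 / 2 : ℂ) with hw
  have hcoord : ∀ (u : Cn (p + 2)) i, ‖u i‖ ≤ ‖u‖ := fun u i => PiLp.norm_apply_le u i
  -- Near `w = (e_0 + e_1)/2` the derivative of the function in the direction `e_0` is positive.
  set g : ContDiffBump w := ⟨1 / 16, 1 / 8, by norm_num, by norm_num⟩ with hg
  have hgsupp : tsupport (g : Cn (p + 2) → ℝ) = Metric.closedBall w (1 / 8) := g.tsupport_eq
  have hre : ∀ u ∈ tsupport (g : Cn (p + 2) → ℝ), 1 / 4 ≤ (u 0).re ∧ u 1 ≠ 0 ∧ u ≠ 0 := by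
    intro u hu
    rw [hgsupp, Metric.mem_closedBall, dist_eq_norm] at hu
    have h0 := (hcoord (u - w) 0).trans hu
    have h1 := (hcoord (u - w) 1).trans hu
    have e0 : (u - w) 0 = u 0 - 1 / 2 := by simp [hw]
    have e1 : (u - w) 1 = u 1 - 1 / 2 := by simp [hw]
    rw [e0] at h0
    rw [e1] at h1
    have h2 := (Complex.abs_re_le_norm _).trans h0
    have h3 : 1 / 4 ≤ (u 0).re := by
      have := (abs_le.1 h2).1
      simp at this
      linarith
    refine ⟨h3, ?_, ?_⟩
    · rintro h
      rw [h] at h1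
      norm_num at h1
    · rintro rfl
      simp at h3
      linarith
  have hsub : tsupport (g : Cn (p + 2) → ℝ) ⊆ {0}ᶜ := fun u hu => (hre u hu).2.2
  have hopen : IsOpen ({0}ᶜ : Set (Cn (p + 2))) := isOpen_compl_singleton
  refine ⟨g, v, g.contDiff, ?_, ?_⟩
  · rw [hgsupp]
    intro u hu
    rw [Metric.mem_closedBall, dist_eq_norm] at hu ⊢
    have h1 : ‖w‖ ≤ 3 / 4 := by
      have h2 : ‖w‖ ^ 2 = 1 / 2 := by
        rw [norm_sq_eq_sum, Fin.sum_univ_succ, Fin.sum_univ_succ]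
        have h3 : ∀ i : Fin p, w i.succ.succ = 0 := fun i => by
          simp [hw, Fin.ext_iff]
        have h4 : w 0 = 1 / 2 := by simp [hw]
        have h5 : w (Fin.succ 0) = 1 / 2 := by simp [hw]
        simp only [h3, h4, h5]
        norm_num
      nlinarith [norm_nonneg w]
    have h2 : ‖u - 0‖ ≤ ‖u - w‖ + ‖w‖ := by
      simpa using norm_add_le (u - w) w
    linarith
  set W : Cn (p + 2) → ℝ := fun u => fderiv ℝ (angQuot 0) u v with hWd
  have hW : ∀ u ∈ tsupport (g : Cn (p + 2) → ℝ), 0 < W u := by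
    intro u hu
    obtain ⟨a1, a2, a3⟩ := hre u hu
    simp only [hWd]
    rw [(hasFDerivAt_angQuot 0 a3 v).2]
    have e1 : v 0 = 1 := by simp [hv]
    have e2 : stdForm (p + 2) ![u, Complex.I • v] = (u 0).re := by
      rw [stdForm_apply, Finset.sum_eq_single 0]
      · simp [hv]
      · intro i _ hi
        simp [hv, hi]
      · simp
    have e3 : coordSq 0 0 u = (u 0).re ^ 2 + (u 0).im ^ 2 := by
      rw [coordSq, sub_zero]
      rfl
    have e4 : coordSq 0 0 u < radSq 0 u := by
      have h6 : 0 < (u 1).re ^ 2 + (u 1).im ^ 2 := by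
        have := Complex.normSq_pos.2 a2
        rw [Complex.normSq_apply] at this
        linarith
      rw [e3, radSq, sub_zero, norm_sq_eq_sum]
      refine Finset.single_lt_sum (f := fun i => (u i).re ^ 2 + (u i).im ^ 2) (j := 1)
        (by simp) (Finset.mem_univ _) (Finset.mem_univ _) h6 fun i _ _ => by positivity
    have e5 : 0 ≤ coordSq 0 0 u := coordSq_nonneg
    rw [e1, e2]
    simp only [Complex.one_re, Complex.one_im, mul_one, mul_zero, add_zero]
    have e6 : (u 0).re * radSq 0 u - coordSq 0 0 u * (u 0).re
        = (u 0).re * (radSq 0 u - coordSq 0 0 u) := by ring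
    rw [e6]
    have e7 : 0 < radSq 0 u - coordSq 0 0 u := by linarith
    have e8 : 0 < radSq 0 u := by linarith
    have e9 : 0 < (u 0).re := by linarith
    positivity
  set P : Cn (p + 2) → ℝ := fun u => angQuot 0 u * g u with hP
  have hPs : tsupport P ⊆ tsupport (g : Cn (p + 2) → ℝ) := closure_mono fun u hu h0 => hu (by
    simp only [hP]
    rw [h0, mul_zero])
  have hPsm : ContDiff ℝ ∞ P := contDiff_of_tsupport_subset hopen
    ((contDiffOn_angQuot 0).mul g.contDiff.contDiffOn) (hPs.trans hsub)
  have hPc : HasCompactSupport P := g.hasCompactSupport.of_isClosed_subset (isClosed_tsupport _) hPs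
  have hPd : ∀ u, fderiv ℝ P u v = angQuot 0 u * fderiv ℝ g u v + W u * g u := by
    intro u
    by_cases hu : u ∈ tsupport (g : Cn (p + 2) → ℝ)
    · have h1 := ((hasFDerivAt_angQuot 0 (hre u hu).2.2 v).1.hasFDerivAt).mul
        (g.contDiff.differentiable (n := ∞) (by simp) u).hasFDerivAt
      have h2 : HasFDerivAt P _ u := h1
      rw [h2.fderiv]
      simp only [add_apply, smul_apply, smul_eq_mul, hWd]
      ring
    · have h1 : (g : Cn (p + 2) → ℝ) =ᶠ[nhds u] fun _ => 0 :=
        notMem_tsupport_iff_eventuallyEq.1 hu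
      have h2 : P =ᶠ[nhds u] fun _ => 0 :=
        notMem_tsupport_iff_eventuallyEq.1 fun h => hu (hPs h)
      rw [h1.fderiv_eq, h2.fderiv_eq, h1.eq_of_nhds]
      simp
  have hWs : tsupport (fun u => W u * g u) ⊆ tsupport (g : Cn (p + 2) → ℝ) :=
    closure_mono fun u hu h0 => hu (by simp only [h0, mul_zero])
  have hWc : Continuous fun u => W u * g u := by
    refine (contDiff_of_tsupport_subset (r := 0) hopen (ContDiffOn.mul ?_
      (g.contDiff (n := 0)).contDiffOn) (hWs.trans hsub)).continuous
    rw [contDiffOn_zero]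
    exact (((contDiffOn_angQuot 0).continuousOn_fderiv_of_isOpen hopen (by simp)).clm_apply
      continuousOn_const)
  have hWcs : HasCompactSupport fun u => W u * g u :=
    g.hasCompactSupport.of_isClosed_subset (isClosed_tsupport _) hWs
  have hpos : 0 < ∫ u, W u * g u := by
    refine hWc.integral_pos_of_hasCompactSupport_nonneg_nonzero hWcs (fun u => ?_) (x := w) ?_
    · by_cases hu : u ∈ tsupport (g : Cn (p + 2) → ℝ)
      · exact mul_nonneg (hW u hu).le g.nonneg
      · change 0 ≤ W u * g u
        rw [image_eq_zero_of_notMem_tsupport hu, mul_zero]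
    · have hww : w ∈ tsupport (g : Cn (p + 2) → ℝ) := by
        rw [hgsupp]
        exact Metric.mem_closedBall_self (by norm_num)
      rw [g.one_of_mem_closedBall (Metric.mem_closedBall_self g.rIn_pos.le), mul_one]
      exact (hW w hww).ne'
  have hWi : Integrable fun u => W u * g u := hWc.integrable_of_hasCompactSupport hWcs
  have hPi : Integrable fun u => fderiv ℝ P u v :=
    ((hPsm.continuous_fderiv (by simp)).clm_apply continuous_const).integrable_of_hasCompactSupport
      (hPc.fderiv_apply ℝ v)
  have hI : ∫ u, angQuot 0 u * fderiv ℝ g u v = - ∫ u, W u * g u := by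
    have h1 : (fun u => angQuot 0 u * fderiv ℝ g u v) = fun u => fderiv ℝ P u v - W u * g u :=
      funext fun u => by rw [hPd]; ring
    rw [h1, integral_sub hPi hWi, integral_fderiv_eq_zero (hPsm.of_le (by simp)) hPc, zero_sub]
  rw [hI]
  exact neg_ne_zero.2 hpos.ne'

end TestFun

end

section

variable {k n : ℕ}

/-! ### Non-reflexivity -/

section NotReflexive

lemma angFun_eq_angQuot {z₀ z : Cn k} (j : Fin k) {a b : ℝ} (hab : a < b) (h : radSq z₀ z ≤ a) :
    angFun z₀ j a b 0 z = angQuot j (z - z₀) := by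
  rw [angFun, add_zero, cutInv_of_le hab h, angQuot, mul_one_div, coordSq, coordSq, radSq, radSq,
    sub_zero]

lemma angQuot_smul (j : Fin k) {r : ℝ} (hr : r ≠ 0) (u : Cn k) :
    angQuot j (r • u) = angQuot j u := by
  rw [angQuot, angQuot, coordSq, coordSq, radSq, radSq, sub_zero, sub_zero, map_smul, map_smul,
    norm_smul, Real.norm_eq_abs, mul_pow, sq_abs, smul_eq_mul, smul_eq_mul, mul_pow, mul_pow,
    ← mul_add, mul_div_mul_left _ _ (pow_ne_zero 2 hr)]

lemma integral_comp_scale {h : Cn k → ℝ} (z₀ : Cn k) {r : ℝ} (hr : 0 < r) :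
    ∫ z, h (r⁻¹ • (z - z₀)) = r ^ (2 * k) * ∫ u, h u := by
  rw [integral_sub_right_eq_self (fun z => h (r⁻¹ • z)) z₀, Measure.integral_comp_inv_smul,
    finrank_Cn, smul_eq_mul, abs_of_pos (pow_pos hr _)]

variable {p : ℕ} {X : Type*} [TopologicalSpace X] [ChartedSpace (Cn (p + 2)) X]
  [IsManifold 𝓘(ℂ, Cn (p + 2)) ω X] {e : OpenPartialHomeomorph X (Cn (p + 2))} [T2Space X]
  [MeasurableSpace X] [BorelSpace X] [SigmaCompactSpace X]

/-- If a function agrees with `|w_j|² / ‖w‖²`, `w = z - z₀`, on the ball of radius `r`, then a multiple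
of `r^(2k-1)` bounds from below the integral of its differential on this ball. It is tested against
the function `g` rescaled to the ball, and the singular function is invariant under the scaling. -/
lemma abs_integral_angQuot_le (he : e ∈ atlas (Cn (p + 2)) X) {z₀ : Cn (p + 2)} {j : Fin (p + 2)}
    {F : X → ℝ} {Θ : X → Covec (p + 2)} (hF : IsWeakDifferential F Θ)
    {r : ℝ} (hr : 0 < r) (hs : Metric.closedBall z₀ r ⊆ e.target)
    (hFe : ∀ᵐ y ∂volume.restrict e.target, y ∈ Metric.closedBall z₀ r →
      F (e.symm y) = angQuot j (y - z₀))
    {g : Cn (p + 2) → ℝ} (hg : ContDiff ℝ ∞ g) (hgs : tsupport g ⊆ Metric.closedBall 0 1)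
    {G : ℝ} (hG : ∀ u, ‖g u‖ ≤ G) (v : Cn (p + 2)) {B : Cn (p + 2) → ℝ}
    (hB : IntegrableOn B (Metric.closedBall z₀ r))
    (hΘB : ∀ y ∈ Metric.closedBall z₀ r, ‖covecIn e Θ y‖ ≤ B y) :
    r ^ (2 * p + 3) * |∫ u, angQuot j u * fderiv ℝ g u v|
      ≤ ‖v‖ * G * ∫ y in Metric.closedBall z₀ r, B y := by
  set I := ∫ u, angQuot j u * fderiv ℝ g u v with hI
  set gr : Cn (p + 2) → ℝ := fun z => g (r⁻¹ • (z - z₀)) with hgr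
  have hG0 : 0 ≤ G := (norm_nonneg _).trans (hG 0)
  have hout : ∀ z, z ∉ Metric.closedBall z₀ r → r⁻¹ • (z - z₀) ∉ tsupport g := by
    intro z hz hz'
    have h1 := hgs hz'
    rw [Metric.mem_closedBall, dist_zero_right, norm_smul, norm_inv, Real.norm_eq_abs,
      abs_of_pos hr, inv_mul_le_iff₀ hr, mul_one] at h1
    exact hz (by rwa [Metric.mem_closedBall, dist_eq_norm])
  have hgr0 : ∀ z, z ∉ Metric.closedBall z₀ r → gr z = 0 := fun z hz =>
    image_eq_zero_of_notMem_tsupport (f := g) (hout z hz)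
  have hgrs : tsupport gr ⊆ Metric.closedBall z₀ r :=
    closure_minimal (fun z hz => by_contra fun h => hz (hgr0 z h)) Metric.isClosed_closedBall
  have hgrc : HasCompactSupport gr :=
    (isCompact_closedBall z₀ r).of_isClosed_subset (isClosed_tsupport _) hgrs
  have hgrsm : ContDiff ℝ ∞ gr :=
    hg.comp ((contDiff_id.sub contDiff_const).const_smul r⁻¹)
  have hfd : ∀ z, fderiv ℝ gr z v = r⁻¹ * fderiv ℝ g (r⁻¹ • (z - z₀)) v := by
    intro z
    have h1 : HasFDerivAt (fun z : Cn (p + 2) => r⁻¹ • (z - z₀))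
        (r⁻¹ • ContinuousLinearMap.id ℝ (Cn (p + 2))) z :=
      ((hasFDerivAt_id z).sub_const z₀).const_smul r⁻¹
    have h2 := ((hg.differentiable (by simp)) (r⁻¹ • (z - z₀))).hasFDerivAt.comp z h1
    have h3 : HasFDerivAt gr _ z := h2
    rw [h3.fderiv]
    simp
  have hfd0 : ∀ z, z ∉ Metric.closedBall z₀ r → fderiv ℝ g (r⁻¹ • (z - z₀)) v = 0 := by
    intro z hz
    have h1 : g =ᶠ[nhds (r⁻¹ • (z - z₀))] fun _ => 0 :=
      notMem_tsupport_iff_eventuallyEq.1 (hout z hz)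
    rw [h1.fderiv_eq]
    simp
  have hw := (hF e he).2.2 gr hgrsm hgrc (hgrs.trans hs) v
  have hleft : ∫ y in e.target, F (e.symm y) * fderiv ℝ gr y v = r ^ (2 * p + 3) * I := by
    have h1 : ∫ y in e.target, F (e.symm y) * fderiv ℝ gr y v
        = ∫ y in e.target, angQuot j (r⁻¹ • (y - z₀))
          * (r⁻¹ * fderiv ℝ g (r⁻¹ • (y - z₀)) v) := by
      refine integral_congr_ae ?_
      filter_upwards [hFe] with y hy
      rw [hfd, angQuot_smul j (inv_ne_zero hr.ne')]
      by_cases h : y ∈ Metric.closedBall z₀ r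
      · rw [hy h]
      · rw [hfd0 y h]
        simp
    rw [h1, setIntegral_eq_integral_of_forall_compl_eq_zero fun y hy => by
        rw [hfd0 y fun h => hy (hs h)]; simp,
      integral_comp_scale (h := fun u => angQuot j u * (r⁻¹ * fderiv ℝ g u v)) z₀ hr]
    have h2 : (fun u => angQuot j u * (r⁻¹ * fderiv ℝ g u v))
        = fun u => r⁻¹ * (angQuot j u * fderiv ℝ g u v) := funext fun u => by ring
    rw [h2, integral_const_mul, ← hI]
    have h3 : r ^ (2 * (p + 2)) = r ^ (2 * p + 3) * r := by ring
    rw [h3]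
    field_simp
  have hright : |∫ y in e.target, covecIn e Θ y v * gr y|
      ≤ ‖v‖ * G * ∫ y in Metric.closedBall z₀ r, B y := by
    rw [setIntegral_eq_of_subset_of_forall_sdiff_eq_zero e.open_target.measurableSet hs
      fun y hy => by rw [hgr0 y hy.2, mul_zero], ← integral_const_mul, ← Real.norm_eq_abs]
    refine norm_integral_le_of_norm_le (hB.const_mul _)
      ((ae_restrict_iff' measurableSet_closedBall).2 (.of_forall fun y hy => ?_))
    calc ‖covecIn e Θ y v * gr y‖ = ‖covecIn e Θ y v‖ * ‖gr y‖ := norm_mul _ _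
      _ ≤ (‖covecIn e Θ y‖ * ‖v‖) * G :=
          mul_le_mul ((covecIn e Θ y).le_opNorm v) (hG _) (norm_nonneg _) (by positivity)
      _ ≤ (B y * ‖v‖) * G := by
          gcongr
          exact hΘB y hy
      _ = ‖v‖ * G * B y := by ring
  have h4 : r ^ (2 * p + 3) * |I| = |∫ y in e.target, F (e.symm y) * fderiv ℝ gr y v| := by
    rw [hleft, abs_mul, abs_of_pos (pow_pos hr _)]
  rw [h4, hw, abs_neg]
  exact hright

namespace KahlerForm

/-- `W^*` is not reflexive when the volume is finite: the singular function `|w_0|² / ‖w‖²` would be a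
limit of smooth functions in `W^*`, which the scaling on small balls excludes. -/
lemma not_isReflexive_wStar [Nonempty X] (Ω : KahlerForm (p + 2) X) (hfin : Ω.vol univ ≠ ⊤) :
    ¬ IsReflexive Ω.WStar := by
  intro hR
  obtain ⟨x₀⟩ := ‹Nonempty X›
  set e := chartAt (Cn (p + 2)) x₀ with hed
  have he : e ∈ atlas (Cn (p + 2)) X := chart_mem_atlas _ _
  set z₀ := e x₀ with hz₀
  obtain ⟨R, hR0, hRs⟩ := Metric.nhds_basis_closedBall.mem_iff.1
    (e.open_target.mem_nhds (e.map_source (mem_chart_source _ x₀)))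
  set b := R ^ 2 with hb
  set a := R ^ 2 / 2 with ha
  have ha0 : 0 < a := by positivity
  have hab : a < b := by
    have : 0 < R ^ 2 := by positivity
    linarith
  have hs : Metric.closedBall z₀ (√b) ⊆ e.target := by
    rwa [hb, Real.sqrt_sq hR0.le]
  obtain ⟨φ, hφ, hφe⟩ := Ω.exists_mem_closure_smoothPart (by omega) hfin hR he 0 ha0 hab hs
  obtain ⟨C, hC, hball⟩ := exists_setIntegral_ball_norm_le Ω he ha0 hab hs
  obtain ⟨g, v, hg, hgs, hgI⟩ := exists_integral_angQuot_ne_zero (p := p)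
  have hgc : HasCompactSupport g :=
    (isCompact_closedBall 0 1).of_isClosed_subset (isClosed_tsupport _) hgs
  obtain ⟨G, hG⟩ := hg.continuous.bounded_above_of_compact_support hgc
  have hG0 : 0 ≤ G := (norm_nonneg _).trans (hG 0)
  set I := ∫ u, angQuot 0 u * fderiv ℝ g u v with hI
  set ν : ℝ := volume.real (Metric.ball (0 : Cn (p + 2)) 1) with hν
  -- The closeness `δ` in `W^*` of smooth functions to the singular function bounds `|I|`.
  have key : ∀ δ : ℝ, 0 < δ → |I| ≤ ‖v‖ * G * C * δ := by
    intro δ hδ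
    obtain ⟨ψ, ⟨s, hsm, hsψ⟩, hψ⟩ := Metric.mem_closure_iff.1 hφ δ hδ
    rw [dist_eq_norm] at hψ
    have hen : Ω.energy (φ - ψ).toLp < ENNReal.ofReal (δ ^ 2) := by
      rw [ENNReal.lt_ofReal_iff_toReal_lt (φ - ψ).energy_ne_top]
      rw [WStar.norm_def, Real.sqrt_lt' hδ] at hψ
      have := sq_nonneg ‖(φ - ψ).toLp‖
      linarith
    obtain ⟨T, hT, ⟨f, θ, hf, hfθ, -, hθT⟩, hm⟩ := exists_of_energy_lt hen
    -- Here `φ - ψ` is represented by `f` and `ψ` by the smooth function `s`, so that `f + s`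
    -- agrees with the singular function.
    have hF : IsWeakDifferential (f + s) (θ + dFun s) := hfθ.add (isWeakDifferential_dFun hsm)
    have hFe : ∀ᵐ y ∂volume.restrict e.target,
        (f + s) (e.symm y) = extendFun e (angFun z₀ 0 a b 0) (e.symm y) := by
      refine (Ω.ae_restrict_source_iff he
        (P := fun x => (f + s) x = extendFun e (angFun z₀ 0 a b 0) x)).1 (ae_restrict_of_ae ?_)
      have h1 : (φ - ψ).toLp = φ.toLp - ψ.toLp := rfl
      rw [h1] at hf
      filter_upwards [hf, hsψ, hφe, Lp.coeFn_sub φ.toLp ψ.toLp] with x a1 a2 a3 a4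
      rw [← a3, Pi.add_apply, a1, a2, a4, Pi.sub_apply]
      ring
    have hsc := (contDiffOn_covecIn_dFun he hsm).continuousOn.mono hs
    obtain ⟨M, hM⟩ := (isCompact_closedBall z₀ (√b)).exists_bound_of_continuousOn hsc
    have hM0 : 0 ≤ M :=
      (norm_nonneg _).trans (hM z₀ (Metric.mem_closedBall_self (Real.sqrt_nonneg _)))
    -- The remainder contributes `C δ r^(2k-1)` and the smooth part, by its volume, `M ν r^(2k)`.
    have hr : ∀ r : ℝ, 0 < r → r ^ 2 ≤ a → |I| ≤ ‖v‖ * G * (C * δ + M * ν * r) := by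
      intro r hr hra
      have hrb : Metric.closedBall z₀ r ⊆ Metric.closedBall z₀ (√b) :=
        Metric.closedBall_subset_closedBall (Real.le_sqrt_of_sq_le (hra.trans hab.le))
      obtain ⟨i1, i2⟩ := hball θ T δ hδ (hfθ e he).2.1.aestronglyMeasurable hT hθT hm.le r hr hra
      have hci : IntegrableOn (fun _ : Cn (p + 2) => M) (Metric.closedBall z₀ r) :=
        integrableOn_const measure_closedBall_lt_top.ne
      have h1 := abs_integral_angQuot_le he (j := 0) hF hr (hrb.trans hs) (by
        filter_upwards [hFe, ae_restrict_mem e.open_target.measurableSet] with y hy hyt hyr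
        rw [hy, extendFun_symm hyt, angFun_eq_angQuot 0 hab]
        rw [Metric.mem_closedBall, dist_eq_norm] at hyr
        refine le_trans ?_ hra
        rw [radSq]
        gcongr) hg hgs hG v (B := fun y => ‖covecIn e θ y‖ + M) (i1.norm.add hci) (fun y hy => by
        rw [covecIn_add]
        exact (norm_add_le _ _).trans (by gcongr; exact hM y (hrb hy)))
      have hvol : volume.real (Metric.closedBall z₀ r) = r ^ (2 * p + 4) * ν := by
        rw [Measure.addHaar_real_closedBall _ _ hr.le, finrank_Cn, hν]
        congr 1
      rw [integral_add i1.norm hci, setIntegral_const, hvol, smul_eq_mul] at h1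
      have h2 : r ^ (2 * p + 3) * |I| ≤ r ^ (2 * p + 3) * (‖v‖ * G * (C * δ + M * ν * r)) := by
        refine h1.trans ?_
        calc _ ≤ ‖v‖ * G * (C * δ * r ^ (2 * p + 3) + r ^ (2 * p + 4) * ν * M) := by gcongr
          _ = _ := by ring
      exact le_of_mul_le_mul_left h2 (pow_pos hr _)
    -- Let `r` tend to `0`: the bound `√a` keeps the ball in the chart, `η / (D + 1)` makes the term of
    -- the smooth part at most `η`.
    refine le_of_forall_pos_le_add fun η hη => ?_
    set D := ‖v‖ * G * (M * ν) with hD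
    have hD0 : 0 ≤ D := by positivity
    have hr0 : 0 < min (√a) (η / (D + 1)) := lt_min (Real.sqrt_pos.2 ha0) (by positivity)
    have h1 := hr _ hr0 (by
      calc min (√a) (η / (D + 1)) ^ 2 ≤ √a ^ 2 := by
            gcongr
            exact min_le_left _ _
        _ = a := Real.sq_sqrt ha0.le)
    have h2 : D * min (√a) (η / (D + 1)) ≤ η := by
      calc D * min (√a) (η / (D + 1)) ≤ (D + 1) * (η / (D + 1)) := by
            gcongr
            · linarith
            · exact min_le_right _ _
        _ = η := by field_simp
    calc |I| ≤ ‖v‖ * G * (C * δ + M * ν * min (√a) (η / (D + 1))) := h1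
      _ = ‖v‖ * G * C * δ + D * min (√a) (η / (D + 1)) := by rw [hD]; ring
      _ ≤ _ := by gcongr
  set D := ‖v‖ * G * C with hD
  have hD0 : 0 ≤ D := by positivity
  have hI0 : 0 < |I| := abs_pos.2 hgI
  have h1 := key (|I| / (2 * (D + 1))) (by positivity)
  have h2 : D * (|I| / (2 * (D + 1))) ≤ |I| / 2 := by
    rw [← mul_div_assoc, div_le_div_iff₀ (by positivity) (by norm_num)]
    nlinarith
  linarith

end KahlerForm

end NotReflexive

end

section

variable {k n : ℕ}

/-! ### Finiteness of the volume -/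

section FiniteVolume

namespace KahlerForm

lemma exists_nhds_vol_lt_top {X : Type*} [TopologicalSpace X] [ChartedSpace (Cn k) X]
    [IsManifold 𝓘(ℂ, Cn k) ω X] [MeasurableSpace X] [BorelSpace X] [LindelofSpace X]
    (Ω : KahlerForm k X) (x : X) : ∃ V ∈ nhds x, Ω.vol V < ⊤ := by
  set e := chartAt (Cn k) x with he
  have hx : x ∈ e.source := mem_chart_source _ x
  have hat : e ∈ atlas (Cn k) X := chart_mem_atlas _ x
  obtain ⟨R, hR, hRs⟩ := Metric.nhds_basis_closedBall.mem_iff.1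
    (e.open_target.mem_nhds (e.map_source hx))
  set V := e.source ∩ e ⁻¹' Metric.ball (e x) R with hV
  have hVo : IsOpen V := e.isOpen_inter_preimage Metric.isOpen_ball
  refine ⟨V, hVo.mem_nhds ⟨hx, Metric.mem_ball_self hR⟩, ?_⟩
  obtain ⟨M, hM⟩ := (isCompact_closedBall (e x) R).exists_bound_of_continuousOn
    ((Ω.volCoeff_contDiffOn hat).continuousOn.mono hRs)
  rw [← Measure.restrict_eq_self Ω.vol (inter_subset_left : V ⊆ e.source),
    Ω.vol_restrict_source hat, Ω.chartVol_apply e hVo.measurableSet]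
  have hsub : e.target ∩ e.symm ⁻¹' V ⊆ Metric.closedBall (e x) R := by
    rintro y ⟨hy, hyV⟩
    have := hyV.2
    rw [mem_preimage, e.right_inv hy] at this
    exact Metric.ball_subset_closedBall this
  calc _ ≤ ∫⁻ y in Metric.closedBall (e x) R, ENNReal.ofReal (Ω.volCoeff e y) :=
        lintegral_mono_set hsub
    _ ≤ ∫⁻ _ in Metric.closedBall (e x) R, ENNReal.ofReal M :=
        setLIntegral_mono measurable_const fun y hy =>
          ENNReal.ofReal_le_ofReal ((le_abs_self _).trans (hM y hy))
    _ < ⊤ := by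
        rw [setLIntegral_const]
        exact ENNReal.mul_lt_top ENNReal.ofReal_lt_top measure_closedBall_lt_top

lemma vol_univ_lt_top {X : Type*} [TopologicalSpace X] [ChartedSpace (Cn k) X]
    [IsManifold 𝓘(ℂ, Cn k) ω X] [MeasurableSpace X] [BorelSpace X] [CompactSpace X]
    (Ω : KahlerForm k X) : Ω.vol univ < ⊤ :=
  isCompact_univ.measure_lt_top_of_nhdsWithin fun x _ => by
    obtain ⟨V, hV, hlt⟩ := Ω.exists_nhds_vol_lt_top x
    exact ⟨V, mem_nhdsWithin_of_mem_nhds hV, hlt⟩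

end KahlerForm

lemma opens_chart_source_eq_univ {U : TopologicalSpace.Opens (Cn k)} (x : U)
    {e : OpenPartialHomeomorph U (Cn k)} (he : e ∈ atlas (Cn k) U) : e.source = univ := by
  obtain ⟨z, rfl⟩ := TopologicalSpace.Opens.chart_eq ⟨x⟩ he
  simp [chartAt_self_eq]

lemma flatKahler_vol_univ_lt_top {U : TopologicalSpace.Opens (Cn k)}
    (hne : (U : Set (Cn k)).Nonempty) (hU : Bornology.IsBounded (U : Set (Cn k)))
    {c : ℝ} (hc : 0 < c) : (flatKahler U c hc).vol univ < ⊤ := by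
  obtain ⟨x, hx⟩ := hne
  set e := chartAt (Cn k) (⟨x, hx⟩ : U)
  have he : e ∈ atlas (Cn k) U := chart_mem_atlas _ _
  have hsrc := opens_chart_source_eq_univ ⟨x, hx⟩ he
  set Ω := flatKahler U c hc with hΩ
  set η : Alt k 2 := (c * (2 / Real.pi)) • stdForm k with hη
  have hcoeff : ∀ y ∈ e.target, Ω.volCoeff e y = coeff (powForm η k) := by
    intro y hy
    rw [KahlerForm.volCoeff, Ω.formIn_pow]
    congr 2
    exact formIn_const U he η hy
  have hsub : e.target ⊆ U := fun y hy => by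
    have h1 := chart_apply U he (e.symm y)
    rw [e.right_inv hy] at h1
    rw [h1]
    exact (e.symm y).2
  have h2 : Ω.vol univ = Ω.chartVol e univ := by
    rw [← Ω.vol_restrict_source he, hsrc, Measure.restrict_univ]
  rw [h2, Ω.chartVol_apply e MeasurableSet.univ, preimage_univ, inter_univ,
    setLIntegral_congr_fun e.open_target.measurableSet
      (fun y hy => congrArg ENNReal.ofReal (hcoeff y hy)), setLIntegral_const]
  exact ENNReal.mul_lt_top ENNReal.ofReal_lt_top (hU.subset hsub).measure_lt_top

end FiniteVolume

end

end ComplexSobolev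

end

theorem corollary2p8 (k : ℕ) (hk : 2 ≤ k) :
    (∀ (U : TopologicalSpace.Opens (Cn k)), (U : Set (Cn k)).Nonempty →
      Bornology.IsBounded (U : Set (Cn k)) → ∀ (c : ℝ) (hc : 0 < c),
        CompleteSpace (flatKahler U c hc).WStar ∧ ¬ IsReflexive (flatKahler U c hc).WStar) ∧
    (∀ (X : Type*) [TopologicalSpace X] [T2Space X] [CompactSpace X] [Nonempty X]
      [ChartedSpace (Cn k) X] [IsManifold 𝓘(ℂ, Cn k) ω X] [MeasurableSpace X] [BorelSpace X]
      (Ω : KahlerForm k X), CompleteSpace Ω.WStar ∧ ¬ IsReflexive Ω.WStar) := by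
  obtain ⟨p, rfl⟩ : ∃ p, k = p + 2 := ⟨k - 2, by omega⟩
  refine ⟨fun U hne hU c hc => ?_, fun X _ _ _ _ _ _ _ _ Ω => ?_⟩
  · have : Nonempty U := hne.to_subtype
    have : ProperSpace (Cn (p + 2)) := FiniteDimensional.proper ℂ _
    have : LocallyCompactSpace U := U.isOpen.locallyCompactSpace
    have : SigmaCompactSpace U := inferInstance
    exact ⟨KahlerForm.completeSpace_wStar (by omega),
      KahlerForm.not_isReflexive_wStar _ (flatKahler_vol_univ_lt_top hne hU hc).ne⟩
  · exact ⟨KahlerForm.completeSpace_wStar (by omega),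
      Ω.not_isReflexive_wStar Ω.vol_univ_lt_top.ne⟩
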